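/- Let $M$ be a (Hausdorff) complex manifold of dimension $n$, and let $\rho : M \to \mathbb{R}$ be a smooth strictly plurisubharmonic exhaustion function, i.e. $\omega := i\partial\bar\partial\rho$ is positive definite and every sublevel set $\{\rho \le c\}$, $c \in \mathbb{R}$, is compact. Endow $M$ with the Kähler metric $g$ whose fundamental form is $\omega$ and with the volume form $\mathrm{Vol}_g = \omega^n/n!$, and suppose that $M$ is a $d$-bounded Stein manifold, i.e. that $\eta := i\bar\partial\rho$ (for which $\omega = d\eta$) is bounded: $\sup_{x \in M} |\eta(x)|_g < \infty$. Let $* : \Omega^{p,q}(M) \to \Omega^{n-p,n-q}(M)$ be the complex antilinear Hodge operator of $g$, characterized by $\alpha \wedge *\beta = \langle \alpha, \beta\rangle\,\mathrm{Vol}_g$, let $\partial^* = -*\partial *$, $\bar\partial^* = -*\bar\partial *$, and let $$\tilde\Delta_{BC}^g = \partial\bar\partial\bar\partial^*\partial^* + \bar\partial^*\partial^*\partial\bar\partial + \bar\partial^*\partial\partial^*\bar\partial + \partial^*\bar\partial\bar\partial^*\partial + \bar\partial^*\bar\partial + \partial^*\partial$$ be the Bott–Chern Laplacian. Let $\varphi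 \in \Omega^{p,q}(M)$ be a smooth complex $(p,q)$-form that belongs to $W^{1,2}(M)$, i.e. $$\int_M \left(|\varphi|_g^2 + |\nabla\varphi|_g^2\right) \mathrm{Vol}_g < \infty,$$ where $\nabla$ is the Levi-Civita connection of $g$. If $\tilde\Delta_{BC}^g\varphi = 0$, then $$\partial\varphi = 0, \qquad \bar\partial\varphi = 0, \qquad \bar\partial^*\partial^*\varphi = 0.$$ -/

import Mathlib

open scoped Manifold ContDiff ComplexConjugate

noncomputable section

namespace BottChern

/-- The model space `ℂⁿ`. -/
abbrev Cn (n : ℕ) : Type := Fin n → ℂ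

/-- `Λᵏ((ℂⁿ)*) ⊗ ℂ`: the complex-valued real-multilinear alternating `k`-forms on `ℂⁿ`. -/
abbrev Alt (n k : ℕ) : Type := Cn n [⋀^Fin k]→L[ℝ] ℂ

/-- The real coordinate directions of `ℂⁿ`: `(j, 0)` stands for `∂/∂xʲ`, `(j, 1)` for `∂/∂yʲ`. -/
abbrev Idx (n : ℕ) : Type := Fin n × Fin 2

/-- The real coordinate vectors `∂/∂xʲ`, `∂/∂yʲ` of `ℂⁿ`. -/
def vec {n : ℕ} (i : Idx n) : Cn n := Pi.single i.1 (![1, Complex.I] i.2)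

/-- The real coordinates `xʲ`, `yʲ` on `ℂⁿ`. -/
def coord {n : ℕ} (i : Idx n) (v : Cn n) : ℝ := ![(v i.1).re, (v i.1).im] i.2

theorem coord_add {n : ℕ} (i : Idx n) (v w : Cn n) : coord i (v + w) = coord i v + coord i w := by
  obtain ⟨j, c⟩ := i
  fin_cases c <;> simp [coord]

theorem coord_smul {n : ℕ} (i : Idx n) (r : ℝ) (v : Cn n) : coord i (r • v) = r * coord i v := by
  obtain ⟨j, c⟩ := i
  fin_cases c <;> simp [coord]

/-- Multiplication by the imaginary unit, as a real-linear map of `ℂⁿ`. -/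
def mulI (n : ℕ) : Cn n →L[ℝ] Cn n := Complex.I • ContinuousLinearMap.id ℝ (Cn n)

/-! ### Linear algebra of forms on `ℂⁿ` with a Euclidean metric given by its Gram matrix -/

/-- The Hermitian product, induced by the metric with Gram matrix `G` in the basis `vec`, of two
covariant tensors with components `S`, `T`; the factor `1 / k!` makes this, on alternating
tensors, the sum over increasing multi-indices (with the indices of `T` raised). -/
def herm {n k : ℕ} (G : Matrix (Idx n) (Idx n) ℝ) (S T : (Fin k → Idx n) → ℂ) : ℂ :=
  (k.factorial : ℂ)⁻¹ *
    ∑ s : Fin k → Idx n, ∑ t : Fin k → Idx n,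
      ((∏ a, G⁻¹ (s a) (t a) : ℝ) : ℂ) * S s * conj (T t)

/-- The components of a form with respect to the real coordinate vectors. -/
def comps {n k : ℕ} (α : Alt n k) (s : Fin k → Idx n) : ℂ := α fun a => vec (s a)

/-- The real coordinates of `ℂⁿ` in the order `x¹, y¹, …, xⁿ, yⁿ`, for `m = 2n`. -/
def coordLin {n m : ℕ} (h : m = n * 2) : Cn n →ₗ[ℝ] (Fin m → ℝ) where
  toFun v a := coord (finProdFinEquiv.symm (Fin.cast h a)) v
  map_add' v w := funext fun _ => coord_add _ v w
  map_smul' r v := funext fun _ => coord_smul _ r v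

/-- The form `dx¹ ∧ dy¹ ∧ ⋯ ∧ dxⁿ ∧ dyⁿ` on `ℂⁿ`, of degree `m = 2n`. -/
def detForm {n m : ℕ} (h : m = n * 2) : Cn n [⋀^Fin m]→ₗ[ℝ] ℝ :=
  Matrix.detRowAlternating.compLinearMap (coordLin h)

theorem append_update_right {k l : ℕ} {α : Type*} [DecidableEq (Fin l)] (u : Fin k → α)
    (v : Fin l → α) (i : Fin l) (x : α) :
    Fin.append u (Function.update v i x) =
      Function.update (Fin.append u v) (Fin.natAdd k i) x := by
  funext b
  refine Fin.addCases (fun b => ?_) (fun b => ?_) b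
  · rw [Fin.append_left, Function.update_of_ne, Fin.append_left]
    intro hb
    have := congrArg Fin.val hb
    simp at this
    omega
  · rw [Fin.append_right]
    by_cases hb : b = i
    · subst hb
      simp
    · rw [Function.update_of_ne hb, Function.update_of_ne, Fin.append_right]
      intro h
      exact hb (by simpa using h)

/-- For `k + l = 2n` and vectors `u₁, …, u_k`, the `l`-form
`(v₁, …, v_l) ↦ (dx¹ ∧ dy¹ ∧ ⋯ ∧ dxⁿ ∧ dyⁿ)(u₁, …, u_k, v₁, …, v_l)`. -/
def contractDet {n k l : ℕ} (h : k + l = n * 2) (u : Fin k → Cn n) : Alt n l where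
  toFun v := (detForm h (Fin.append u v) : ℂ)
  map_update_add' v i x y := by
    simp only [append_update_right, AlternatingMap.map_update_add, Complex.ofReal_add]
  map_update_smul' v i c x := by
    simp only [append_update_right, AlternatingMap.map_update_smul, smul_eq_mul,
      Complex.ofReal_mul, Complex.real_smul]
  map_eq_zero_of_eq' v i j hv hij := by
    have : detForm h (Fin.append u v) = 0 :=
      (detForm h).map_eq_zero_of_eq (i := Fin.natAdd k i) (j := Fin.natAdd k j) _
        (by simpa using hv) (by simpa using hij)
    simp [this]
  cont := by
    have hc : ∀ b : Fin (k + l), Continuous fun v : Fin l → Cn n => Fin.append u v b := by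
      intro b
      refine Fin.addCases (fun b => ?_) (fun b => ?_) b
      · simpa using continuous_const
      · simpa using continuous_apply b
    have hl : Continuous (coordLin (n := n) h) := LinearMap.continuous_of_finiteDimensional _
    refine Complex.continuous_ofReal.comp ?_
    exact Continuous.matrix_det (continuous_pi fun b => hl.comp (hc b))

/-- The complex antilinear Hodge operator from `k`-forms to `l`-forms, `k + l = 2n`, of the metric
with Gram matrix `G` and the orientation of `ℂⁿ`:
`(*β)(v) = (1 / k!) ∑ β̄^{i₁ ⋯ i_k} vol(∂_{i₁}, …, ∂_{i_k}, v)`, `vol = √(det G) dx¹ ∧ ⋯ ∧ dyⁿ`,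
so that `α ∧ *β = ⟨α, β⟩ vol`. -/
def hodge {n k l : ℕ} (h : k + l = n * 2) (G : Matrix (Idx n) (Idx n) ℝ) (β : Alt n k) : Alt n l :=
  ∑ s : Fin k → Idx n,
    ((k.factorial : ℂ)⁻¹ * ((√G.det : ℝ) : ℂ) *
      ∑ t : Fin k → Idx n, ((∏ a, G⁻¹ (s a) (t a) : ℝ) : ℂ) * conj (comps β t)) •
    contractDet h fun a => vec (s a)

/-- The complex-linear part `∑ (∂/∂zʲ) dzʲ` of a real differential. -/
def linPart {n k : ℕ} (L : Cn n →L[ℝ] Alt n k) : Cn n →L[ℝ] Alt n k :=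
  (1 / 2 : ℂ) • (L - Complex.I • L.comp (mulI n))

/-- The complex-antilinear part `∑ (∂/∂z̄ʲ) dz̄ʲ` of a real differential. -/
def antiPart {n k : ℕ} (L : Cn n →L[ℝ] Alt n k) : Cn n →L[ℝ] Alt n k :=
  (1 / 2 : ℂ) • (L + Complex.I • L.comp (mulI n))

/-! ### Forms on a complex manifold -/

variable {n : ℕ} {M : Type*}

/-- Complex-valued (inhomogeneous, not necessarily smooth) differential forms on `M`: `φ k x` is
the component of degree `k` at `x`, an alternating form on the tangent space of `M` at `x`, which
Mathlib identifies with the model space `ℂⁿ` through the preferred chart `chartAt (Cn n) x`. -/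
abbrev Form (n : ℕ) (M : Type*) : Type _ := ∀ k : ℕ, M → Alt n k

/-- A function, as a form of degree `0`. -/
def ofFun (f : M → ℂ) : Form n M
  | 0 => fun x => ContinuousAlternatingMap.constOfIsEmpty ℝ (Cn n) (Fin 0) (f x)
  | _ + 1 => 0

variable [TopologicalSpace M] [ChartedSpace (Cn n) M]

/-- The differential at `y` of the inverse of the chart `e`, from `ℂⁿ` to the tangent space of `M`
at `e.symm y`. -/
def dSymm (e : OpenPartialHomeomorph M (Cn n)) (y : Cn n) : Cn n →L[ℝ] Cn n :=
  mfderiv 𝓘(ℝ, Cn n) 𝓘(ℝ, Cn n) e.symm y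

/-- The expression of a form in the chart `e`, i.e. its pull-back by `e.symm`; meaningful on
`e.target`. -/
def rep (e : OpenPartialHomeomorph M (Cn n)) (φ : Form n M) (k : ℕ) (y : Cn n) : Alt n k :=
  (φ k (e.symm y)).compContinuousLinearMap (dSymm e y)

/-- Smoothness (in the real sense) of a form: its chart expressions are smooth. -/
def IsSmooth (φ : Form n M) : Prop :=
  ∀ e ∈ atlas (Cn n) M, ∀ k, ContDiffOn ℝ ∞ (rep e φ k) e.target

/-- `φ` is of bidegree `(p, q)`: it is of degree `p + q`, and multiplying all the vectors by
`c : ℂ` multiplies its values by `c ^ p * (conj c) ^ q`. -/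
def IsOfType (p q : ℕ) (φ : Form n M) : Prop :=
  (∀ k, k ≠ p + q → φ k = 0) ∧
    ∀ x (c : ℂ) (v : Fin (p + q) → Cn n),
      φ (p + q) x (fun a => c • v a) = c ^ p * conj c ^ q * φ (p + q) x v

/-- The operator `∂`, computed at `x` in the holomorphic chart at `x`:
`∂(∑ φ_{AB} dz^A ∧ dz̄^B) = ∑ (∂φ_{AB}/∂zʲ) dzʲ ∧ dz^A ∧ dz̄^B`. -/
def del (φ : Form n M) : Form n M
  | 0 => 0
  | k + 1 => fun x => ContinuousAlternatingMap.alternatizeUncurryFin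
      (linPart (fderiv ℝ (rep (chartAt (Cn n) x) φ k) (chartAt (Cn n) x x)))

/-- The operator `∂̄`, computed at `x` in the holomorphic chart at `x`:
`∂̄(∑ φ_{AB} dz^A ∧ dz̄^B) = ∑ (∂φ_{AB}/∂z̄ʲ) dz̄ʲ ∧ dz^A ∧ dz̄^B`. -/
def delbar (φ : Form n M) : Form n M
  | 0 => 0
  | k + 1 => fun x => ContinuousAlternatingMap.alternatizeUncurryFin
      (antiPart (fderiv ℝ (rep (chartAt (Cn n) x) φ k) (chartAt (Cn n) x x)))

/-! ### The Kähler metric with potential `ρ` -/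

/-- The form `η = i ∂̄ρ`. -/
def eta (ρ : M → ℝ) : Form n M := Complex.I • delbar (ofFun fun x => (ρ x : ℂ))

/-- The fundamental form `ω = i ∂∂̄ρ`. -/
def omega (ρ : M → ℝ) : Form n M := Complex.I • del (delbar (ofFun fun x => (ρ x : ℂ)))

/-- The Riemannian metric `g(v, w) = ω(v, J w)` with fundamental form `ω = i ∂∂̄ρ`. -/
def metric (ρ : M → ℝ) (x : M) (v w : Cn n) : ℝ :=
  (omega (n := n) ρ 2 x ![v, Complex.I • w]).re

/-- The Gram matrix of the metric at `x`. -/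
def gram (ρ : M → ℝ) (x : M) : Matrix (Idx n) (Idx n) ℝ :=
  Matrix.of fun i j => metric ρ x (vec i) (vec j)

/-- The components `g_{ij}` of the metric in the real coordinates of the chart `e`. -/
def gramIn (ρ : M → ℝ) (e : OpenPartialHomeomorph M (Cn n)) (y : Cn n) :
    Matrix (Idx n) (Idx n) ℝ :=
  Matrix.of fun i j => metric ρ (e.symm y) (dSymm e y (vec i)) (dSymm e y (vec j))

/-- `|φ|²` at `x`, for the component of degree `k` of `φ`. -/
def normSq (ρ : M → ℝ) (k : ℕ) (φ : Form n M) (x : M) : ℝ :=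
  (herm (gram ρ x) (comps (φ k x)) (comps (φ k x))).re

/-- The complex antilinear Hodge operator of the metric. -/
def star (ρ : M → ℝ) (φ : Form n M) : Form n M := fun k x =>
  if h : k ≤ n * 2 then hodge (Nat.sub_add_cancel h) (gram ρ x) (φ (n * 2 - k) x) else 0

/-- `∂* = - * ∂ *`. -/
def delStar (ρ : M → ℝ) (φ : Form n M) : Form n M := -star ρ (del (star ρ φ))

/-- `∂̄* = - * ∂̄ *`. -/
def delbarStar (ρ : M → ℝ) (φ : Form n M) : Form n M := -star ρ (delbar (star ρ φ))

/-- The Bott–Chern Laplacian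
`∂∂̄∂̄*∂* + ∂̄*∂*∂∂̄ + ∂̄*∂∂*∂̄ + ∂*∂̄∂̄*∂ + ∂̄*∂̄ + ∂*∂`. -/
def bottChernLaplacian (ρ : M → ℝ) (φ : Form n M) : Form n M :=
  del (delbar (delbarStar ρ (delStar ρ φ)))
    + delbarStar ρ (delStar ρ (del (delbar φ)))
    + delbarStar ρ (del (delStar ρ (delbar φ)))
    + delStar ρ (delbar (delbarStar ρ (del φ)))
    + delbarStar ρ (delbar φ)
    + delStar ρ (del φ)

/-- The Christoffel symbols
`Γᵐ_{ij} = ½ ∑ g^{ml} (∂_i g_{jl} + ∂_j g_{il} - ∂_l g_{ij})` of the Levi-Civita connection at `x`,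
in the real coordinates of the chart at `x`. -/
def christoffel (ρ : M → ℝ) (x : M) (m i j : Idx n) : ℝ :=
  let e := chartAt (Cn n) x
  let dg : Idx n → Idx n → Idx n → ℝ := fun a b c =>
    fderiv ℝ (fun y => gramIn ρ e y b c) (e x) (vec a)
  (1 / 2) * ∑ l, (gram ρ x)⁻¹ m l * (dg i j l + dg j i l - dg l i j)

/-- The components `(∇φ)_{i s₁ ⋯ s_k}` at `x` of the Levi-Civita covariant derivative of the
component of degree `k` of `φ`, in the real coordinates of the chart at `x`. -/
def nabla (ρ : M → ℝ) (k : ℕ) (φ : Form n M) (x : M) (i : Idx n) (s : Fin k → Idx n) : ℂ :=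
  comps (fderiv ℝ (rep (chartAt (Cn n) x) φ k) (chartAt (Cn n) x x) (vec i)) s
    - ∑ a, ∑ m, (christoffel ρ x m i (s a) : ℂ) * comps (φ k x) (Function.update s a m)

/-- `|∇φ|²` at `x`, for the component of degree `k` of `φ`. -/
def nablaNormSq (ρ : M → ℝ) (k : ℕ) (φ : Form n M) (x : M) : ℝ :=
  (∑ i, ∑ j, (((gram ρ x)⁻¹ i j : ℝ) : ℂ) *
    herm (gram ρ x) (nabla ρ k φ x i) (nabla ρ k φ x j)).re

/-- The Riemannian volume measure `ωⁿ / n!`: the smallest measure on `M` that dominates, for every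
chart `e`, the measure `√(det g_{ij}) dx¹ dy¹ ⋯ dxⁿ dyⁿ` carried from `e.target` to `e.source`.
As these agree on overlaps, it restricts on each chart domain to exactly that measure. -/
def vol (n : ℕ) {M : Type*} [TopologicalSpace M] [ChartedSpace (Cn n) M] [MeasurableSpace M]
    (ρ : M → ℝ) : MeasureTheory.Measure M :=
  ⨆ e ∈ atlas (Cn n) M,
    (((MeasureTheory.volume : MeasureTheory.Measure (Cn n)).restrict e.target).withDensity
      fun y => ENNReal.ofReal √(gramIn ρ e y).det).map e.symm

/-- `φ` (as a form of degree `k`) belongs to `W^{1,2}`: `∫ (|φ|² + |∇φ|²) vol < ∞`. -/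
def MemW12 [MeasurableSpace M] (ρ : M → ℝ) (k : ℕ) (φ : Form n M) : Prop :=
  ∫⁻ x, ENNReal.ofReal (normSq ρ k φ x + nablaNormSq ρ k φ x) ∂(vol n ρ) < ⊤

/-- `ρ` makes `M` a `d`-bounded Stein manifold: it is a smooth strictly plurisubharmonic
exhaustion function, and `η = i ∂̄ρ` is bounded for the Kähler metric with fundamental form
`i ∂∂̄ρ`. -/
structure IsDBoundedStein (n : ℕ) {M : Type*} [TopologicalSpace M] [ChartedSpace (Cn n) M]
    (ρ : M → ℝ) : Prop where
  smooth : ContMDiff 𝓘(ℝ, Cn n) 𝓘(ℝ, ℝ) ∞ ρ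
  exhaustion : ∀ c : ℝ, IsCompact {x | ρ x ≤ c}
  strictly_psh : ∀ (x : M) (v : Cn n), v ≠ 0 → 0 < metric ρ x v v
  bounded : ∃ C : ℝ, ∀ x : M, √(normSq (n := n) ρ 1 (eta ρ) x) ≤ C

end BottChern

end

/-! ### Linear algebra on `ℂⁿ`: coordinates, metric contractions and the Hodge operator under linear
changes of basis. -/

noncomputable section

open scoped Manifold ContDiff ComplexConjugate

namespace BottChern

/-! ### Linear algebra in the real coordinate basis -/

/-! Throughout, a sign `σ` treats both types of derivative at once: `σ = -1` stands for `∂` and `σ =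
1` for `∂̄`. Write `Δ = ∂∂* + ∂*∂` (`lap`). By the Kähler identities (`kahler_identity`), `∂*` and
`∂̄*` are, up to the factors `±i`, the commutators of the dual Lefschetz operator `Λ` with `∂̄` and
`∂`. It follows formally that `∂*` anticommutes with `∂̄`, that `∂̄*` anticommutes with `∂`, and
that the `∂`- and `∂̄`-Laplacians coincide. The fourth-order part of the Bott–Chern Laplacian is
therefore `Δ²` (`bottChern_algebra`), and the equation reads `Δ²φ + ∂̄*∂̄φ + ∂*∂φ = 0`. For
compactly supported `φ`, pairing with `φ` would already give `Δφ = 0`, `∂̄φ = 0` and `∂φ = 0`.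

In general the equation is paired with `χφ`, where `χ = cut R ∘ ρ` has compact support because `ρ`
is an exhaustion (`integral_weak_bottChern`). The commutators of `Δ`, `∂`, `∂̄` with `χ` have to be
bounded pointwise by `√χ (|φ| + |∇φ|) / R`. The first derivatives of `χ` cause no trouble, because
`dρ` is bounded: this is what `d`-boundedness provides. The full Hessian of `ρ` is not controlled.
But each half of `Δ` composes derivatives of opposite types, so it sees only the `i`-invariant part
of the Hessian of `χ`, which is built from `dρ` and from `i∂∂̄ρ`; the latter is the Kähler form
itself and has constant length (`norm_mixed_le`, `exists_norm_lap_comm_le`). Since the cutoff is a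
fourth power, its derivatives are `O(√χ / R)`, and Young's inequality absorbs the cross terms into
half of the main term (`exists_re_hm_ge`). What remains is `O(1/R)` times the `W^{1,2}` energy, and
`R → ∞` finishes the argument (`eq_zero_of_cutoff`).

Then `Δφ = 0` and `∂φ = 0` leave `∂∂*φ = 0`. The same cutoff argument, now for `∂*` alone, gives
`∂*φ = 0` (`ddStar_eq_zero_of_dd_ddStar_eq_zero`), which is stronger than `∂̄*∂*φ = 0`.

All pointwise identities are checked at the centre of holomorphic normal coordinates
(`exists_normal_map`), which exist because the metric comes from a potential. There the metric
agrees with the flat one to first order, so `∗`, `Λ` and the Hermitian product differentiate as if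
they were constant, and ordinary first derivatives of forms are covariant derivatives. The formula
for the adjoints, the Kähler identities and the product rule behind formal adjointness thus become
multilinear algebra on `ℂⁿ`. Integration by parts comes from Stokes' theorem in charts, glued by a
partition of unity (`integral_ddStar`). -/

/-- The real coordinates as a linear equivalence. -/
def coordEquiv (n : ℕ) : Cn n ≃ₗ[ℝ] (Idx n → ℝ) where
  toFun v i := coord i v
  map_add' v w := funext fun _ => coord_add _ v w
  map_smul' r v := funext fun _ => coord_smul _ r v
  invFun f j := ⟨f (j, 0), f (j, 1)⟩
  left_inv v := by
    funext j
    apply Complex.ext <;> simp [coord]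
  right_inv f := by
    funext ⟨j, c⟩
    fin_cases c <;> simp [coord]

/-- The basis of real coordinate vectors. -/
def basisR (n : ℕ) : Module.Basis (Idx n) ℝ (Cn n) := Module.Basis.ofEquivFun (coordEquiv n)

theorem coord_vec {n : ℕ} (i j : Idx n) : coord i (vec j) = if i = j then 1 else 0 := by
  obtain ⟨a, c⟩ := i
  obtain ⟨b, d⟩ := j
  by_cases h : a = b
  · subst h
    fin_cases c <;> fin_cases d <;> simp [coord, vec]
  · fin_cases c <;> fin_cases d <;> simp [coord, vec, h]

@[simp]
theorem basisR_repr {n : ℕ} (v : Cn n) (i : Idx n) : (basisR n).repr v i = coord i v := rfl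

@[simp]
theorem basisR_apply {n : ℕ} (i : Idx n) : basisR n i = vec i := by
  apply (basisR n).repr.injective
  ext j
  rw [Module.Basis.repr_self, basisR_repr, coord_vec, Finsupp.single_apply]
  simp [eq_comm]

theorem sum_coord_smul_vec {n : ℕ} (v : Cn n) : ∑ i, coord i v • vec i = v := by
  simpa using (basisR n).sum_repr v

/-- The matrix of a real-linear endomorphism of `ℂⁿ`. -/
def mat {n : ℕ} (A : Cn n →L[ℝ] Cn n) : Matrix (Idx n) (Idx n) ℝ :=
  Matrix.of fun i j => coord i (A (vec j))

theorem apply_vec {n : ℕ} (A : Cn n →L[ℝ] Cn n) (j : Idx n) :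
    A (vec j) = ∑ i, mat A i j • vec i := (sum_coord_smul_vec _).symm

theorem mat_eq_toMatrix {n : ℕ} (A : Cn n →L[ℝ] Cn n) :
    mat A = LinearMap.toMatrix (basisR n) (basisR n) (A : Cn n →ₗ[ℝ] Cn n) := by
  ext i j
  simp [LinearMap.toMatrix_apply, mat]

theorem det_mat {n : ℕ} (A : Cn n →L[ℝ] Cn n) :
    (mat A).det = LinearMap.det (A : Cn n →ₗ[ℝ] Cn n) := by
  rw [mat_eq_toMatrix, LinearMap.det_toMatrix]

theorem mat_comp {n : ℕ} (A B : Cn n →L[ℝ] Cn n) : mat (A.comp B) = mat A * mat B := by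
  simp only [mat_eq_toMatrix]
  exact LinearMap.toMatrix_comp (basisR n) (basisR n) (basisR n) _ _

theorem mat_id {n : ℕ} : mat (ContinuousLinearMap.id ℝ (Cn n)) = 1 := by
  rw [mat_eq_toMatrix]
  exact LinearMap.toMatrix_id (basisR n)

/-- A real-linear map that commutes with multiplication by `i`. -/
def IsCLin {n : ℕ} (A : Cn n →L[ℝ] Cn n) : Prop := ∀ v, A (Complex.I • v) = Complex.I • A v

theorem IsCLin.smul {n : ℕ} {A : Cn n →L[ℝ] Cn n} (hA : IsCLin A) (c : ℂ) (v : Cn n) :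
    A (c • v) = c • A v := by
  have h : ∀ (c : ℂ) (w : Cn n), c • w = c.re • w + c.im • (Complex.I • w) := by
    intro c w
    funext j
    apply Complex.ext <;> simp [sub_eq_add_neg]
  rw [h c v, h c (A v), map_add, map_smul, map_smul, hA v]

theorem isCLin_restrictScalars {n : ℕ} (A : Cn n →L[ℂ] Cn n) :
    IsCLin (A.restrictScalars ℝ) := fun v => by simp

/-- A complex-linear automorphism has positive real determinant. -/
theorem IsCLin.det_pos {n : ℕ} {A : Cn n →L[ℝ] Cn n} (hA : IsCLin A) (h : (mat A).det ≠ 0) :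
    0 < (mat A).det := by
  let A' : Cn n →ₗ[ℂ] Cn n :=
    { toFun := A, map_add' := A.map_add, map_smul' := fun c v => hA.smul c v }
  have e : (A : Cn n →ₗ[ℝ] Cn n) = A'.restrictScalars ℝ := rfl
  -- The real determinant of a complex-linear map is the squared modulus of its complex determinant.
  rw [det_mat, e, LinearMap.det_restrictScalars, Algebra.norm_complex_apply] at h ⊢
  exact lt_of_le_of_ne (Complex.normSq_nonneg _) (Ne.symm h)

/-! ### Components of forms -/

theorem comps_injective {n k : ℕ} : Function.Injective (comps : Alt n k → _) := by
  intro α β h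
  apply ContinuousAlternatingMap.toAlternatingMap_injective
  apply Module.Basis.ext_alternating (basisR n)
  intro v _
  simpa [comps] using congrFun h v

/-- Components, as a real-linear map. -/
def compsLin (n k : ℕ) : Alt n k →ₗ[ℝ] ((Fin k → Idx n) → ℂ) where
  toFun := comps
  map_add' _ _ := rfl
  map_smul' _ _ := rfl

instance (n k : ℕ) : FiniteDimensional ℝ (Alt n k) :=
  FiniteDimensional.of_injective (compsLin n k) comps_injective

/-- Components, as a continuous linear map. -/
def compsCLM (n k : ℕ) : Alt n k →L[ℝ] ((Fin k → Idx n) → ℂ) :=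
  LinearMap.toContinuousLinearMap (compsLin n k)

/-- Smoothness of a form-valued map can be tested on components, by applying this left inverse to
them. -/
theorem exists_compsCLM_leftInverse (n k : ℕ) :
    ∃ g : ((Fin k → Idx n) → ℂ) →L[ℝ] Alt n k, ∀ α, g (comps α) = α := by
  obtain ⟨g, hg⟩ := (compsLin n k).exists_leftInverse_of_injective
    (LinearMap.ker_eq_bot.2 comps_injective)
  exact ⟨LinearMap.toContinuousLinearMap g, fun α => LinearMap.congr_fun hg α⟩

/-- Pull-back of a form by a linear map. -/
abbrev pb {n k : ℕ} (A : Cn n →L[ℝ] Cn n) (α : Alt n k) : Alt n k := α.compContinuousLinearMap A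

theorem multilinear_apply_comp {n k : ℕ} {V : Type*} [AddCommGroup V] [Module ℝ V]
    (F : MultilinearMap ℝ (fun _ : Fin k => Cn n) V) (A : Cn n →L[ℝ] Cn n) (s : Fin k → Idx n) :
    F (fun a => A (vec (s a))) =
      ∑ s' : Fin k → Idx n, (∏ a, mat A (s' a) (s a)) • F (fun a => vec (s' a)) := by
  have : (fun a => A (vec (s a))) = fun a => ∑ i, mat A i (s a) • (vec i : Cn n) :=
    funext fun a => apply_vec A _
  rw [this, F.map_sum]
  exact Finset.sum_congr rfl fun s' _ => F.map_smul_univ _ _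

theorem comps_pb {n k : ℕ} (A : Cn n →L[ℝ] Cn n) (α : Alt n k) (s : Fin k → Idx n) :
    comps (pb A α) s = ∑ s' : Fin k → Idx n, (∏ a, mat A (s' a) (s a)) • comps α s' :=
  multilinear_apply_comp α.toMultilinearMap A s

/-- There are only `2n` coordinate vectors, so a longer tuple repeats one of them. This disposes of
all degrees above `2n`, where `star` is `0` by convention. -/
theorem subsingleton_of_lt {n k : ℕ} (h : n * 2 < k) : Subsingleton (Alt n k) := by
  refine ⟨fun α β => comps_injective (funext fun s => ?_)⟩
  have hs : ¬ Function.Injective fun a => (vec (s a) : Cn n) := by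
    intro hs
    have := Fintype.card_le_of_injective s (fun a b hab => hs (by simp [hab]))
    simp at this
    omega
  simp only [comps]
  rw [α.map_eq_zero_of_not_injective _ hs, β.map_eq_zero_of_not_injective _ hs]

/-! ### Metric contractions -/

/-- Full contraction of two covariant tensors by the metric with Gram matrix `G`. -/
def contr {n k : ℕ} (G : Matrix (Idx n) (Idx n) ℝ) (S T : (Fin k → Idx n) → ℂ) : ℂ :=
  ∑ s : Fin k → Idx n, ∑ t : Fin k → Idx n, ((∏ a, G⁻¹ (s a) (t a) : ℝ) : ℂ) * S s * T t

theorem inv_transform {n : ℕ} (G M : Matrix (Idx n) (Idx n) ℝ) (hM : M.det ≠ 0) :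
    M * (M.transpose * G * M)⁻¹ * M.transpose = G⁻¹ := by
  have hu : IsUnit M.det := isUnit_iff_ne_zero.2 hM
  have hu' : IsUnit M.transpose.det := by rwa [Matrix.det_transpose]
  rw [Matrix.mul_inv_rev, Matrix.mul_inv_rev, ← Matrix.mul_assoc, Matrix.mul_nonsing_inv _ hu,
    Matrix.one_mul, Matrix.mul_assoc, Matrix.nonsing_inv_mul _ hu', Matrix.mul_one]

/-- The inverse Gram matrix transforms contravariantly (`inv_transform`), which cancels the matrices
coming from the covariant components. The coordinate independence of `herm` and `hodge` rests on
this. -/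
theorem contr_transform {n k : ℕ} (G : Matrix (Idx n) (Idx n) ℝ) (A : Cn n →L[ℝ] Cn n)
    (hA : (mat A).det ≠ 0) (F H : MultilinearMap ℝ (fun _ : Fin k => Cn n) ℂ) :
    contr ((mat A).transpose * G * mat A) (fun s => F fun a => A (vec (s a)))
      (fun s => H fun a => A (vec (s a))) =
    contr G (fun s => F fun a => vec (s a)) (fun s => H fun a => vec (s a)) := by
  have key : ∀ s' t' : Fin k → Idx n, ∏ a, G⁻¹ (s' a) (t' a) =
      ∑ s : Fin k → Idx n, ∑ t : Fin k → Idx n,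
        (∏ a, mat A (s' a) (s a)) * (∏ a, ((mat A).transpose * G * mat A)⁻¹ (s a) (t a)) *
          ∏ a, mat A (t' a) (t a) := by
    intro s' t'
    rw [← inv_transform G (mat A) hA]
    simp_rw [← Finset.prod_mul_distrib]
    rw [Finset.sum_comm]
    simp_rw [Matrix.mul_apply (M := mat A * _), Matrix.mul_apply (M := mat A),
      Matrix.transpose_apply, Finset.sum_mul]
    rw [Finset.prod_univ_sum]
    simp only [Fintype.piFinset_univ]
    refine Finset.sum_congr rfl fun t _ => ?_
    rw [Finset.prod_univ_sum]
    simp only [Fintype.piFinset_univ]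
  unfold contr
  simp_rw [multilinear_apply_comp F A, multilinear_apply_comp H A, key]
  simp only [Complex.ofReal_sum, Finset.mul_sum, Finset.sum_mul]
  have e : ∀ f : (Fin k → Idx n) → (Fin k → Idx n) → (Fin k → Idx n) → (Fin k → Idx n) → ℂ,
      ∑ s, ∑ t, ∑ t', ∑ s', f s t s' t' = ∑ s', ∑ t', ∑ s, ∑ t, f s t s' t' := by
    intro f
    calc _ = ∑ s, ∑ t', ∑ t, ∑ s', f s t s' t' :=
          Finset.sum_congr rfl fun s _ => Finset.sum_comm
      _ = ∑ t', ∑ s, ∑ t, ∑ s', f s t s' t' := Finset.sum_comm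
      _ = ∑ t', ∑ s', ∑ s, ∑ t, f s t s' t' := by
          refine Finset.sum_congr rfl fun t' _ => ?_
          calc _ = ∑ s, ∑ s', ∑ t, f s t s' t' :=
                Finset.sum_congr rfl fun s _ => Finset.sum_comm
            _ = _ := Finset.sum_comm
      _ = _ := Finset.sum_comm
  rw [e]
  refine Finset.sum_congr rfl fun s' _ => Finset.sum_congr rfl fun t' _ =>
    Finset.sum_congr rfl fun s _ => Finset.sum_congr rfl fun t _ => ?_
  simp only [Complex.real_smul]
  push_cast
  ring

/-- The conjugate of a complex-valued real-multilinear map. -/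
def conjMul {n k : ℕ} (F : MultilinearMap ℝ (fun _ : Fin k => Cn n) ℂ) :
    MultilinearMap ℝ (fun _ : Fin k => Cn n) ℂ :=
  Complex.conjLIE.toLinearEquiv.toLinearMap.compMultilinearMap F

theorem herm_eq_contr {n k : ℕ} (G : Matrix (Idx n) (Idx n) ℝ) (S T : (Fin k → Idx n) → ℂ) :
    herm G S T = (k.factorial : ℂ)⁻¹ * contr G S (fun t => conj (T t)) := rfl

theorem herm_transform {n k : ℕ} (G : Matrix (Idx n) (Idx n) ℝ) (A : Cn n →L[ℝ] Cn n)
    (hA : (mat A).det ≠ 0) (F H : MultilinearMap ℝ (fun _ : Fin k => Cn n) ℂ) :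
    herm ((mat A).transpose * G * mat A) (fun s => F fun a => A (vec (s a)))
      (fun s => H fun a => A (vec (s a))) =
    herm G (fun s => F fun a => vec (s a)) (fun s => H fun a => vec (s a)) := by
  rw [herm_eq_contr, herm_eq_contr]
  congr 1
  exact contr_transform G A hA F (conjMul H)

theorem herm_pb {n k : ℕ} (G : Matrix (Idx n) (Idx n) ℝ) (A : Cn n →L[ℝ] Cn n)
    (hA : (mat A).det ≠ 0) (α β : Alt n k) :
    herm ((mat A).transpose * G * mat A) (comps (pb A α)) (comps (pb A β)) =
      herm G (comps α) (comps β) :=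
  herm_transform G A hA α.toMultilinearMap β.toMultilinearMap

theorem prod_one_apply {n k : ℕ} (s t : Fin k → Idx n) :
    ∏ a, (1 : Matrix (Idx n) (Idx n) ℝ) (s a) (t a) = if s = t then 1 else 0 := by
  split_ifs with h
  · exact Finset.prod_eq_one fun a _ => by rw [h, Matrix.one_apply_eq]
  · obtain ⟨a, ha⟩ := Function.ne_iff.1 h
    exact Finset.prod_eq_zero (Finset.mem_univ a) (Matrix.one_apply_ne ha)

theorem contr_one {n k : ℕ} (S T : (Fin k → Idx n) → ℂ) :
    contr 1 S T = ∑ s, S s * T s := by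
  have h1 : (1 : Matrix (Idx n) (Idx n) ℝ)⁻¹ = 1 := Matrix.inv_eq_right_inv (one_mul 1)
  have h2 : ∀ s t : Fin k → Idx n,
      ∏ a, (1 : Matrix (Idx n) (Idx n) ℝ)⁻¹ (s a) (t a) = if s = t then 1 else 0 := by
    rw [h1]
    exact prod_one_apply
  unfold contr
  refine Finset.sum_congr rfl fun s _ => ?_
  rw [Finset.sum_eq_single s]
  · rw [h2 s s, if_pos rfl]
    simp
  · intro t _ hts
    rw [h2 s t, if_neg (Ne.symm hts)]
    simp
  · simp

theorem herm_one {n k : ℕ} (S T : (Fin k → Idx n) → ℂ) :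
    herm 1 S T = (k.factorial : ℂ)⁻¹ * ∑ s, S s * conj (T s) := by
  rw [herm_eq_contr, contr_one]

/-! ### The volume form and the Hodge operator -/

/-- The coordinate basis in the order used by `detForm`. -/
def basisFin {n m : ℕ} (h : m = n * 2) : Module.Basis (Fin m) ℝ (Cn n) :=
  (basisR n).reindex (finProdFinEquiv.trans (finCongr h.symm))

theorem detForm_eq {n m : ℕ} (h : m = n * 2) (w : Fin m → Cn n) :
    detForm h w = (basisFin h).det w := by
  rw [Module.Basis.det_apply, ← Matrix.det_transpose]
  rfl

theorem detForm_comp {n m : ℕ} (h : m = n * 2) (A : Cn n →L[ℝ] Cn n) (w : Fin m → Cn n) :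
    detForm h (fun a => A (w a)) = (mat A).det * detForm h w := by
  rw [detForm_eq, detForm_eq, det_mat]
  exact Module.Basis.det_comp (basisFin h) (A : Cn n →ₗ[ℝ] Cn n) w

theorem hodge_apply {n k l : ℕ} (h : k + l = n * 2) (G : Matrix (Idx n) (Idx n) ℝ) (β : Alt n k)
    (v : Fin l → Cn n) :
    hodge h G β v = (k.factorial : ℂ)⁻¹ * ((√G.det : ℝ) : ℂ) *
      contr G (fun s => (detForm h (Fin.append (fun a => vec (s a)) v) : ℂ))
        (fun t => conj (comps β t)) := by
  simp only [hodge, contr, ContinuousAlternatingMap.sum_apply, ContinuousAlternatingMap.smul_apply,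
    smul_eq_mul, Finset.mul_sum]
  refine Finset.sum_congr rfl fun s _ => ?_
  rw [Finset.sum_mul]
  refine Finset.sum_congr rfl fun t _ => ?_
  change _ * ((detForm h _ : ℝ) : ℂ) = _
  ring

theorem append_update_left {k l : ℕ} {α : Type*} [DecidableEq (Fin k)] (u : Fin k → α)
    (v : Fin l → α) (i : Fin k) (x : α) :
    Fin.append (Function.update u i x) v =
      Function.update (Fin.append u v) (Fin.castAdd l i) x := by
  funext b
  refine Fin.addCases (fun b => ?_) (fun b => ?_) b
  · rw [Fin.append_left]
    by_cases hb : b = i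
    · subst hb
      simp
    · rw [Function.update_of_ne hb, Function.update_of_ne, Fin.append_left]
      intro h
      exact hb (by simpa using h)
  · rw [Fin.append_right, Function.update_of_ne, Fin.append_right]
    intro hb
    have := congrArg Fin.val hb
    simp at this
    omega

/-- The volume form with its last arguments fixed, as a multilinear map. -/
def detLeft {n k l : ℕ} (h : k + l = n * 2) (v : Fin l → Cn n) :
    MultilinearMap ℝ (fun _ : Fin k => Cn n) ℂ where
  toFun u := (detForm h (Fin.append u v) : ℂ)
  map_update_add' u i x y := by
    simp only [append_update_left, AlternatingMap.map_update_add, Complex.ofReal_add]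
  map_update_smul' u i c x := by
    simp only [append_update_left, AlternatingMap.map_update_smul, smul_eq_mul,
      Complex.ofReal_mul, Complex.real_smul]

theorem append_comp {k l : ℕ} {α β : Type*} (f : α → β) (u : Fin k → α) (v : Fin l → α) :
    Fin.append (fun a => f (u a)) (fun a => f (v a)) = fun b => f (Fin.append u v b) := by
  funext b
  refine Fin.addCases (fun b => ?_) (fun b => ?_) b <;> simp

theorem det_transform {n : ℕ} (G M : Matrix (Idx n) (Idx n) ℝ) :
    (M.transpose * G * M).det = M.det ^ 2 * G.det := by
  rw [Matrix.det_mul, Matrix.det_mul, Matrix.det_transpose]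
  ring

theorem sqrt_det_transform {n : ℕ} (G M : Matrix (Idx n) (Idx n) ℝ) :
    √(M.transpose * G * M).det = |M.det| * √G.det := by
  rw [det_transform, Real.sqrt_mul (sq_nonneg _), Real.sqrt_sq_eq_abs]

/-- The factor `√det G` picks up `|det A|` and the volume form picks up `det A`. They agree because
`det A` is positive, as it is for invertible complex-linear `A`. -/
theorem hodge_pb {n k l : ℕ} (h : k + l = n * 2) (G : Matrix (Idx n) (Idx n) ℝ)
    (A : Cn n →L[ℝ] Cn n) (hA : 0 < (mat A).det) (β : Alt n k) :
    hodge h ((mat A).transpose * G * mat A) (pb A β) = pb A (hodge h G β) := by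
  ext v
  rw [ContinuousAlternatingMap.compContinuousLinearMap_apply, hodge_apply, hodge_apply,
    sqrt_det_transform, abs_of_pos hA]
  have := contr_transform G A hA.ne' (detLeft h (A ∘ v)) (conjMul β.toMultilinearMap)
  have e1 : (fun s : Fin k → Idx n => detLeft h (A ∘ v) fun a => A (vec (s a))) =
      fun s => ((mat A).det : ℂ) * (detForm h (Fin.append (fun a => vec (s a)) v) : ℂ) := by
    funext s
    change ((detForm h (Fin.append (fun a => A (vec (s a))) fun a => A (v a)) : ℝ) : ℂ) = _
    rw [append_comp A, detForm_comp]
    push_cast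
    rfl
  rw [e1] at this
  have e2 : ∀ (G : Matrix (Idx n) (Idx n) ℝ) (c : ℂ) (S T : (Fin k → Idx n) → ℂ),
      contr G (fun s => c * S s) T = c * contr G S T := by
    intro G c S T
    simp only [contr, Finset.mul_sum]
    refine Finset.sum_congr rfl fun s _ => Finset.sum_congr rfl fun t _ => ?_
    ring
  rw [e2] at this
  have e3 : contr G (fun s => (detForm h (Fin.append (fun a => vec (s a)) (A ∘ v)) : ℂ))
        (fun t => conj (comps β t)) =
      contr G (fun s => detLeft h (A ∘ v) fun a => vec (s a))
        (fun s => conjMul β.toMultilinearMap fun a => vec (s a)) := rfl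
  rw [e3, ← this, Complex.ofReal_mul]
  have e4 : (fun t => conj (comps (pb A β) t)) =
      fun s => conjMul β.toMultilinearMap fun a => A (vec (s a)) := rfl
  rw [e4]
  ring

end BottChern

end

/-! ### The flat Hodge operator applied to an antisymmetrized derivative. -/

noncomputable section

open scoped Manifold ContDiff ComplexConjugate

namespace BottChern

open ContinuousAlternatingMap (alternatizeUncurryFin alternatizeUncurryFin_apply)

/-! ### Signs of the volume form on concatenated tuples -/

theorem detForm_cast {n m m' : ℕ} (h : m = n * 2) (h' : m' = n * 2) (e : m = m')
    (w : Fin m' → Cn n) : detForm h (w ∘ Fin.cast e) = detForm h' w := by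
  subst e
  rfl

theorem detForm_append_insertNth {n k l : ℕ} (h : k + 1 + l = n * 2) (b : Fin (k + 1)) (x : Cn n)
    (u : Fin k → Cn n) (w : Fin l → Cn n) :
    detForm h (Fin.append (b.insertNth x u) w) =
      (-1) ^ (b : ℕ) * detForm h (Fin.append (Matrix.vecCons x u) w) := by
  let D : Cn n [⋀^Fin (k + 1)]→ₗ[ℝ] ℝ :=
    { toFun := fun u => detForm h (Fin.append u w)
      map_update_add' := fun u i x y => by
        simp only [append_update_left, AlternatingMap.map_update_add]
      map_update_smul' := fun u i c x => by
        simp only [append_update_left, AlternatingMap.map_update_smul]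
      map_eq_zero_of_eq' := fun v i j hv hij =>
        (detForm h).map_eq_zero_of_eq (i := Fin.castAdd l i) (j := Fin.castAdd l j) _
          (by simpa using hv) (by simpa using hij) }
  have := D.map_insertNth b x u
  rw [zsmul_eq_mul] at this
  push_cast at this
  exact this

theorem succAbove_natAdd_castAdd {k l : ℕ} (a : Fin (l + 1)) (c : Fin k) :
    (Fin.natAdd k a : Fin (k + l + 1)).succAbove (Fin.castAdd l c) = Fin.castAdd (l + 1) c := by
  apply Fin.ext
  rw [Fin.succAbove_of_castSucc_lt]
  · simp
  · simp [Fin.lt_def]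
    omega

theorem succAbove_natAdd_natAdd {k l : ℕ} (a : Fin (l + 1)) (c : Fin l) :
    (Fin.natAdd k a : Fin (k + l + 1)).succAbove (Fin.natAdd k c) =
      Fin.natAdd k (a.succAbove c) := by
  apply Fin.ext
  by_cases hc : c.castSucc < a
  · rw [Fin.succAbove_of_castSucc_lt _ _ hc, Fin.succAbove_of_castSucc_lt]
    · simp
    · simpa [Fin.lt_def] using hc
  · rw [Fin.succAbove_of_le_castSucc _ _ (not_lt.1 hc), Fin.succAbove_of_le_castSucc]
    · simp [add_assoc]
    · simpa [Fin.le_def] using hc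

theorem removeNth_natAdd_append {k l : ℕ} {α : Type*} (u : Fin k → α) (w : Fin (l + 1) → α)
    (a : Fin (l + 1)) :
    (Fin.natAdd k a : Fin (k + l + 1)).removeNth (Fin.append u w : Fin (k + (l + 1)) → α) =
      Fin.append u (a.removeNth w) := by
  funext c
  refine Fin.addCases (fun c => ?_) (fun c => ?_) c
  · rw [Fin.append_left, Fin.removeNth, succAbove_natAdd_castAdd, Fin.append_left]
  · rw [Fin.append_right, Fin.removeNth, succAbove_natAdd_natAdd, Fin.append_right]
    rfl

theorem removeNth_castAdd_append {k l : ℕ} {α : Type*} (u : Fin (k + 1) → α) (w : Fin (l + 1) → α)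
    (b : Fin (k + 1)) (e : k + 1 + l = k + (l + 1)) :
    (Fin.castAdd (l + 1) b : Fin (k + 1 + l + 1)).removeNth
        (Fin.append u w : Fin (k + 1 + (l + 1)) → α) =
      Fin.append (b.removeNth u) w ∘ Fin.cast e := by
  funext c
  obtain ⟨c, rfl⟩ : ∃ d, c = Fin.cast e.symm d := ⟨Fin.cast e c, rfl⟩
  simp only [Function.comp_apply, Fin.cast_cast, Fin.cast_eq_self]
  refine Fin.addCases (fun c => ?_) (fun c => ?_) c
  · rw [Fin.append_left, Fin.removeNth]
    have : (Fin.castAdd (l + 1) b : Fin (k + 1 + l + 1)).succAbove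
        (Fin.cast e.symm (Fin.castAdd (l + 1) c)) = Fin.castAdd (l + 1) (b.succAbove c) := by
      apply Fin.ext
      by_cases hc : c.castSucc < b
      · rw [Fin.succAbove_of_castSucc_lt, Fin.val_castAdd, Fin.succAbove_of_castSucc_lt _ _ hc]
        · simp
        · simpa [Fin.lt_def] using hc
      · rw [Fin.succAbove_of_le_castSucc, Fin.val_castAdd,
          Fin.succAbove_of_le_castSucc _ _ (not_lt.1 hc)]
        · simp
        · simpa [Fin.le_def] using hc
    rw [this, Fin.append_left]
    rfl
  · rw [Fin.append_right, Fin.removeNth]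
    have : (Fin.castAdd (l + 1) b : Fin (k + 1 + l + 1)).succAbove
        (Fin.cast e.symm (Fin.natAdd k c)) = Fin.natAdd (k + 1) c := by
      apply Fin.ext
      rw [Fin.succAbove_of_le_castSucc]
      · simp
        omega
      · simp [Fin.le_def]
        omega
    rw [this, Fin.append_right]

theorem detForm_append_cons {n k l : ℕ} (h : k + 1 + l = n * 2) (h' : k + (l + 1) = n * 2)
    (x : Cn n) (u : Fin k → Cn n) (w : Fin l → Cn n) :
    detForm h' (Fin.append u (Matrix.vecCons x w)) =
      (-1) ^ k * detForm h (Fin.append (Matrix.vecCons x u) w) := by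
  have e1 : (Fin.append u (Matrix.vecCons x w) : Fin (k + (l + 1)) → Cn n) =
      (Fin.natAdd k (0 : Fin (l + 1)) : Fin (k + l + 1)).insertNth x (Fin.append u w) := by
    rw [Fin.eq_insertNth_iff]
    refine ⟨by simp, ?_⟩
    rw [removeNth_natAdd_append]
    rfl
  have e2 : Fin.append (Matrix.vecCons x u) w =
      Matrix.vecCons x (Fin.append u w) ∘ Fin.cast (by omega) := Fin.append_cons x u w
  have h3 : k + l + 1 = n * 2 := h'
  rw [e2, detForm_cast h h3]
  change detForm h3 _ = _
  rw [e1, AlternatingMap.map_insertNth]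
  simp

/-- In dimension `2n`, `ℓ ∧ (dx¹ ∧ ⋯ ∧ dyⁿ) = 0` for every linear functional `ℓ`. -/
theorem sum_removeNth_detForm {n k l : ℕ} (h : k + 1 + l = n * 2) (h' : k + (l + 1) = n * 2)
    (ℓ : Cn n →ₗ[ℝ] ℂ) (u : Fin (k + 1) → Cn n) (w : Fin (l + 1) → Cn n) :
    ∑ a : Fin (l + 1), (-1 : ℂ) ^ (a : ℕ) * (ℓ (w a) * (detForm h (Fin.append u (a.removeNth w)) : ℂ)) =
      (-1) ^ k * ∑ b : Fin (k + 1), (-1 : ℂ) ^ (b : ℕ) *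
        (ℓ (u b) * (detForm h' (Fin.append (b.removeNth u) w) : ℂ)) := by
  let D : Cn n [⋀^Fin (k + 1 + l)]→ₗ[ℝ] ℂ := Complex.ofRealCLM.toLinearMap.compAlternatingMap
    (detForm h)
  let f : Cn n →ₗ[ℝ] Cn n [⋀^Fin (k + 1 + l)]→ₗ[ℝ] ℂ :=
    { toFun := fun v => ℓ v • D
      map_add' := fun v w => by rw [map_add, add_smul]
      map_smul' := fun r v => by rw [map_smul, smul_assoc]; rfl }
  -- This is `ℓ ∧ vol` on the `2n + 1` vectors `u`, `w`, which are linearly dependent. Splitting the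
  -- alternating sum into the terms where `ℓ` meets a `u` and those where it meets a `w` gives the
  -- identity.
  have hz : AlternatingMap.alternatizeUncurryFin f (Fin.append u w : Fin (k + 1 + (l + 1)) → Cn n)
      = 0 := by
    apply AlternatingMap.map_linearDependent
    intro hli
    have h1 := hli.fintype_card_le_finrank
    have h2 : Module.finrank ℝ (Cn n) = n * 2 := by
      rw [Module.finrank_eq_card_basis (basisR n)]
      simp
    rw [h2, Fintype.card_fin] at h1
    omega
  rw [AlternatingMap.alternatizeUncurryFin_apply] at hz
  change ∑ i : Fin (k + 1 + (l + 1)), _ = 0 at hz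
  rw [Fin.sum_univ_add] at hz
  have e1 : ∀ b : Fin (k + 1), (-1 : ℤ) ^ ((Fin.castAdd (l + 1) b : Fin _) : ℕ) •
        (f (Fin.append u w (Fin.castAdd (l + 1) b)))
        ((Fin.castAdd (l + 1) b : Fin (k + 1 + l + 1)).removeNth
          (Fin.append u w : Fin (k + 1 + (l + 1)) → Cn n)) =
      (-1 : ℂ) ^ (b : ℕ) * (ℓ (u b) * (detForm h' (Fin.append (b.removeNth u) w) : ℂ)) := by
    intro b
    rw [removeNth_castAdd_append u w b (by omega), Fin.append_left]
    change _ • (ℓ (u b) * ((detForm h _ : ℝ) : ℂ)) = _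
    rw [detForm_cast h h']
    simp
  have e2 : ∀ a : Fin (l + 1), (-1 : ℤ) ^ ((Fin.natAdd (k + 1) a : Fin _) : ℕ) •
        (f (Fin.append u w (Fin.natAdd (k + 1) a)))
        ((Fin.natAdd (k + 1) a : Fin (k + 1 + l + 1)).removeNth
          (Fin.append u w : Fin (k + 1 + (l + 1)) → Cn n)) =
      (-1) ^ (k + 1) * ((-1 : ℂ) ^ (a : ℕ) *
        (ℓ (w a) * (detForm h (Fin.append u (a.removeNth w)) : ℂ))) := by
    intro a
    rw [removeNth_natAdd_append, Fin.append_right]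
    change _ • (ℓ (w a) * ((detForm h _ : ℝ) : ℂ)) = _
    rw [Fin.val_natAdd, pow_add]
    simp [mul_assoc]
  rw [Finset.sum_congr rfl fun b _ => e1 b, Finset.sum_congr rfl fun a _ => e2 a,
    ← Finset.mul_sum] at hz
  have hk : ((-1 : ℂ) ^ k) * (-1) ^ k = 1 := by rw [← mul_pow]; simp
  rw [eq_neg_of_add_eq_zero_left hz, pow_succ]
  linear_combination (∑ a : Fin (l + 1), (-1 : ℂ) ^ (a : ℕ) *
    (ℓ (w a) * (detForm h (Fin.append u (a.removeNth w)) : ℂ))) * (-hk)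

/-! ### The Hodge operator of the standard metric -/

theorem sum_tuple_succ {n k : ℕ} {V : Type*} [AddCommMonoid V] (b : Fin (k + 1))
    (f : (Fin (k + 1) → Idx n) → V) :
    ∑ s, f s = ∑ i : Idx n, ∑ s' : Fin k → Idx n, f (b.insertNth i s') := by
  rw [← Fintype.sum_prod_type']
  exact (Equiv.sum_comp (Fin.insertNthEquiv (fun _ => Idx n) b) f).symm

theorem vec_insertNth {n k : ℕ} (b : Fin (k + 1)) (i : Idx n) (s : Fin k → Idx n) :
    (fun a => (vec ((b.insertNth i s : Fin (k + 1) → Idx n) a) : Cn n)) =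
      b.insertNth (vec i) (fun a => vec (s a)) := by
  rw [Fin.eq_insertNth_iff]
  refine ⟨by simp, ?_⟩
  funext a
  simp [Fin.removeNth]

theorem hodge_one_apply {n k l : ℕ} (h : k + l = n * 2) (β : Alt n k) (v : Fin l → Cn n) :
    hodge h 1 β v = (k.factorial : ℂ)⁻¹ *
      ∑ s, (detForm h (Fin.append (fun a => vec (s a)) v) : ℂ) * conj (comps β s) := by
  rw [hodge_apply, contr_one]
  simp

theorem hodge_smul {n k l : ℕ} (h : k + l = n * 2) (G : Matrix (Idx n) (Idx n) ℝ) (c : ℂ)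
    (β : Alt n k) : hodge h G (c • β) = conj c • hodge h G β := by
  ext v
  rw [ContinuousAlternatingMap.smul_apply, hodge_apply, hodge_apply]
  have : (fun t => conj (comps (c • β) t)) = fun t => conj c * conj (comps β t) := by
    funext t
    simp [comps]
  rw [this]
  simp only [contr, smul_eq_mul, Finset.mul_sum]
  refine Finset.sum_congr rfl fun s _ => Finset.sum_congr rfl fun t _ => ?_
  ring

theorem hodge_add {n k l : ℕ} (h : k + l = n * 2) (G : Matrix (Idx n) (Idx n) ℝ)
    (β γ : Alt n k) : hodge h G (β + γ) = hodge h G β + hodge h G γ := by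
  ext v
  rw [ContinuousAlternatingMap.add_apply, hodge_apply, hodge_apply, hodge_apply, ← mul_add]
  have : (fun t => conj (comps (β + γ) t)) = fun t => conj (comps β t) + conj (comps γ t) := by
    funext t
    simp [comps]
  rw [this]
  congr 1
  simp only [contr, ← Finset.sum_add_distrib]
  refine Finset.sum_congr rfl fun s _ => Finset.sum_congr rfl fun t _ => ?_
  ring

theorem hodge_real_smul {n k l : ℕ} (h : k + l = n * 2) (G : Matrix (Idx n) (Idx n) ℝ) (c : ℝ)
    (β : Alt n k) : hodge h G (c • β) = c • hodge h G β := by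
  have := hodge_smul h G (c : ℂ) β
  rw [Complex.conj_ofReal] at this
  exact this

/-- The Hodge operator as a real-linear map. -/
def hodgeL {n k l : ℕ} (h : k + l = n * 2) (G : Matrix (Idx n) (Idx n) ℝ) :
    Alt n k →L[ℝ] Alt n l :=
  LinearMap.toContinuousLinearMap
    { toFun := hodge h G
      map_add' := hodge_add h G
      map_smul' := hodge_real_smul h G }

@[simp]
theorem hodgeL_apply {n k l : ℕ} (h : k + l = n * 2) (G : Matrix (Idx n) (Idx n) ℝ) (β : Alt n k) :
    hodgeL h G β = hodge h G β := rfl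

/-- The metric trace `∑ ι_{e_i} L(e_i)` of a form-valued linear map, for the standard metric. -/
def trace {n k : ℕ} (L : Cn n →L[ℝ] Alt n (k + 1)) : Alt n k := ∑ i, (L (vec i)).curryLeft (vec i)

theorem trace_apply {n k : ℕ} (L : Cn n →L[ℝ] Alt n (k + 1)) (v : Fin k → Cn n) :
    trace L v = ∑ i, L (vec i) (Matrix.vecCons (vec i) v) := by
  simp [trace, ContinuousAlternatingMap.sum_apply]

/-- The conjugate of a form-valued linear map evaluated on a tuple. -/
def conjEval {n k : ℕ} (L : Cn n →L[ℝ] Alt n k) (u : Fin k → Cn n) : Cn n →ₗ[ℝ] ℂ where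
  toFun v := conj (L v u)
  map_add' v w := by simp
  map_smul' r v := by simp

/-- `sum_removeNth_detForm` moves the derivative index from the `l + 1` free slots into the `k + 1`
slots that are contracted with the form, where summation turns it into a trace. The `k + 1` slots
contribute equally, which changes `1/(k+1)!` into `1/k!`. For `L` a derivative this is the flat
formula expressing `d∗` as `±∗` of a divergence. -/
theorem alternatize_hodge_one {n k l : ℕ} (h : k + 1 + l = n * 2) (h' : k + (l + 1) = n * 2)
    (L : Cn n →L[ℝ] Alt n (k + 1)) :
    alternatizeUncurryFin ((hodgeL h 1).comp L) = (-1 : ℂ) ^ k • hodge h' 1 (trace L) := by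
  ext w
  rw [alternatizeUncurryFin_apply, ContinuousAlternatingMap.smul_apply, hodge_one_apply]
  simp only [ContinuousLinearMap.comp_apply, hodgeL_apply, hodge_one_apply]
  have e1 : ∑ a : Fin (l + 1), (-1 : ℤ) ^ (a : ℕ) • (((k + 1).factorial : ℂ)⁻¹ *
      ∑ s, (detForm h (Fin.append (fun a => vec (s a)) (a.removeNth w)) : ℂ) *
        conj (comps (L (w a)) s)) =
      ((k + 1).factorial : ℂ)⁻¹ * ∑ s : Fin (k + 1) → Idx n, ∑ a : Fin (l + 1), (-1 : ℂ) ^ (a : ℕ) *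
        (conjEval L (fun b => vec (s b)) (w a) *
          (detForm h (Fin.append (fun a => vec (s a)) (a.removeNth w)) : ℂ)) := by
    rw [Finset.sum_comm, Finset.mul_sum]
    refine Finset.sum_congr rfl fun a _ => ?_
    rw [zsmul_eq_mul]
    push_cast
    rw [mul_left_comm, Finset.mul_sum]
    congr 1
    refine Finset.sum_congr rfl fun s _ => ?_
    change _ = _ * (conj (comps (L (w a)) s) * _)
    ring
  rw [e1]
  simp_rw [sum_removeNth_detForm h h']
  rw [← Finset.mul_sum, Finset.sum_comm]
  have e2 : ∀ b : Fin (k + 1), ∑ s : Fin (k + 1) → Idx n, (-1 : ℂ) ^ (b : ℕ) *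
      (conjEval L (fun b => vec (s b)) (vec (s b)) *
        (detForm h' (Fin.append (b.removeNth fun b => vec (s b)) w) : ℂ)) =
      ∑ s : Fin k → Idx n, (detForm h' (Fin.append (fun a => vec (s a)) w) : ℂ) *
        conj (comps (trace L) s) := by
    intro b
    rw [sum_tuple_succ b, Finset.sum_comm]
    refine Finset.sum_congr rfl fun s _ => ?_
    have : comps (trace L) s = ∑ i, L (vec i) (Matrix.vecCons (vec i) fun a => vec (s a)) :=
      trace_apply L _
    rw [this, map_sum, Finset.mul_sum]
    refine Finset.sum_congr rfl fun i _ => ?_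
    have e3 : conjEval L (fun c => vec ((b.insertNth i s : Fin (k + 1) → Idx n) c))
        (vec ((b.insertNth i s : Fin (k + 1) → Idx n) b)) =
        (-1) ^ (b : ℕ) * conj (L (vec i) (Matrix.vecCons (vec i) fun a => vec (s a))) := by
      change conj (L _ _) = _
      rw [Fin.insertNth_apply_same, vec_insertNth, ContinuousAlternatingMap.map_insertNth]
      simp
    rw [e3, vec_insertNth, Fin.removeNth_insertNth]
    have hb : ((-1 : ℂ) ^ (b : ℕ)) * (-1) ^ (b : ℕ) = 1 := by rw [← mul_pow]; simp
    linear_combination (conj (L (vec i) (Matrix.vecCons (vec i) fun a => vec (s a))) *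
      (detForm h' (Fin.append (fun a => vec (s a)) w) : ℂ)) * hb
  rw [Finset.sum_congr rfl fun b _ => e2 b]
  simp only [Finset.sum_const, Finset.card_univ, Fintype.card_fin, nsmul_eq_mul, smul_eq_mul]
  rw [Nat.factorial_succ]
  push_cast
  have h1 : (k : ℂ) + 1 ≠ 0 := by exact_mod_cast Nat.succ_ne_zero k
  have h2 : (k.factorial : ℂ) ≠ 0 := by exact_mod_cast Nat.factorial_ne_zero k
  field_simp

/-- The real functional dual to a coordinate vector. -/
def coordC {n : ℕ} (i : Idx n) : Cn n →L[ℝ] ℂ := LinearMap.toContinuousLinearMap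
  { toFun := fun v => (coord i v : ℂ)
    map_add' := fun v w => by rw [coord_add]; push_cast; rfl
    map_smul' := fun r v => by rw [coord_smul]; push_cast; rfl }

@[simp]
theorem coordC_apply {n : ℕ} (i : Idx n) (v : Cn n) : coordC i v = (coord i v : ℂ) := rfl

/-- The exterior product `ℓ ∧ β` with a one-form `ℓ`. -/
def wedge {n k : ℕ} (ℓ : Cn n →L[ℝ] ℂ) (β : Alt n k) : Alt n (k + 1) :=
  alternatizeUncurryFin (ℓ.smulRight β)

theorem wedge_apply {n k : ℕ} (ℓ : Cn n →L[ℝ] ℂ) (β : Alt n k) (v : Fin (k + 1) → Cn n) :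
    wedge ℓ β v = ∑ a : Fin (k + 1), (-1) ^ (a : ℕ) * (ℓ (v a) * β (a.removeNth v)) := by
  simp [wedge, alternatizeUncurryFin_apply]

end BottChern

end

/-! ### Exchange of exterior and interior multiplication by `∗`, and the square of `∗`. -/

noncomputable section

open scoped Manifold ContDiff ComplexConjugate

namespace BottChern

open ContinuousAlternatingMap (alternatizeUncurryFin alternatizeUncurryFin_apply)

theorem comps_succ {n k : ℕ} (α : Alt n (k + 1)) (s : Fin (k + 1) → Idx n) :
    comps α s = comps (α.curryLeft (vec (s 0))) (fun a => s a.succ) := by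
  simp only [comps, ContinuousAlternatingMap.curryLeft_apply_apply]
  congr 1
  funext a
  refine Fin.cases ?_ (fun a => ?_) a <;> simp

theorem ext_curryLeft {n k : ℕ} {α β : Alt n (k + 1)}
    (h : ∀ i, α.curryLeft (vec i) = β.curryLeft (vec i)) : α = β :=
  comps_injective (funext fun s => by rw [comps_succ, comps_succ, h])

/-- This is `alternatize_hodge_one` for the rank-one map `v ↦ coord i v • β`, whose trace is a
single contraction. -/
theorem wedge_hodge_one {n k l : ℕ} (h : k + 1 + l = n * 2) (h' : k + (l + 1) = n * 2)
    (i : Idx n) (β : Alt n (k + 1)) :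
    wedge (coordC i) (hodge h 1 β) = (-1 : ℂ) ^ k • hodge h' 1 (β.curryLeft (vec i)) := by
  have h1 := alternatize_hodge_one h h' ((coordC i).smulRight β)
  have h2 : (hodgeL h 1).comp ((coordC i).smulRight β) = (coordC i).smulRight (hodge h 1 β) := by
    ext1 v
    simp only [ContinuousLinearMap.comp_apply, ContinuousLinearMap.smulRight_apply, hodgeL_apply,
      hodge_smul, coordC_apply, Complex.conj_ofReal]
  have h3 : trace ((coordC i).smulRight β) = β.curryLeft (vec i) := by
    ext v
    rw [trace_apply, Finset.sum_eq_single i]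
    · simp [coord_vec]
    · intro j _ hj
      simp [coord_vec, hj.symm]
    · simp
  rw [h2, h3] at h1
  exact h1

theorem curryLeft_hodge_one {n k l : ℕ} (h : k + 1 + l = n * 2) (h' : k + (l + 1) = n * 2)
    (i : Idx n) (β : Alt n k) :
    (hodge h' 1 β).curryLeft (vec i) = (-1 : ℂ) ^ k • hodge h 1 (wedge (coordC i) β) := by
  ext w
  rw [ContinuousAlternatingMap.curryLeft_apply_apply, ContinuousAlternatingMap.smul_apply,
    hodge_one_apply, hodge_one_apply]
  simp_rw [detForm_append_cons h h']
  have e1 : ∀ s, conj (comps (wedge (coordC i) β) s) = ∑ b : Fin (k + 1), (-1) ^ (b : ℕ) *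
      ((coord i (vec (s b)) : ℂ) * conj (comps β (b.removeNth s))) := by
    intro s
    rw [comps, wedge_apply, map_sum]
    refine Finset.sum_congr rfl fun b _ => ?_
    simp only [coordC_apply, map_mul, map_pow, map_neg, map_one, Complex.conj_ofReal]
    rfl
  simp_rw [e1, Finset.mul_sum]
  rw [Finset.sum_comm]
  have e2 : ∀ b : Fin (k + 1), ∑ s : Fin (k + 1) → Idx n,
      (((k + 1).factorial : ℂ)⁻¹ * ((detForm h (Fin.append (fun a => vec (s a)) w) : ℂ) *
        ((-1) ^ (b : ℕ) * ((coord i (vec (s b)) : ℂ) * conj (comps β (b.removeNth s)))))) =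
      ∑ s : Fin k → Idx n, ((k + 1).factorial : ℂ)⁻¹ *
        ((detForm h (Fin.append (Matrix.vecCons (vec i) fun a => vec (s a)) w) : ℂ) *
          conj (comps β s)) := by
    intro b
    rw [sum_tuple_succ b, Finset.sum_eq_single i]
    · refine Finset.sum_congr rfl fun s _ => ?_
      rw [vec_insertNth, Fin.insertNth_apply_same, Fin.removeNth_insertNth, coord_vec, if_pos rfl,
        detForm_append_insertNth]
      push_cast
      have hb : ((-1 : ℂ) ^ (b : ℕ)) * (-1) ^ (b : ℕ) = 1 := by rw [← mul_pow]; simp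
      linear_combination (((k + 1).factorial : ℂ)⁻¹ *
        (detForm h (Fin.append (Matrix.vecCons (vec i) fun a => vec (s a)) w) : ℂ) *
        conj (comps β s)) * hb
    · intro j _ hj
      refine Finset.sum_eq_zero fun s _ => ?_
      rw [Fin.insertNth_apply_same, coord_vec, if_neg hj.symm]
      simp
    · simp
  rw [Finset.sum_congr rfl fun b _ => e2 b]
  simp only [Finset.sum_const, Finset.card_univ, Fintype.card_fin, nsmul_eq_mul, smul_eq_mul]
  rw [Finset.mul_sum, Finset.mul_sum]
  refine Finset.sum_congr rfl fun s _ => ?_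
  rw [Nat.factorial_succ]
  push_cast
  have h1 : (k : ℂ) + 1 ≠ 0 := by exact_mod_cast Nat.succ_ne_zero k
  have h2 : (k.factorial : ℂ) ≠ 0 := by exact_mod_cast Nat.factorial_ne_zero k
  field_simp

/-- Only bijective index tuples contribute: on each of these `(2n)!` tuples the determinant is `±1`,
and on all others a vector is repeated. -/
theorem sum_detForm_sq {n m : ℕ} (h : m = n * 2) :
    ∑ s : Fin m → Idx n, (detForm h fun a => vec (s a)) ^ 2 = (m.factorial : ℝ) := by
  classical
  let e : Fin m ≃ Idx n := (finCongr h).trans finProdFinEquiv.symm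
  have h1 : ∀ s : Fin m → Idx n, (detForm h fun a => vec (s a)) ^ 2 =
      if Function.Bijective s then 1 else 0 := by
    intro s
    split_ifs with hs
    · let σ : Equiv.Perm (Fin m) := (Equiv.ofBijective s hs).trans e.symm
      have h2 : (fun a => (vec (s a) : Cn n)) = (basisFin h) ∘ σ := by
        funext a
        have : basisFin h (σ a) = vec (e (σ a)) := by
          simp only [basisFin, Module.Basis.reindex_apply, basisR_apply]
          rfl
        rw [Function.comp_apply, this]
        simp [σ]
      rw [detForm_eq, h2, AlternatingMap.map_perm, Module.Basis.det_self]
      rcases Int.units_eq_one_or (Equiv.Perm.sign σ) with h3 | h3 <;> simp [h3]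
    · have : ¬ Function.Injective fun a => (vec (s a) : Cn n) := by
        intro hi
        have hsi : Function.Injective s := fun a b hab => hi (by simp [hab])
        exact hs ((Fintype.bijective_iff_injective_and_card s).2 ⟨hsi, by simp [h]⟩)
      rw [(detForm h).map_eq_zero_of_not_injective _ this]
      simp
  simp_rw [h1]
  rw [Finset.sum_boole]
  congr 1
  rw [← Fintype.card_subtype]
  have := Fintype.card_equiv e
  simp only [Fintype.card_fin] at this ⊢
  rw [← this]
  exact Fintype.card_congr (Equiv.ofBijective
    (fun f : {f : Fin m → Idx n // Function.Bijective f} => Equiv.ofBijective f.1 f.2)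
    ⟨fun f g hfg => Subtype.ext (funext fun a => by simpa using DFunLike.congr_fun hfg a),
      fun g => ⟨⟨g, g.bijective⟩, Equiv.ext fun _ => rfl⟩⟩)

/-- Induction on the degree: contracting `∗∗β` with a coordinate vector gives `∗(eⁱ ∧ ∗β)` up to
sign, hence `∗∗` of the contraction of `β`, and a form is determined by its contractions. In degree
`0` the normalization is `sum_detForm_sq`. The sign `(-1)^k` is the usual `(-1)^(kl)`, because `k`
and `l` have the same parity. -/
theorem hodge_hodge_one {n k l : ℕ} (h : k + l = n * 2) (h' : l + k = n * 2) (β : Alt n k) :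
    hodge h' 1 (hodge h 1 β) = (-1 : ℂ) ^ k • β := by
  induction k generalizing l with
  | zero =>
    apply comps_injective
    funext r
    obtain rfl : l = n * 2 := by omega
    have e1 : ∀ s : Fin (n * 2) → Idx n, comps (hodge h 1 β) s =
        (detForm rfl fun a => vec (s a)) * conj (comps β r) := by
      intro s
      rw [comps, hodge_one_apply]
      rw [Fintype.sum_eq_single r (fun x hx => absurd (Subsingleton.elim x r) hx),
        Fin.append_left_nil _ _ rfl, detForm_cast h rfl]
      simp
    have e2 : ∀ s : Fin (n * 2) → Idx n, detForm h' (Fin.append (fun a => vec (s a))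
        (fun a => vec (r a))) = detForm rfl fun a => vec (s a) := by
      intro s
      rw [Fin.append_right_nil _ _ rfl]
      exact detForm_cast h' rfl _ _
    rw [comps, hodge_one_apply]
    simp_rw [e1, e2]
    have e3 := congrArg (Complex.ofReal) (sum_detForm_sq (n := n) rfl)
    push_cast at e3
    simp only [map_mul, Complex.conj_ofReal, Complex.conj_conj]
    simp_rw [← mul_assoc, ← pow_two]
    rw [← Finset.sum_mul, e3]
    have h2 : ((n * 2).factorial : ℂ) ≠ 0 := by exact_mod_cast Nat.factorial_ne_zero _
    rw [inv_mul_cancel_left₀ h2]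
    simp [comps]
  | succ k ih =>
    apply ext_curryLeft
    intro i
    have h1 : k + (l + 1) = n * 2 := by omega
    have h2 : l + 1 + k = n * 2 := by omega
    rw [curryLeft_hodge_one h2 h' i, wedge_hodge_one h h1 i, hodge_smul, ih h1 h2]
    -- Here `l + k = 2n - 1`, since the degree in the induction step is `k + 1`.
    have e : ((-1 : ℂ) ^ l) * (-1) ^ k = -1 := by
      rw [← pow_add]
      exact Odd.neg_one_pow ⟨n - 1, by omega⟩
    ext v
    simp only [map_pow, map_neg, map_one, ContinuousAlternatingMap.smul_apply,
      ContinuousAlternatingMap.curryLeft_apply_apply, smul_eq_mul]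
    rw [pow_succ]
    linear_combination ((-1 : ℂ) ^ k * β (Matrix.vecCons (vec i) v)) * e

end BottChern

end

/-! ### Types of derivatives, contractions, and the symbol form of the Kähler identities. -/

noncomputable section

open scoped Manifold ContDiff ComplexConjugate

namespace BottChern

open ContinuousAlternatingMap (alternatizeUncurryFin alternatizeUncurryFin_apply
  alternatizeUncurryFinCLM)

/-! ### Complex-linear and antilinear parts -/

section part

variable {n : ℕ} {V W : Type*} [NormedAddCommGroup V] [NormedSpace ℝ V] [NormedSpace ℂ V]
  [SMulCommClass ℝ ℂ V] [NormedAddCommGroup W] [NormedSpace ℝ W] [NormedSpace ℂ W]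
  [SMulCommClass ℝ ℂ W]

/-- For `σ = -1` the complex-linear part, and for `σ = 1` the antilinear part, of a real-linear
map. -/
def part (σ : ℝ) (L : Cn n →L[ℝ] V) : Cn n →L[ℝ] V :=
  (1 / 2 : ℂ) • (L + ((σ : ℂ) * Complex.I) • L.comp (mulI n))

theorem part_apply (σ : ℝ) (L : Cn n →L[ℝ] V) (v : Cn n) :
    part σ L v = (1 / 2 : ℂ) • (L v + ((σ : ℂ) * Complex.I) • L (Complex.I • v)) := rfl

theorem part_add (σ : ℝ) (L K : Cn n →L[ℝ] V) : part σ (L + K) = part σ L + part σ K := by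
  ext v
  simp only [part_apply, _root_.add_apply]
  module

theorem part_smul (σ : ℝ) (c : ℂ) (L : Cn n →L[ℝ] V) : part σ (c • L) = c • part σ L := by
  ext v
  simp only [part_apply, _root_.smul_apply]
  module

/-- `part`, as a real-linear map. -/
def partL (σ : ℝ) : (Cn n →L[ℝ] V) →L[ℝ] (Cn n →L[ℝ] V) :=
  (1 / 2 : ℂ) • (ContinuousLinearMap.id ℝ _ +
    ((σ : ℂ) * Complex.I) • ContinuousLinearMap.precomp V (mulI n))

@[simp]
theorem partL_apply (σ : ℝ) (L : Cn n →L[ℝ] V) : partL σ L = part σ L := rfl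

theorem part_comp (σ : ℝ) (L : Cn n →L[ℝ] V) {A : Cn n →L[ℝ] Cn n} (hA : IsCLin A) :
    part σ (L.comp A) = (part σ L).comp A := by
  ext v
  simp only [part_apply, ContinuousLinearMap.comp_apply, hA v]

theorem comp_part (σ : ℝ) (L : Cn n →L[ℝ] V) (T : V →L[ℝ] W) (hT : ∀ (c : ℂ) v, T (c • v) = c • T v) :
    T.comp (part σ L) = part σ (T.comp L) := by
  ext v
  simp only [part_apply, ContinuousLinearMap.comp_apply, hT, map_add]

theorem part_I_smul {σ : ℝ} (hσ : σ ^ 2 = 1) (L : Cn n →L[ℝ] V) (v : Cn n) :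
    part σ L (Complex.I • v) = -((σ : ℂ) * Complex.I) • part σ L v := by
  have h1 : Complex.I • Complex.I • v = -v := by
    rw [smul_smul, Complex.I_mul_I, neg_one_smul]
  have h2 : ((σ : ℂ) * Complex.I) * ((σ : ℂ) * Complex.I) = -1 := by
    have : ((σ : ℂ)) ^ 2 = 1 := by exact_mod_cast hσ
    linear_combination (Complex.I ^ 2) * this + Complex.I_sq
  rw [part_apply, part_apply, h1, map_neg, smul_comm, smul_add (-((σ : ℂ) * Complex.I)),
    smul_smul (-((σ : ℂ) * Complex.I)), neg_mul, h2]
  module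

end part

theorem linPart_eq {n k : ℕ} (L : Cn n →L[ℝ] Alt n k) : linPart L = part (-1) L := by
  ext1 v
  simp only [linPart, part_apply, _root_.smul_apply, _root_.sub_apply]
  push_cast
  rw [neg_one_mul, neg_smul, ← sub_eq_add_neg]
  rfl

theorem antiPart_eq {n k : ℕ} (L : Cn n →L[ℝ] Alt n k) : antiPart L = part 1 L := by
  ext1 v
  simp only [antiPart, part_apply, _root_.smul_apply, _root_.add_apply]
  push_cast
  rw [one_mul]
  rfl

/-- `hodge` is conjugate-linear, so it turns the coefficient `σi` into `-σi`. This is why `ddStar ρ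
σ` is built from derivatives of type `-σ`. -/
theorem hodge_part {n k l : ℕ} (h : k + l = n * 2) (G : Matrix (Idx n) (Idx n) ℝ) (σ : ℝ)
    (L : Cn n →L[ℝ] Alt n k) :
    part σ ((hodgeL h G).comp L) = (hodgeL h G).comp (part (-σ) L) := by
  ext1 v
  simp only [part_apply, ContinuousLinearMap.comp_apply, hodgeL_apply, hodge_smul, hodge_add]
  simp [map_ofNat]

/-! ### Contractions and exterior products -/

theorem curryLeft_alternatize {n k : ℕ} (L : Cn n →L[ℝ] Alt n (k + 1)) (v : Cn n)
    (L' : Cn n →L[ℝ] Alt n k) (hL : ∀ w, L' w = (L w).curryLeft v) :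
    (alternatizeUncurryFin L).curryLeft v = L v - alternatizeUncurryFin L' := by
  ext w
  rw [ContinuousAlternatingMap.curryLeft_apply_apply, ContinuousAlternatingMap.sub_apply,
    alternatizeUncurryFin_apply, alternatizeUncurryFin_apply, Fin.sum_univ_succ, sub_eq_add_neg,
    ← Finset.sum_neg_distrib]
  congr 1
  · simp
  · refine Finset.sum_congr rfl fun a _ => ?_
    rw [hL, ContinuousAlternatingMap.curryLeft_apply_apply]
    have : a.succ.removeNth (Matrix.vecCons v w) = Matrix.vecCons v (a.removeNth w) := by
      funext b
      refine Fin.cases ?_ (fun b => ?_) b <;> simp [Fin.removeNth]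
    rw [this, Matrix.cons_val_succ, Fin.val_succ, pow_succ]
    simp

/-- Interior multiplication, as a linear map in the form. -/
def iota {n k : ℕ} (v : Cn n) : Alt n (k + 1) →L[ℝ] Alt n k := LinearMap.toContinuousLinearMap
  { toFun := fun α => α.curryLeft v
    map_add' := fun _ _ => rfl
    map_smul' := fun _ _ => rfl }

@[simp]
theorem iota_apply {n k : ℕ} (v : Cn n) (α : Alt n (k + 1)) : iota v α = α.curryLeft v := rfl

theorem iota_smul {n k : ℕ} (v : Cn n) (c : ℂ) (α : Alt n (k + 1)) :
    iota v (c • α) = c • iota v α := rfl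

/-- Exterior and interior multiplication are adjoint. In each term of the antisymmetrization the
derivative index is moved to the front of `β`; the two signs cancel, and `k + 1` equal terms remain.
-/
theorem herm_one_alternatize {n k : ℕ} (β : Alt n (k + 1)) (L : Cn n →L[ℝ] Alt n k) :
    herm 1 (comps β) (comps (alternatizeUncurryFin L)) =
      ∑ i, herm 1 (comps (iota (vec i) β)) (comps (L (vec i))) := by
  simp_rw [herm_one]
  have e1 : ∀ s, conj (comps (alternatizeUncurryFin L) s) = ∑ b : Fin (k + 1), (-1) ^ (b : ℕ) *
      conj (comps (L (vec (s b))) (b.removeNth s)) := by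
    intro s
    rw [comps, alternatizeUncurryFin_apply, map_sum]
    refine Finset.sum_congr rfl fun b _ => ?_
    rw [zsmul_eq_mul]
    simp only [map_mul, map_pow, map_neg, map_one, Int.cast_pow, Int.cast_neg, Int.cast_one]
    rfl
  simp_rw [e1, Finset.mul_sum]
  rw [Finset.sum_comm]
  have e2 : ∀ b : Fin (k + 1), ∑ s : Fin (k + 1) → Idx n, (((k + 1).factorial : ℂ)⁻¹ *
      (comps β s * ((-1) ^ (b : ℕ) * conj (comps (L (vec (s b))) (b.removeNth s))))) =
      ∑ i, ∑ s : Fin k → Idx n, ((k + 1).factorial : ℂ)⁻¹ *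
        (comps (iota (vec i) β) s * conj (comps (L (vec i)) s)) := by
    intro b
    rw [sum_tuple_succ b]
    refine Finset.sum_congr rfl fun i _ => Finset.sum_congr rfl fun s _ => ?_
    rw [Fin.insertNth_apply_same, Fin.removeNth_insertNth]
    have : comps β (b.insertNth i s) = (-1) ^ (b : ℕ) * comps (iota (vec i) β) s := by
      rw [comps, vec_insertNth, ContinuousAlternatingMap.map_insertNth]
      simp [comps]
    rw [this]
    have hb : ((-1 : ℂ) ^ (b : ℕ)) * (-1) ^ (b : ℕ) = 1 := by rw [← mul_pow]; simp
    linear_combination (((k + 1).factorial : ℂ)⁻¹ *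
      comps (iota (vec i) β) s * conj (comps (L (vec i)) s)) * hb
  rw [Finset.sum_congr rfl fun b _ => e2 b]
  simp only [Finset.sum_const, Finset.card_univ, Fintype.card_fin, nsmul_eq_mul]
  rw [Finset.mul_sum]
  refine Finset.sum_congr rfl fun i _ => ?_
  rw [Finset.mul_sum]
  refine Finset.sum_congr rfl fun s _ => ?_
  rw [Nat.factorial_succ]
  push_cast
  have h1 : (k : ℂ) + 1 ≠ 0 := by exact_mod_cast Nat.succ_ne_zero k
  have h2 : (k.factorial : ℂ) ≠ 0 := by exact_mod_cast Nat.factorial_ne_zero k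
  field_simp

/-! ### The contraction with the fundamental form -/

/-- Contraction with the fundamental form of the metric with Gram matrix `G`. -/
def lam {n k : ℕ} (G : Matrix (Idx n) (Idx n) ℝ) : Alt n (k + 2) →L[ℝ] Alt n k :=
  ∑ i, ∑ j, (G⁻¹ i j / 2) • (iota (Complex.I • vec j)).comp (iota (vec i))

theorem lam_apply {n k : ℕ} (G : Matrix (Idx n) (Idx n) ℝ) (β : Alt n (k + 2)) :
    lam G β = ∑ i, ∑ j, (G⁻¹ i j / 2) • iota (Complex.I • vec j) (iota (vec i) β) := by
  simp [lam]

theorem lam_smul {n k : ℕ} (G : Matrix (Idx n) (Idx n) ℝ) (c : ℂ) (β : Alt n (k + 2)) :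
    lam G (c • β) = c • lam G β := by
  simp only [lam_apply, iota_smul, Finset.smul_sum]
  refine Finset.sum_congr rfl fun i _ => Finset.sum_congr rfl fun j _ => ?_
  rw [smul_comm]

theorem sum_inv_transform {n : ℕ} {V : Type*} [AddCommGroup V] [Module ℝ V]
    (G : Matrix (Idx n) (Idx n) ℝ) (A : Cn n →L[ℝ] Cn n) (hA : (mat A).det ≠ 0)
    (b : Cn n →ₗ[ℝ] Cn n →ₗ[ℝ] V) :
    ∑ i, ∑ j, ((mat A).transpose * G * mat A)⁻¹ i j • b (A (vec i)) (A (vec j)) =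
      ∑ i, ∑ j, G⁻¹ i j • b (vec i) (vec j) := by
  rw [← inv_transform G (mat A) hA]
  simp_rw [apply_vec A, map_sum, LinearMap.sum_apply, map_smul, LinearMap.smul_apply,
    Matrix.mul_apply (M := mat A * _), Matrix.mul_apply (M := mat A), Matrix.transpose_apply,
    Finset.smul_sum, Finset.sum_smul, Finset.sum_mul, Finset.sum_smul]
  have e : ∀ f : Idx n → Idx n → Idx n → Idx n → V,
      ∑ i, ∑ j, ∑ q, ∑ p, f i j p q = ∑ p, ∑ q, ∑ j, ∑ i, f i j p q := by
    intro f
    calc _ = ∑ i, ∑ q, ∑ j, ∑ p, f i j p q := Finset.sum_congr rfl fun i _ => Finset.sum_comm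
      _ = ∑ q, ∑ i, ∑ j, ∑ p, f i j p q := Finset.sum_comm
      _ = ∑ q, ∑ j, ∑ i, ∑ p, f i j p q := Finset.sum_congr rfl fun i _ => Finset.sum_comm
      _ = ∑ q, ∑ j, ∑ p, ∑ i, f i j p q :=
          Finset.sum_congr rfl fun i _ => Finset.sum_congr rfl fun i _ => Finset.sum_comm
      _ = ∑ q, ∑ p, ∑ j, ∑ i, f i j p q := Finset.sum_congr rfl fun i _ => Finset.sum_comm
      _ = _ := Finset.sum_comm
  rw [e]
  refine Finset.sum_congr rfl fun p _ => Finset.sum_congr rfl fun q _ =>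
    Finset.sum_congr rfl fun j _ => Finset.sum_congr rfl fun i _ => ?_
  rw [smul_smul, smul_smul]
  congr 1
  ring

/-- Bilinearity of `(u, v) ↦ ι_{iv} ι_u β`. -/
def lamBil {n k : ℕ} (β : Alt n (k + 2)) : Cn n →ₗ[ℝ] Cn n →ₗ[ℝ] Alt n k :=
  LinearMap.mk₂ ℝ (fun u v => iota (Complex.I • v) (iota u β))
    (fun u v w => by simp) (fun c u w => by simp) (fun u v w => by simp [smul_add])
    (fun c u w => by simp [smul_comm Complex.I c])

/-- Complex linearity of `A` is needed because `Λ` contracts with `i e_j`, and this `i` has to pass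
through `A`. -/
theorem lam_pb {n k : ℕ} (G : Matrix (Idx n) (Idx n) ℝ) {A : Cn n →L[ℝ] Cn n}
    (hA : (mat A).det ≠ 0) (hc : IsCLin A) (β : Alt n (k + 2)) :
    lam ((mat A).transpose * G * mat A) (pb A β) = pb A (lam G β) := by
  have h1 : ∀ (G : Matrix (Idx n) (Idx n) ℝ) (β : Alt n (k + 2)), lam G β =
      (1 / 2 : ℝ) • ∑ i, ∑ j, G⁻¹ i j • lamBil β (vec i) (vec j) := by
    intro G β
    simp only [lam_apply, Finset.smul_sum]
    refine Finset.sum_congr rfl fun i _ => Finset.sum_congr rfl fun j _ => ?_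
    rw [smul_smul, one_div_mul_eq_div]
    rfl
  have h2 : ∀ u v, lamBil (pb A β) u v = pb A (lamBil β (A u) (A v)) := by
    intro u v
    ext w
    simp only [lamBil, LinearMap.mk₂_apply, iota_apply,
      ContinuousAlternatingMap.curryLeft_apply_apply,
      ContinuousAlternatingMap.compContinuousLinearMap_apply]
    congr 1
    funext a
    refine Fin.cases (by simp) (fun a => Fin.cases (by simp [hc v]) (fun a => by simp) a) a
  rw [h1, h1, ← sum_inv_transform G A hA]
  simp_rw [h2]
  ext w
  simp [ContinuousAlternatingMap.sum_apply]

theorem inv_one_apply {n : ℕ} (i j : Idx n) :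
    (1 : Matrix (Idx n) (Idx n) ℝ)⁻¹ i j = if i = j then 1 else 0 := by
  rw [Matrix.inv_eq_right_inv (one_mul (1 : Matrix (Idx n) (Idx n) ℝ)), Matrix.one_apply]

theorem lam_one {n k : ℕ} (β : Alt n (k + 2)) :
    lam 1 β = (1 / 2 : ℝ) • ∑ i, iota (Complex.I • vec i) (iota (vec i) β) := by
  rw [lam_apply, Finset.smul_sum]
  refine Finset.sum_congr rfl fun i _ => ?_
  rw [Finset.sum_eq_single i]
  · rw [inv_one_apply, if_pos rfl]
  · intro j _ hj
    rw [inv_one_apply, if_neg hj.symm, zero_div]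
    ext v
    simp
  · simp

theorem I_smul_vec_zero {n : ℕ} (j : Fin n) : (Complex.I • vec (j, 0) : Cn n) = vec (j, 1) := by
  simp [vec, ← Pi.single_smul]

theorem I_smul_vec_one {n : ℕ} (j : Fin n) : (Complex.I • vec (j, 1) : Cn n) = -vec (j, 0) := by
  simp [vec, ← Pi.single_smul, ← Pi.single_neg]

/-- Multiplication by `i` permutes the coordinate basis up to sign: `∂/∂x` goes to `∂/∂y`, and
`∂/∂y` to `-∂/∂x`. -/
theorem sum_vec_rotate {n : ℕ} {V : Type*} [AddCommGroup V] [Module ℝ V]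
    (b : Cn n →ₗ[ℝ] Cn n →ₗ[ℝ] V) :
    ∑ i : Idx n, b (Complex.I • vec i) (vec i) = -∑ i : Idx n, b (vec i) (Complex.I • vec i) := by
  rw [Fintype.sum_prod_type, Fintype.sum_prod_type, ← Finset.sum_neg_distrib]
  refine Finset.sum_congr rfl fun j _ => ?_
  simp only [Fin.sum_univ_two, I_smul_vec_zero, I_smul_vec_one, map_neg, LinearMap.neg_apply]
  abel

theorem curryLeft_alternatize_zero {n : ℕ} (L : Cn n →L[ℝ] Alt n 0) (v : Cn n) :
    (alternatizeUncurryFin L).curryLeft v = L v := by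
  ext w
  rw [ContinuousAlternatingMap.curryLeft_apply_apply, alternatizeUncurryFin_apply]
  simp [Subsingleton.elim _ w]

theorem trace_I {n k : ℕ} {σ : ℝ} (hσ : σ ^ 2 = 1) (L : Cn n →L[ℝ] Alt n (k + 1)) :
    ∑ i, iota (vec i) (part σ L (Complex.I • vec i)) =
      -((σ : ℂ) * Complex.I) • trace (part σ L) := by
  rw [trace, Finset.smul_sum]
  refine Finset.sum_congr rfl fun i _ => ?_
  rw [part_I_smul hσ, iota_smul, iota_apply]

theorem iota_I_trace {n k : ℕ} {σ : ℝ} (hσ : σ ^ 2 = 1) (L : Cn n →L[ℝ] Alt n (k + 1)) :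
    ∑ i, iota (Complex.I • vec i) (part σ L (vec i)) =
      ((σ : ℂ) * Complex.I) • trace (part σ L) := by
  let b : Cn n →ₗ[ℝ] Cn n →ₗ[ℝ] Alt n k :=
    LinearMap.mk₂ ℝ (fun u v => iota u (part σ L v))
      (fun u v w => by simp) (fun c u w => by simp) (fun u v w => by simp)
      (fun c u w => by simp)
  have h : ∑ i : Idx n, iota (Complex.I • vec i) (part σ L (vec i)) =
      -∑ i : Idx n, iota (vec i) (part σ L (Complex.I • vec i)) := sum_vec_rotate b
  rw [h, trace_I hσ]
  ext v
  simp

theorem half_sub_neg {n k : ℕ} (c : ℂ) (α : Alt n k) :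
    (1 / 2 : ℝ) • (c • α - -c • α) = c • α := by
  ext v
  simp
  ring

theorem iota_alternatize {n k : ℕ} (P : Cn n →L[ℝ] Alt n (k + 1)) (v : Cn n) :
    iota v (alternatizeUncurryFin P) = P v - alternatizeUncurryFin ((iota v).comp P) :=
  curryLeft_alternatize P v ((iota v).comp P) fun _ => rfl

theorem iota_iota_alternatize {n k : ℕ} (P : Cn n →L[ℝ] Alt n (k + 1 + 1)) (v w : Cn n) :
    iota w (iota v (alternatizeUncurryFin P)) = iota w (P v) - iota v (P w) +
      alternatizeUncurryFin ((iota w).comp ((iota v).comp P)) := by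
  rw [iota_alternatize, map_sub, iota_alternatize, ContinuousLinearMap.comp_apply]
  abel

/-- The commutator of the contraction `Λ` with the principal symbol of `∂̄` (or `∂`). -/
theorem lam_one_alternatize {n k : ℕ} {σ : ℝ} (hσ : σ ^ 2 = 1)
    (L : Cn n →L[ℝ] Alt n (k + 2)) :
    lam 1 (alternatizeUncurryFin (part σ L)) =
      alternatizeUncurryFin (part σ ((lam 1).comp L)) +
        ((σ : ℂ) * Complex.I) • trace (part σ L) := by
  -- When both contractions hit the coefficient they form `Λ` inside the derivative. In the other
  -- two terms one contraction hits the derivative slot; these sums are `σi` and `-σi` times the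
  -- trace, and the factor `1/2` in `lam` averages their difference.
  have h1 : ∀ i, iota (Complex.I • vec i) (iota (vec i) (alternatizeUncurryFin (part σ L))) =
      iota (Complex.I • vec i) (part σ L (vec i)) - iota (vec i) (part σ L (Complex.I • vec i)) +
        alternatizeUncurryFin ((iota (Complex.I • vec i)).comp
          ((iota (vec i)).comp (part σ L))) := by
    exact fun i => iota_iota_alternatize (part σ L) _ _
  have h2 : (lam 1).comp (part σ L) = (1 / 2 : ℝ) • ∑ i, (iota (Complex.I • vec i)).comp
      ((iota (vec i)).comp (part σ L)) := by
    ext1 v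
    rw [ContinuousLinearMap.comp_apply, lam_one, _root_.smul_apply, _root_.sum_apply]
    rfl
  have h3 : alternatizeUncurryFin ((lam 1).comp (part σ L)) = (1 / 2 : ℝ) • ∑ i,
      alternatizeUncurryFin ((iota (Complex.I • vec i)).comp ((iota (vec i)).comp (part σ L))) := by
    rw [h2, ContinuousAlternatingMap.alternatizeUncurryFin_smul]
    congr 1
    exact map_sum (alternatizeUncurryFinCLM ℝ (Cn n) ℂ) _ _
  rw [lam_one, Finset.sum_congr rfl fun i _ => h1 i, Finset.sum_add_distrib,
    Finset.sum_sub_distrib, iota_I_trace hσ, trace_I hσ, smul_add, half_sub_neg,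
    ← comp_part _ _ _ (fun c v => lam_smul 1 c v), h3]
  exact add_comm _ _

theorem lam_one_alternatize_zero {n : ℕ} {σ : ℝ} (hσ : σ ^ 2 = 1) (L : Cn n →L[ℝ] Alt n 1) :
    lam 1 (alternatizeUncurryFin (part σ L)) = ((σ : ℂ) * Complex.I) • trace (part σ L) := by
  have h1 : ∀ i, iota (Complex.I • vec i) (iota (vec i) (alternatizeUncurryFin (part σ L))) =
      iota (Complex.I • vec i) (part σ L (vec i)) -
        iota (vec i) (part σ L (Complex.I • vec i)) := by
    intro i
    rw [iota_apply (vec i), curryLeft_alternatize (part σ L) (vec i)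
      ((iota (vec i)).comp (part σ L)) (fun _ => rfl), map_sub, iota_apply,
      iota_apply _ (alternatizeUncurryFin _), curryLeft_alternatize_zero]
    rfl
  rw [lam_one, Finset.sum_congr rfl fun i _ => h1 i,
    Finset.sum_sub_distrib, iota_I_trace hσ, trace_I hσ, half_sub_neg]

end BottChern

end

/-! ### Local `∂` and `∂̄`: invariance under holomorphic maps and anticommutation. -/

noncomputable section

open scoped Manifold ContDiff ComplexConjugate Topology

namespace BottChern

open ContinuousAlternatingMap (alternatizeUncurryFin alternatizeUncurryFin_apply
  alternatizeUncurryFinCLM)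

/-! ### The operators `∂` and `∂̄` on open subsets of `ℂⁿ` -/

/-- `∂` (for `σ = -1`) and `∂̄` (for `σ = 1`) of a form on an open subset of `ℂⁿ`. -/
def lpd {n k : ℕ} (σ : ℝ) (φ : Cn n → Alt n k) (y : Cn n) : Alt n (k + 1) :=
  alternatizeUncurryFin (part σ (fderiv ℝ φ y))

/-- `alternatizeUncurryFin ∘ part σ` as a continuous linear map. -/
def altPart (n k : ℕ) (σ : ℝ) : (Cn n →L[ℝ] Alt n k) →L[ℝ] Alt n (k + 1) :=
  (alternatizeUncurryFinCLM ℝ (Cn n) ℂ).comp (partL σ)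

theorem hasFDerivAt_clm_comp {E F G : Type*} [NormedAddCommGroup E] [NormedSpace ℝ E]
    [NormedAddCommGroup F] [NormedSpace ℝ F] [NormedAddCommGroup G] [NormedSpace ℝ G]
    (T : F →L[ℝ] G) {f : E → F} {f' : E →L[ℝ] F} {x : E} (h : HasFDerivAt f f' x) :
    HasFDerivAt (fun z => T (f z)) (T.comp f') x := T.hasFDerivAt.comp x h

theorem hasFDerivAt_altPart {n k : ℕ} (σ : ℝ) {E : Type*} [NormedAddCommGroup E] [NormedSpace ℝ E]
    {f : E → Cn n →L[ℝ] Alt n k} {f' : E →L[ℝ] Cn n →L[ℝ] Alt n k} {x : E}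
    (h : HasFDerivAt f f' x) :
    HasFDerivAt (fun z => altPart n k σ (f z)) ((altPart n k σ).comp f') x :=
  hasFDerivAt_clm_comp (F := Cn n →L[ℝ] Alt n k) (G := Alt n (k + 1)) (altPart n k σ) h

theorem altPart_apply {n k : ℕ} (σ : ℝ) (L : Cn n →L[ℝ] Alt n k) :
    altPart n k σ L = alternatizeUncurryFin (part σ L) := rfl

theorem altPart_smul {n k : ℕ} (σ : ℝ) (c : ℂ) (L : Cn n →L[ℝ] Alt n k) :
    altPart n k σ (c • L) = c • altPart n k σ L := by
  rw [altPart_apply, altPart_apply, part_smul,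
    ContinuousAlternatingMap.alternatizeUncurryFin_smul]

theorem lpd_eq {n k : ℕ} (σ : ℝ) (φ : Cn n → Alt n k) (y : Cn n) :
    lpd σ φ y = altPart n k σ (fderiv ℝ φ y) := rfl

theorem lpd_congr {n k : ℕ} (σ : ℝ) {φ ψ : Cn n → Alt n k} {y : Cn n} (h : φ =ᶠ[𝓝 y] ψ) :
    lpd σ φ y = lpd σ ψ y := by
  rw [lpd, lpd, h.fderiv_eq]

theorem contDiffAt_lpd {n k : ℕ} (σ : ℝ) {φ : Cn n → Alt n k} {y : Cn n}
    (h : ContDiffAt ℝ ∞ φ y) : ContDiffAt ℝ ∞ (lpd σ φ) y := by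
  have h1 : ContDiffAt ℝ ∞ (fun z => altPart n k σ (fderiv ℝ φ z)) y := by
    exact (h.fderiv_right (m := ∞) (by simp)).continuousLinearMap_comp (altPart n k σ)
  exact h1

theorem contDiffOn_lpd {n k : ℕ} (σ : ℝ) {φ : Cn n → Alt n k} {U : Set (Cn n)} (hU : IsOpen U)
    (h : ContDiffOn ℝ ∞ φ U) : ContDiffOn ℝ ∞ (lpd σ φ) U := fun _ hy =>
  (contDiffAt_lpd σ (h.contDiffAt (hU.mem_nhds hy))).contDiffWithinAt

theorem lpd_add {n k : ℕ} (σ : ℝ) {φ ψ : Cn n → Alt n k} {y : Cn n}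
    (hφ : DifferentiableAt ℝ φ y) (hψ : DifferentiableAt ℝ ψ y) :
    lpd σ (fun z => φ z + ψ z) y = lpd σ φ y + lpd σ ψ y := by
  rw [lpd_eq, fderiv_fun_add hφ hψ, map_add]
  rfl

theorem lpd_const_smul {n k : ℕ} (σ : ℝ) (c : ℂ) {φ : Cn n → Alt n k} {y : Cn n}
    (hφ : DifferentiableAt ℝ φ y) :
    lpd σ (fun z => c • φ z) y = c • lpd σ φ y := by
  rw [lpd_eq, fderiv_fun_const_smul hφ c, altPart_smul]
  rfl

/-- Pull-back of a form by a map. -/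
def pull {n k : ℕ} (ψ : Cn n → Cn n) (φ : Cn n → Alt n k) (y : Cn n) : Alt n k :=
  pb (fderiv ℝ ψ y) (φ (ψ y))

theorem contDiffAt_of_comps {n k : ℕ} {E : Type*} [NormedAddCommGroup E] [NormedSpace ℝ E]
    {f : E → Alt n k} {y : E} {m : WithTop ℕ∞}
    (h : ∀ s, ContDiffAt ℝ m (fun y => comps (f y) s) y) : ContDiffAt ℝ m f y := by
  rw [← contDiffWithinAt_univ]
  obtain ⟨g, hg⟩ := exists_compsCLM_leftInverse n k
  have : f = fun y => g (comps (f y)) := funext fun y => (hg _).symm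
  rw [this]
  exact (g.contDiff.contDiffAt.comp y (contDiffAt_pi.2 h)).contDiffWithinAt

theorem contDiffAt_comps {n k : ℕ} {E : Type*} [NormedAddCommGroup E] [NormedSpace ℝ E]
    {f : E → Alt n k} {y : E} {m : WithTop ℕ∞} (h : ContDiffAt ℝ m f y) (s : Fin k → Idx n) :
    ContDiffAt ℝ m (fun y => comps (f y) s) y :=
  contDiffAt_pi.1 ((compsCLM n k).contDiff.contDiffAt.comp y h) s

/-- A coordinate, as a continuous linear functional. -/
def coordL {n : ℕ} (i : Idx n) : Cn n →L[ℝ] ℝ := LinearMap.toContinuousLinearMap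
  { toFun := coord i
    map_add' := coord_add i
    map_smul' := coord_smul i }

@[simp]
theorem coordL_apply {n : ℕ} (i : Idx n) (v : Cn n) : coordL i v = coord i v := rfl

theorem contDiffAt_mat {n : ℕ} {E : Type*} [NormedAddCommGroup E] [NormedSpace ℝ E]
    {A : E → Cn n →L[ℝ] Cn n} {y : E} {m : WithTop ℕ∞} (h : ContDiffAt ℝ m A y) (i j : Idx n) :
    ContDiffAt ℝ m (fun y => mat (A y) i j) y :=
  (coordL i).contDiff.contDiffAt.comp y (h.clm_apply contDiffAt_const)

theorem contDiffAt_pb {n k : ℕ} {E : Type*} [NormedAddCommGroup E] [NormedSpace ℝ E]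
    {A : E → Cn n →L[ℝ] Cn n} {φ : E → Alt n k} {y : E} {m : WithTop ℕ∞}
    (hA : ContDiffAt ℝ m A y) (hφ : ContDiffAt ℝ m φ y) :
    ContDiffAt ℝ m (fun y => pb (A y) (φ y)) y := by
  apply contDiffAt_of_comps
  intro s
  simp_rw [comps_pb]
  exact ContDiffAt.sum fun s' _ => ContDiffAt.fun_smul
    (contDiffAt_prod fun a _ => contDiffAt_mat hA _ _) (contDiffAt_comps hφ s')

theorem contDiffAt_pull {n k : ℕ} {ψ : Cn n → Cn n} {φ : Cn n → Alt n k} {y : Cn n}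
    (hψ : ContDiffAt ℝ ∞ ψ y) (hφ : ContDiffAt ℝ ∞ φ (ψ y)) : ContDiffAt ℝ ∞ (pull ψ φ) y :=
  contDiffAt_pb (hψ.fderiv_right (m := ∞) (by simp)) (hφ.comp y hψ)

/-- A smooth map with complex-linear differential near a point. -/
def IsHolAt {n : ℕ} (ψ : Cn n → Cn n) (y : Cn n) : Prop :=
  ∀ᶠ z in 𝓝 y, ContDiffAt ℝ ∞ ψ z ∧ IsCLin (fderiv ℝ ψ z)

theorem IsHolAt.eventually {n : ℕ} {ψ : Cn n → Cn n} {y : Cn n} (h : IsHolAt ψ y) :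
    ∀ᶠ z in 𝓝 y, IsHolAt ψ z := h.eventually_nhds

theorem IsHolAt.contDiffAt {n : ℕ} {ψ : Cn n → Cn n} {y : Cn n} (h : IsHolAt ψ y) :
    ContDiffAt ℝ ∞ ψ y := h.self_of_nhds.1

theorem IsHolAt.isCLin {n : ℕ} {ψ : Cn n → Cn n} {y : Cn n} (h : IsHolAt ψ y) :
    IsCLin (fderiv ℝ ψ y) := h.self_of_nhds.2

theorem minSmoothness_two_le : minSmoothness ℝ 2 ≤ (∞ : WithTop ℕ∞) := by
  rw [minSmoothness_of_isRCLikeNormedField]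
  exact WithTop.coe_le_coe.2 le_top

theorem IsHolAt.fderiv_fderiv_symm {n : ℕ} {ψ : Cn n → Cn n} {y : Cn n} (h : IsHolAt ψ y)
    (v w : Cn n) : fderiv ℝ (fderiv ℝ ψ) y v w = fderiv ℝ (fderiv ℝ ψ) y w v :=
  (h.contDiffAt.isSymmSndFDerivAt minSmoothness_two_le).eq v w

/-- Differentiate the Cauchy–Riemann equation `Dψ(iw) = i Dψ(w)`, which holds on a neighbourhood. -/
theorem IsHolAt.fderiv_fderiv_I {n : ℕ} {ψ : Cn n → Cn n} {y : Cn n} (h : IsHolAt ψ y)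
    (v w : Cn n) : fderiv ℝ (fderiv ℝ ψ) y v (Complex.I • w) =
      Complex.I • fderiv ℝ (fderiv ℝ ψ) y v w := by
  have hd : DifferentiableAt ℝ (fderiv ℝ ψ) y :=
    (h.contDiffAt.fderiv_right (m := ∞) (by simp)).differentiableAt (by simp)
  have h1 : (fun z => fderiv ℝ ψ z (Complex.I • w)) =ᶠ[𝓝 y]
      fun z => mulI n (fderiv ℝ ψ z w) := by
    filter_upwards [h] with z hz
    exact hz.2 w
  have h2 := h1.fderiv_eq (𝕜 := ℝ)
  have h3 := (hd.hasFDerivAt.clm_apply (hasFDerivAt_const (Complex.I • w) y)).fderiv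
  have h4 : HasFDerivAt (fun z => mulI n (fderiv ℝ ψ z w)) _ y :=
    (mulI n).hasFDerivAt.comp y (hd.hasFDerivAt.clm_apply (hasFDerivAt_const w y))
  have h5 := DFunLike.congr_fun (h3.symm.trans (h2.trans h4.fderiv)) v
  simpa [mulI] using h5

theorem fderiv_pull {n k : ℕ} {ψ : Cn n → Cn n} {φ : Cn n → Alt n k} {y : Cn n}
    (hψ : ContDiffAt ℝ ∞ ψ y) (hφ : DifferentiableAt ℝ φ (ψ y)) :
    fderiv ℝ (pull ψ φ) y =
      (ContinuousAlternatingMap.compContinuousLinearMapCLM (fderiv ℝ ψ y)).comp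
        ((fderiv ℝ φ (ψ y)).comp (fderiv ℝ ψ y)) +
      ((φ (ψ y)).fderivCompContinuousLinearMap (fderiv ℝ ψ y)).comp
        (fderiv ℝ (fderiv ℝ ψ) y) := by
  have hd : DifferentiableAt ℝ ψ y := hψ.differentiableAt (by simp)
  have hd2 : DifferentiableAt ℝ (fderiv ℝ ψ) y :=
    (hψ.fderiv_right (m := ∞) (by simp)).differentiableAt (by simp)
  have := fderiv_continuousAlternatingMapCompContinuousLinearMap (f := fun z => φ (ψ z))
    (hφ.comp y hd) hd2
  rw [fderiv_fun_comp y hφ hd] at this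
  exact this

/-- Differentiating a pull-back produces extra terms in `D²ψ`. Antisymmetrization kills them,
because `D²ψ(v, w)` and, `ψ` being holomorphic, also `D²ψ(iv, w)` are symmetric in `v` and `w`. -/
theorem lpd_pull {n k : ℕ} (σ : ℝ) {ψ : Cn n → Cn n} {φ : Cn n → Alt n k} {y : Cn n}
    (hψ : IsHolAt ψ y) (hφ : DifferentiableAt ℝ φ (ψ y)) :
    lpd σ (pull ψ φ) y = pb (fderiv ℝ ψ y) (lpd σ φ (ψ y)) := by
  set F := (φ (ψ y)).fderivCompContinuousLinearMap (fderiv ℝ ψ y)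
  set D := fderiv ℝ (fderiv ℝ ψ) y with hD
  have h2 : part σ (F.comp D) = (1 / 2 : ℂ) • (F.comp D +
      ((σ : ℂ) * Complex.I) • F.comp (D.comp (mulI n))) := rfl
  have h3 : alternatizeUncurryFin (F.comp D) = 0 :=
    ContinuousAlternatingMap.alternatizeUncurryFin_fderivCompContinuousLinearMap_eq_zero _ _
      (hψ.fderiv_fderiv_symm)
  have h4 : alternatizeUncurryFin (F.comp (D.comp (mulI n))) = 0 := by
    refine ContinuousAlternatingMap.alternatizeUncurryFin_fderivCompContinuousLinearMap_eq_zero _ _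
      fun v w => ?_
    change D (Complex.I • v) w = D (Complex.I • w) v
    rw [hψ.fderiv_fderiv_symm, hψ.fderiv_fderiv_I, hψ.fderiv_fderiv_symm (Complex.I • w),
      hψ.fderiv_fderiv_I, hψ.fderiv_fderiv_symm v w]
  rw [lpd, fderiv_pull hψ.contDiffAt hφ, part_add, ContinuousAlternatingMap.alternatizeUncurryFin_add, h2,
    ContinuousAlternatingMap.alternatizeUncurryFin_smul,
    ContinuousAlternatingMap.alternatizeUncurryFin_add,
    ContinuousAlternatingMap.alternatizeUncurryFin_smul, h3, h4, smul_zero, add_zero, smul_zero,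
    add_zero]
  rw [← ContinuousLinearMap.comp_assoc, part_comp _ _ hψ.isCLin]
  have h5 := comp_part σ (fderiv ℝ φ (ψ y))
    (ContinuousAlternatingMap.compContinuousLinearMapCLM (fderiv ℝ ψ y) : Alt n k →L[ℝ] Alt n k)
    (fun c v => rfl)
  rw [← h5]
  ext v
  simp only [alternatizeUncurryFin_apply, lpd,
    ContinuousAlternatingMap.compContinuousLinearMap_apply]
  rfl

theorem lpd_lpd {n k : ℕ} (σ τ : ℝ) {φ : Cn n → Alt n k} {y : Cn n} (hφ : ContDiffAt ℝ ∞ φ y) :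
    lpd σ (lpd τ φ) y = alternatizeUncurryFin ((alternatizeUncurryFinCLM ℝ (Cn n) ℂ).comp
      (part σ ((partL τ).comp (fderiv ℝ (fderiv ℝ φ) y)))) := by
  have hd : DifferentiableAt ℝ (fderiv ℝ φ) y :=
    (hφ.fderiv_right (m := ∞) (by simp)).differentiableAt (by simp)
  have h2 : HasFDerivAt (fun z => altPart n k τ (fderiv ℝ φ z))
      ((altPart n k τ).comp (fderiv ℝ (fderiv ℝ φ) y)) y :=
    hasFDerivAt_altPart τ hd.hasFDerivAt
  have : fderiv ℝ (lpd τ φ) y = (altPart n k τ).comp (fderiv ℝ (fderiv ℝ φ) y) := h2.fderiv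
  rw [lpd, this]
  congr 1
  ext1 v
  rw [ContinuousLinearMap.comp_apply, part_apply, part_apply,
    ContinuousAlternatingMap.alternatizeUncurryFinCLM_apply,
    ContinuousAlternatingMap.alternatizeUncurryFin_smul,
    ContinuousAlternatingMap.alternatizeUncurryFin_add,
    ContinuousAlternatingMap.alternatizeUncurryFin_smul]
  rfl

/-- Each composite antisymmetrizes the Hessian after projection to types `σ` and `τ` in its two
slots. The sum over both orders is a symmetric bilinear map, so its antisymmetrization vanishes. For
`σ = τ` this contains `∂² = 0` and `∂̄² = 0`. -/
theorem lpd_lpd_add {n k : ℕ} (σ τ : ℝ) {φ : Cn n → Alt n k} {y : Cn n}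
    (hφ : ContDiffAt ℝ ∞ φ y) : lpd σ (lpd τ φ) y + lpd τ (lpd σ φ) y = 0 := by
  rw [lpd_lpd σ τ hφ, lpd_lpd τ σ hφ, ← ContinuousAlternatingMap.alternatizeUncurryFin_add,
    ← ContinuousLinearMap.comp_add]
  apply ContinuousAlternatingMap.alternatizeUncurryFin_alternatizeUncurryFinCLM_comp_of_symmetric
  intro v w
  have hs : ∀ v w, fderiv ℝ (fderiv ℝ φ) y v w = fderiv ℝ (fderiv ℝ φ) y w v :=
    (hφ.isSymmSndFDerivAt minSmoothness_two_le).eq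
  simp only [_root_.add_apply, part_apply, ContinuousLinearMap.comp_apply, partL_apply,
    _root_.smul_apply]
  rw [hs w v, hs (Complex.I • w) v, hs w (Complex.I • v), hs (Complex.I • w) (Complex.I • v)]
  ext u
  simp only [ContinuousAlternatingMap.add_apply, ContinuousAlternatingMap.smul_apply, smul_eq_mul]
  ring

end BottChern

end

/-! ### Chart independence of forms and of the operators `∂`, `∂̄` on the manifold. -/

noncomputable section

open scoped Manifold ContDiff ComplexConjugate Topology

namespace BottChern

open ContinuousAlternatingMap (alternatizeUncurryFin alternatizeUncurryFin_apply
  alternatizeUncurryFinCLM)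

/-! ### Forms on the manifold and their chart expressions -/

section Charts

/-- The transition map between two charts. -/
def transition {n : ℕ} {M : Type*} [TopologicalSpace M]
    (e e' : OpenPartialHomeomorph M (Cn n)) (y : Cn n) :
    Cn n := e' (e.symm y)

theorem transition_comp_eventuallyEq {n : ℕ} {M : Type*} [TopologicalSpace M]
    {e e' e'' : OpenPartialHomeomorph M (Cn n)} {y : Cn n}
    (hy : y ∈ e.target) (hy' : e.symm y ∈ e'.source) :
    transition e e'' =ᶠ[𝓝 y] transition e' e'' ∘ transition e e' := by
  filter_upwards [e.symm.continuousAt hy |>.eventually (e'.open_source.mem_nhds hy')] with z hz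
  simp [transition, e'.left_inv hz]

variable {n : ℕ} {M : Type*} [TopologicalSpace M] [ChartedSpace (Cn n) M]

theorem isHolAt_of_contDiffOn {ψ : Cn n → Cn n} {U : Set (Cn n)} (hU : IsOpen U)
    (h : ContDiffOn ℂ ω ψ U) {y : Cn n} (hy : y ∈ U) : IsHolAt ψ y := by
  filter_upwards [hU.mem_nhds hy] with z hz
  have h1 : ContDiffAt ℂ ω ψ z := h.contDiffAt (hU.mem_nhds hz)
  refine ⟨(h1.restrict_scalars ℝ).of_le le_top, ?_⟩
  have h2 : DifferentiableAt ℂ ψ z := h1.differentiableAt (by simp)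
  rw [h2.fderiv_restrictScalars ℝ]
  exact isCLin_restrictScalars _

variable [IsManifold 𝓘(ℂ, Cn n) ω M]

theorem isHolAt_transition {e e' : OpenPartialHomeomorph M (Cn n)} (he : e ∈ atlas (Cn n) M)
    (he' : e' ∈ atlas (Cn n) M) {y : Cn n} (hy : y ∈ e.target) (hy' : e.symm y ∈ e'.source) :
    IsHolAt (transition e e') y := by
  have h1 : e.symm.trans e' ∈ contDiffGroupoid ω 𝓘(ℂ, Cn n) :=
    HasGroupoid.compatible he he'
  have h2 : ContDiffOn ℂ ω (e.symm.trans e') (e.symm.trans e').source := by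
    rw [contDiffGroupoid, mem_groupoid_of_pregroupoid] at h1
    simpa [contDiffPregroupoid] using h1.1
  exact isHolAt_of_contDiffOn (e.symm.trans e').open_source h2 (by simp [hy, hy'])

/-- Tangent vectors at a point are read in the preferred chart of that point, so the differential of
`e.symm` is that of the transition map into this chart. -/
theorem dSymm_eq {e : OpenPartialHomeomorph M (Cn n)} (he : e ∈ atlas (Cn n) M) {y : Cn n}
    (hy : y ∈ e.target) :
    dSymm e y = fderiv ℝ (transition e (chartAt (Cn n) (e.symm y))) y := by
  have h1 : IsHolAt (transition e (chartAt (Cn n) (e.symm y))) y :=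
    isHolAt_transition he (chart_mem_atlas _ _) hy (mem_chart_source _ _)
  have h2 : MDifferentiableAt 𝓘(ℝ, Cn n) 𝓘(ℝ, Cn n) e.symm y := by
    rw [mdifferentiableAt_iff]
    refine ⟨e.symm.continuousAt hy, ?_⟩
    have := h1.contDiffAt.differentiableAt (by simp)
    simpa [writtenInExtChartAt, Function.comp_def, transition, differentiableWithinAt_univ,
      extChartAt_model_space_eq_id, chartAt_self_eq] using this
  have h3 := h2.mfderiv
  refine Eq.trans (b := fderivWithin ℝ _ _ _) h3 ?_
  simp only [modelWithCornersSelf_coe, Set.range_id, fderivWithin_univ]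
  have h4 : extChartAt 𝓘(ℝ, Cn n) y y = y := by simp [chartAt_self_eq]
  rw [h4]
  refine Filter.EventuallyEq.fderiv_eq (Filter.Eventually.of_forall fun z => ?_)
  simp [writtenInExtChartAt, transition, chartAt_self_eq]

theorem rep_transition {e e' : OpenPartialHomeomorph M (Cn n)} (he : e ∈ atlas (Cn n) M)
    (he' : e' ∈ atlas (Cn n) M) {y : Cn n} (hy : y ∈ e.target) (hy' : e.symm y ∈ e'.source)
    (φ : Form n M) (k : ℕ) :
    rep e φ k y = pull (transition e e') (rep e' φ k) y := by
  have h0 : e'.symm (transition e e' y) = e.symm y := e'.left_inv hy'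
  have ht : transition e e' y ∈ e'.target := e'.map_source hy'
  set c := chartAt (Cn n) (e.symm y) with hc
  have hcs : e.symm y ∈ c.source := mem_chart_source _ _
  have h1 : dSymm e' (transition e e' y) = fderiv ℝ (transition e' c) (transition e e' y) := by
    rw [dSymm_eq he' ht, h0]
  have h2 : dSymm e y = (dSymm e' (transition e e' y)).comp (fderiv ℝ (transition e e') y) := by
    rw [dSymm_eq he hy, ← hc, (transition_comp_eventuallyEq (e'' := c) hy hy').fderiv_eq, h1]
    refine fderiv_comp y ?_ ?_
    · exact (isHolAt_transition he' (chart_mem_atlas _ _) ht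
        (by rw [h0]; exact hcs)).contDiffAt.differentiableAt (by simp)
    · exact (isHolAt_transition he he' hy hy').contDiffAt.differentiableAt (by simp)
  rw [pull, rep, rep, h0, h2]
  rfl

theorem rep_transition_eventuallyEq {e e' : OpenPartialHomeomorph M (Cn n)}
    (he : e ∈ atlas (Cn n) M) (he' : e' ∈ atlas (Cn n) M) {y : Cn n} (hy : y ∈ e.target)
    (hy' : e.symm y ∈ e'.source) (φ : Form n M) (k : ℕ) :
    rep e φ k =ᶠ[𝓝 y] pull (transition e e') (rep e' φ k) := by
  filter_upwards [e.symm.continuousAt hy |>.eventually (e'.open_source.mem_nhds hy'),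
    e.open_target.mem_nhds hy] with z hz hz'
  exact rep_transition he he' hz' hz φ k

theorem dSymm_chartAt (x : M) :
    dSymm (chartAt (Cn n) x) (chartAt (Cn n) x x) = ContinuousLinearMap.id ℝ (Cn n) := by
  set c := chartAt (Cn n) x with hc
  have hx : x ∈ c.source := mem_chart_source _ _
  rw [dSymm_eq (chart_mem_atlas _ _) (c.map_source hx), c.left_inv hx, ← hc]
  have : transition c c =ᶠ[𝓝 (c x)] id := by
    filter_upwards [c.open_target.mem_nhds (c.map_source hx)] with z hz
    exact c.right_inv hz
  rw [this.fderiv_eq, fderiv_id]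

theorem rep_chartAt (φ : Form n M) (k : ℕ) (x : M) :
    rep (chartAt (Cn n) x) φ k (chartAt (Cn n) x x) = φ k x := by
  rw [rep, dSymm_chartAt, (chartAt (Cn n) x).left_inv (mem_chart_source _ _)]
  rfl

theorem isCLin_dSymm {e : OpenPartialHomeomorph M (Cn n)} (he : e ∈ atlas (Cn n) M) {y : Cn n}
    (hy : y ∈ e.target) : IsCLin (dSymm e y) := by
  rw [dSymm_eq he hy]
  exact (isHolAt_transition he (chart_mem_atlas _ _) hy (mem_chart_source _ _)).isCLin

theorem fderiv_transition_comp {e e' : OpenPartialHomeomorph M (Cn n)} (he : e ∈ atlas (Cn n) M)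
    (he' : e' ∈ atlas (Cn n) M) {y : Cn n} (hy : y ∈ e.target) (hy' : e.symm y ∈ e'.source) :
    (fderiv ℝ (transition e' e) (transition e e' y)).comp (fderiv ℝ (transition e e') y) =
      ContinuousLinearMap.id ℝ (Cn n) := by
  have ht : transition e e' y ∈ e'.target := e'.map_source hy'
  have h0 : e'.symm (transition e e' y) = e.symm y := e'.left_inv hy'
  rw [← fderiv_comp y, ← (transition_comp_eventuallyEq (e'' := e) hy hy').fderiv_eq]
  · have : transition e e =ᶠ[𝓝 y] id := by
      filter_upwards [e.open_target.mem_nhds hy] with z hz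
      exact e.right_inv hz
    rw [this.fderiv_eq, fderiv_id]
  · exact (isHolAt_transition he' he ht
      (by rw [h0]; exact e.map_target hy)).contDiffAt.differentiableAt (by simp)
  · exact (isHolAt_transition he he' hy hy').contDiffAt.differentiableAt (by simp)

theorem det_transition_pos {e e' : OpenPartialHomeomorph M (Cn n)} (he : e ∈ atlas (Cn n) M)
    (he' : e' ∈ atlas (Cn n) M) {y : Cn n} (hy : y ∈ e.target) (hy' : e.symm y ∈ e'.source) :
    0 < (mat (fderiv ℝ (transition e e') y)).det := by
  refine (isHolAt_transition he he' hy hy').isCLin.det_pos ?_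
  have h := congrArg (fun A => (mat A).det) (fderiv_transition_comp he he' hy hy')
  simp only [mat_comp, Matrix.det_mul, mat_id, Matrix.det_one] at h
  exact right_ne_zero_of_mul_eq_one h

theorem det_dSymm_pos {e : OpenPartialHomeomorph M (Cn n)} (he : e ∈ atlas (Cn n) M) {y : Cn n}
    (hy : y ∈ e.target) : 0 < (mat (dSymm e y)).det := by
  rw [dSymm_eq he hy]
  exact det_transition_pos he (chart_mem_atlas _ _) hy (mem_chart_source _ _)

end Charts

/-! ### The operators `∂` and `∂̄` on the manifold -/

section Operators

variable {n : ℕ} {M : Type*} [TopologicalSpace M] [ChartedSpace (Cn n) M]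

/-- `∂` for `σ = -1` and `∂̄` for `σ = 1`. -/
def dd (σ : ℝ) (φ : Form n M) : Form n M
  | 0 => 0
  | k + 1 => fun x => lpd σ (rep (chartAt (Cn n) x) φ k) (chartAt (Cn n) x x)

theorem del_eq (φ : Form n M) : del φ = dd (-1) φ := by
  funext k
  cases k with
  | zero => rfl
  | succ k =>
    funext x
    change alternatizeUncurryFin (linPart _) = alternatizeUncurryFin (part _ _)
    rw [linPart_eq]

theorem delbar_eq (φ : Form n M) : delbar φ = dd 1 φ := by
  funext k
  cases k with
  | zero => rfl
  | succ k =>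
    funext x
    change alternatizeUncurryFin (antiPart _) = alternatizeUncurryFin (part _ _)
    rw [antiPart_eq]

theorem IsSmooth.contDiffAt {φ : Form n M} (hφ : IsSmooth φ)
    {e : OpenPartialHomeomorph M (Cn n)} (he : e ∈ atlas (Cn n) M) (k : ℕ) {y : Cn n}
    (hy : y ∈ e.target) : ContDiffAt ℝ ∞ (rep e φ k) y :=
  (hφ e he k).contDiffAt (e.open_target.mem_nhds hy)

theorem IsSmooth.differentiableAt {φ : Form n M} (hφ : IsSmooth φ)
    {e : OpenPartialHomeomorph M (Cn n)} (he : e ∈ atlas (Cn n) M) (k : ℕ) {y : Cn n}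
    (hy : y ∈ e.target) : DifferentiableAt ℝ (rep e φ k) y :=
  (hφ.contDiffAt he k hy).differentiableAt (by simp)

theorem IsSmooth.add {φ ψ : Form n M} (hφ : IsSmooth φ) (hψ : IsSmooth ψ) : IsSmooth (φ + ψ) :=
  fun e he k => (hφ e he k).add (hψ e he k)

theorem IsSmooth.smul {φ : Form n M} (hφ : IsSmooth φ) (c : ℂ) : IsSmooth (c • φ) :=
  fun e he k => (hφ e he k).const_smul c

theorem IsSmooth.neg {φ : Form n M} (hφ : IsSmooth φ) : IsSmooth (-φ) :=
  fun e he k => (hφ e he k).neg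

theorem IsSmooth.sub {φ ψ : Form n M} (hφ : IsSmooth φ) (hψ : IsSmooth ψ) : IsSmooth (φ - ψ) :=
  fun e he k => (hφ e he k).sub (hψ e he k)

theorem dd_add (σ : ℝ) {φ ψ : Form n M} (hφ : IsSmooth φ) (hψ : IsSmooth ψ) :
    dd σ (φ + ψ) = dd σ φ + dd σ ψ := by
  funext k
  cases k with
  | zero =>
    funext x
    exact (add_zero (0 : Alt n 0)).symm
  | succ k =>
    funext x
    change lpd σ (fun y => rep _ φ k y + rep _ ψ k y) _ = lpd σ _ _ + lpd σ _ _
    exact lpd_add σ (hφ.differentiableAt (chart_mem_atlas _ x) k (mem_chart_target _ x))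
      (hψ.differentiableAt (chart_mem_atlas _ x) k (mem_chart_target _ x))

theorem dd_smul (σ : ℝ) (c : ℂ) {φ : Form n M} (hφ : IsSmooth φ) :
    dd σ (c • φ) = c • dd σ φ := by
  funext k
  cases k with
  | zero =>
    funext x
    exact (smul_zero (A := Alt n 0) c).symm
  | succ k =>
    funext x
    change lpd σ (fun y => c • rep _ φ k y) _ = c • lpd σ _ _
    exact lpd_const_smul σ c (hφ.differentiableAt (chart_mem_atlas _ x) k (mem_chart_target _ x))

theorem dd_neg (σ : ℝ) {φ : Form n M} (hφ : IsSmooth φ) : dd σ (-φ) = -dd σ φ := by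
  have h : ∀ ψ : Form n M, -ψ = (-1 : ℂ) • ψ := fun ψ => by
    funext k x
    ext v
    change -(ψ k x v) = (-1 : ℂ) • ψ k x v
    simp
  rw [h, h, dd_smul σ _ hφ]

theorem dd_of_degree_eq_zero (σ : ℝ) {φ : Form n M} {k : ℕ} (h : φ k = 0) :
    dd σ φ (k + 1) = 0 := by
  funext x
  have : rep (chartAt (Cn n) x) φ k = fun _ => 0 := by
    funext y
    rw [rep, h]
    rfl
  change lpd σ (rep (chartAt (Cn n) x) φ k) _ = 0
  rw [lpd_eq, this, fderiv_fun_const]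
  exact map_zero _

variable [IsManifold 𝓘(ℂ, Cn n) ω M]

/-- At each point `dd` is defined through the preferred chart there, which varies with the point.
Since transition maps are holomorphic, `lpd_pull` lets one compute it in any fixed chart, and so
differentiate it again. -/
theorem rep_dd (σ : ℝ) {φ : Form n M} (hφ : IsSmooth φ) {e : OpenPartialHomeomorph M (Cn n)}
    (he : e ∈ atlas (Cn n) M) (k : ℕ) {y : Cn n} (hy : y ∈ e.target) :
    rep e (dd σ φ) (k + 1) y = lpd σ (rep e φ k) y := by
  set c := chartAt (Cn n) (e.symm y) with hc
  have hcs : e.symm y ∈ c.source := mem_chart_source _ _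
  rw [lpd_congr σ (rep_transition_eventuallyEq he (chart_mem_atlas _ _) hy hcs φ k),
    lpd_pull σ (isHolAt_transition he (chart_mem_atlas _ _) hy hcs)
      (hφ.differentiableAt (chart_mem_atlas _ _) k (c.map_source hcs)), rep, dSymm_eq he hy]
  rfl

theorem rep_dd_eventuallyEq (σ : ℝ) {φ : Form n M} (hφ : IsSmooth φ)
    {e : OpenPartialHomeomorph M (Cn n)} (he : e ∈ atlas (Cn n) M) (k : ℕ) {y : Cn n}
    (hy : y ∈ e.target) : rep e (dd σ φ) (k + 1) =ᶠ[𝓝 y] lpd σ (rep e φ k) := by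
  filter_upwards [e.open_target.mem_nhds hy] with z hz using rep_dd σ hφ he k hz

theorem IsSmooth.dd (σ : ℝ) {φ : Form n M} (hφ : IsSmooth φ) : IsSmooth (dd σ φ) := by
  intro e he k
  cases k with
  | zero => exact contDiffOn_const (c := (0 : Alt n 0))
  | succ k =>
    exact (contDiffOn_lpd σ e.open_target (hφ e he k)).congr fun y hy => rep_dd σ hφ he k hy

theorem dd_dd_add (σ τ : ℝ) {φ : Form n M} (hφ : IsSmooth φ) :
    dd σ (dd τ φ) + dd τ (dd σ φ) = 0 := by
  funext k
  match k with
  | 0 => exact add_zero _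
  | 1 =>
    have h : ∀ σ τ : ℝ, dd σ (dd τ φ) 1 = 0 := fun σ τ => dd_of_degree_eq_zero σ rfl
    rw [Pi.add_apply, h, h, add_zero]
    rfl
  | k + 2 =>
    funext x
    have hx := chart_mem_atlas (Cn n) x
    have ht := mem_chart_target (Cn n) x
    change lpd σ (rep _ (dd τ φ) (k + 1)) _ + lpd τ (rep _ (dd σ φ) (k + 1)) _ = 0
    rw [lpd_congr σ (rep_dd_eventuallyEq τ hφ hx k ht),
      lpd_congr τ (rep_dd_eventuallyEq σ hφ hx k ht)]
    exact lpd_lpd_add σ τ (hφ.contDiffAt hx k ht)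

theorem dd_dd_self (σ : ℝ) {φ : Form n M} (hφ : IsSmooth φ) : dd σ (dd σ φ) = 0 := by
  have h := dd_dd_add σ σ hφ
  rw [← two_smul ℂ] at h
  exact (smul_eq_zero.1 h).resolve_left two_ne_zero

end Operators

end BottChern

end

/-! ### The metric of a local potential and its behaviour under holomorphic maps. -/

noncomputable section

open scoped Manifold ContDiff ComplexConjugate Topology

namespace BottChern

open ContinuousAlternatingMap (alternatizeUncurryFin alternatizeUncurryFin_apply
  alternatizeUncurryFinCLM)

/-! ### Metrics with a potential on open subsets of `ℂⁿ` -/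

/-- Constants as forms of degree `0`. -/
def scalL (n : ℕ) : ℂ →L[ℝ] Alt n 0 := LinearMap.toContinuousLinearMap
  { toFun := fun c => ContinuousAlternatingMap.constOfIsEmpty ℝ (Cn n) (Fin 0) c
    map_add' := fun _ _ => rfl
    map_smul' := fun _ _ => rfl }

@[simp]
theorem scalL_apply (n : ℕ) (c : ℂ) (v : Fin 0 → Cn n) : scalL n c v = c := rfl

/-- A real function, as a form of degree `0`. -/
def scal {n : ℕ} (r : Cn n → ℝ) (y : Cn n) : Alt n 0 := scalL n (r y)

/-- The inclusion of the reals in the forms of degree `0`. -/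
def scalR (n : ℕ) : ℝ →L[ℝ] Alt n 0 := (scalL n).comp Complex.ofRealCLM

@[simp]
theorem scalR_apply (n : ℕ) (c : ℝ) (v : Fin 0 → Cn n) : scalR n c v = c := rfl

theorem contDiffAt_scal {n : ℕ} {r : Cn n → ℝ} {y : Cn n} (h : ContDiffAt ℝ ∞ r y) :
    ContDiffAt ℝ ∞ (scal r) y := (scalR n).contDiff.contDiffAt.comp y h

theorem fderiv_scal {n : ℕ} {r : Cn n → ℝ} {y : Cn n} (h : DifferentiableAt ℝ r y) :
    fderiv ℝ (scal r) y = (scalR n).comp (fderiv ℝ r y) :=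
  ((scalR n).hasFDerivAt.comp y h.hasFDerivAt).fderiv

theorem fderiv_fderiv_scal {n : ℕ} {r : Cn n → ℝ} {y : Cn n} (h : ContDiffAt ℝ ∞ r y)
    (v w : Cn n) : fderiv ℝ (fderiv ℝ (scal r)) y v w = scalR n (fderiv ℝ (fderiv ℝ r) y v w) := by
  have hd : DifferentiableAt ℝ (fderiv ℝ r) y :=
    (h.fderiv_right (m := ∞) (by simp)).differentiableAt (by simp)
  have h1 : fderiv ℝ (scal r) =ᶠ[𝓝 y] fun z => (scalR n).comp (fderiv ℝ r z) := by
    have h2 := (h.of_le (m := 1) (WithTop.coe_le_coe.2 le_top)).eventually (by simp)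
    filter_upwards [h2] with z hz
    exact fderiv_scal (hz.differentiableAt (by simp))
  rw [h1.fderiv_eq]
  have h3 := hasFDerivAt_clm_comp (F := Cn n →L[ℝ] ℝ) (G := Cn n →L[ℝ] Alt n 0)
    (ContinuousLinearMap.compL ℝ (Cn n) ℝ (Alt n 0) (scalR n)) hd.hasFDerivAt
  have h4 : fderiv ℝ (fun z => (scalR n).comp (fderiv ℝ r z)) y = _ := h3.fderiv
  rw [h4]
  rfl

/-- The metric `g(v, w) = (i ∂∂̄r)(v, J w)` on an open subset of `ℂⁿ`. -/
def kMet {n : ℕ} (r : Cn n → ℝ) (y v w : Cn n) : ℝ :=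
  (Complex.I • lpd (-1) (lpd 1 (scal r)) y ![v, Complex.I • w]).re

/-- The Gram matrix of `kMet`. -/
def gramR {n : ℕ} (r : Cn n → ℝ) (y : Cn n) : Matrix (Idx n) (Idx n) ℝ :=
  Matrix.of fun i j => kMet r y (vec i) (vec j)

theorem alternatize_two {n : ℕ} (L : Cn n →L[ℝ] Alt n 1) (a b : Cn n) :
    alternatizeUncurryFin L ![a, b] = L a ![b] - L b ![a] := by
  rw [alternatizeUncurryFin_apply, Fin.sum_univ_two]
  have h0 : (0 : Fin 2).removeNth ![a, b] = ![b] := by ext i; fin_cases i; rfl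
  have h1 : (1 : Fin 2).removeNth ![a, b] = ![a] := by ext i; fin_cases i; rfl
  rw [h0, h1]
  simp [sub_eq_add_neg]

theorem alternatize_one {n : ℕ} (L : Cn n →L[ℝ] Alt n 0) (v : Fin 1 → Cn n) :
    alternatizeUncurryFin L v = L (v 0) ![] := by
  rw [alternatizeUncurryFin_apply, Fin.sum_univ_one]
  have h0 : (0 : Fin 1).removeNth v = ![] := Subsingleton.elim _ _
  rw [h0]
  simp

/-- The metric is the `i`-invariant half of the real Hessian of the potential. Bilinearity,
symmetry, `i`-invariance and the formulas for its derivatives are all read off from this. -/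
theorem kMet_eq {n : ℕ} {r : Cn n → ℝ} {y : Cn n} (h : ContDiffAt ℝ ∞ r y) (v w : Cn n) :
    kMet r y v w = (fderiv ℝ (fderiv ℝ r) y v w +
      fderiv ℝ (fderiv ℝ r) y (Complex.I • v) (Complex.I • w)) / 2 := by
  have hs : ∀ v w, fderiv ℝ (fderiv ℝ r) y v w = fderiv ℝ (fderiv ℝ r) y w v :=
    (h.isSymmSndFDerivAt minSmoothness_two_le).eq
  have hJ : Complex.I • Complex.I • w = -w := by rw [smul_smul, Complex.I_mul_I, neg_one_smul]
  rw [kMet, lpd_lpd (-1) 1 (contDiffAt_scal h), alternatize_two]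
  simp only [ContinuousLinearMap.comp_apply,
    ContinuousAlternatingMap.alternatizeUncurryFinCLM_apply, alternatize_one, part_apply,
    partL_apply, fderiv_fderiv_scal h, _root_.add_apply, _root_.smul_apply,
    ContinuousAlternatingMap.add_apply, ContinuousAlternatingMap.smul_apply, scalR_apply,
    Matrix.cons_val_zero, hJ, hs _ v, hs _ (Complex.I • v)]
  simp only [map_neg, Complex.ofReal_neg]
  simp
  ring

theorem exists_bilin_kMet {n : ℕ} {r : Cn n → ℝ} {y : Cn n} (h : ContDiffAt ℝ ∞ r y) :
    ∃ B : Cn n →ₗ[ℝ] Cn n →ₗ[ℝ] ℝ, ∀ v w, kMet r y v w = B v w := by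
  have hI : ∀ (c : ℝ) (v : Cn n), Complex.I • c • v = c • Complex.I • v := fun c v =>
    smul_comm _ _ _
  refine ⟨LinearMap.mk₂ ℝ (kMet r y) ?_ ?_ ?_ ?_, fun v w => rfl⟩ <;> intros <;>
    simp only [kMet_eq h, map_add, smul_add, map_smul, hI, _root_.add_apply, _root_.smul_apply,
      smul_eq_mul] <;> ring

theorem gram_transform {n : ℕ} (B : Cn n →ₗ[ℝ] Cn n →ₗ[ℝ] ℝ) (A : Cn n →L[ℝ] Cn n) :
    (Matrix.of fun i j => B (A (vec i)) (A (vec j))) =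
      (mat A).transpose * (Matrix.of fun i j => B (vec i) (vec j)) * mat A := by
  ext i j
  simp only [Matrix.of_apply, apply_vec A, map_sum, map_smul, LinearMap.sum_apply,
    LinearMap.smul_apply, Matrix.mul_apply, Matrix.transpose_apply, smul_eq_mul, Finset.mul_sum,
    Finset.sum_mul]
  refine Finset.sum_congr rfl fun a _ => Finset.sum_congr rfl fun b _ => by ring

theorem pull_scal {n : ℕ} (r : Cn n → ℝ) (ψ : Cn n → Cn n) :
    pull ψ (scal r) = scal fun z => r (ψ z) := by
  funext z
  ext v
  rfl

theorem kMet_comp {n : ℕ} {r : Cn n → ℝ} {ψ : Cn n → Cn n} {y : Cn n} (hψ : IsHolAt ψ y)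
    (hr : ContDiffAt ℝ ∞ r (ψ y)) (v w : Cn n) :
    kMet (fun z => r (ψ z)) y v w = kMet r (ψ y) (fderiv ℝ ψ y v) (fderiv ℝ ψ y w) := by
  have h1 : lpd 1 (scal fun z => r (ψ z)) =ᶠ[𝓝 y] pull ψ (lpd 1 (scal r)) := by
    have h2 := hψ.contDiffAt.continuousAt.eventually
      ((hr.of_le (m := 1) (WithTop.coe_le_coe.2 le_top)).eventually (by simp))
    filter_upwards [hψ.eventually, h2] with z hz hz2
    have h3 : DifferentiableAt ℝ (scal r) (ψ z) :=
      (scalR n).differentiableAt.comp _ (hz2.differentiableAt (by simp))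
    rw [← pull_scal, lpd_pull 1 hz h3, pull]
  rw [kMet, lpd_congr (-1) h1, lpd_pull (-1) hψ
    ((contDiffAt_lpd 1 (contDiffAt_scal hr)).differentiableAt (by simp)), kMet,
    ContinuousAlternatingMap.compContinuousLinearMap_apply]
  have h2 : (fderiv ℝ ψ y ∘ ![v, Complex.I • w]) =
      ![fderiv ℝ ψ y v, Complex.I • fderiv ℝ ψ y w] := by
    ext i
    fin_cases i
    · rfl
    · change fderiv ℝ ψ y (Complex.I • w) _ = _
      rw [hψ.isCLin]
      rfl
  rw [h2]

theorem gramR_comp {n : ℕ} {r : Cn n → ℝ} {ψ : Cn n → Cn n} {y : Cn n} (hψ : IsHolAt ψ y)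
    (hr : ContDiffAt ℝ ∞ r (ψ y)) : gramR (fun z => r (ψ z)) y =
      (mat (fderiv ℝ ψ y)).transpose * gramR r (ψ y) * mat (fderiv ℝ ψ y) := by
  obtain ⟨B, hB⟩ := exists_bilin_kMet hr
  simp only [gramR, kMet_comp hψ hr, hB]
  exact gram_transform B _

theorem contDiffAt_kMet {n : ℕ} {r : Cn n → ℝ} {y : Cn n} (h : ContDiffAt ℝ ∞ r y) (v w : Cn n) :
    ContDiffAt ℝ ∞ (fun z => kMet r z v w) y := by
  have h1 := contDiffAt_lpd (-1) (contDiffAt_lpd 1 (contDiffAt_scal h))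
  have h2 := (ContinuousAlternatingMap.apply ℝ (Cn n) ℂ ![v, Complex.I • w]).contDiff.contDiffAt.comp
    y h1
  exact Complex.reCLM.contDiff.contDiffAt.comp y (h2.const_smul Complex.I)

section Manifold

theorem omega_eq {n : ℕ} {M : Type*} [TopologicalSpace M] [ChartedSpace (Cn n) M]
    (ρ : M → ℝ) :
    omega (n := n) ρ = Complex.I • dd (-1) (dd 1 (ofFun fun x => (ρ x : ℂ))) := by
  rw [omega, del_eq, delbar_eq]

variable {n : ℕ} {M : Type*} [TopologicalSpace M] [ChartedSpace (Cn n) M]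
  [IsManifold 𝓘(ℂ, Cn n) ω M]

theorem contDiffAt_comp_symm {ρ : M → ℝ} (hρ : ContMDiff 𝓘(ℝ, Cn n) 𝓘(ℝ, ℝ) ∞ ρ)
    {e : OpenPartialHomeomorph M (Cn n)} (he : e ∈ atlas (Cn n) M) {y : Cn n} (hy : y ∈ e.target) :
    ContDiffAt ℝ ∞ (fun z => ρ (e.symm z)) y := by
  set c := chartAt (Cn n) (e.symm y) with hc
  have hcs : e.symm y ∈ c.source := mem_chart_source _ _
  have h1 : ContDiffAt ℝ ∞ (fun z => ρ (c.symm z)) (c (e.symm y)) := by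
    have := (contMDiffAt_iff.1 (hρ (e.symm y))).2
    simpa [Function.comp_def, contDiffWithinAt_univ, ← hc, chartAt_self_eq] using this
  have h2 := (isHolAt_transition he (chart_mem_atlas _ _) hy hcs).contDiffAt
  refine (ContDiffAt.comp y (f := transition e c) h1 h2).congr_of_eventuallyEq ?_
  filter_upwards [e.symm.continuousAt hy |>.eventually (c.open_source.mem_nhds hcs)] with z hz
  simp [transition, c.left_inv hz]

theorem isSmooth_ofFun {ρ : M → ℝ} (hρ : ContMDiff 𝓘(ℝ, Cn n) 𝓘(ℝ, ℝ) ∞ ρ) :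
    IsSmooth (n := n) (ofFun fun x => (ρ x : ℂ)) := by
  intro e he k
  cases k with
  | zero => exact fun y hy => (contDiffAt_scal (contDiffAt_comp_symm hρ he hy)).contDiffWithinAt
  | succ k => exact contDiffOn_const (c := (0 : Alt n (k + 1)))

theorem metric_dSymm {ρ : M → ℝ} (hρ : ContMDiff 𝓘(ℝ, Cn n) 𝓘(ℝ, ℝ) ∞ ρ)
    {e : OpenPartialHomeomorph M (Cn n)} (he : e ∈ atlas (Cn n) M) {y : Cn n} (hy : y ∈ e.target)
    (v w : Cn n) :
    metric ρ (e.symm y) (dSymm e y v) (dSymm e y w) = kMet (fun z => ρ (e.symm z)) y v w := by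
  have h0 := isSmooth_ofFun (n := n) hρ
  have h1 : rep e (dd (-1) (dd 1 (ofFun fun x => (ρ x : ℂ)))) 2 y =
      lpd (-1) (lpd 1 (scal fun z => ρ (e.symm z))) y := by
    rw [rep_dd (-1) (h0.dd 1) he 1 hy, lpd_congr (-1) (rep_dd_eventuallyEq 1 h0 he 0 hy)]
    rfl
  rw [metric, omega_eq, kMet, ← h1, rep, ContinuousAlternatingMap.compContinuousLinearMap_apply]
  have h2 : (dSymm e y ∘ ![v, Complex.I • w]) = ![dSymm e y v, Complex.I • dSymm e y w] := by
    ext i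
    fin_cases i
    · rfl
    · change dSymm e y (Complex.I • w) _ = _
      rw [isCLin_dSymm he hy]
      rfl
  rw [h2]
  rfl

theorem gramIn_eq {ρ : M → ℝ} (hρ : ContMDiff 𝓘(ℝ, Cn n) 𝓘(ℝ, ℝ) ∞ ρ)
    {e : OpenPartialHomeomorph M (Cn n)} (he : e ∈ atlas (Cn n) M) {y : Cn n}
    (hy : y ∈ e.target) : gramIn ρ e y = gramR (fun z => ρ (e.symm z)) y := by
  simp only [gramIn, gramR, metric_dSymm hρ he hy]

theorem gram_eq {ρ : M → ℝ} (hρ : ContMDiff 𝓘(ℝ, Cn n) 𝓘(ℝ, ℝ) ∞ ρ) (x : M) :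
    gram ρ x = gramR (fun z => ρ ((chartAt (Cn n) x).symm z)) (chartAt (Cn n) x x) := by
  rw [← gramIn_eq hρ (chart_mem_atlas _ x) (mem_chart_target _ x), gramIn, gram, dSymm_chartAt,
    (chartAt (Cn n) x).left_inv (mem_chart_source _ x)]
  rfl

/-- This has the form `AᵀGA` with `A = dSymm e y`, to which the linear invariance lemmas for `herm`,
`hodge` and `lam` apply. They thereby become statements about chart expressions. -/
theorem gramR_transform {ρ : M → ℝ} (hρ : ContMDiff 𝓘(ℝ, Cn n) 𝓘(ℝ, ℝ) ∞ ρ)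
    {e : OpenPartialHomeomorph M (Cn n)} (he : e ∈ atlas (Cn n) M) {y : Cn n} (hy : y ∈ e.target) :
    gramR (fun z => ρ (e.symm z)) y =
      (mat (dSymm e y)).transpose * gram ρ (e.symm y) * mat (dSymm e y) := by
  have hr := contDiffAt_comp_symm hρ (chart_mem_atlas (Cn n) (e.symm y))
    (mem_chart_target (Cn n) (e.symm y))
  obtain ⟨B, hB⟩ := exists_bilin_kMet hr
  have h1 : ∀ v w, metric ρ (e.symm y) v w = B v w := by
    intro v w
    rw [← hB, ← metric_dSymm hρ (chart_mem_atlas _ _) (mem_chart_target _ _), dSymm_chartAt,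
      (chartAt (Cn n) (e.symm y)).left_inv (mem_chart_source _ _)]
    rfl
  rw [← gramIn_eq hρ he hy]
  simp only [gramIn, gram, h1]
  exact gram_transform B _

end Manifold

end BottChern

end

/-! ### Smooth dependence on the metric; `∗`, `Λ` and the Hermitian product in charts. -/

noncomputable section

open scoped Manifold ContDiff ComplexConjugate Topology

namespace BottChern

open ContinuousAlternatingMap (alternatizeUncurryFin alternatizeUncurryFin_apply
  alternatizeUncurryFinCLM)

/-! ### Smooth dependence on the metric -/

section Param

variable {n : ℕ} {E : Type*} [NormedAddCommGroup E] [NormedSpace ℝ E]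

theorem contDiffAt_det {ι : Type*} [Fintype ι] [DecidableEq ι] {G : E → Matrix ι ι ℝ} {y : E}
    (hG : ∀ i j, ContDiffAt ℝ ∞ (fun z => G z i j) y) : ContDiffAt ℝ ∞ (fun z => (G z).det) y := by
  simp_rw [Matrix.det_apply]
  exact ContDiffAt.sum fun σ _ => (contDiffAt_prod fun i _ => hG _ _).const_smul _

theorem contDiffAt_inv_apply {ι : Type*} [Fintype ι] [DecidableEq ι] {G : E → Matrix ι ι ℝ} {y : E}
    (hG : ∀ i j, ContDiffAt ℝ ∞ (fun z => G z i j) y) (hd : (G y).det ≠ 0) (i j : ι) :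
    ContDiffAt ℝ ∞ (fun z => (G z)⁻¹ i j) y := by
  simp_rw [Matrix.inv_def, Ring.inverse_eq_inv', Matrix.smul_apply, smul_eq_mul,
    Matrix.adjugate_apply]
  refine ((contDiffAt_det hG).inv hd).mul (contDiffAt_det fun a b => ?_)
  simp only [Matrix.updateRow_apply]
  split_ifs
  · exact contDiffAt_const
  · exact hG a b

theorem contDiffAt_conj {f : E → ℂ} {y : E} (h : ContDiffAt ℝ ∞ f y) :
    ContDiffAt ℝ ∞ (fun z => conj (f z)) y :=
  Complex.conjCLE.contDiff.contDiffAt.comp y h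

theorem contDiffAt_ofReal {f : E → ℝ} {y : E} (h : ContDiffAt ℝ ∞ f y) :
    ContDiffAt ℝ ∞ (fun z => (f z : ℂ)) y :=
  Complex.ofRealCLM.contDiff.contDiffAt.comp y h

theorem contDiffAt_contr {k : ℕ} {G : E → Matrix (Idx n) (Idx n) ℝ} {y : E}
    (hG : ∀ i j, ContDiffAt ℝ ∞ (fun z => G z i j) y) (hd : (G y).det ≠ 0)
    {S T : E → (Fin k → Idx n) → ℂ} (hS : ∀ s, ContDiffAt ℝ ∞ (fun z => S z s) y)
    (hT : ∀ s, ContDiffAt ℝ ∞ (fun z => T z s) y) :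
    ContDiffAt ℝ ∞ (fun z => contr (G z) (S z) (T z)) y :=
  ContDiffAt.sum fun s _ => ContDiffAt.sum fun t _ =>
    ((contDiffAt_ofReal (contDiffAt_prod fun _ _ => contDiffAt_inv_apply hG hd _ _)).mul
      (hS s)).mul (hT t)

theorem contDiffAt_herm {k : ℕ} {G : E → Matrix (Idx n) (Idx n) ℝ} {y : E}
    (hG : ∀ i j, ContDiffAt ℝ ∞ (fun z => G z i j) y) (hd : (G y).det ≠ 0)
    {S T : E → (Fin k → Idx n) → ℂ} (hS : ∀ s, ContDiffAt ℝ ∞ (fun z => S z s) y)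
    (hT : ∀ s, ContDiffAt ℝ ∞ (fun z => T z s) y) :
    ContDiffAt ℝ ∞ (fun z => herm (G z) (S z) (T z)) y :=
  contDiffAt_const.mul (contDiffAt_contr hG hd hS fun s => contDiffAt_conj (hT s))

theorem contDiffAt_hodge {k l : ℕ} (h : k + l = n * 2) {G : E → Matrix (Idx n) (Idx n) ℝ} {y : E}
    (hG : ∀ i j, ContDiffAt ℝ ∞ (fun z => G z i j) y) (hd : (G y).det ≠ 0)
    {β : E → Alt n k} (hβ : ContDiffAt ℝ ∞ β y) :
    ContDiffAt ℝ ∞ (fun z => hodge h (G z) (β z)) y := by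
  apply contDiffAt_of_comps
  intro s
  simp_rw [comps, hodge_apply]
  exact (contDiffAt_const.mul (contDiffAt_ofReal ((contDiffAt_det hG).sqrt hd))).mul
    (contDiffAt_contr hG hd (fun _ => contDiffAt_const)
      fun t => contDiffAt_conj (contDiffAt_comps hβ t))

theorem contDiffAt_lam {k : ℕ} {G : E → Matrix (Idx n) (Idx n) ℝ} {y : E}
    (hG : ∀ i j, ContDiffAt ℝ ∞ (fun z => G z i j) y) (hd : (G y).det ≠ 0)
    {β : E → Alt n (k + 2)} (hβ : ContDiffAt ℝ ∞ β y) :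
    ContDiffAt ℝ ∞ (fun z => lam (G z) (β z)) y := by
  simp_rw [lam_apply]
  refine ContDiffAt.sum fun i _ => ContDiffAt.sum fun j _ => ContDiffAt.fun_smul
    ((contDiffAt_inv_apply hG hd i j).div_const 2) ?_
  exact (((iota (k := k) (Complex.I • vec j)).comp
    (iota (k := k + 1) (vec i))).contDiff.contDiffAt.comp y hβ)

/-- If the parameter has zero derivative at the point, the operator differentiates as though it were
frozen. The parameter will be the Gram matrix in normal coordinates, and `F` the Hodge operator, `Λ`
or the Hermitian product. -/
theorem hasFDerivAt_of_stationary {P V W : Type*} [NormedAddCommGroup P] [NormedSpace ℝ P]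
    [NormedAddCommGroup V] [NormedSpace ℝ V] [NormedAddCommGroup W] [NormedSpace ℝ W]
    {F : P → V → W} {Γ : E → P} {β : E → V} {β' : E →L[ℝ] V} {y : E} {T : V →L[ℝ] W}
    (hT : HasFDerivAt (F (Γ y)) T (β y))
    (hF : DifferentiableAt ℝ (fun q : P × V => F q.1 q.2) (Γ y, β y))
    (hΓ : HasFDerivAt Γ (0 : E →L[ℝ] P) y) (hβ : HasFDerivAt β β' y) :
    HasFDerivAt (fun z => F (Γ z) (β z)) (T.comp β') y := by
  obtain ⟨D, hD⟩ := hF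
  have h1 : HasFDerivAt (F (Γ y)) (D.comp (ContinuousLinearMap.inr ℝ P V)) (β y) := by
    have h2 : HasFDerivAt (fun v : V => (Γ y, v)) (ContinuousLinearMap.inr ℝ P V) (β y) :=
      hasFDerivAt_prodMk_right _ _
    exact HasFDerivAt.comp (g := fun q : P × V => F q.1 q.2) (β y) hD h2
  have h3 : HasFDerivAt (fun z => (Γ z, β z)) ((0 : E →L[ℝ] P).prod β') y := hΓ.prodMk hβ
  have h4 := HasFDerivAt.comp (g := fun q : P × V => F q.1 q.2) y hD h3
  have h5 : T.comp β' = D.comp ((0 : E →L[ℝ] P).prod β') := by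
    rw [hT.unique h1]
    rfl
  rw [h5]
  exact h4

end Param

/-! ### The metric and the Hodge operator in charts -/

section Manifold

/-- The dual Lefschetz operator. -/
def lefschetz {n : ℕ} {M : Type*} [TopologicalSpace M] [ChartedSpace (Cn n) M]
    (ρ : M → ℝ) (φ : Form n M) : Form n M := fun k x => lam (gram ρ x) (φ (k + 2) x)

theorem kMet_symm {n : ℕ} {r : Cn n → ℝ} {y : Cn n} (h : ContDiffAt ℝ ∞ r y) (v w : Cn n) :
    kMet r y v w = kMet r y w v := by
  have hs := (h.isSymmSndFDerivAt minSmoothness_two_le).eq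
  rw [kMet_eq h, kMet_eq h, hs v w, hs (Complex.I • v)]

theorem kMet_I {n : ℕ} {r : Cn n → ℝ} {y : Cn n} (h : ContDiffAt ℝ ∞ r y) (v w : Cn n) :
    kMet r y (Complex.I • v) (Complex.I • w) = kMet r y v w := by
  have hJ : ∀ w : Cn n, Complex.I • Complex.I • w = -w := fun w => by
    rw [smul_smul, Complex.I_mul_I, neg_one_smul]
  rw [kMet_eq h, kMet_eq h, hJ, hJ]
  simp only [map_neg, neg_apply, neg_neg]
  rw [add_comm]

theorem posDef_gramR {n : ℕ} {r : Cn n → ℝ} {y : Cn n} (h : ContDiffAt ℝ ∞ r y)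
    (hp : ∀ v, v ≠ 0 → 0 < kMet r y v v) : (gramR r y).PosDef := by
  obtain ⟨B, hB⟩ := exists_bilin_kMet h
  rw [Matrix.posDef_iff_dotProduct_mulVec]
  refine ⟨?_, fun x hx => ?_⟩
  · ext i j
    simp only [gramR, Matrix.conjTranspose_apply, Matrix.of_apply, star_trivial]
    exact kMet_symm h _ _
  · have h1 : Star.star x ⬝ᵥ (gramR r y).mulVec x = kMet r y (∑ i, x i • vec i) (∑ i, x i • vec i) := by
      simp only [hB, gramR, dotProduct, Matrix.mulVec, Pi.star_apply, star_trivial,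
        Matrix.of_apply, map_sum, map_smul, LinearMap.sum_apply, LinearMap.smul_apply,
        smul_eq_mul, Finset.mul_sum]
      rw [Finset.sum_comm]
      exact Finset.sum_congr rfl fun a _ => Finset.sum_congr rfl fun b _ => by ring
    rw [h1]
    apply hp
    intro h0
    apply hx
    have h2 := (basisR n).linearIndependent
    rw [Fintype.linearIndependent_iff] at h2
    funext i
    exact h2 x (by simpa using h0) i

variable {n : ℕ} {M : Type*} [TopologicalSpace M] [ChartedSpace (Cn n) M]
  [IsManifold 𝓘(ℂ, Cn n) ω M]

theorem posDef_gram {ρ : M → ℝ} (hρ : IsDBoundedStein n ρ) (x : M) :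
    (gram (n := n) ρ x).PosDef := by
  rw [gram_eq hρ.smooth]
  refine posDef_gramR (contDiffAt_comp_symm hρ.smooth (chart_mem_atlas _ x)
    (mem_chart_target _ x)) fun v hv => ?_
  rw [← metric_dSymm hρ.smooth (chart_mem_atlas _ x) (mem_chart_target _ x), dSymm_chartAt,
    (chartAt (Cn n) x).left_inv (mem_chart_source _ x)]
  exact hρ.strictly_psh x v hv

theorem det_gramR_pos {ρ : M → ℝ} (hρ : IsDBoundedStein n ρ)
    {e : OpenPartialHomeomorph M (Cn n)} (he : e ∈ atlas (Cn n) M) {y : Cn n} (hy : y ∈ e.target) :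
    0 < (gramR (fun z => ρ (e.symm z)) y).det := by
  rw [gramR_transform hρ.smooth he hy, det_transform]
  exact mul_pos (pow_pos (det_dSymm_pos he hy) 2) (posDef_gram hρ _).det_pos

theorem rep_star {ρ : M → ℝ} (hρ : IsDBoundedStein n ρ) (φ : Form n M)
    {e : OpenPartialHomeomorph M (Cn n)} (he : e ∈ atlas (Cn n) M) {k : ℕ} (hk : k ≤ n * 2)
    {y : Cn n} (hy : y ∈ e.target) :
    rep e (star ρ φ) k y =
      hodge (Nat.sub_add_cancel hk) (gramR (fun z => ρ (e.symm z)) y) (rep e φ (n * 2 - k) y) := by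
  rw [gramR_transform hρ.smooth he hy, rep, rep, star, dif_pos hk]
  exact (hodge_pb _ _ _ (det_dSymm_pos he hy) _).symm

theorem IsSmooth.star {ρ : M → ℝ} (hρ : IsDBoundedStein n ρ) {φ : Form n M} (hφ : IsSmooth φ) :
    IsSmooth (star ρ φ) := by
  intro e he k y hy
  by_cases hk : k ≤ n * 2
  · refine ContDiffAt.contDiffWithinAt ?_
    refine (contDiffAt_hodge (Nat.sub_add_cancel hk)
      (fun i j => contDiffAt_kMet (contDiffAt_comp_symm hρ.smooth he hy) _ _)
      (det_gramR_pos hρ he hy).ne' (hφ.contDiffAt he _ hy)).congr_of_eventuallyEq ?_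
    filter_upwards [e.open_target.mem_nhds hy] with z hz using rep_star hρ φ he hk hz
  · have := subsingleton_of_lt (n := n) (k := k) (by omega)
    exact contDiffWithinAt_of_subsingleton

theorem herm_rep {ρ : M → ℝ} (hρ : IsDBoundedStein n ρ) (φ ψ : Form n M)
    {e : OpenPartialHomeomorph M (Cn n)} (he : e ∈ atlas (Cn n) M) (k : ℕ) {y : Cn n}
    (hy : y ∈ e.target) :
    herm (gramR (fun z => ρ (e.symm z)) y) (comps (rep e φ k y)) (comps (rep e ψ k y)) =
      herm (gram ρ (e.symm y)) (comps (φ k (e.symm y))) (comps (ψ k (e.symm y))) := by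
  rw [gramR_transform hρ.smooth he hy]
  exact herm_pb _ _ (det_dSymm_pos he hy).ne' _ _

theorem rep_lefschetz {ρ : M → ℝ} (hρ : IsDBoundedStein n ρ) (φ : Form n M)
    {e : OpenPartialHomeomorph M (Cn n)} (he : e ∈ atlas (Cn n) M) (k : ℕ)
    {y : Cn n} (hy : y ∈ e.target) :
    rep e (lefschetz ρ φ) k y =
      lam (gramR (fun z => ρ (e.symm z)) y) (rep e φ (k + 2) y) := by
  rw [gramR_transform hρ.smooth he hy]
  exact (lam_pb _ (det_dSymm_pos he hy).ne' (isCLin_dSymm he hy) _).symm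

theorem IsSmooth.lefschetz {ρ : M → ℝ} (hρ : IsDBoundedStein n ρ) {φ : Form n M}
    (hφ : IsSmooth φ) : IsSmooth (lefschetz ρ φ) := by
  intro e he k y hy
  refine ContDiffAt.contDiffWithinAt ?_
  refine (contDiffAt_lam
    (fun i j => contDiffAt_kMet (contDiffAt_comp_symm hρ.smooth he hy) _ _)
    (det_gramR_pos hρ he hy).ne' (hφ.contDiffAt he _ hy)).congr_of_eventuallyEq ?_
  filter_upwards [e.open_target.mem_nhds hy] with z hz using rep_lefschetz hρ φ he k hz

end Manifold

end BottChern

end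

/-! ### Unitary frames, and the complex linearity of the Levi-Civita connection. -/

noncomputable section

open scoped Manifold ContDiff ComplexConjugate Topology ComplexOrder MatrixOrder

namespace BottChern

open ContinuousAlternatingMap (alternatizeUncurryFin alternatizeUncurryFin_apply
  alternatizeUncurryFinCLM)

/-! ### Unitary frames -/

theorem I_smul_I_smul {n : ℕ} (v : Cn n) : Complex.I • Complex.I • v = -v := by
  rw [smul_smul, Complex.I_mul_I, neg_one_smul]

/-- The Hermitian matrix of a real bilinear form. -/
def hermMatrix {n : ℕ} (B : Cn n →ₗ[ℝ] Cn n →ₗ[ℝ] ℝ) : Matrix (Fin n) (Fin n) ℂ :=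
  Matrix.of fun j k => (B (Pi.single j 1) (Pi.single k 1) : ℂ) -
    Complex.I * B (Pi.single j 1) (Complex.I • Pi.single k 1)

section Frame

variable {n : ℕ} {B : Cn n →ₗ[ℝ] Cn n →ₗ[ℝ] ℝ}

theorem bilin_I_left (hI : ∀ v w, B (Complex.I • v) (Complex.I • w) = B v w) (v w : Cn n) :
    B (Complex.I • v) w = -B v (Complex.I • w) := by
  have := hI v (Complex.I • w)
  rw [I_smul_I_smul, map_neg] at this
  linarith

theorem smul_eq_re_im (c : ℂ) (v : Cn n) : c • v = c.re • v + c.im • Complex.I • v := by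
  ext j
  apply Complex.ext <;> simp [sub_eq_add_neg]

theorem hermMatrix_dotProduct (hI : ∀ v w, B (Complex.I • v) (Complex.I • w) = B v w)
    (v w : Cn n) : (Star.star v) ⬝ᵥ (hermMatrix B).mulVec w =
      (B v w : ℂ) - Complex.I * B v (Complex.I • w) := by
  let h : Cn n → Cn n → ℂ := fun v w => (B v w : ℂ) - Complex.I * B v (Complex.I • w)
  have hl : ∀ (c : ℂ) v w, h (c • v) w = conj c * h v w := by
    intro c v w
    simp only [h]
    rw [smul_eq_re_im c v]
    simp only [map_add, map_smul, LinearMap.add_apply, LinearMap.smul_apply, bilin_I_left hI,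
      I_smul_I_smul, smul_eq_mul, map_neg]
    apply Complex.ext <;> simp <;> ring
  have hr : ∀ (c : ℂ) v w, h v (c • w) = c * h v w := by
    intro c v w
    simp only [h]
    rw [smul_comm Complex.I c w, smul_eq_re_im c w, smul_eq_re_im c (Complex.I • w)]
    simp only [map_add, map_smul, I_smul_I_smul, smul_eq_mul, map_neg]
    apply Complex.ext <;> simp <;> ring
  have sl : ∀ (f : Fin n → Cn n) w, h (∑ j, f j) w = ∑ j, h (f j) w := by
    intro f w
    simp only [h, map_sum, LinearMap.sum_apply, Complex.ofReal_sum, Finset.mul_sum,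
      Finset.sum_sub_distrib]
  have sr : ∀ (f : Fin n → Cn n) v, h v (∑ j, f j) = ∑ j, h v (f j) := by
    intro f v
    simp only [h, map_sum, Finset.smul_sum, Complex.ofReal_sum, Finset.mul_sum,
      Finset.sum_sub_distrib]
  have key : h v w = ∑ j, ∑ k, conj (v j) * (w k * h (Pi.single j 1) (Pi.single k 1)) := by
    conv_lhs => rw [pi_eq_sum_univ' v, pi_eq_sum_univ' w]
    rw [sl]
    refine Finset.sum_congr rfl fun j _ => ?_
    rw [sr]
    refine Finset.sum_congr rfl fun k _ => ?_
    rw [hl, hr]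
  rw [show (B v w : ℂ) - Complex.I * B v (Complex.I • w) = h v w from rfl, key]
  simp only [dotProduct, Matrix.mulVec, hermMatrix, Matrix.of_apply, Pi.star_apply,
    Finset.mul_sum]
  refine Finset.sum_congr rfl fun j _ => Finset.sum_congr rfl fun k _ => ?_
  simp only [h, RCLike.star_def]
  ring

theorem posDef_hermMatrix (hI : ∀ v w, B (Complex.I • v) (Complex.I • w) = B v w)
    (hs : ∀ v w, B v w = B w v) (hp : ∀ v, v ≠ 0 → 0 < B v v) : (hermMatrix B).PosDef := by
  rw [Matrix.posDef_iff_dotProduct_mulVec]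
  refine ⟨?_, fun x hx => ?_⟩
  · ext j k
    simp only [hermMatrix, Matrix.conjTranspose_apply, Matrix.of_apply, RCLike.star_def, map_sub,
      map_mul, Complex.conj_ofReal, Complex.conj_I]
    rw [hs (Pi.single k 1) (Pi.single j 1), hs (Pi.single k 1), bilin_I_left hI]
    push_cast
    ring
  · rw [hermMatrix_dotProduct hI]
    have h0 : B x (Complex.I • x) = 0 := by
      have := bilin_I_left hI x x
      rw [hs] at this
      linarith
    rw [h0]
    simpa using hp x hx

/-- `B` is the real part of a positive definite Hermitian form with matrix `H = C*C`, and the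
columns of `C⁻¹` form a unitary basis for it. Being given by a complex matrix, the resulting map is
complex-linear. -/
theorem exists_unitary_frame (hI : ∀ v w, B (Complex.I • v) (Complex.I • w) = B v w)
    (hs : ∀ v w, B v w = B w v) (hp : ∀ v, v ≠ 0 → 0 < B v v) :
    ∃ A : Cn n →L[ℝ] Cn n, IsCLin A ∧
      (Matrix.of fun i j => B (A (vec i)) (A (vec j))) = (1 : Matrix (Idx n) (Idx n) ℝ) := by
  have hpd := posDef_hermMatrix hI hs hp
  obtain ⟨C, hC⟩ := CStarAlgebra.nonneg_iff_eq_star_mul_self.1 hpd.posSemidef.nonneg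
  rw [Matrix.star_eq_conjTranspose] at hC
  have hCu : IsUnit C.det := by
    have h1 := hpd.det_pos.ne'
    rw [hC, Matrix.det_mul] at h1
    exact isUnit_iff_ne_zero.2 (right_ne_zero_of_mul h1)
  let A : Cn n →L[ℂ] Cn n := LinearMap.toContinuousLinearMap (Matrix.mulVecLin C⁻¹)
  refine ⟨A.restrictScalars ℝ, isCLin_restrictScalars A, ?_⟩
  have h2 : ∀ v w, B (A v) (A w) = (Star.star v ⬝ᵥ w).re := by
    intro v w
    have h3 := hermMatrix_dotProduct hI (A v) (A w)
    have h4 : Star.star (A v) ⬝ᵥ (hermMatrix B).mulVec (A w) = Star.star v ⬝ᵥ w := by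
      change Star.star (C⁻¹.mulVec v) ⬝ᵥ (hermMatrix B).mulVec (C⁻¹.mulVec w) = _
      rw [hC, Matrix.star_mulVec, ← Matrix.dotProduct_mulVec, Matrix.mulVec_mulVec,
        Matrix.mulVec_mulVec, ← Matrix.mul_assoc,
        Matrix.mul_assoc (C⁻¹.conjTranspose * C.conjTranspose), Matrix.mul_nonsing_inv _ hCu, Matrix.mul_one,
        ← Matrix.conjTranspose_mul, Matrix.mul_nonsing_inv _ hCu, Matrix.conjTranspose_one,
        Matrix.one_mulVec]
    rw [h4] at h3
    rw [h3]
    simp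
  ext i j
  change B (A (vec i)) (A (vec j)) = _
  rw [h2, Matrix.one_apply]
  obtain ⟨a, c⟩ := i
  obtain ⟨b, d⟩ := j
  by_cases hab : a = b
  · subst hab
    fin_cases c <;> fin_cases d <;>
      simp [vec, dotProduct, Pi.single_apply]
  · fin_cases c <;> fin_cases d <;>
      simp [vec, dotProduct, Pi.single_apply, hab, Ne.symm hab]

end Frame

/-! ### Third derivatives of the potential and the connection -/

section Third

variable {n : ℕ} {r : Cn n → ℝ} {y : Cn n}

/-- The third derivative. -/
def third (r : Cn n → ℝ) (y : Cn n) : Cn n →L[ℝ] Cn n →L[ℝ] Cn n →L[ℝ] ℝ :=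
  fderiv ℝ (fderiv ℝ (fderiv ℝ r)) y

theorem third_symm_left (h : ContDiffAt ℝ ∞ r y) (a b c : Cn n) :
    third r y a b c = third r y b a c := by
  have h1 : ContDiffAt ℝ ∞ (fderiv ℝ r) y := h.fderiv_right (m := ∞) (by simp)
  exact DFunLike.congr_fun ((h1.isSymmSndFDerivAt minSmoothness_two_le).eq a b) c

theorem hasFDerivAt_hess (h : ContDiffAt ℝ ∞ r y) :
    HasFDerivAt (fderiv ℝ (fderiv ℝ r)) (third r y) y :=
  (((h.fderiv_right (m := ∞) (by simp)).fderiv_right (m := ∞) (by simp)).differentiableAt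
    (by simp)).hasFDerivAt

theorem hasFDerivAt_hess_apply (h : ContDiffAt ℝ ∞ r y) (b c : Cn n) :
    HasFDerivAt (fun z => fderiv ℝ (fderiv ℝ r) z b c) (((third r y).flip b).flip c) y := by
  have h1 := ((hasFDerivAt_hess h).clm_apply (hasFDerivAt_const b y)).clm_apply
    (hasFDerivAt_const c y)
  have h2 : ((third r y).flip b).flip c = (fderiv ℝ (fderiv ℝ r) y b).comp (0 : Cn n →L[ℝ] Cn n) +
      ((fderiv ℝ (fderiv ℝ r) y).comp (0 : Cn n →L[ℝ] Cn n) + (third r y).flip b).flip c := by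
    ext v
    simp
  rw [h2]
  exact h1

theorem eventually_contDiffAt_two (h : ContDiffAt ℝ ∞ r y) :
    ∀ᶠ z in 𝓝 y, ContDiffAt ℝ (minSmoothness ℝ 2) r z := by
  rw [minSmoothness_of_isRCLikeNormedField]
  exact (h.of_le (m := 2) (WithTop.coe_le_coe.2 le_top)).eventually (by simp)

theorem third_symm_right (h : ContDiffAt ℝ ∞ r y) (a b c : Cn n) :
    third r y a b c = third r y a c b := by
  have h1 : (fun z => fderiv ℝ (fderiv ℝ r) z b c) =ᶠ[𝓝 y]
      fun z => fderiv ℝ (fderiv ℝ r) z c b := by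
    filter_upwards [eventually_contDiffAt_two h] with z hz
    exact (hz.isSymmSndFDerivAt le_rfl).eq b c
  have h2 := ((hasFDerivAt_hess_apply h b c).unique
    ((hasFDerivAt_hess_apply h c b).congr_of_eventuallyEq h1))
  simpa using DFunLike.congr_fun h2 a

/-- The derivative of the metric. -/
def dMet (r : Cn n → ℝ) (y a b c : Cn n) : ℝ :=
  (third r y a b c + third r y a (Complex.I • b) (Complex.I • c)) / 2

theorem fderiv_kMet (h : ContDiffAt ℝ ∞ r y) (hn : ∀ᶠ z in 𝓝 y, ContDiffAt ℝ ∞ r z) (a b c : Cn n) :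
    fderiv ℝ (fun z => kMet r z b c) y a = dMet r y a b c := by
  have h1 : (fun z => kMet r z b c) =ᶠ[𝓝 y] fun z => (fderiv ℝ (fderiv ℝ r) z b c +
      fderiv ℝ (fderiv ℝ r) z (Complex.I • b) (Complex.I • c)) / 2 := by
    filter_upwards [hn] with z hz using kMet_eq hz b c
  rw [h1.fderiv_eq]
  have h2 := ((hasFDerivAt_hess_apply h b c).add
    (hasFDerivAt_hess_apply h (Complex.I • b) (Complex.I • c))).mul_const (2⁻¹ : ℝ)
  have h3 : HasFDerivAt (fun z => (fderiv ℝ (fderiv ℝ r) z b c +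
      fderiv ℝ (fderiv ℝ r) z (Complex.I • b) (Complex.I • c)) / 2) _ y := h2
  rw [h3.fderiv]
  simp [dMet]
  ring

/-- The first-kind Christoffel form `g(∇_a b, c)`. -/
def chrForm (r : Cn n → ℝ) (y a b c : Cn n) : ℝ :=
  (dMet r y a b c + dMet r y b a c - dMet r y c a b) / 2

/-- The connection form `Γ(a, b)` of the Levi-Civita connection. -/
def conn (r : Cn n → ℝ) (y a b : Cn n) : Cn n :=
  ∑ m, (∑ l, (gramR r y)⁻¹ m l * chrForm r y a b (vec l)) • vec m

theorem exists_bilin_conn (r : Cn n → ℝ) (y : Cn n) :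
    ∃ Γ : Cn n →L[ℝ] Cn n →L[ℝ] Cn n, ∀ a b, Γ a b = conn r y a b := by
  have hI : ∀ (c : ℝ) (v : Cn n), Complex.I • c • v = c • Complex.I • v := fun c v =>
    smul_comm _ _ _
  let f : Cn n →ₗ[ℝ] Cn n →ₗ[ℝ] Cn n := LinearMap.mk₂ ℝ (conn r y)
    (fun a a' b => by
      simp only [conn, chrForm, dMet, map_add, smul_add, _root_.add_apply,
        ← Finset.sum_add_distrib, ← add_smul]
      refine Finset.sum_congr rfl fun m _ => congrArg (· • vec m) ?_
      refine Finset.sum_congr rfl fun l _ => by ring)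
    (fun c a b => by
      simp only [conn, chrForm, dMet, map_smul, hI, _root_.smul_apply, Finset.smul_sum,
        smul_smul, Finset.mul_sum]
      refine Finset.sum_congr rfl fun m _ => congrArg (· • vec m) ?_
      refine Finset.sum_congr rfl fun l _ => by simp only [smul_eq_mul]; ring)
    (fun a b b' => by
      simp only [conn, chrForm, dMet, map_add, smul_add, _root_.add_apply,
        ← Finset.sum_add_distrib, ← add_smul]
      refine Finset.sum_congr rfl fun m _ => congrArg (· • vec m) ?_
      refine Finset.sum_congr rfl fun l _ => by ring)
    (fun c a b => by
      simp only [conn, chrForm, dMet, map_smul, hI, _root_.smul_apply, Finset.smul_sum,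
        smul_smul, Finset.mul_sum]
      refine Finset.sum_congr rfl fun m _ => congrArg (· • vec m) ?_
      refine Finset.sum_congr rfl fun l _ => by simp only [smul_eq_mul]; ring)
  exact ⟨LinearMap.toContinuousLinearMap
    ((LinearMap.toContinuousLinearMap (𝕜 := ℝ) (E := Cn n) (F' := Cn n)).toLinearMap ∘ₗ f),
    fun a b => rfl⟩

theorem kMet_conn (h : ContDiffAt ℝ ∞ r y) (hp : (gramR r y).det ≠ 0) (a b c : Cn n) :
    kMet r y (conn r y a b) c = chrForm r y a b c := by
  obtain ⟨B, hB⟩ := exists_bilin_kMet h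
  have hI : ∀ (c : ℝ) (v : Cn n), Complex.I • c • v = c • Complex.I • v := fun c v =>
    smul_comm _ _ _
  have hC : chrForm r y a b c = ∑ p, coord p c * chrForm r y a b (vec p) := by
    conv_lhs => rw [← sum_coord_smul_vec c]
    simp only [chrForm, dMet, map_sum, map_smul, Finset.smul_sum, hI, _root_.sum_apply,
      _root_.smul_apply, smul_eq_mul, ← Finset.sum_add_distrib, ← Finset.sum_sub_distrib,
      Finset.sum_div]
    exact Finset.sum_congr rfl fun p _ => by ring
  have h1 : ∀ p, B (conn r y a b) (vec p) = chrForm r y a b (vec p) := by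
    intro p
    have h2 : ∀ m, B (vec m) (vec p) = gramR r y p m := fun m => by
      rw [← hB, kMet_symm h]
      rfl
    simp only [conn, map_sum, map_smul, LinearMap.sum_apply, LinearMap.smul_apply, smul_eq_mul,
      h2, Finset.sum_mul]
    rw [Finset.sum_comm]
    have h3 : ∀ l, ∑ m, (gramR r y)⁻¹ m l * chrForm r y a b (vec l) * gramR r y p m =
        (1 : Matrix (Idx n) (Idx n) ℝ) p l * chrForm r y a b (vec l) := by
      intro l
      rw [← Matrix.mul_nonsing_inv (gramR r y) (isUnit_iff_ne_zero.2 hp), Matrix.mul_apply,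
        Finset.sum_mul]
      exact Finset.sum_congr rfl fun m _ => by ring
    simp [h3, Matrix.one_apply]
  rw [hB, hC]
  conv_lhs => rw [← sum_coord_smul_vec c]
  simp [h1]

theorem dMet_symm (h : ContDiffAt ℝ ∞ r y) (a b c : Cn n) : dMet r y a b c = dMet r y a c b := by
  rw [dMet, dMet, third_symm_right h, third_symm_right h a (Complex.I • b)]

theorem conn_symm (h : ContDiffAt ℝ ∞ r y) (a b : Cn n) : conn r y a b = conn r y b a := by
  simp only [conn, chrForm]
  refine Finset.sum_congr rfl fun m _ => congrArg (· • vec m) ?_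
  refine Finset.sum_congr rfl fun l _ => ?_
  rw [dMet_symm h (vec l) a b]
  ring

/-- This is the Kähler property that the connection commutes with `i`. Paired with any `c`, both
sides are combinations of third derivatives of the potential. These are totally symmetric, so the
combinations agree, and the metric is nondegenerate. -/
theorem conn_I (h : ContDiffAt ℝ ∞ r y) (hp : ∀ v, v ≠ 0 → 0 < kMet r y v v) (a b : Cn n) :
    conn r y a (Complex.I • b) = Complex.I • conn r y a b := by
  obtain ⟨B, hB⟩ := exists_bilin_kMet h
  have hd : (gramR r y).det ≠ 0 := (posDef_gramR h hp).det_pos.ne'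
  have h1 : ∀ c, B (conn r y a (Complex.I • b)) c = B (Complex.I • conn r y a b) c := by
    intro c
    have hBI : ∀ v w, B (Complex.I • v) (Complex.I • w) = B v w := fun v w => by
      rw [← hB, ← hB, kMet_I h]
    rw [bilin_I_left hBI, ← hB, ← hB, kMet_conn h hd, kMet_conn h hd]
    simp only [chrForm, dMet, I_smul_I_smul, map_neg, _root_.neg_apply]
    -- The rewrites only bring the arguments of the third derivatives into a common order.
    rw [third_symm_left h (Complex.I • b) a c, third_symm_left h c a (Complex.I • b),
      third_symm_right h a c (Complex.I • b), third_symm_left h c (Complex.I • a) b,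
      third_symm_right h (Complex.I • a) c b,
      third_symm_left h (Complex.I • b) (Complex.I • a) (Complex.I • c),
      third_symm_left h (Complex.I • c) a b, third_symm_right h a (Complex.I • c) b,
      third_symm_left h (Complex.I • c) (Complex.I • a) (Complex.I • b),
      third_symm_right h (Complex.I • a) (Complex.I • c) (Complex.I • b),
      third_symm_left h b a, third_symm_left h b (Complex.I • a)]
    ring
  by_contra hne
  have h2 := hp _ (sub_ne_zero.2 hne)
  rw [hB, LinearMap.map_sub₂, h1, sub_self] at h2
  exact lt_irrefl _ h2

end Third

end BottChern

end

/-! ### Construction of holomorphic coordinates in which the metric is flat to first order. -/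

noncomputable section

open scoped Manifold ContDiff ComplexConjugate Topology

namespace BottChern

open ContinuousAlternatingMap (alternatizeUncurryFin alternatizeUncurryFin_apply
  alternatizeUncurryFinCLM)

/-! ### Holomorphic normal coordinates -/

theorem hasFDerivAt_comp_map {E F G : Type*} [NormedAddCommGroup E] [NormedSpace ℝ E]
    [NormedAddCommGroup F] [NormedSpace ℝ F] [NormedAddCommGroup G] [NormedSpace ℝ G]
    {g : F → G} {g' : F →L[ℝ] G} {f : E → F} {f' : E →L[ℝ] F} {x : E}
    (hg : HasFDerivAt g g' (f x)) (hf : HasFDerivAt f f' x) :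
    HasFDerivAt (fun z => g (f z)) (g'.comp f') x := hg.comp x hf

section NormalMap

variable {n : ℕ}

/-- The map `z ↦ y₀ + A z - ½ Γ(A z, A z)`. -/
def quadMap (y₀ : Cn n) (A : Cn n →L[ℝ] Cn n) (Γ : Cn n →L[ℝ] Cn n →L[ℝ] Cn n) (z : Cn n) : Cn n :=
  y₀ + A z - (1 / 2 : ℝ) • Γ (A z) (A z)

theorem contDiff_quadMap (y₀ : Cn n) (A : Cn n →L[ℝ] Cn n) (Γ : Cn n →L[ℝ] Cn n →L[ℝ] Cn n) :
    ContDiff ℝ ∞ (quadMap y₀ A Γ) :=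
  (contDiff_const.add A.contDiff).sub
    (((Γ.contDiff.comp A.contDiff).clm_apply A.contDiff).const_smul (1 / 2 : ℝ))

theorem fderiv_quadMap (y₀ : Cn n) (A : Cn n →L[ℝ] Cn n) {Γ : Cn n →L[ℝ] Cn n →L[ℝ] Cn n}
    (hs : ∀ a b, Γ a b = Γ b a) (z : Cn n) :
    fderiv ℝ (quadMap y₀ A Γ) z = A - (Γ (A z)).comp A := by
  have h1 : HasFDerivAt (fun z => Γ (A z) (A z)) ((Γ (A z)).comp A + (Γ.comp A).flip (A z)) z :=
    ((Γ.comp A).hasFDerivAt (x := z)).clm_apply (A.hasFDerivAt (x := z))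
  have h2 : HasFDerivAt (quadMap y₀ A Γ)
      (0 + A - (1 / 2 : ℝ) • ((Γ (A z)).comp A + (Γ.comp A).flip (A z))) z :=
    ((hasFDerivAt_const y₀ z).add A.hasFDerivAt).sub (h1.const_smul (1 / 2 : ℝ))
  rw [h2.fderiv]
  ext1 v
  simp only [_root_.sub_apply, _root_.add_apply, _root_.smul_apply, _root_.zero_apply,
    ContinuousLinearMap.comp_apply, ContinuousLinearMap.flip_apply, hs (A v) (A z)]
  module

theorem fderiv_fderiv_quadMap (y₀ : Cn n) (A : Cn n →L[ℝ] Cn n) {Γ : Cn n →L[ℝ] Cn n →L[ℝ] Cn n}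
    (hs : ∀ a b, Γ a b = Γ b a) (z u v : Cn n) :
    fderiv ℝ (fderiv ℝ (quadMap y₀ A Γ)) z u v = -Γ (A u) (A v) := by
  have h1 : fderiv ℝ (quadMap y₀ A Γ) = fun z =>
      A - (((ContinuousLinearMap.compL ℝ (Cn n) (Cn n) (Cn n)).flip A).comp (Γ.comp A)) z :=
    funext fun z => fderiv_quadMap y₀ A hs z
  have h2 := (((ContinuousLinearMap.compL ℝ (Cn n) (Cn n) (Cn n)).flip A).comp
    (Γ.comp A)).hasFDerivAt (x := z) |>.const_sub A
  rw [h1, h2.fderiv]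
  simp

/-- Take `ψ(z) = y₀ + Az - ½Γ(Az, Az)` with `A` a unitary frame and `Γ` the connection. The linear
term makes the Gram matrix the identity, and the quadratic one removes its first derivatives. The
map is holomorphic because `Γ` is symmetric and commutes with `i`. The last clause records `D²ψ =
-Γ`, which is what makes ordinary derivatives covariant at the centre. -/
theorem exists_normal_map {r : Cn n → ℝ} {y₀ : Cn n} (hn : ∀ᶠ z in 𝓝 y₀, ContDiffAt ℝ ∞ r z)
    (hp : ∀ v, v ≠ 0 → 0 < kMet r y₀ v v) :
    ∃ ψ : Cn n → Cn n, ψ 0 = y₀ ∧ IsHolAt ψ 0 ∧ (mat (fderiv ℝ ψ 0)).det ≠ 0 ∧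
      gramR (fun z => r (ψ z)) 0 = 1 ∧
      (∀ i j, HasFDerivAt (fun z => gramR (fun z => r (ψ z)) z i j) (0 : Cn n →L[ℝ] ℝ) 0) ∧
      ∀ u v, fderiv ℝ (fderiv ℝ ψ) 0 u v = -conn r y₀ (fderiv ℝ ψ 0 u) (fderiv ℝ ψ 0 v) := by
  have h : ContDiffAt ℝ ∞ r y₀ := hn.self_of_nhds
  have hd : (gramR r y₀).det ≠ 0 := (posDef_gramR h hp).det_pos.ne'
  obtain ⟨Γ, hΓ⟩ := exists_bilin_conn r y₀
  obtain ⟨B, hB⟩ := exists_bilin_kMet h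
  obtain ⟨A, hA, hA1⟩ := exists_unitary_frame (B := B) (fun v w => by rw [← hB, ← hB, kMet_I h])
    (fun v w => by rw [← hB, ← hB, kMet_symm h]) (fun v hv => by rw [← hB]; exact hp v hv)
  have hs : ∀ a b, Γ a b = Γ b a := fun a b => by rw [hΓ, hΓ, conn_symm h]
  set ψ := quadMap y₀ A Γ with hψ
  have h0 : ψ 0 = y₀ := by simp [hψ, quadMap]
  have hD0 : fderiv ℝ ψ 0 = A := by
    rw [hψ, fderiv_quadMap y₀ A hs]
    ext1 v
    simp
  have hhol : ∀ z, IsHolAt ψ z := fun z => Filter.Eventually.of_forall fun w => by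
    refine ⟨(contDiff_quadMap y₀ A Γ).contDiffAt, fun v => ?_⟩
    rw [hψ, fderiv_quadMap y₀ A hs]
    simp only [_root_.sub_apply, ContinuousLinearMap.comp_apply, hA v, hΓ, conn_I h hp, smul_sub]
  have hr0 : ContDiffAt ℝ ∞ r (ψ 0) := by rwa [h0]
  have hg : gramR (fun z => r (ψ z)) 0 = 1 := by
    rw [gramR_comp (hhol 0) hr0, hD0, h0, ← hA1, gram_transform B A]
    simp only [gramR, hB]
  refine ⟨ψ, h0, hhol 0, ?_, hg, ?_, ?_⟩
  · intro hdet
    have h1 := congrArg Matrix.det (gramR_comp (hhol 0) hr0)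
    rw [hg, det_transform, hdet] at h1
    simp at h1
  · intro i j
    set v : Cn n := vec i
    set w : Cn n := vec j
    have hev : (fun z => gramR (fun z => r (ψ z)) z i j) =ᶠ[𝓝 0] fun z =>
        (fderiv ℝ (fderiv ℝ r) (ψ z) (fderiv ℝ ψ z v) (fderiv ℝ ψ z w) +
          fderiv ℝ (fderiv ℝ r) (ψ z) (mulI n (fderiv ℝ ψ z v)) (mulI n (fderiv ℝ ψ z w))) *
            (2⁻¹ : ℝ) := by
      have hc : ContinuousAt ψ 0 := (hhol 0).contDiffAt.continuousAt
      rw [← h0] at hn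
      filter_upwards [hc.eventually hn] with z hz
      change kMet (fun z => r (ψ z)) z v w = _
      rw [kMet_comp (hhol z) hz, kMet_eq hz]
      rfl
    have hd2 : DifferentiableAt ℝ (fderiv ℝ ψ) 0 :=
      ((hhol 0).contDiffAt.fderiv_right (m := ∞) (by simp)).differentiableAt (by simp)
    have hψd : HasFDerivAt ψ A 0 := by
      rw [← hD0]
      exact ((hhol 0).contDiffAt.differentiableAt (by simp)).hasFDerivAt
    have hv : ∀ v : Cn n, HasFDerivAt (fun z => fderiv ℝ ψ z v)
        ((fderiv ℝ (fderiv ℝ ψ) 0).flip v) 0 := by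
      intro v
      have h1 := hd2.hasFDerivAt.clm_apply (hasFDerivAt_const v 0)
      have h2 : (fderiv ℝ (fderiv ℝ ψ) 0).flip v = (fderiv ℝ ψ 0).comp (0 : Cn n →L[ℝ] Cn n) +
          (fderiv ℝ (fderiv ℝ ψ) 0).flip v := by
        ext1 u
        simp
      rw [h2]
      exact h1
    have hI : ∀ v : Cn n, HasFDerivAt (fun z => mulI n (fderiv ℝ ψ z v))
        ((mulI n).comp ((fderiv ℝ (fderiv ℝ ψ) 0).flip v)) 0 := fun v =>
      (mulI n).hasFDerivAt.comp 0 (hv v)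
    have hH : HasFDerivAt (fun z => fderiv ℝ (fderiv ℝ r) (ψ z)) ((third r (ψ 0)).comp A) 0 :=
      hasFDerivAt_comp_map (G := Cn n →L[ℝ] Cn n →L[ℝ] ℝ) (hasFDerivAt_hess hr0) hψd
    have h1 := (((hH.clm_apply (hv v)).clm_apply (hv w)).add
      ((hH.clm_apply (hI v)).clm_apply (hI w))).mul_const (2⁻¹ : ℝ)
    refine HasFDerivAt.congr_of_eventuallyEq ?_ hev
    refine h1.congr_fderiv ?_
    ext1 u
    -- The derivative of the Gram entry is `∂_u g(v, w) - g(Γ(u, v), w) - g(v, Γ(u, w))`. It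
    -- vanishes because the connection is metric: the sum of the two Christoffel forms telescopes to
    -- `∂_u g(v, w)`.
    have e1 := kMet_conn h hd (A u) (A v) (A w)
    have e2 := kMet_conn h hd (A u) (A w) (A v)
    rw [kMet_eq h] at e1
    rw [kMet_symm h, kMet_eq h] at e2
    have e3 := dMet_symm h (A u) (A v) (A w)
    rw [chrForm] at e1 e2
    have hDD : ∀ v, fderiv ℝ (fderiv ℝ ψ) 0 u v = -conn r y₀ (A u) (A v) := fun v => by
      rw [hψ, fderiv_fderiv_quadMap y₀ A hs, hΓ]
    have m : ∀ v, mulI n v = Complex.I • v := fun v => rfl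
    simp only [_root_.smul_apply, _root_.add_apply, ContinuousLinearMap.comp_apply,
      ContinuousLinearMap.flip_apply, hD0, h0, hDD, smul_eq_mul, _root_.zero_apply, m, smul_neg,
      map_neg, _root_.neg_apply]
    have e4 : dMet r y₀ (A u) (A v) (A w) = (third r y₀ (A u) (A v) (A w) +
      third r y₀ (A u) (Complex.I • A v) (Complex.I • A w)) / 2 := rfl
    linarith
  · intro u v
    rw [hD0, hψ, fderiv_fderiv_quadMap y₀ A hs, hΓ]

end NormalMap

end BottChern

end

/-! ### Forms, the metric operators and the covariant derivative at the centre of normal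
coordinates. -/

noncomputable section

open scoped Manifold ContDiff ComplexConjugate Topology

namespace BottChern

open ContinuousAlternatingMap (alternatizeUncurryFin alternatizeUncurryFin_apply
  alternatizeUncurryFinCLM)

/-! ### Forms in holomorphic normal coordinates -/

/-- `ψ`, followed by the inverse of the chart at `x`, is a holomorphic normal parametrization at
`x`. -/
structure IsNormal {n : ℕ} {M : Type*} [TopologicalSpace M] [ChartedSpace (Cn n) M]
    (ρ : M → ℝ) (x : M) (ψ : Cn n → Cn n) : Prop where
  map_zero : ψ 0 = chartAt (Cn n) x x
  hol : IsHolAt ψ 0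
  det_ne : (mat (fderiv ℝ ψ 0)).det ≠ 0
  gram_one : gramR (fun z => ρ ((chartAt (Cn n) x).symm (ψ z))) 0 = 1
  dgram : ∀ i j, HasFDerivAt (fun z => gramR (fun z => ρ ((chartAt (Cn n) x).symm (ψ z))) z i j)
    (0 : Cn n →L[ℝ] ℝ) 0
  second : ∀ u v, fderiv ℝ (fderiv ℝ ψ) 0 u v =
    -conn (fun z => ρ ((chartAt (Cn n) x).symm z)) (chartAt (Cn n) x x) (fderiv ℝ ψ 0 u)
      (fderiv ℝ ψ 0 v)

/-- The expression of a form in the coordinates given by `ψ` and the chart at `x`. -/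
def nrep {n : ℕ} {M : Type*} [TopologicalSpace M] [ChartedSpace (Cn n) M] (x : M)
    (ψ : Cn n → Cn n) (φ : Form n M) (k : ℕ) : Cn n → Alt n k :=
  pull ψ (rep (chartAt (Cn n) x) φ k)

theorem surjective_of_det_ne {n : ℕ} {A : Cn n →L[ℝ] Cn n} (h : (mat A).det ≠ 0) :
    Function.Surjective A := by
  rw [det_mat] at h
  intro w
  obtain ⟨v, hv⟩ := (LinearMap.equivOfIsUnitDet (isUnit_iff_ne_zero.2 h)).surjective w
  refine ⟨v, ?_⟩
  rw [← hv, LinearMap.equivOfIsUnitDet_apply]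
  rfl

theorem pb_injective {n k : ℕ} {A : Cn n →L[ℝ] Cn n} (h : (mat A).det ≠ 0) :
    Function.Injective (pb A : Alt n k → Alt n k) := by
  intro α β hαβ
  ext v
  choose w hw using fun a => surjective_of_det_ne h (v a)
  have h1 := DFunLike.congr_fun hαβ w
  rw [ContinuousAlternatingMap.compContinuousLinearMap_apply,
    ContinuousAlternatingMap.compContinuousLinearMap_apply] at h1
  have h2 : A ∘ w = v := funext hw
  rwa [h2] at h1

/-- Matrices, as a normed space of functions. -/
abbrev MatFun (n : ℕ) : Type := Idx n → Idx n → ℝ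

section Normal

variable {n : ℕ} {M : Type*} [TopologicalSpace M] [ChartedSpace (Cn n) M]
  {ρ : M → ℝ} {x : M} {ψ : Cn n → Cn n}

theorem nrep_add (φ φ' : Form n M) (k : ℕ) (z : Cn n) :
    nrep x ψ (φ + φ') k z = nrep x ψ φ k z + nrep x ψ φ' k z := rfl

theorem nrep_sub (φ φ' : Form n M) (k : ℕ) (z : Cn n) :
    nrep x ψ (φ - φ') k z = nrep x ψ φ k z - nrep x ψ φ' k z := rfl

theorem nrep_neg (φ : Form n M) (k : ℕ) (z : Cn n) :
    nrep x ψ (-φ) k z = -nrep x ψ φ k z := rfl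

theorem nrep_smul (c : ℂ) (φ : Form n M) (k : ℕ) (z : Cn n) :
    nrep x ψ (c • φ) k z = c • nrep x ψ φ k z := rfl

theorem IsNormal.det_pos (h : IsNormal ρ x ψ) : 0 < (mat (fderiv ℝ ψ 0)).det :=
  h.hol.isCLin.det_pos h.det_ne

theorem IsNormal.eventually_mem (h : IsNormal ρ x ψ) :
    ∀ᶠ z in 𝓝 0, ψ z ∈ (chartAt (Cn n) x).target := by
  refine h.hol.contDiffAt.continuousAt.eventually ?_
  rw [h.map_zero]
  exact (chartAt (Cn n) x).open_target.mem_nhds (mem_chart_target _ x)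

theorem IsNormal.eventually_det_pos (h : IsNormal ρ x ψ) :
    ∀ᶠ z in 𝓝 0, 0 < (mat (fderiv ℝ ψ z)).det := by
  have h1 : ContDiffAt ℝ ∞ (fun z => (mat (fderiv ℝ ψ z)).det) 0 :=
    contDiffAt_det fun i j => contDiffAt_mat (h.hol.contDiffAt.fderiv_right (m := ∞) (by simp)) i j
  exact h1.continuousAt.eventually (lt_mem_nhds h.det_pos)

theorem IsNormal.contDiffAt_nrep (h : IsNormal ρ x ψ) {φ : Form n M} (hφ : IsSmooth φ) (k : ℕ) :
    ContDiffAt ℝ ∞ (nrep x ψ φ k) 0 :=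
  contDiffAt_pull h.hol.contDiffAt
    (hφ.contDiffAt (chart_mem_atlas _ x) k (by rw [h.map_zero]; exact mem_chart_target _ x))

theorem IsNormal.hasFDerivAt_nrep (h : IsNormal ρ x ψ) {φ : Form n M} (hφ : IsSmooth φ) (k : ℕ) :
    HasFDerivAt (nrep x ψ φ k) (fderiv ℝ (nrep x ψ φ k) 0) 0 :=
  ((h.contDiffAt_nrep hφ k).differentiableAt (by simp)).hasFDerivAt

theorem IsNormal.hasFDerivAt_gram (h : IsNormal ρ x ψ) :
    HasFDerivAt (fun z => (fun i j => gramR (fun z => ρ ((chartAt (Cn n) x).symm (ψ z))) z i j :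
      MatFun n)) (0 : Cn n →L[ℝ] MatFun n) 0 :=
  hasFDerivAt_pi.2 fun i => hasFDerivAt_pi.2 fun j => h.dgram i j

variable [IsManifold 𝓘(ℂ, Cn n) ω M]

theorem exists_isNormal (hρ : IsDBoundedStein n ρ) (x : M) :
    ∃ ψ : Cn n → Cn n, IsNormal ρ x ψ := by
  have hn : ∀ᶠ z in 𝓝 (chartAt (Cn n) x x),
      ContDiffAt ℝ ∞ (fun z => ρ ((chartAt (Cn n) x).symm z)) z := by
    filter_upwards [(chartAt (Cn n) x).open_target.mem_nhds (mem_chart_target _ x)] with z hz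
    exact contDiffAt_comp_symm hρ.smooth (chart_mem_atlas _ x) hz
  obtain ⟨ψ, h1, h2, h3, h4, h5, h6⟩ := exists_normal_map hn (fun v hv => by
    rw [← metric_dSymm hρ.smooth (chart_mem_atlas _ x) (mem_chart_target _ x), dSymm_chartAt,
      (chartAt (Cn n) x).left_inv (mem_chart_source _ x)]
    exact hρ.strictly_psh x v hv)
  exact ⟨ψ, h1, h2, h3, h4, h5, h6⟩

theorem IsNormal.nrep_zero (h : IsNormal ρ x ψ) (φ : Form n M) (k : ℕ) :
    nrep x ψ φ k 0 = pb (fderiv ℝ ψ 0) (φ k x) := by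
  rw [nrep, pull, h.map_zero, rep_chartAt]

theorem IsNormal.eq_of_nrep (h : IsNormal ρ x ψ) {φ φ' : Form n M} {k : ℕ}
    (he : nrep x ψ φ k 0 = nrep x ψ φ' k 0) : φ k x = φ' k x := by
  rw [h.nrep_zero, h.nrep_zero] at he
  exact pb_injective h.det_ne he

theorem IsNormal.nrep_dd (h : IsNormal ρ x ψ) (σ : ℝ) {φ : Form n M} (hφ : IsSmooth φ) (k : ℕ) :
    nrep x ψ (dd σ φ) (k + 1) =ᶠ[𝓝 0] lpd σ (nrep x ψ φ k) := by
  filter_upwards [h.eventually_mem, h.hol.eventually] with z hz hz'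
  rw [nrep, pull, rep_dd σ hφ (chart_mem_atlas _ x) k hz, nrep,
    lpd_pull σ hz' (hφ.differentiableAt (chart_mem_atlas _ x) k hz)]

theorem IsNormal.nrep_dd_zero (h : IsNormal ρ x ψ) (σ : ℝ) {φ : Form n M} (hφ : IsSmooth φ)
    (k : ℕ) : nrep x ψ (dd σ φ) (k + 1) 0 =
      alternatizeUncurryFin (part σ (fderiv ℝ (nrep x ψ φ k) 0)) :=
  (h.nrep_dd σ hφ k).self_of_nhds

theorem IsNormal.gram_eventuallyEq (hρ : IsDBoundedStein n ρ) (h : IsNormal ρ x ψ) :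
    ∀ᶠ z in 𝓝 0, gramR (fun z => ρ ((chartAt (Cn n) x).symm (ψ z))) z =
      (mat (fderiv ℝ ψ z)).transpose *
        gramR (fun z => ρ ((chartAt (Cn n) x).symm z)) (ψ z) * mat (fderiv ℝ ψ z) := by
  filter_upwards [h.eventually_mem, h.hol.eventually] with z hz hz'
  exact gramR_comp (r := fun z => ρ ((chartAt (Cn n) x).symm z)) (ψ := ψ) hz'
    (contDiffAt_comp_symm hρ.smooth (chart_mem_atlas _ x) hz)

theorem IsNormal.gram_zero (hρ : IsDBoundedStein n ρ) (h : IsNormal ρ x ψ) :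
    (mat (fderiv ℝ ψ 0)).transpose * gram ρ x * mat (fderiv ℝ ψ 0) = 1 := by
  rw [← h.gram_one, (h.gram_eventuallyEq hρ).self_of_nhds, gram_eq hρ.smooth, h.map_zero]

theorem IsNormal.herm_nrep (hρ : IsDBoundedStein n ρ) (h : IsNormal ρ x ψ) (φ φ' : Form n M)
    (k : ℕ) : herm (gram ρ x) (comps (φ k x)) (comps (φ' k x)) =
      herm 1 (comps (nrep x ψ φ k 0)) (comps (nrep x ψ φ' k 0)) := by
  rw [← h.gram_zero hρ, h.nrep_zero, h.nrep_zero, herm_pb _ _ h.det_ne]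

theorem IsNormal.nrep_star (hρ : IsDBoundedStein n ρ) (h : IsNormal ρ x ψ) (φ : Form n M) {k : ℕ}
    (hk : k ≤ n * 2) : nrep x ψ (star ρ φ) k =ᶠ[𝓝 0] fun z =>
      hodge (Nat.sub_add_cancel hk) (gramR (fun z => ρ ((chartAt (Cn n) x).symm (ψ z))) z)
        (nrep x ψ φ (n * 2 - k) z) := by
  filter_upwards [h.eventually_mem, h.gram_eventuallyEq hρ, h.eventually_det_pos] with z hz hg hd
  rw [hg, nrep, pull, rep_star hρ φ (chart_mem_atlas _ x) hk hz, nrep, pull, hodge_pb _ _ _ hd]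

theorem IsNormal.nrep_lefschetz (hρ : IsDBoundedStein n ρ) (h : IsNormal ρ x ψ) (φ : Form n M)
    (k : ℕ) : nrep x ψ (lefschetz ρ φ) k =ᶠ[𝓝 0] fun z =>
      lam (gramR (fun z => ρ ((chartAt (Cn n) x).symm (ψ z))) z) (nrep x ψ φ (k + 2) z) := by
  filter_upwards [h.eventually_mem, h.gram_eventuallyEq hρ, h.eventually_det_pos,
    h.hol.eventually] with z hz hg hd hz'
  rw [hg, nrep, pull, rep_lefschetz hρ φ (chart_mem_atlas _ x) k hz, nrep, pull,
    lam_pb _ hd.ne' hz'.isCLin]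

theorem contDiffAt_entry {V : Type*} [NormedAddCommGroup V] [NormedSpace ℝ V] (q : MatFun n × V)
    (i j : Idx n) : ContDiffAt ℝ ∞ (fun q : MatFun n × V => (Matrix.of q.1) i j) q :=
  ((contDiff_apply_apply ℝ ℝ i j).comp contDiff_fst).contDiffAt

theorem hasFDerivAt_hodge_stationary {k l : ℕ} (hkl : k + l = n * 2)
    {G : Cn n → Matrix (Idx n) (Idx n) ℝ} {y : Cn n} (h1 : G y = 1)
    (hG : HasFDerivAt (fun z => (fun i j => G z i j : MatFun n)) (0 : Cn n →L[ℝ] MatFun n) y)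
    {β : Cn n → Alt n k} {β' : Cn n →L[ℝ] Alt n k} (hβ : HasFDerivAt β β' y) :
    HasFDerivAt (fun z => hodge hkl (G z) (β z)) ((hodgeL hkl 1).comp β') y := by
  refine hasFDerivAt_of_stationary (F := fun (g : MatFun n) b => hodge hkl (Matrix.of g) b)
    (Γ := fun z => (fun i j => G z i j : MatFun n)) ?_ ?_ hG hβ
  · have : (Matrix.of fun i j => G y i j) = (1 : Matrix (Idx n) (Idx n) ℝ) := h1
    simp only [this]
    exact (hodgeL hkl 1).hasFDerivAt
  · refine (contDiffAt_hodge hkl (fun i j => contDiffAt_entry _ i j) ?_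
      contDiffAt_snd).differentiableAt (by simp)
    change (G y).det ≠ 0
    rw [h1]
    simp

theorem hasFDerivAt_lam_stationary {k : ℕ}
    {G : Cn n → Matrix (Idx n) (Idx n) ℝ} {y : Cn n} (h1 : G y = 1)
    (hG : HasFDerivAt (fun z => (fun i j => G z i j : MatFun n)) (0 : Cn n →L[ℝ] MatFun n) y)
    {β : Cn n → Alt n (k + 2)} {β' : Cn n →L[ℝ] Alt n (k + 2)} (hβ : HasFDerivAt β β' y) :
    HasFDerivAt (fun z => lam (G z) (β z)) ((lam 1).comp β') y := by
  refine hasFDerivAt_of_stationary (F := fun (g : MatFun n) b => lam (Matrix.of g) b)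
    (Γ := fun z => (fun i j => G z i j : MatFun n)) ?_ ?_ hG hβ
  · have : (Matrix.of fun i j => G y i j) = (1 : Matrix (Idx n) (Idx n) ℝ) := h1
    simp only [this]
    exact (lam 1).hasFDerivAt
  · refine (contDiffAt_lam (fun i j => contDiffAt_entry _ i j) ?_
      contDiffAt_snd).differentiableAt (by simp)
    change (G y).det ≠ 0
    rw [h1]
    simp

theorem IsNormal.nrep_star_zero (hρ : IsDBoundedStein n ρ) (h : IsNormal ρ x ψ) (φ : Form n M)
    {k : ℕ} (hk : k ≤ n * 2) : nrep x ψ (star ρ φ) k 0 =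
      hodge (Nat.sub_add_cancel hk) 1 (nrep x ψ φ (n * 2 - k) 0) := by
  rw [(h.nrep_star hρ φ hk).self_of_nhds]
  beta_reduce
  rw [h.gram_one]

theorem IsNormal.fderiv_nrep_star (hρ : IsDBoundedStein n ρ) (h : IsNormal ρ x ψ) {φ : Form n M}
    (hφ : IsSmooth φ) {k : ℕ} (hk : k ≤ n * 2) : fderiv ℝ (nrep x ψ (star ρ φ) k) 0 =
      (hodgeL (Nat.sub_add_cancel hk) 1).comp (fderiv ℝ (nrep x ψ φ (n * 2 - k)) 0) := by
  rw [(h.nrep_star hρ φ hk).fderiv_eq]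
  exact (hasFDerivAt_hodge_stationary _ h.gram_one h.hasFDerivAt_gram
    (h.hasFDerivAt_nrep hφ _)).fderiv

theorem IsNormal.nrep_lefschetz_zero (hρ : IsDBoundedStein n ρ) (h : IsNormal ρ x ψ) (φ : Form n M)
    (k : ℕ) : nrep x ψ (lefschetz ρ φ) k 0 = lam 1 (nrep x ψ φ (k + 2) 0) := by
  rw [(h.nrep_lefschetz hρ φ k).self_of_nhds]
  beta_reduce
  rw [h.gram_one]

theorem IsNormal.fderiv_nrep_lefschetz (hρ : IsDBoundedStein n ρ) (h : IsNormal ρ x ψ)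
    {φ : Form n M} (hφ : IsSmooth φ) (k : ℕ) : fderiv ℝ (nrep x ψ (lefschetz ρ φ) k) 0 =
      (lam 1).comp (fderiv ℝ (nrep x ψ φ (k + 2)) 0) := by
  rw [(h.nrep_lefschetz hρ φ k).fderiv_eq]
  exact (hasFDerivAt_lam_stationary h.gram_one h.hasFDerivAt_gram
    (h.hasFDerivAt_nrep hφ _)).fderiv

/-! ### The covariant derivative in normal coordinates -/

theorem conn_vec (hρ : IsDBoundedStein n ρ) (x : M) (i j : Idx n) :
    conn (fun z => ρ ((chartAt (Cn n) x).symm z)) (chartAt (Cn n) x x) (vec i) (vec j) =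
      ∑ m, christoffel ρ x m i j • vec m := by
  set c := chartAt (Cn n) x with hc
  have hm : ∀ᶠ z in 𝓝 (c x), z ∈ c.target := c.open_target.mem_nhds (mem_chart_target _ x)
  have hn : ∀ᶠ z in 𝓝 (c x), ContDiffAt ℝ ∞ (fun z => ρ (c.symm z)) z :=
    hm.mono fun z hz => contDiffAt_comp_symm hρ.smooth (chart_mem_atlas _ x) hz
  have hdg : ∀ a b l : Idx n, fderiv ℝ (fun y => gramIn ρ c y b l) (c x) (vec a) =
      dMet (fun z => ρ (c.symm z)) (c x) (vec a) (vec b) (vec l) := by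
    intro a b l
    rw [← fderiv_kMet hn.self_of_nhds hn]
    have : (fun y => gramIn ρ c y b l) =ᶠ[𝓝 (c x)]
        fun y => kMet (fun z => ρ (c.symm z)) y (vec b) (vec l) :=
      hm.mono fun z hz => by
        change gramIn ρ c z b l = gramR _ z b l
        rw [gramIn_eq hρ.smooth (chart_mem_atlas _ x) hz]
    rw [this.fderiv_eq]
  simp only [conn, christoffel, ← hc, hdg, gram_eq hρ.smooth x, chrForm, Finset.mul_sum]
  refine Finset.sum_congr rfl fun m _ => congrArg (· • vec m) ?_
  exact Finset.sum_congr rfl fun l _ => by ring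

/-- The covariant derivative of a form, from its derivative and the connection form. -/
def covD {k : ℕ} (L : Cn n →L[ℝ] Alt n k) (α : Alt n k) (Γ : Cn n →L[ℝ] Cn n →L[ℝ] Cn n) :
    Cn n →L[ℝ] Alt n k :=
  L - (α.fderivCompContinuousLinearMap (ContinuousLinearMap.id ℝ (Cn n))).comp Γ

theorem covD_apply {k : ℕ} (L : Cn n →L[ℝ] Alt n k) (α : Alt n k)
    (Γ : Cn n →L[ℝ] Cn n →L[ℝ] Cn n) (u : Cn n) (v : Fin k → Cn n) :
    covD L α Γ u v = L u v - ∑ a, α (Function.update v a (Γ u (v a))) := by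
  simp only [covD, _root_.sub_apply, ContinuousLinearMap.comp_apply,
    ContinuousAlternatingMap.sub_apply,
    ContinuousAlternatingMap.fderivCompContinuousLinearMap_apply]
  congr 1
  refine Finset.sum_congr rfl fun a _ => congrArg α (funext fun b => ?_)
  by_cases hb : b = a
  · subst hb
    simp
  · simp [Function.update_of_ne hb]

theorem nabla_eq (hρ : IsDBoundedStein n ρ) (k : ℕ) (φ : Form n M) (x : M)
    {Γ : Cn n →L[ℝ] Cn n →L[ℝ] Cn n}
    (hΓ : ∀ a b, Γ a b = conn (fun z => ρ ((chartAt (Cn n) x).symm z)) (chartAt (Cn n) x x) a b)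
    (i : Idx n) : nabla ρ k φ x i =
      comps (covD (fderiv ℝ (rep (chartAt (Cn n) x) φ k) (chartAt (Cn n) x x)) (φ k x) Γ
        (vec i)) := by
  funext s
  rw [nabla, comps, comps, covD_apply]
  congr 1
  refine Finset.sum_congr rfl fun a _ => ?_
  rw [hΓ, conn_vec hρ]
  have h1 := (φ k x).toMultilinearMap.map_update_sum Finset.univ a
    (fun m => christoffel ρ x m i (s a) • vec m) (fun b => vec (s b))
  refine Eq.trans ?_ h1.symm
  refine Finset.sum_congr rfl fun m _ => ?_
  rw [MultilinearMap.map_update_smul, comps, Complex.real_smul]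
  refine congrArg (fun t => (christoffel ρ x m i (s a) : ℂ) * t) ?_
  refine congrArg (φ k x) (funext fun b => ?_)
  by_cases hb : b = a
  · subst hb
    simp
  · simp [Function.update_of_ne hb]

/-- The derivative of the pull-back contains a term in `D²ψ`. As `D²ψ = -Γ`, this is exactly the
Christoffel correction, so the ordinary derivative at the centre is the pull-back of the covariant
one. -/
theorem IsNormal.fderiv_nrep (h : IsNormal ρ x ψ) {φ : Form n M} (hφ : IsSmooth φ) (k : ℕ)
    {Γ : Cn n →L[ℝ] Cn n →L[ℝ] Cn n}
    (hΓ : ∀ a b, Γ a b = conn (fun z => ρ ((chartAt (Cn n) x).symm z)) (chartAt (Cn n) x x) a b)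
    (u : Cn n) : fderiv ℝ (nrep x ψ φ k) 0 u = pb (fderiv ℝ ψ 0)
      (covD (fderiv ℝ (rep (chartAt (Cn n) x) φ k) (chartAt (Cn n) x x)) (φ k x) Γ
        (fderiv ℝ ψ 0 u)) := by
  have hd : DifferentiableAt ℝ (rep (chartAt (Cn n) x) φ k) (ψ 0) :=
    hφ.differentiableAt (chart_mem_atlas _ x) k (by rw [h.map_zero]; exact mem_chart_target _ x)
  rw [nrep, fderiv_pull h.hol.contDiffAt hd, h.map_zero, rep_chartAt]
  ext v
  rw [ContinuousAlternatingMap.compContinuousLinearMap_apply, covD_apply]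
  simp only [_root_.add_apply, ContinuousLinearMap.comp_apply,
    ContinuousAlternatingMap.add_apply,
    ContinuousAlternatingMap.fderivCompContinuousLinearMap_apply, sub_eq_add_neg,
    ← Finset.sum_neg_distrib]
  congr 1
  refine Finset.sum_congr rfl fun a _ => ?_
  have h1 : (fun j => Function.update (fun _ => fderiv ℝ ψ 0) a (fderiv ℝ (fderiv ℝ ψ) 0 u) j
      (v j)) = Function.update (fderiv ℝ ψ 0 ∘ v) a (-Γ (fderiv ℝ ψ 0 u) (fderiv ℝ ψ 0 (v a))) := by
    funext b
    by_cases hb : b = a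
    · subst hb
      simp [h.second, hΓ]
    · simp [Function.update_of_ne hb]
  rw [h1]
  exact (φ k x).toMultilinearMap.map_update_neg _ _ _

theorem nablaNormSq_eq (hρ : IsDBoundedStein n ρ) (h : IsNormal ρ x ψ) {φ : Form n M}
    (hφ : IsSmooth φ) (k : ℕ) : nablaNormSq ρ k φ x =
      (∑ i, herm 1 (comps (fderiv ℝ (nrep x ψ φ k) 0 (vec i)))
        (comps (fderiv ℝ (nrep x ψ φ k) 0 (vec i)))).re := by
  obtain ⟨Γ, hΓ⟩ := exists_bilin_conn (fun z => ρ ((chartAt (Cn n) x).symm z)) (chartAt (Cn n) x x)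
  set N := covD (fderiv ℝ (rep (chartAt (Cn n) x) φ k) (chartAt (Cn n) x x)) (φ k x) Γ with hN
  let b : Cn n →ₗ[ℝ] Cn n →ₗ[ℝ] ℂ := LinearMap.mk₂ ℝ
    (fun u v => herm (gram ρ x) (comps (N u)) (comps (N v)))
    (fun u v w => by
      simp only [herm, ← mul_add, ← Finset.sum_add_distrib]
      congr 1
      refine Finset.sum_congr rfl fun s _ => Finset.sum_congr rfl fun t _ => ?_
      simp [comps]
      ring)
    (fun c u w => by
      simp only [herm, Complex.real_smul, Finset.mul_sum]
      refine Finset.sum_congr rfl fun s _ => Finset.sum_congr rfl fun t _ => ?_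
      simp [comps]
      ring)
    (fun u v w => by
      simp only [herm, ← mul_add, ← Finset.sum_add_distrib]
      congr 1
      refine Finset.sum_congr rfl fun s _ => Finset.sum_congr rfl fun t _ => ?_
      simp [comps])
    (fun c u w => by
      simp only [herm, Complex.real_smul, Finset.mul_sum]
      refine Finset.sum_congr rfl fun s _ => Finset.sum_congr rfl fun t _ => ?_
      simp [comps]
      ring)
  have hb : ∀ u v, b u v = herm (gram ρ x) (comps (N u)) (comps (N v)) := fun _ _ => rfl
  clear_value b
  -- The trace over the derivative index is rewritten in the unitary frame, where the inverse Gram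
  -- matrix becomes the identity.
  have h1 := sum_inv_transform (gram ρ x) (fderiv ℝ ψ 0) h.det_ne b
  rw [h.gram_zero hρ] at h1
  have h2 : nablaNormSq ρ k φ x = (∑ i, ∑ j, (gram ρ x)⁻¹ i j • b (vec i) (vec j)).re := by
    rw [nablaNormSq]
    congr 1
    refine Finset.sum_congr rfl fun i _ => Finset.sum_congr rfl fun j _ => ?_
    rw [nabla_eq hρ k φ x hΓ, nabla_eq hρ k φ x hΓ, Complex.real_smul, hb]
  rw [h2, ← h1]
  congr 1
  refine Finset.sum_congr rfl fun i _ => ?_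
  simp only [inv_one, Matrix.one_apply, ite_smul, one_smul, zero_smul, Finset.sum_ite_eq,
    Finset.mem_univ, if_true]
  rw [h.fderiv_nrep hφ k hΓ, ← h.gram_zero hρ, herm_pb _ _ h.det_ne, hb]

end Normal

end BottChern

end

/-! ### Adjoints, Kähler identities and the factorization of the Bott–Chern Laplacian. -/

noncomputable section

open scoped Manifold ContDiff ComplexConjugate Topology

namespace BottChern

open ContinuousAlternatingMap (alternatizeUncurryFin alternatizeUncurryFin_apply
  alternatizeUncurryFinCLM)

/-! ### The formal adjoints and the Kähler identities -/

/-- The degree involution. -/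
def eps {n : ℕ} {M : Type*} (φ : Form n M) : Form n M := fun k x => (-1 : ℂ) ^ k • φ k x

theorem eps_add {n : ℕ} {M : Type*} (φ φ' : Form n M) : eps (φ + φ') = eps φ + eps φ' := by
  funext k x
  exact smul_add _ (φ k x) (φ' k x)

theorem eps_zero {n : ℕ} {M : Type*} : eps (0 : Form n M) = 0 := by
  funext k x
  exact smul_zero (A := Alt n k) ((-1 : ℂ) ^ k)

section Adjoints

variable {n : ℕ} {M : Type*} [TopologicalSpace M] [ChartedSpace (Cn n) M]
  {ρ : M → ℝ} {x : M} {ψ : Cn n → Cn n}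

/-- `∂*` for `σ = -1` and `∂̄*` for `σ = 1`. -/
def ddStar (ρ : M → ℝ) (σ : ℝ) (φ : Form n M) : Form n M := -star ρ (dd σ (star ρ φ))

theorem delStar_eq (ρ : M → ℝ) (φ : Form n M) : delStar ρ φ = ddStar ρ (-1) φ := by
  rw [delStar, ddStar, del_eq]

theorem delbarStar_eq (ρ : M → ℝ) (φ : Form n M) : delbarStar ρ φ = ddStar ρ 1 φ := by
  rw [delbarStar, ddStar, delbar_eq]

theorem star_apply {φ : Form n M} {k l : ℕ} (h : l + k = n * 2) (x : M) :
    star ρ φ k x = hodge h (gram ρ x) (φ l x) := by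
  obtain rfl : l = n * 2 - k := by omega
  rw [star, dif_pos (by omega)]

theorem star_add (φ φ' : Form n M) : star ρ (φ + φ') = star ρ φ + star ρ φ' := by
  funext k x
  by_cases hk : k ≤ n * 2
  · have h : n * 2 - k + k = n * 2 := Nat.sub_add_cancel hk
    change _ = star ρ φ k x + star ρ φ' k x
    rw [star_apply h, star_apply h, star_apply h, ← hodge_add]
    rfl
  · have := subsingleton_of_lt (n := n) (k := k) (by omega)
    exact Subsingleton.elim _ _

theorem star_zero : star ρ (0 : Form n M) = 0 := by
  have h := star_add (ρ := ρ) (0 : Form n M) 0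
  rw [add_zero] at h
  exact left_eq_add.1 h

theorem star_neg (φ : Form n M) : star ρ (-φ) = -star ρ φ := by
  have h := star_add (ρ := ρ) φ (-φ)
  rw [add_neg_cancel, star_zero] at h
  exact (neg_eq_of_add_eq_zero_right h.symm).symm

theorem dd_eps (σ : ℝ) {φ : Form n M} (hφ : IsSmooth φ) : dd σ (eps φ) = -eps (dd σ φ) := by
  funext k
  cases k with
  | zero =>
    funext x
    change (0 : Alt n 0) = -((-1 : ℂ) ^ 0 • (0 : Alt n 0))
    simp
  | succ k =>
    funext x
    have h1 := lpd_const_smul σ ((-1 : ℂ) ^ k)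
      (hφ.differentiableAt (chart_mem_atlas _ x) k (mem_chart_target _ x))
    refine h1.trans ?_
    ext v
    change (-1 : ℂ) ^ k • dd σ φ (k + 1) x v = -((-1 : ℂ) ^ (k + 1) • dd σ φ (k + 1) x v)
    simp [pow_succ]

variable [IsManifold 𝓘(ℂ, Cn n) ω M]

theorem IsSmooth.ddStar (hρ : IsDBoundedStein n ρ) (σ : ℝ) {φ : Form n M} (hφ : IsSmooth φ) :
    IsSmooth (ddStar ρ σ φ) := (((hφ.star hρ).dd σ).star hρ).neg

theorem IsNormal.nrep_star_apply (hρ : IsDBoundedStein n ρ) (h : IsNormal ρ x ψ) (φ : Form n M)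
    {k l : ℕ} (hk : l + k = n * 2) : nrep x ψ (star ρ φ) k 0 = hodge hk 1 (nrep x ψ φ l 0) := by
  obtain rfl : l = n * 2 - k := by omega
  exact h.nrep_star_zero hρ φ (by omega)

theorem IsNormal.fderiv_nrep_star_apply (hρ : IsDBoundedStein n ρ) (h : IsNormal ρ x ψ)
    {φ : Form n M} (hφ : IsSmooth φ) {k l : ℕ} (hk : l + k = n * 2) :
    fderiv ℝ (nrep x ψ (star ρ φ) k) 0 = (hodgeL hk 1).comp (fderiv ℝ (nrep x ψ φ l) 0) := by
  obtain rfl : l = n * 2 - k := by omega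
  exact h.fderiv_nrep_star hρ hφ (by omega)

theorem star_star (hρ : IsDBoundedStein n ρ) (φ : Form n M) : star ρ (star ρ φ) = eps φ := by
  funext k x
  by_cases hk : k ≤ n * 2
  · obtain ⟨ψ, h⟩ := exists_isNormal hρ x
    obtain ⟨l, hl⟩ := Nat.exists_eq_add_of_le hk
    apply h.eq_of_nrep
    rw [h.nrep_star_apply hρ _ (l := l) (by omega), h.nrep_star_apply hρ _ (l := k) (by omega),
      hodge_hodge_one]
    rfl
  · have := subsingleton_of_lt (n := n) (k := k) (by omega)
    exact Subsingleton.elim _ _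

/-- The inner `∗∗` is the degree sign, so each composite is, up to sign, `∗ (dd σ) (dd τ) ∗`. The
claim reduces to the anticommutation of `dd σ` and `dd τ`. -/
theorem ddStar_ddStar_add (hρ : IsDBoundedStein n ρ) (σ τ : ℝ) {φ : Form n M} (hφ : IsSmooth φ) :
    ddStar ρ σ (ddStar ρ τ φ) + ddStar ρ τ (ddStar ρ σ φ) = 0 := by
  have h1 : ∀ σ τ : ℝ, ddStar ρ σ (ddStar ρ τ φ) =
      -star ρ (eps (dd σ (dd τ (star ρ φ)))) := by
    intro σ τ
    have hs := (hφ.star hρ).dd τ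
    rw [ddStar, ddStar, star_neg, star_star hρ, dd_neg σ, dd_eps σ hs, neg_neg]
    intro e he k
    exact (hs e he k).const_smul ((-1 : ℂ) ^ k)
  rw [h1, h1, ← neg_add, ← star_add, ← eps_add, dd_dd_add σ τ (hφ.star hρ), eps_zero, star_zero,
    neg_zero]

theorem trace_eq_zero_of_lt {k : ℕ} (h : n * 2 < k + 1) (L : Cn n →L[ℝ] Alt n (k + 1)) :
    trace L = 0 := by
  have := subsingleton_of_lt (n := n) (k := k + 1) h
  ext v
  rw [trace_apply]
  refine Finset.sum_eq_zero fun i _ => ?_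
  rw [Subsingleton.elim (L (vec i)) 0]
  rfl

/-- At the centre `∗` has the same first-order jet as the constant flat one. The inner `∗` therefore
commutes with differentiation, up to the change of type in `hodge_part`; `alternatize_hodge_one`
evaluates the result, and the signs `(-1)^k` from there and from `∗∗` cancel. -/
theorem IsNormal.nrep_ddStar (hρ : IsDBoundedStein n ρ) (h : IsNormal ρ x ψ) (σ : ℝ) {φ : Form n M}
    (hφ : IsSmooth φ) (k : ℕ) : nrep x ψ (ddStar ρ σ φ) k 0 =
      -trace (part (-σ) (fderiv ℝ (nrep x ψ φ (k + 1)) 0)) := by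
  rcases lt_or_ge k (n * 2) with hk | hk
  · obtain ⟨l, hl⟩ := Nat.exists_eq_add_of_lt hk
    rw [ddStar, nrep_neg, h.nrep_star_apply hρ _ (l := l + 1) (by omega),
      h.nrep_dd_zero σ (hφ.star hρ) l, h.fderiv_nrep_star_apply hρ hφ (l := k + 1) (by omega),
      hodge_part, alternatize_hodge_one (k := k) (l := l) (by omega) (by omega), hodge_smul,
      hodge_hodge_one, smul_smul]
    simp [← mul_pow]
  -- For `k ≥ 2n` both sides vanish. In degree `2n` the left side is `∗` of the degree-zero
  -- component of `dd`, which is `0` by definition.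
  · rw [trace_eq_zero_of_lt (by omega)]
    rcases hk.eq_or_lt with hk | hk
    · rw [ddStar, nrep_neg, h.nrep_star_apply hρ _ (l := 0) (by omega)]
      have : nrep x ψ (dd σ (star ρ φ)) 0 0 = 0 := rfl
      rw [this, ← hodgeL_apply, _root_.map_zero]
    · have := subsingleton_of_lt (n := n) (k := k) hk
      exact Subsingleton.elim _ _

/-- Only the first-order jet of the metric enters, so the identity can be checked at the centre of
normal coordinates. There it is the symbol identity `lam_one_alternatize`, multiplied by `(σi)² =
-1`. -/
theorem kahler_identity (hρ : IsDBoundedStein n ρ) {σ : ℝ} (hσ : σ ^ 2 = 1) {φ : Form n M}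
    (hφ : IsSmooth φ) : ddStar ρ (-σ) φ =
      (σ * Complex.I : ℂ) • (lefschetz ρ (dd σ φ) - dd σ (lefschetz ρ φ)) := by
  funext k x
  obtain ⟨ψ, h⟩ := exists_isNormal hρ x
  apply h.eq_of_nrep
  have hI : (σ : ℂ) * Complex.I * (σ * Complex.I) = -1 := by
    have h1 : (σ : ℂ) ^ 2 = 1 := by exact_mod_cast hσ
    linear_combination (Complex.I ^ 2) * h1 + Complex.I_sq
  rw [h.nrep_ddStar hρ (-σ) hφ k, neg_neg, nrep_smul, nrep_sub, h.nrep_lefschetz_zero hρ,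
    h.nrep_dd_zero σ hφ]
  cases k with
  | zero =>
    rw [lam_one_alternatize_zero hσ]
    -- In degree `0` the term `dd σ (Λφ)` is absent.
    have : nrep x ψ (dd σ (lefschetz ρ φ)) 0 0 = 0 := rfl
    rw [this, sub_zero, smul_smul, hI]
    ext v
    simp
  | succ k =>
    rw [lam_one_alternatize hσ, h.nrep_dd_zero σ (hφ.lefschetz hρ),
      h.fderiv_nrep_lefschetz hρ hφ, add_sub_cancel_left, smul_smul, hI]
    ext v
    simp

end Adjoints

/-! ### The algebra of the Laplacians -/

section Laplacian

set_option synthInstance.maxHeartbeats 200000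

variable {n : ℕ} {M : Type*} [TopologicalSpace M] [ChartedSpace (Cn n) M]

theorem isSmooth_zero : IsSmooth (0 : Form n M) := fun _ _ k =>
  contDiffOn_const (c := (0 : Alt n k))

/-- The smooth forms. -/
def smoothForms (n : ℕ) (M : Type*) [TopologicalSpace M] [ChartedSpace (Cn n) M] :
    @Submodule ℂ (Form n M) _ AddCommGroup.toAddCommMonoid inferInstance where
  carrier := {φ | IsSmooth φ}
  add_mem' := IsSmooth.add
  zero_mem' := isSmooth_zero
  smul_mem' c _ h := h.smul c

theorem lefschetz_add (ρ : M → ℝ) (φ φ' : Form n M) :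
    lefschetz ρ (φ + φ') = lefschetz ρ φ + lefschetz ρ φ' := by
  funext k x
  exact map_add (lam (gram ρ x)) (φ (k + 2) x) (φ' (k + 2) x)

theorem lefschetz_smul (ρ : M → ℝ) (c : ℂ) (φ : Form n M) :
    lefschetz ρ (c • φ) = c • lefschetz ρ φ := by
  funext k x
  exact lam_smul (gram ρ x) c (φ (k + 2) x)

/-- The Laplacian `∂∂* + ∂*∂`. -/
def lap (ρ : M → ℝ) (φ : Form n M) : Form n M :=
  dd (-1) (ddStar ρ (-1) φ) + ddStar ρ (-1) (dd (-1) φ)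

variable [IsManifold 𝓘(ℂ, Cn n) ω M] {ρ : M → ℝ}

/-- `dd σ`, on the space of smooth forms. -/
def ddEnd (n : ℕ) (M : Type*) [TopologicalSpace M] [ChartedSpace (Cn n) M]
    [IsManifold 𝓘(ℂ, Cn n) ω M] (σ : ℝ) : Module.End ℂ (smoothForms n M) where
  toFun φ := ⟨dd σ φ.1, IsSmooth.dd σ φ.2⟩
  map_add' φ φ' := Subtype.ext (dd_add σ φ.2 φ'.2)
  map_smul' c φ := Subtype.ext (dd_smul σ c φ.2)

/-- The dual Lefschetz operator, on the space of smooth forms. -/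
def lefEnd (hρ : IsDBoundedStein n ρ) : Module.End ℂ (smoothForms n M) where
  toFun φ := ⟨lefschetz ρ φ.1, IsSmooth.lefschetz hρ φ.2⟩
  map_add' φ φ' := Subtype.ext (lefschetz_add ρ φ.1 φ'.1)
  map_smul' c φ := Subtype.ext (lefschetz_smul ρ c φ.1)

/-- `ddStar σ`, on the space of smooth forms, for `σ = ±1`. -/
def ddStarEnd (hρ : IsDBoundedStein n ρ) (σ : ℝ) : Module.End ℂ (smoothForms n M) :=
  -- Defining the operator as the right-hand side of the Kähler identity makes its complex linearity
  -- automatic and puts it in the form required by `bottChern_algebra`.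
  (-σ * Complex.I : ℂ) • (lefEnd hρ * ddEnd n M (-σ) - ddEnd n M (-σ) * lefEnd hρ)

theorem ddStarEnd_apply (hρ : IsDBoundedStein n ρ) {σ : ℝ} (hσ : σ ^ 2 = 1)
    (φ : smoothForms n M) : (ddStarEnd hρ σ φ).1 = ddStar ρ σ φ.1 := by
  have h := kahler_identity hρ (σ := -σ) (by simpa using hσ) φ.2
  rw [neg_neg, Complex.ofReal_neg] at h
  exact h.symm

theorem ddEnd_mul_self (σ : ℝ) : ddEnd n M σ * ddEnd n M σ = 0 :=
  LinearMap.ext fun φ => Subtype.ext (dd_dd_self σ φ.2)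

theorem ddEnd_mul_add (σ τ : ℝ) : ddEnd n M σ * ddEnd n M τ + ddEnd n M τ * ddEnd n M σ = 0 :=
  LinearMap.ext fun φ => Subtype.ext (dd_dd_add σ τ φ.2)

theorem ddStarEnd_mul_add (hρ : IsDBoundedStein n ρ) {σ τ : ℝ} (hσ : σ ^ 2 = 1) (hτ : τ ^ 2 = 1) :
    ddStarEnd hρ σ * ddStarEnd hρ τ + ddStarEnd hρ τ * ddStarEnd hρ σ =
      (0 : Module.End ℂ (smoothForms n M)) := by
  refine LinearMap.ext fun φ => Subtype.ext ?_
  refine Eq.trans ?_ (ddStar_ddStar_add hρ σ τ φ.2)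
  rw [← ddStarEnd_apply hρ hσ φ, ← ddStarEnd_apply hρ hτ φ, ← ddStarEnd_apply hρ hσ,
    ← ddStarEnd_apply hρ hτ]
  rfl

/-- Read `a = ∂`, `b = ∂̄`, `l = Λ`, with `a'`, `b'` the adjoints. Since `a'` is a commutator with
`b` and `b² = 0`, it anticommutes with `b`; likewise `b'` with `a`. From `ab + ba = 0` one gets `aa'
+ a'a = bb' + b'b`. With these relations the four quartic terms become `aa'bb'`, `a'ab'b`, `aa'b'b`
and `a'abb'`, whose sum is the product of the two equal Laplacians. -/
theorem bottChern_algebra {R : Type*} [Ring R] [Algebra ℂ R] {a b l : R} (ha : a * a = 0)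
    (hb : b * b = 0) (hab : a * b + b * a = 0) {a' b' : R}
    (ha' : a' = Complex.I • (l * b - b * l)) (hb' : b' = (-Complex.I) • (l * a - a * l))
    (hab' : a' * b' + b' * a' = 0) :
    a * b * (b' * a') + b' * a' * (a * b) + b' * a * (a' * b) + a' * b * (b' * a) =
      (a * a' + a' * a) * (a * a' + a' * a) := by
  have e : b * a = -(a * b) := by rw [eq_neg_iff_add_eq_zero, add_comm, hab]
  have e' : b' * a' = -(a' * b') := by rw [eq_neg_iff_add_eq_zero, add_comm, hab']
  have h1 : a' * b + b * a' = 0 := by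
    rw [ha', smul_mul_assoc, mul_smul_comm, ← smul_add]
    have : (l * b - b * l) * b + b * (l * b - b * l) = l * (b * b) - b * b * l := by noncomm_ring
    rw [this, hb]
    simp
  have h2 : b' * a + a * b' = 0 := by
    rw [hb', smul_mul_assoc, mul_smul_comm, ← smul_add]
    have : (l * a - a * l) * a + a * (l * a - a * l) = l * (a * a) - a * a * l := by noncomm_ring
    rw [this, ha]
    simp
  have h3 : a * a' + a' * a = b * b' + b' * b := by
    rw [ha', hb']
    simp only [smul_mul_assoc, mul_smul_comm, ← smul_add]
    rw [neg_smul, ← smul_neg]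
    congr 1
    have : a * (l * b - b * l) + (l * b - b * l) * a + (b * (l * a - a * l) +
        (l * a - a * l) * b) = l * (a * b + b * a) - (a * b + b * a) * l := by noncomm_ring
    rw [hab, mul_zero, zero_mul, sub_zero] at this
    exact eq_neg_of_add_eq_zero_left this
  have e1 : b * a' = -(a' * b) := by rw [eq_neg_iff_add_eq_zero, add_comm, h1]
  have e2 : a * b' = -(b' * a) := by rw [eq_neg_iff_add_eq_zero, add_comm, h2]
  have t1 : a * b * (b' * a') = a * a' * (b * b') := by
    calc a * b * (b' * a') = -(a * (b * a') * b') := by rw [e']; noncomm_ring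
      _ = a * a' * (b * b') := by rw [e1]; noncomm_ring
  have t2 : b' * a' * (a * b) = a' * a * (b' * b) := by
    calc b' * a' * (a * b) = -(a' * (b' * a) * b) := by rw [e']; noncomm_ring
      _ = a' * (a * b') * b := by rw [e2]; noncomm_ring
      _ = a' * a * (b' * b) := by noncomm_ring
  have t3 : b' * a * (a' * b) = a * a' * (b' * b) := by
    calc b' * a * (a' * b) = -(a * b') * (a' * b) := by rw [e2, neg_neg]
      _ = -(a * (b' * a') * b) := by noncomm_ring
      _ = a * a' * (b' * b) := by rw [e']; noncomm_ring
  have t4 : a' * b * (b' * a) = a' * a * (b * b') := by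
    calc a' * b * (b' * a) = -(a' * b * (a * b')) := by rw [e2]; noncomm_ring
      _ = -(a' * (b * a) * b') := by noncomm_ring
      _ = a' * a * (b * b') := by rw [e]; noncomm_ring
  rw [t1, t2, t3, t4]
  -- One factor of the square becomes the `∂̄`-Laplacian, and the product then expands into the four
  -- reordered terms.
  nth_rewrite 2 [h3]
  noncomm_ring

theorem bottChernLaplacian_eq (hρ : IsDBoundedStein n ρ) {φ : Form n M} (hφ : IsSmooth φ) :
    bottChernLaplacian ρ φ = lap ρ (lap ρ φ) + ddStar ρ 1 (dd 1 φ) +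
      ddStar ρ (-1) (dd (-1) φ) := by
  have h1 : (1 : ℝ) ^ 2 = 1 := one_pow 2
  have h1' : (-1 : ℝ) ^ 2 = 1 := by norm_num
  have key := bottChern_algebra (a := ddEnd n M (-1)) (b := ddEnd n M 1) (l := lefEnd hρ)
    (a' := ddStarEnd hρ (-1)) (b' := ddStarEnd hρ 1) (ddEnd_mul_self _) (ddEnd_mul_self _)
    (ddEnd_mul_add _ _) (by rw [ddStarEnd]; simp)
    (by rw [ddStarEnd, Complex.ofReal_one, neg_one_mul])
    (ddStarEnd_mul_add hρ h1' h1)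
  have h := congrArg Subtype.val (LinearMap.congr_fun key ⟨φ, hφ⟩)
  have hs : ∀ ψ : smoothForms n M, (ddEnd n M 1 ψ).1 = dd 1 ψ.1 := fun _ => rfl
  have hs' : ∀ ψ : smoothForms n M, (ddEnd n M (-1) ψ).1 = dd (-1) ψ.1 := fun _ => rfl
  simp only [LinearMap.add_apply, Module.End.mul_apply, Submodule.coe_add, hs, hs',
    ddStarEnd_apply hρ h1, ddStarEnd_apply hρ h1'] at h
  rw [bottChernLaplacian]
  simp only [del_eq, delbar_eq, delStar_eq, delbarStar_eq]
  rw [h]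
  rfl

end Laplacian

end BottChern

end

/-! ### The Hermitian product of forms and the divergence identity behind formal adjointness. -/

noncomputable section

open scoped Manifold ContDiff ComplexConjugate Topology

namespace BottChern

open ContinuousAlternatingMap (alternatizeUncurryFin alternatizeUncurryFin_apply
  alternatizeUncurryFinCLM)

/-! ### The pointwise Hermitian product -/

/-- A bilinear map on finite-dimensional spaces, as a continuous bilinear map. -/
def mkBilin {E F G : Type*} [NormedAddCommGroup E] [NormedSpace ℝ E] [FiniteDimensional ℝ E]
    [NormedAddCommGroup F] [NormedSpace ℝ F] [FiniteDimensional ℝ F] [NormedAddCommGroup G]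
    [NormedSpace ℝ G] (f : E →ₗ[ℝ] F →ₗ[ℝ] G) : E →L[ℝ] F →L[ℝ] G :=
  LinearMap.toContinuousLinearMap
    ((LinearMap.toContinuousLinearMap (𝕜 := ℝ) (E := F) (F' := G)).toLinearMap ∘ₗ f)

theorem hasFDerivAt_bilin {E F G : Type*} [NormedAddCommGroup E] [NormedSpace ℝ E]
    [NormedAddCommGroup F] [NormedSpace ℝ F] [NormedAddCommGroup G] [NormedSpace ℝ G]
    (B : E →L[ℝ] F →L[ℝ] G) (a : E) (b : F) :
    ∃ T : E × F →L[ℝ] G, HasFDerivAt (fun q : E × F => B q.1 q.2) T (a, b) ∧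
      ∀ u v, T (u, v) = B u b + B a v := by
  refine ⟨_, B.hasFDerivAt_of_bilinear (hasFDerivAt_fst (p := (a, b)))
    (hasFDerivAt_snd (p := (a, b))), fun u v => ?_⟩
  simp [add_comm]

section Pairing

variable {n k : ℕ} (G : Matrix (Idx n) (Idx n) ℝ)

/-- The Hermitian product of two forms. -/
def hm (α β : Alt n k) : ℂ := herm G (comps α) (comps β)

theorem hm_add_left (α α' β : Alt n k) : hm G (α + α') β = hm G α β + hm G α' β := by
  simp only [hm, herm, ← mul_add, ← Finset.sum_add_distrib]
  congr 1
  refine Finset.sum_congr rfl fun s _ => Finset.sum_congr rfl fun t _ => ?_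
  simp only [comps, ContinuousAlternatingMap.add_apply]
  ring

theorem hm_add_right (α β β' : Alt n k) : hm G α (β + β') = hm G α β + hm G α β' := by
  simp only [hm, herm, ← mul_add, ← Finset.sum_add_distrib]
  congr 1
  refine Finset.sum_congr rfl fun s _ => Finset.sum_congr rfl fun t _ => ?_
  simp only [comps, ContinuousAlternatingMap.add_apply, map_add]

theorem hm_smul_left (c : ℂ) (α β : Alt n k) : hm G (c • α) β = c * hm G α β := by
  simp only [hm, herm, Finset.mul_sum]
  refine Finset.sum_congr rfl fun s _ => Finset.sum_congr rfl fun t _ => ?_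
  simp only [comps, ContinuousAlternatingMap.smul_apply, smul_eq_mul]
  ring

theorem hm_smul_right (c : ℂ) (α β : Alt n k) : hm G α (c • β) = conj c * hm G α β := by
  simp only [hm, herm, Finset.mul_sum]
  refine Finset.sum_congr rfl fun s _ => Finset.sum_congr rfl fun t _ => ?_
  simp only [comps, ContinuousAlternatingMap.smul_apply, smul_eq_mul, map_mul]
  ring

theorem hm_real_smul_left (c : ℝ) (α β : Alt n k) : hm G (c • α) β = c * hm G α β :=
  hm_smul_left G (c : ℂ) α β

theorem hm_real_smul_right (c : ℝ) (α β : Alt n k) : hm G α (c • β) = c * hm G α β := by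
  have h := hm_smul_right G (c : ℂ) α β
  rw [Complex.conj_ofReal] at h
  exact h

theorem hm_zero_left (β : Alt n k) : hm G 0 β = 0 := by
  simp [hm, herm, comps]

theorem hm_zero_right (β : Alt n k) : hm G β 0 = 0 := by
  simp [hm, herm, comps]

theorem hm_neg_left (α β : Alt n k) : hm G (-α) β = -hm G α β := by
  have h := hm_add_left G α (-α) β
  rw [add_neg_cancel, hm_zero_left] at h
  exact (neg_eq_of_add_eq_zero_right h.symm).symm

theorem hm_sum_left {ι : Type*} (s : Finset ι) (α : ι → Alt n k) (β : Alt n k) :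
    hm G (∑ i ∈ s, α i) β = ∑ i ∈ s, hm G (α i) β := by
  classical
  induction s using Finset.induction_on with
  | empty => simp [hm_zero_left]
  | insert a s ha ih => rw [Finset.sum_insert ha, Finset.sum_insert ha, hm_add_left, ih]

/-- `hm`, as a continuous real-bilinear map. -/
def hmB (n k : ℕ) (G : Matrix (Idx n) (Idx n) ℝ) : Alt n k →L[ℝ] Alt n k →L[ℝ] ℂ :=
  mkBilin (E := Alt n k) (F := Alt n k) (LinearMap.mk₂ ℝ (hm G) (hm_add_left G)
    (hm_real_smul_left G) (hm_add_right G) (hm_real_smul_right G))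

@[simp]
theorem hmB_apply (α β : Alt n k) : hmB n k G α β = hm G α β := rfl

theorem hm_pb (A : Cn n →L[ℝ] Cn n) (hA : (mat A).det ≠ 0) (α β : Alt n k) :
    hm ((mat A).transpose * G * mat A) (pb A α) (pb A β) = hm G α β := herm_pb G A hA α β

/-- The linear form `v ↦ ⟨ι_v β, α⟩`. -/
def conL (β : Alt n (k + 1)) (α : Alt n k) : Cn n →L[ℝ] Alt n 0 :=
  LinearMap.toContinuousLinearMap
    { toFun := fun v => scalL n (hm G (iota v β) α)
      map_add' := fun v w => by
        have : iota (v + w) β = iota v β + iota w β := by simp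
        rw [this, hm_add_left, map_add]
      map_smul' := fun c v => by
        have : iota (c • v) β = c • iota v β := by simp
        rw [this, hm_real_smul_left, RingHom.id_apply, ← map_smul, Complex.real_smul] }

/-- The one-form `v ↦ ⟨ι_v β, α⟩`. -/
def oneForm (β : Alt n (k + 1)) (α : Alt n k) : Alt n 1 := alternatizeUncurryFin (conL G β α)

theorem oneForm_apply (β : Alt n (k + 1)) (α : Alt n k) (v : Fin 1 → Cn n) :
    oneForm G β α v = hm G (iota (v 0) β) α := by
  rw [oneForm, alternatize_one]
  rfl

theorem iota_pb (A : Cn n →L[ℝ] Cn n) (β : Alt n (k + 1)) (v : Cn n) :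
    iota v (pb A β) = pb A (iota (A v) β) := by
  ext w
  simp only [iota_apply, ContinuousAlternatingMap.curryLeft_apply_apply,
    ContinuousAlternatingMap.compContinuousLinearMap_apply]
  congr 1
  funext b
  refine Fin.cases ?_ (fun b => ?_) b <;> rfl

theorem oneForm_pb (A : Cn n →L[ℝ] Cn n) (hA : (mat A).det ≠ 0) (β : Alt n (k + 1))
    (α : Alt n k) :
    oneForm ((mat A).transpose * G * mat A) (pb A β) (pb A α) = pb A (oneForm G β α) := by
  ext v
  rw [ContinuousAlternatingMap.compContinuousLinearMap_apply, oneForm_apply, oneForm_apply,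
    iota_pb, hm_pb _ _ hA]
  rfl

theorem hm_one_alternatize (β : Alt n (k + 1)) (L : Cn n →L[ℝ] Alt n k) :
    hm 1 β (alternatizeUncurryFin L) = ∑ i, hm 1 (iota (vec i) β) (L (vec i)) :=
  herm_one_alternatize β L

end Pairing

theorem contDiffAt_hm {n k : ℕ} {E : Type*} [NormedAddCommGroup E] [NormedSpace ℝ E]
    {G : E → Matrix (Idx n) (Idx n) ℝ} {y : E}
    (hG : ∀ i j, ContDiffAt ℝ ∞ (fun z => G z i j) y) (hd : (G y).det ≠ 0)
    {α β : E → Alt n k} (hα : ContDiffAt ℝ ∞ α y) (hβ : ContDiffAt ℝ ∞ β y) :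
    ContDiffAt ℝ ∞ (fun z => hm (G z) (α z) (β z)) y :=
  contDiffAt_herm hG hd (contDiffAt_comps hα) (contDiffAt_comps hβ)

theorem contDiffAt_oneForm {n k : ℕ} {E : Type*} [NormedAddCommGroup E] [NormedSpace ℝ E]
    {G : E → Matrix (Idx n) (Idx n) ℝ} {y : E}
    (hG : ∀ i j, ContDiffAt ℝ ∞ (fun z => G z i j) y) (hd : (G y).det ≠ 0)
    {β : E → Alt n (k + 1)} {α : E → Alt n k} (hβ : ContDiffAt ℝ ∞ β y)
    (hα : ContDiffAt ℝ ∞ α y) :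
    ContDiffAt ℝ ∞ (fun z => oneForm (G z) (β z) (α z)) y := by
  apply contDiffAt_of_comps
  intro s
  simp_rw [comps, oneForm_apply]
  exact contDiffAt_hm hG hd ((iota (vec (s 0))).contDiff.contDiffAt.comp y hβ) hα

/-- At a point where the metric is flat to first order, the Hermitian product obeys the plain
Leibniz rule. -/
theorem hasFDerivAt_hm_stationary {n k : ℕ} {G : Cn n → Matrix (Idx n) (Idx n) ℝ} {y : Cn n}
    (h1 : G y = 1)
    (hG : HasFDerivAt (fun z => (fun i j => G z i j : MatFun n)) (0 : Cn n →L[ℝ] MatFun n) y)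
    {α β : Cn n → Alt n k} {α' β' : Cn n →L[ℝ] Alt n k} (hα : HasFDerivAt α α' y)
    (hβ : HasFDerivAt β β' y) (u : Cn n) :
    fderiv ℝ (fun z => hm (G z) (α z) (β z)) y u =
      hm 1 (α' u) (β y) + hm 1 (α y) (β' u) := by
  obtain ⟨T, hT, hT'⟩ := hasFDerivAt_bilin (E := Alt n k) (F := Alt n k) (hmB n k 1) (α y) (β y)
  have h2 := hasFDerivAt_of_stationary
    (F := fun (g : MatFun n) (q : Alt n k × Alt n k) => hm (Matrix.of g) q.1 q.2)
    (Γ := fun z => (fun i j => G z i j : MatFun n)) (β := fun z => (α z, β z)) (y := y)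
    (T := T) ?_ ?_ hG
    (hα.prodMk hβ)
  · have h3 : HasFDerivAt (fun z => hm (G z) (α z) (β z)) _ y := h2
    rw [h3.fderiv]
    exact hT' (α' u) (β' u)
  · have : (Matrix.of fun i j => G y i j) = (1 : Matrix (Idx n) (Idx n) ℝ) := h1
    simp only [this]
    exact hT
  · refine (contDiffAt_hm (fun i j => contDiffAt_entry _ i j) ?_
      (contDiffAt_fst.comp _ contDiffAt_snd)
      (contDiffAt_snd.comp _ contDiffAt_snd)).differentiableAt (by simp)
    change (G y).det ≠ 0
    rw [h1]
    simp

/-! ### Multiplication by functions -/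

/-- The product of a form and a real function. -/
def fmul {n : ℕ} {M : Type*} (f : M → ℝ) (φ : Form n M) : Form n M := fun k x => f x • φ k x

/-- The one-form `v ↦ ⟨ι_v β, α⟩` on `M`, for `β` in degree `k + 1` and `α` in degree `k`. -/
def pairForm {n : ℕ} {M : Type*} [TopologicalSpace M] [ChartedSpace (Cn n) M] (ρ : M → ℝ) (k : ℕ)
    (β α : Form n M) : Form n M
  | 1 => fun x => oneForm (gram ρ x) (β (k + 1) x) (α k x)
  | _ => 0

section Manifold

variable {n : ℕ} {M : Type*} [TopologicalSpace M] [ChartedSpace (Cn n) M]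
  [IsManifold 𝓘(ℂ, Cn n) ω M] {ρ : M → ℝ} {x : M} {ψ : Cn n → Cn n}

theorem IsSmooth.fmul {f : M → ℝ} (hf : ContMDiff 𝓘(ℝ, Cn n) 𝓘(ℝ, ℝ) ∞ f) {φ : Form n M}
    (hφ : IsSmooth φ) : IsSmooth (fmul f φ) := fun e he k y hy =>
  ((contDiffAt_comp_symm hf he hy).contDiffWithinAt).smul (hφ e he k y hy)

theorem rep_pairForm (hρ : IsDBoundedStein n ρ) (k : ℕ) (β α : Form n M)
    {e : OpenPartialHomeomorph M (Cn n)} (he : e ∈ atlas (Cn n) M) {y : Cn n} (hy : y ∈ e.target) :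
    rep e (pairForm ρ k β α) 1 y =
      oneForm (gramR (fun z => ρ (e.symm z)) y) (rep e β (k + 1) y) (rep e α k y) := by
  rw [gramR_transform hρ.smooth he hy]
  exact (oneForm_pb _ _ (det_dSymm_pos he hy).ne' _ _).symm

theorem isSmooth_pairForm (hρ : IsDBoundedStein n ρ) (k : ℕ) {β α : Form n M} (hβ : IsSmooth β)
    (hα : IsSmooth α) : IsSmooth (pairForm ρ k β α) := by
  intro e he j
  match j with
  | 0 => exact contDiffOn_const (c := (0 : Alt n 0))
  | 1 =>
    intro y hy
    refine ContDiffAt.contDiffWithinAt ?_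
    refine (contDiffAt_oneForm
      (fun i j => contDiffAt_kMet (contDiffAt_comp_symm hρ.smooth he hy) _ _)
      (det_gramR_pos hρ he hy).ne' (hβ.contDiffAt he (k + 1) hy)
      (hα.contDiffAt he k hy)).congr_of_eventuallyEq ?_
    filter_upwards [e.open_target.mem_nhds hy] with z hz using rep_pairForm hρ k β α he hz
  | j + 2 => exact contDiffOn_const (c := (0 : Alt n (j + 2)))

theorem IsNormal.nrep_pairForm (hρ : IsDBoundedStein n ρ) (h : IsNormal ρ x ψ) (k : ℕ)
    (β α : Form n M) : nrep x ψ (pairForm ρ k β α) 1 =ᶠ[𝓝 0] fun z =>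
      oneForm (gramR (fun z => ρ ((chartAt (Cn n) x).symm (ψ z))) z) (nrep x ψ β (k + 1) z)
        (nrep x ψ α k z) := by
  filter_upwards [h.eventually_mem, h.gram_eventuallyEq hρ, h.eventually_det_pos] with z hz hg hd
  rw [hg, nrep, pull, rep_pairForm hρ k β α (chart_mem_atlas _ x) hz, nrep, pull, nrep, pull,
    oneForm_pb _ _ hd.ne']

theorem IsNormal.fderiv_pairForm (hρ : IsDBoundedStein n ρ) (h : IsNormal ρ x ψ) (k : ℕ)
    {β α : Form n M} (hβ : IsSmooth β) (hα : IsSmooth α) (u : Cn n) (v : Fin 1 → Cn n) :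
    fderiv ℝ (nrep x ψ (pairForm ρ k β α) 1) 0 u v =
      hm 1 (iota (v 0) (fderiv ℝ (nrep x ψ β (k + 1)) 0 u)) (nrep x ψ α k 0) +
        hm 1 (iota (v 0) (nrep x ψ β (k + 1) 0)) (fderiv ℝ (nrep x ψ α k) 0 u) := by
  have h1 := (h.hasFDerivAt_nrep (isSmooth_pairForm hρ k hβ hα) 1)
  have h2 : HasFDerivAt (fun z => nrep x ψ (pairForm ρ k β α) 1 z v)
      ((ContinuousAlternatingMap.apply ℝ (Cn n) ℂ v).comp
        (fderiv ℝ (nrep x ψ (pairForm ρ k β α) 1) 0)) 0 :=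
    hasFDerivAt_clm_comp (ContinuousAlternatingMap.apply ℝ (Cn n) ℂ v) h1
  have h3 : (fun z => nrep x ψ (pairForm ρ k β α) 1 z v) =ᶠ[𝓝 0] fun z =>
      hm (gramR (fun z => ρ ((chartAt (Cn n) x).symm (ψ z))) z)
        (iota (v 0) (nrep x ψ β (k + 1) z)) (nrep x ψ α k z) := by
    filter_upwards [h.nrep_pairForm hρ k β α] with z hz
    rw [hz, oneForm_apply]
  have h4 := DFunLike.congr_fun h2.fderiv u
  rw [h3.fderiv_eq, hasFDerivAt_hm_stationary h.gram_one h.hasFDerivAt_gram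
    (hasFDerivAt_clm_comp (iota (v 0)) (h.hasFDerivAt_nrep hβ (k + 1)))
    (h.hasFDerivAt_nrep hα k)] at h4
  exact h4.symm

/-- This is the product rule for the divergence of `v ↦ ⟨ι_v β, α⟩`, computed in normal coordinates.
The terms differentiating `β` assemble into `ddStar β`. In the terms differentiating `α`, conjugate
linearity of the second slot turns type `-σ` into type `σ`, and the adjointness of contraction and
antisymmetrization assembles them into `dd σ α`. -/
theorem ddStar_pairForm (hρ : IsDBoundedStein n ρ) (σ : ℝ) (k : ℕ) {β α : Form n M}
    (hβ : IsSmooth β) (hα : IsSmooth α) (x : M) :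
    ddStar ρ σ (pairForm ρ k β α) 0 x ![] =
      hm (gram ρ x) (ddStar ρ σ β k x) (α k x) -
        hm (gram ρ x) (β (k + 1) x) (dd σ α (k + 1) x) := by
  obtain ⟨ψ, h⟩ := exists_isNormal hρ x
  have h0 : ddStar ρ σ (pairForm ρ k β α) 0 x ![] =
      nrep x ψ (ddStar ρ σ (pairForm ρ k β α)) 0 0 ![] := by
    rw [h.nrep_zero, ContinuousAlternatingMap.compContinuousLinearMap_apply]
    congr 1
    exact Subsingleton.elim _ _
  rw [h0, h.nrep_ddStar hρ σ (isSmooth_pairForm hρ k hβ hα), hm, hm, h.herm_nrep hρ,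
    h.herm_nrep hρ, ← hm, ← hm, h.nrep_ddStar hρ σ hβ, h.nrep_dd_zero σ hα,
    ContinuousAlternatingMap.neg_apply, trace_apply, hm_neg_left, hm_one_alternatize,
    trace, hm_sum_left, ← neg_add', ← Finset.sum_add_distrib]
  congr 1
  refine Finset.sum_congr rfl fun i _ => ?_
  set Dβ := fderiv ℝ (nrep x ψ β (k + 1)) 0
  set Dα := fderiv ℝ (nrep x ψ α k) 0
  have e : iota (vec i) (part (-σ) Dβ (vec i)) = (1 / 2 : ℂ) • (iota (vec i) (Dβ (vec i)) +
      ((-σ : ℝ) * Complex.I : ℂ) • iota (vec i) (Dβ (Complex.I • vec i))) := rfl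
  rw [← iota_apply, e, part_apply, part_apply]
  simp only [ContinuousAlternatingMap.smul_apply, ContinuousAlternatingMap.add_apply,
    h.fderiv_pairForm hρ k hβ hα, hm_smul_left, hm_smul_right, hm_add_left, hm_add_right,
    smul_eq_mul, Matrix.cons_val_zero]
  simp only [Dβ, Dα, map_div₀, map_one, map_ofNat, map_mul, Complex.conj_ofReal, Complex.conj_I]
  push_cast
  ring

end Manifold

end BottChern

end

/-! ### The Riemannian measure: agreement on chart overlaps, positivity and local finiteness. -/

noncomputable section

open scoped Manifold ContDiff ComplexConjugate Topology ENNReal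

namespace BottChern

open MeasureTheory

/-! ### The volume measure -/

/-- The density of the volume measure in the chart `e`. -/
def density {n : ℕ} {M : Type*} [TopologicalSpace M] [ChartedSpace (Cn n) M] (ρ : M → ℝ)
    (e : OpenPartialHomeomorph M (Cn n)) (y : Cn n) : ℝ := √(gramIn ρ e y).det

/-- The volume measure of the chart `e`. -/
def chartVol {n : ℕ} {M : Type*} [TopologicalSpace M] [ChartedSpace (Cn n) M] [MeasurableSpace M]
    (ρ : M → ℝ) (e : OpenPartialHomeomorph M (Cn n)) : Measure M :=
  (((volume : Measure (Cn n)).restrict e.target).withDensity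
      fun y => ENNReal.ofReal (density ρ e y)).map e.symm

theorem measurableSet_preimage_symm {n : ℕ} {M : Type*} [TopologicalSpace M] [MeasurableSpace M]
    [BorelSpace M] {A : Set M} (hA : MeasurableSet A)
    (e : OpenPartialHomeomorph M (Cn n)) : MeasurableSet (e.target ∩ e.symm ⁻¹' A) := by
  have h := (e.symm.continuousOn.domRestrict.measurable hA)
  have h2 := (MeasurableEmbedding.subtype_coe e.open_target.measurableSet).measurableSet_image.2 h
  convert h2 using 1
  ext y
  simp [Set.mem_image, and_comm]

section Density

variable {n : ℕ} {M : Type*} [TopologicalSpace M] [ChartedSpace (Cn n) M]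
  [IsManifold 𝓘(ℂ, Cn n) ω M] {ρ : M → ℝ} {e e' : OpenPartialHomeomorph M (Cn n)}

theorem density_transition (hρ : IsDBoundedStein n ρ) (he : e ∈ atlas (Cn n) M)
    (he' : e' ∈ atlas (Cn n) M) {y : Cn n} (hy : y ∈ e.target) (hy' : e.symm y ∈ e'.source) :
    density ρ e y = |(fderiv ℝ (transition e e') y).det| * density ρ e' (transition e e' y) := by
  have ht : transition e e' y ∈ e'.target := e'.map_source hy'
  have h1 : (fun z => ρ (e.symm z)) =ᶠ[𝓝 y] fun z => ρ (e'.symm (transition e e' z)) := by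
    filter_upwards [e.symm.continuousAt hy |>.eventually (e'.open_source.mem_nhds hy')] with z hz
    rw [transition, e'.left_inv hz]
  have h2 : gramR (fun z => ρ (e.symm z)) y =
      gramR (fun z => (fun w => ρ (e'.symm w)) (transition e e' z)) y := by
    ext i j
    simp only [gramR, Matrix.of_apply]
    -- The Gram matrix involves two derivatives of the potential, so equality of the potentials is
    -- needed on a neighbourhood.
    rw [kMet, kMet, lpd_congr (-1) (y := y)]
    filter_upwards [h1.eventuallyEq_nhds] with z hz
    apply lpd_congr
    filter_upwards [hz] with w hw
    simp only [scal, hw]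
  rw [density, gramIn_eq hρ.smooth he hy, h2, gramR_comp (isHolAt_transition he he' hy hy')
    (contDiffAt_comp_symm hρ.smooth he' ht), sqrt_det_transform, density,
    gramIn_eq hρ.smooth he' ht, det_mat]

theorem contDiffAt_density (hρ : IsDBoundedStein n ρ) (he : e ∈ atlas (Cn n) M) {y : Cn n}
    (hy : y ∈ e.target) : ContDiffAt ℝ ∞ (density ρ e) y := by
  have h1 : ContDiffAt ℝ ∞ (fun z => (gramR (fun z => ρ (e.symm z)) z).det) y :=
    contDiffAt_det fun i j => contDiffAt_kMet (contDiffAt_comp_symm hρ.smooth he hy) _ _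
  refine (h1.sqrt (det_gramR_pos hρ he hy).ne').congr_of_eventuallyEq ?_
  filter_upwards [e.open_target.mem_nhds hy] with z hz
  rw [density, gramIn_eq hρ.smooth he hz]

theorem density_pos (hρ : IsDBoundedStein n ρ) (he : e ∈ atlas (Cn n) M) {y : Cn n}
    (hy : y ∈ e.target) : 0 < density ρ e y := by
  rw [density, gramIn_eq hρ.smooth he hy]
  exact Real.sqrt_pos.2 (det_gramR_pos hρ he hy)

theorem continuousOn_density (hρ : IsDBoundedStein n ρ) (he : e ∈ atlas (Cn n) M) :
    ContinuousOn (density ρ e) e.target := fun _ hy =>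
  (contDiffAt_density hρ he hy).continuousAt.continuousWithinAt

end Density

section Manifold

variable {n : ℕ} {M : Type*} [TopologicalSpace M] [ChartedSpace (Cn n) M]
  [MeasurableSpace M] {ρ : M → ℝ} {e e' : OpenPartialHomeomorph M (Cn n)}

theorem chartVol_le_vol (ρ : M → ℝ) (he : e ∈ atlas (Cn n) M) : chartVol ρ e ≤ vol n ρ :=
  le_iSup₂_of_le e he le_rfl

theorem aemeasurable_symm [BorelSpace M] (ρ : M → ℝ) (e : OpenPartialHomeomorph M (Cn n)) :
    AEMeasurable e.symm (((volume : Measure (Cn n)).restrict e.target).withDensity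
      fun y => ENNReal.ofReal (density ρ e y)) :=
  (e.symm.continuousOn.aemeasurable e.open_target.measurableSet).mono_ac
    (withDensity_absolutelyContinuous _ _)

theorem chartVol_apply [BorelSpace M] (ρ : M → ℝ) (e : OpenPartialHomeomorph M (Cn n)) {A : Set M}
    (hA : MeasurableSet A) : chartVol ρ e A =
      ∫⁻ y in e.target ∩ e.symm ⁻¹' A, ENNReal.ofReal (density ρ e y) := by
  have hm := measurableSet_preimage_symm hA e
  have h0 : ∀ μ : Measure (Cn n), μ e.targetᶜ = 0 →
      μ (e.symm ⁻¹' A) = μ (e.target ∩ e.symm ⁻¹' A) := fun μ hμ => by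
    refine le_antisymm ?_ (measure_mono Set.inter_subset_right)
    refine (measure_mono (t := (e.target ∩ e.symm ⁻¹' A) ∪ e.targetᶜ) ?_).trans
      ((measure_union_le _ _).trans (by rw [hμ, add_zero]))
    intro y hy
    by_cases h : y ∈ e.target
    · exact Or.inl ⟨h, hy⟩
    · exact Or.inr h
  rw [chartVol, Measure.map_apply_of_aemeasurable (aemeasurable_symm ρ e) hA, h0,
    withDensity_apply _ hm, Measure.restrict_restrict hm, Set.inter_right_comm, Set.inter_self]
  refine withDensity_absolutelyContinuous _ _ ?_
  rw [Measure.restrict_apply e.open_target.measurableSet.compl]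
  simp

variable [IsManifold 𝓘(ℂ, Cn n) ω M]

theorem chartVol_le_of_subset [BorelSpace M] (hρ : IsDBoundedStein n ρ) (he : e ∈ atlas (Cn n) M)
    (he' : e' ∈ atlas (Cn n) M) {A : Set M} (hA : MeasurableSet A) (hAe : A ⊆ e'.source) :
    chartVol ρ e A ≤ chartVol ρ e' A := by
  rw [chartVol_apply ρ e hA, chartVol_apply ρ e' hA]
  set B := e.target ∩ e.symm ⁻¹' A with hB
  have hBm : MeasurableSet B := measurableSet_preimage_symm hA e
  have h1 : ∫⁻ y in B, ENNReal.ofReal (density ρ e y) =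
      ∫⁻ y in transition e e' '' B, ENNReal.ofReal (density ρ e' y) := by
    rw [lintegral_image_eq_lintegral_abs_det_fderiv_mul volume hBm (f := transition e e')
      (f' := fderiv ℝ (transition e e'))]
    · refine setLIntegral_congr_fun hBm fun y hy => ?_
      rw [density_transition hρ he he' hy.1 (hAe hy.2), ENNReal.ofReal_mul (abs_nonneg _)]
    · intro y hy
      exact ((isHolAt_transition he he' hy.1 (hAe hy.2)).contDiffAt.differentiableAt
        (by simp)).hasFDerivAt.hasFDerivWithinAt
    · intro y hy z hz hyz
      exact e.symm.injOn hy.1 hz.1 (e'.injOn (hAe hy.2) (hAe hz.2) hyz)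
  rw [h1]
  refine lintegral_mono_set ?_
  rintro _ ⟨y, hy, rfl⟩
  refine ⟨e'.map_source (hAe hy.2), ?_⟩
  rw [Set.mem_preimage, transition, e'.left_inv (hAe hy.2)]
  exact hy.2

/-- Chart measures agree on overlaps by change of variables, so on a chart domain the supremum does
not exceed the measure of that chart. Integrals of functions supported in a chart domain can thus be
computed in coordinates. -/
theorem vol_restrict_source [BorelSpace M] (hρ : IsDBoundedStein n ρ) (he : e ∈ atlas (Cn n) M) :
    (vol n ρ).restrict e.source = chartVol ρ e := by
  have hs := e.open_source.measurableSet
  -- As `vol` is a least upper bound, it is enough to bound each chart measure: on `e.source` by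
  -- `chartVol ρ e`, and off it trivially by `vol`.
  have hle : vol n ρ ≤ chartVol ρ e + (vol n ρ).restrict e.sourceᶜ := by
    refine iSup₂_le fun e' he' => ?_
    change chartVol ρ e' ≤ _
    refine Measure.le_iff.2 fun A hA => ?_
    rw [← measure_inter_add_sdiff A hs, Measure.add_apply, Measure.restrict_apply hA]
    refine add_le_add ?_ (chartVol_le_vol ρ he' _)
    exact (chartVol_le_of_subset hρ he' he (hA.inter hs) Set.inter_subset_right).trans
      (measure_mono Set.inter_subset_left)
  refine le_antisymm ?_ ?_
  · refine Measure.le_iff.2 fun A hA => ?_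
    rw [Measure.restrict_apply hA]
    refine (hle _).trans ?_
    rw [Measure.add_apply, Measure.restrict_apply (hA.inter hs)]
    have h0 : A ∩ e.source ∩ e.sourceᶜ = ∅ := by rw [Set.inter_assoc]; simp
    rw [h0, measure_empty, add_zero]
    exact measure_mono Set.inter_subset_left
  · refine Measure.le_iff.2 fun A hA => ?_
    rw [Measure.restrict_apply hA]
    refine le_trans (le_of_eq ?_) (chartVol_le_vol ρ he _)
    rw [chartVol_apply ρ e hA, chartVol_apply ρ e (hA.inter hs)]
    congr 2
    ext y
    simp only [Set.mem_inter_iff, Set.mem_preimage]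
    exact ⟨fun h => ⟨h.1, h.2, e.map_target h.1⟩, fun h => ⟨h.1, h.2.1⟩⟩

theorem integral_vol_eq [BorelSpace M] (hρ : IsDBoundedStein n ρ) (he : e ∈ atlas (Cn n) M)
    {F : M → ℂ} (hF : Continuous F) (hs : ∀ x ∉ e.source, F x = 0) :
    ∫ x, F x ∂(vol n ρ) = ∫ y in e.target, density ρ e y • F (e.symm y) := by
  have h1 : ∫ x, F x ∂(vol n ρ) = ∫ x in e.source, F x ∂(vol n ρ) :=
    (setIntegral_eq_integral_of_forall_compl_eq_zero hs).symm
  rw [h1, vol_restrict_source hρ he, chartVol,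
    integral_map (aemeasurable_symm ρ e) hF.aestronglyMeasurable,
    integral_withDensity_eq_integral_toReal_smul₀]
  · simp only [ENNReal.toReal_ofReal (Real.sqrt_nonneg _), density]
  · exact ((continuousOn_density hρ he).aemeasurable e.open_target.measurableSet).ennreal_ofReal
  · simp

/-- The density is positive in every chart. This lets a vanishing integral of a nonnegative
continuous function force pointwise vanishing. -/
theorem isOpenPosMeasure_vol [BorelSpace M] (hρ : IsDBoundedStein n ρ) :
    (vol n ρ).IsOpenPosMeasure := by
  refine ⟨fun U hU ⟨x, hx⟩ h0 => ?_⟩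
  set e := chartAt (Cn n) x
  have he : e ∈ atlas (Cn n) M := chart_mem_atlas _ x
  have h1 : chartVol ρ e U = 0 := le_antisymm ((chartVol_le_vol ρ he U).trans h0.le) bot_le
  rw [chartVol_apply ρ e hU.measurableSet] at h1
  have hV : IsOpen (e.target ∩ e.symm ⁻¹' U) := e.isOpen_inter_preimage_symm hU
  have hc := (continuousOn_density hρ he).mono
    (Set.inter_subset_left : e.target ∩ e.symm ⁻¹' U ⊆ e.target)
  rw [lintegral_eq_zero_iff' (hc.aemeasurable hV.measurableSet).ennreal_ofReal,
    Filter.EventuallyEq, ae_restrict_iff' hV.measurableSet] at h1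
  have h2 : volume (e.target ∩ e.symm ⁻¹' U) = 0 := by
    refine measure_mono_null (fun y hy => ?_) h1
    simp only [Set.mem_compl_iff, Set.mem_ofPred_eq, not_forall]
    refine ⟨hy, ?_⟩
    simpa using density_pos hρ he hy.1
  refine hV.measure_pos volume ⟨e x, ?_⟩ |>.ne' h2
  refine ⟨mem_chart_target _ x, ?_⟩
  rw [Set.mem_preimage, e.left_inv (mem_chart_source _ x)]
  exact hx

theorem isLocallyFiniteMeasure_vol [BorelSpace M] (hρ : IsDBoundedStein n ρ) :
    IsLocallyFiniteMeasure (vol n ρ) := by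
  refine ⟨fun x => ?_⟩
  set e := chartAt (Cn n) x
  have he : e ∈ atlas (Cn n) M := chart_mem_atlas _ x
  have hx : e x ∈ e.target := mem_chart_target _ x
  obtain ⟨K, hK, hxK, hKe⟩ := exists_compact_subset e.open_target hx
  have hU : IsOpen (e.source ∩ e ⁻¹' interior K) := e.isOpen_inter_preimage isOpen_interior
  refine ⟨e.source ∩ e ⁻¹' interior K, hU.mem_nhds ⟨mem_chart_source _ x, hxK⟩, ?_⟩
  have h1 : vol n ρ (e.source ∩ e ⁻¹' interior K) = chartVol ρ e (e.source ∩ e ⁻¹' interior K) := by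
    rw [← vol_restrict_source hρ he, Measure.restrict_apply hU.measurableSet,
      Set.inter_right_comm, Set.inter_self]
  rw [h1, chartVol_apply ρ e hU.measurableSet]
  refine (lintegral_mono_set (t := K) ?_).trans_lt ?_
  · rintro y ⟨hy, hy'⟩
    have := hy'.2
    rw [Set.mem_preimage, e.right_inv hy] at this
    exact interior_subset this
  · have := ((continuousOn_density hρ he).mono hKe).integrableOn_compact (μ := volume) hK
    have h2 := this.2
    rw [hasFiniteIntegral_iff_ofReal] at h2
    · exact h2
    · exact Filter.Eventually.of_forall fun y => Real.sqrt_nonneg _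

end Manifold

end BottChern

end

/-! ### Supports, and Stokes' theorem in the form that `∂*` and `∂̄*` of compactly supported forms
integrate to zero. -/

noncomputable section

open scoped Manifold ContDiff ComplexConjugate Topology ENNReal

namespace BottChern

open MeasureTheory

/-! ### Supports -/

/-- `φ` vanishes outside `K`. -/
def SuppIn {n : ℕ} {M : Type*} (K : Set M) (φ : Form n M) : Prop := ∀ k, ∀ x ∉ K, φ k x = 0

theorem SuppIn.neg {n : ℕ} {M : Type*} {K : Set M} {φ : Form n M} (h : SuppIn K φ) : SuppIn K (-φ) := fun k x hx => by
  change -φ k x = 0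
  rw [h k x hx, neg_zero]

theorem fmul_apply_of_left {n : ℕ} {M : Type*} {f : M → ℝ} {x : M} (h : f x = 0) (φ : Form n M)
    (k : ℕ) : fmul f φ k x = 0 := by
  ext v
  change f x • φ k x v = 0
  rw [h, zero_smul]

theorem fmul_apply_of_right {n : ℕ} {M : Type*} (f : M → ℝ) {x : M} {φ : Form n M} {k : ℕ}
    (h : φ k x = 0) : fmul f φ k x = 0 := by
  ext v
  change f x • φ k x v = 0
  rw [h]
  exact smul_zero (f x)

section Support

variable {n : ℕ} {M : Type*} [TopologicalSpace M] [ChartedSpace (Cn n) M] {K : Set M} {φ : Form n M}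

theorem hodge_zero {n k l : ℕ} (h : k + l = n * 2) (G : Matrix (Idx n) (Idx n) ℝ) :
    hodge h G (0 : Alt n k) = 0 := by
  have h2 := hodge_add h G 0 0
  rw [add_zero] at h2
  exact left_eq_add.1 h2

theorem SuppIn.star (ρ : M → ℝ) (h : SuppIn K φ) : SuppIn K (star ρ φ) := by
  intro k x hx
  by_cases hk : k ≤ n * 2
  · rw [star_apply (Nat.sub_add_cancel hk), h _ x hx, hodge_zero]
  · rw [BottChern.star, dif_neg hk]

theorem SuppIn.dd (hK : IsClosed K) (σ : ℝ) (h : SuppIn K φ) : SuppIn K (dd σ φ) := by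
  intro k x hx
  cases k with
  | zero => rfl
  | succ k =>
    set e := chartAt (Cn n) x with he
    have hex : e.symm (e x) = x := e.left_inv (mem_chart_source _ x)
    have h1 : rep e φ k =ᶠ[𝓝 (e x)] fun _ => 0 := by
      have h2 : ∀ᶠ z in 𝓝 (e x), e.symm z ∈ Kᶜ :=
        (e.symm.continuousAt (mem_chart_target _ x)).eventually
          (hK.isOpen_compl.mem_nhds (by rwa [hex]))
      filter_upwards [h2] with z hz
      rw [rep, h k _ hz]
      rfl
    change lpd σ (rep e φ k) (e x) = 0
    rw [lpd_congr σ h1, lpd_eq, fderiv_fun_const]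
    exact map_zero (altPart n k σ)

theorem SuppIn.ddStar (hK : IsClosed K) (ρ : M → ℝ) (σ : ℝ) (h : SuppIn K φ) :
    SuppIn K (ddStar ρ σ φ) := (((h.star ρ).dd hK σ).star ρ).neg

theorem continuous_of_chart {Y : Type*} [TopologicalSpace Y] {F : M → Y}
    (h : ∀ e ∈ atlas (Cn n) M, ∀ y ∈ e.target, ContinuousAt (fun z => F (e.symm z)) y) :
    Continuous F := by
  refine continuous_iff_continuousAt.2 fun x => ?_
  set e := chartAt (Cn n) x with he
  have h1 := (h e (chart_mem_atlas _ x) (e x) (mem_chart_target _ x)).comp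
    (e.continuousAt (mem_chart_source _ x))
  refine h1.congr ?_
  filter_upwards [e.open_source.mem_nhds (mem_chart_source _ x)] with z hz
  simp [e.left_inv hz]

theorem rep_apply_zero (e : OpenPartialHomeomorph M (Cn n)) (φ : Form n M) (y : Cn n) : rep e φ 0 y ![] = φ 0 (e.symm y) ![] := by
  rw [rep, ContinuousAlternatingMap.compContinuousLinearMap_apply]
  congr 1
  exact Subsingleton.elim _ _

theorem IsSmooth.continuous_apply_zero {φ : Form n M} (hφ : IsSmooth φ) :
    Continuous fun x => φ 0 x ![] := by
  refine continuous_of_chart (n := n) fun e he y hy => ?_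
  simp_rw [← rep_apply_zero e]
  exact (ContinuousAlternatingMap.apply ℝ (Cn n) ℂ ![]).continuous.continuousAt.comp
    (hφ.contDiffAt he 0 hy).continuousAt

theorem isManifold_real [IsManifold 𝓘(ℂ, Cn n) ω M] : IsManifold 𝓘(ℝ, Cn n) ∞ M := by
  refine isManifold_of_contDiffOn _ _ _ fun e e' he he' y hy => ?_
  have hy' : y ∈ e.target ∧ e.symm y ∈ e'.source := by simpa using hy
  exact (isHolAt_transition he he' hy'.1 hy'.2).contDiffAt.contDiffWithinAt

/-- The sets `{ρ ≤ N}`, `N ∈ ℕ`, are a countable cover by compact sets. This provides the partitions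
of unity. -/
theorem sigmaCompactSpace_of_exhaustion {ρ : M → ℝ} (hρ : IsDBoundedStein n ρ) :
    SigmaCompactSpace M := by
  refine SigmaCompactSpace.of_countable (Set.range fun N : ℕ => {x | ρ x ≤ N})
    (Set.countable_range _) ?_ ?_
  · rintro _ ⟨N, rfl⟩
    exact hρ.exhaustion N
  · refine Set.eq_univ_of_forall fun x => ?_
    obtain ⟨N, hN⟩ := exists_nat_ge (ρ x)
    exact ⟨_, ⟨N, rfl⟩, hN⟩

end Support

/-! ### Stokes theorem -/

/-- Integration by parts against the constant function `1`. -/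
theorem integral_fderiv_eq_zero {E F : Type*} [NormedAddCommGroup E] [NormedSpace ℝ E]
    [FiniteDimensional ℝ E] [MeasurableSpace E] [BorelSpace E] (μ : Measure E) [μ.IsAddHaarMeasure]
    [NormedAddCommGroup F] [NormedSpace ℝ F] [CompleteSpace F] {γ : E → F} (hγ : ContDiff ℝ 1 γ)
    (hc : HasCompactSupport γ) : ∫ y, fderiv ℝ γ y ∂μ = 0 := by
  have hd : Continuous (fderiv ℝ γ) := hγ.continuous_fderiv (by simp)
  have hi : Integrable (fderiv ℝ γ) μ := hd.integrable_of_hasCompactSupport (hc.fderiv ℝ)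
  ext v
  rw [ContinuousLinearMap.integral_apply hi]
  have hiv : Integrable (fun y => fderiv ℝ γ y v) μ := hi.apply_continuousLinearMap v
  have h := integral_bilinear_hasFDerivAt_right_eq_neg_left_of_integrable (μ := μ)
    (f := fun _ : E => (1 : ℝ)) (f' := fun _ => 0) (g := γ) (g' := fderiv ℝ γ) (v := v)
    (B := ContinuousLinearMap.lsmul ℝ ℝ) (by simp) (by simpa using hiv)
    (by simpa using hγ.continuous.integrable_of_hasCompactSupport hc)
    (fun x _ => hasFDerivAt_const _ _)
    (fun x _ => (hγ.differentiable (by simp) x).hasFDerivAt)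
  simpa using h

theorem integral_clm_fderiv_eq_zero {E F G : Type*} [NormedAddCommGroup E] [NormedSpace ℝ E]
    [FiniteDimensional ℝ E] [MeasurableSpace E] [BorelSpace E] (μ : Measure E) [μ.IsAddHaarMeasure]
    [NormedAddCommGroup F] [NormedSpace ℝ F] [CompleteSpace F] [NormedAddCommGroup G]
    [NormedSpace ℝ G] [CompleteSpace G] (Λ : (E →L[ℝ] F) →L[ℝ] G) {γ : E → F}
    (hγ : ContDiff ℝ 1 γ) (hc : HasCompactSupport γ) : ∫ y, Λ (fderiv ℝ γ y) ∂μ = 0 := by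
  have hi : Integrable (fderiv ℝ γ) μ :=
    (hγ.continuous_fderiv (by simp)).integrable_of_hasCompactSupport (hc.fderiv ℝ)
  rw [Λ.integral_comp_comm hi, integral_fderiv_eq_zero μ hγ hc, map_zero]

/-- Evaluate on the ordered coordinate frame, where the determinant form equals `1`. In this way a
function times the volume density is read off from a top-degree form. -/
theorem hodge_zero_degree {n l : ℕ} (h : 0 + l = n * 2) :
    ∃ b : Fin l → Cn n, ∀ (G : Matrix (Idx n) (Idx n) ℝ) (β : Alt n 0),
      hodge h G β b = (√G.det : ℝ) * conj (β ![]) := by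
  set w : Fin (0 + l) → Cn n := fun i => vec (finProdFinEquiv.symm (Fin.cast h i)) with hw
  refine ⟨fun a => w (Fin.natAdd 0 a), fun G β => ?_⟩
  have h1 : ∀ s : Fin 0 → Idx n,
      Fin.append (fun a => (vec (s a) : Cn n)) (fun a => w (Fin.natAdd 0 a)) = w := by
    intro s
    funext b
    refine Fin.addCases (fun b => b.elim0) (fun b => ?_) b
    rw [Fin.append_right]
  have h2 : detForm h w = 1 := by
    have h3 : (fun i => coordLin h (w i)) = (1 : Matrix (Fin (0 + l)) (Fin (0 + l)) ℝ) := by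
      ext i j
      change coord _ (vec _) = _
      rw [coord_vec, Matrix.one_apply]
      refine if_congr ?_ rfl rfl
      rw [finProdFinEquiv.symm.apply_eq_iff_eq, Fin.cast_inj, eq_comm]
    change Matrix.det (fun i => coordLin h (w i)) = 1
    rw [h3, Matrix.det_one]
  rw [hodge_apply]
  simp only [h1, h2, contr]
  have h4 : ∀ t : Fin 0 → Idx n, comps β t = β ![] := fun t =>
    congrArg β (Subsingleton.elim _ _)
  simp [h4]

section Manifold

variable {n : ℕ} {M : Type*} [TopologicalSpace M] [ChartedSpace (Cn n) M]
  [IsManifold 𝓘(ℂ, Cn n) ω M] {ρ : M → ℝ} {e : OpenPartialHomeomorph M (Cn n)} {K : Set M}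

theorem rep_star_apply (hρ : IsDBoundedStein n ρ) (φ : Form n M) (he : e ∈ atlas (Cn n) M)
    {k l : ℕ} (h : l + k = n * 2) {y : Cn n} (hy : y ∈ e.target) :
    rep e (star ρ φ) k y = hodge h (gramR (fun z => ρ (e.symm z)) y) (rep e φ l y) := by
  obtain rfl : l = n * 2 - k := by omega
  exact rep_star hρ φ he (by omega) hy

theorem continuous_hm (hρ : IsDBoundedStein n ρ) (k : ℕ) {α β : Form n M} (hα : IsSmooth α)
    (hβ : IsSmooth β) : Continuous fun x => hm (gram ρ x) (α k x) (β k x) := by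
  refine continuous_of_chart (n := n) fun e he y hy => ?_
  have h1 := (contDiffAt_hm
      (fun i j => contDiffAt_kMet (contDiffAt_comp_symm hρ.smooth he hy) (vec i) (vec j))
      (det_gramR_pos hρ he hy).ne' (hα.contDiffAt he k hy)
      (hβ.contDiffAt he k hy)).continuousAt
  refine h1.congr ?_
  filter_upwards [e.open_target.mem_nhds hy] with z hz
  exact herm_rep hρ α β he k hz

theorem ddStar_add (σ : ℝ) (hρ : IsDBoundedStein n ρ) {φ φ' : Form n M} (hφ : IsSmooth φ)
    (hφ' : IsSmooth φ') : ddStar ρ σ (φ + φ') = ddStar ρ σ φ + ddStar ρ σ φ' := by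
  rw [ddStar, star_add, dd_add σ (hφ.star hρ) (hφ'.star hρ), star_add, neg_add]
  rfl

/-- Applying `∗` to `ddStar θ` undoes its outer `∗` and leaves `-dd σ (∗θ)`. Evaluated on the
coordinate frame, this writes density times `ddStar θ` as a fixed real-linear function of the
derivative of `∗θ`, that is, as a divergence in coordinates. -/
theorem density_smul_ddStar (hρ : IsDBoundedStein n ρ) (σ : ℝ) {θ : Form n M} (hθ : IsSmooth θ)
    {j : ℕ} (hj : 0 + (j + 1) = n * 2) : ∃ b : Fin (j + 1) → Cn n,
      ∀ e ∈ atlas (Cn n) M, ∀ y ∈ e.target, density ρ e y • ddStar ρ σ θ 0 (e.symm y) ![] =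
        -conj (lpd σ (rep e (star ρ θ) j) y b) := by
  obtain ⟨b, hb⟩ := hodge_zero_degree (n := n) hj
  refine ⟨b, fun e he y hy => ?_⟩
  have h1 : star ρ (ddStar ρ σ θ) (j + 1) = -dd σ (star ρ θ) (j + 1) := by
    rw [ddStar, star_neg, star_star hρ]
    funext x
    change -((-1 : ℂ) ^ (j + 1) • dd σ (star ρ θ) (j + 1) x) = -dd σ (star ρ θ) (j + 1) x
    -- The sign of `∗∗` is trivial in the even degree `2n`.
    rw [show j + 1 = n * 2 by omega, pow_mul']
    simp
  have h2 : rep e (star ρ (ddStar ρ σ θ)) (j + 1) y = -lpd σ (rep e (star ρ θ) j) y := by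
    rw [← rep_dd σ (hθ.star hρ) he j hy, rep, h1]
    rfl
  have h3 := congrArg (fun a => a b) h2
  simp only [rep_star_apply hρ _ he hj hy, hb, rep_apply_zero,
    ContinuousAlternatingMap.neg_apply] at h3
  rw [density, gramIn_eq hρ.smooth he hy, ← map_neg, ← h3, map_mul, Complex.conj_conj,
    Complex.conj_ofReal, Complex.real_smul]

variable [T2Space M] [MeasurableSpace M] [BorelSpace M]

theorem integrable_of_continuous (hρ : IsDBoundedStein n ρ) {E : Type*} [NormedAddCommGroup E]
    [SecondCountableTopology E] {F : M → E} (hF : Continuous F) (hK : IsCompact K)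
    (h : ∀ x ∉ K, F x = 0) : Integrable F (vol n ρ) := by
  have := isLocallyFiniteMeasure_vol hρ
  exact hF.integrable_of_hasCompactSupport (HasCompactSupport.intro hK h)

theorem integral_ddStar_of_chart (hρ : IsDBoundedStein n ρ) (σ : ℝ) {θ : Form n M}
    (hθ : IsSmooth θ) (he : e ∈ atlas (Cn n) M) (hK : IsCompact K) (hKe : K ⊆ e.source)
    (hs : SuppIn K θ) : ∫ x, ddStar ρ σ θ 0 x ![] ∂(vol n ρ) = 0 := by
  have hs' := hs.ddStar hK.isClosed ρ σ
  -- In complex dimension `0` there is no degree `2n - 1`; there `ddStar` is `∗` of the degree-zero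
  -- part of `dd`, hence zero.
  rcases Nat.eq_zero_or_pos n with hn | hn
  · have h0 : ∀ x, ddStar ρ σ θ 0 x = 0 := by
      intro x
      change -star ρ (dd σ (star ρ θ)) 0 x = 0
      rw [star_apply (l := 0) (by omega)]
      exact neg_eq_zero.2 (hodge_zero _ _)
    simp [h0]
  obtain ⟨j, hj⟩ : ∃ j, 0 + (j + 1) = n * 2 := ⟨n * 2 - 1, by omega⟩
  obtain ⟨b, hb⟩ := density_smul_ddStar hρ σ hθ hj
  rw [integral_vol_eq hρ he (hθ.ddStar hρ σ).continuous_apply_zero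
    (fun x hx => by rw [hs' 0 x fun h => hx (hKe h)]; rfl),
    setIntegral_congr_fun e.open_target.measurableSet (hb e he)]
  classical
  -- The chart expression of `∗θ` is extended by zero. It stays smooth because its support lies in
  -- the compact image of `K`, inside the chart target.
  set γ : Cn n → Alt n j := fun y => if y ∈ e.target then rep e (star ρ θ) j y else 0 with hγ
  have hK' : IsCompact (e '' K) := hK.image_of_continuousOn (e.continuousOn.mono hKe)
  have hγ0 : ∀ y ∉ e '' K, γ y = 0 := by
    intro y hy
    by_cases hyt : y ∈ e.target
    · rw [hγ]
      simp only [if_pos hyt]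
      rw [rep, hs.star ρ j]
      · rfl
      · exact fun h => hy ⟨_, h, e.right_inv hyt⟩
    · simp [hγ, hyt]
  have hγe : ∀ y ∈ e.target, γ =ᶠ[𝓝 y] rep e (star ρ θ) j := by
    intro y hy
    filter_upwards [e.open_target.mem_nhds hy] with z hz
    simp [hγ, hz]
  have hγs : ContDiff ℝ 1 γ := by
    refine contDiff_iff_contDiffAt.2 fun y => ?_
    by_cases hyt : y ∈ e.target
    · exact (((hθ.star hρ).contDiffAt he j hyt).of_le (by simp)).congr_of_eventuallyEq (hγe y hyt)
    · have hy : y ∈ (e '' K)ᶜ := by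
        rintro ⟨x, hx, rfl⟩
        exact hyt (e.map_source (hKe hx))
      refine (contDiffAt_const (c := (0 : Alt n j))).congr_of_eventuallyEq ?_
      filter_upwards [hK'.isClosed.isOpen_compl.mem_nhds hy] with z hz using hγ0 z hz
  have hγc : HasCompactSupport γ := HasCompactSupport.intro hK' hγ0
  set Λ : (Cn n →L[ℝ] Alt n j) →L[ℝ] ℂ :=
    (-(Complex.conjCLE : ℂ →L[ℝ] ℂ)).comp
      ((ContinuousAlternatingMap.apply ℝ (Cn n) ℂ b).comp (altPart n j σ)) with hΛ
  have h2 := integral_clm_fderiv_eq_zero (E := Cn n) (F := Alt n j) volume Λ hγs hγc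
  refine Eq.trans ?_ h2
  rw [← setIntegral_eq_integral_of_forall_compl_eq_zero (s := e.target)
    (f := fun y => Λ (fderiv ℝ γ y))]
  · refine setIntegral_congr_fun e.open_target.measurableSet fun y hy => ?_
    change _ = -conj (altPart n j σ (fderiv ℝ γ y) b)
    rw [(hγe y hy).fderiv_eq]
    rfl
  · intro y hy
    have hy' : y ∈ (e '' K)ᶜ := by
      rintro ⟨x, hx, rfl⟩
      exact hy (e.map_source (hKe hx))
    have h3 : γ =ᶠ[𝓝 y] fun _ => 0 := by
      filter_upwards [hK'.isClosed.isOpen_compl.mem_nhds hy'] with z hz using hγ0 z hz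
    rw [h3.fderiv_eq, fderiv_fun_const]
    exact map_zero Λ

/-- A smooth partition of unity subordinate to chart domains writes `θ` as a sum of pieces to which
the chart version applies. The sum is finite because only finitely many members meet the compact set
`K`. -/
theorem integral_ddStar (hρ : IsDBoundedStein n ρ) (σ : ℝ) {θ : Form n M} (hθ : IsSmooth θ)
    (hK : IsCompact K) (hs : SuppIn K θ) : ∫ x, ddStar ρ σ θ 0 x ![] ∂(vol n ρ) = 0 := by
  have := isManifold_real (n := n) (M := M)
  have := sigmaCompactSpace_of_exhaustion hρ
  obtain ⟨f, hf⟩ := SmoothPartitionOfUnity.exists_isSubordinate_chartAt_source_of_isClosed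
    𝓘(ℝ, Cn n) hK.isClosed
  have hfin := f.locallyFinite.finite_nonempty_inter_compact hK
  have hsum : θ = ∑ i ∈ hfin.toFinset, fmul (f i) θ := by
    funext k x
    rw [Finset.sum_apply, Finset.sum_apply]
    change θ k x = ∑ i ∈ hfin.toFinset, f i x • θ k x
    rw [← Finset.sum_smul]
    by_cases hx : x ∈ K
    · rw [← finsum_eq_sum_of_support_subset, f.sum_eq_one hx, one_smul]
      intro i hi
      simp only [Set.Finite.coe_toFinset, Set.mem_ofPred_eq]
      exact ⟨x, hi, hx⟩
    · rw [hs k x hx, smul_zero]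
  have hone : ∀ i, ∫ x, ddStar ρ σ (fmul (f i) θ) 0 x ![] ∂(vol n ρ) = 0 := by
    intro i
    refine integral_ddStar_of_chart hρ σ (hθ.fmul (f i).contMDiff) (chart_mem_atlas (Cn n) (i : M))
      (K := K ∩ tsupport (f i)) (hK.inter_right (isClosed_tsupport _))
      (Set.inter_subset_right.trans (hf i)) fun k x hx => ?_
    by_cases hxK : x ∈ K
    · exact fmul_apply_of_left (image_eq_zero_of_notMem_tsupport fun h => hx ⟨hxK, h⟩) θ k
    · exact fmul_apply_of_right _ (hs k x hxK)
  -- Smoothness and support are carried through the induction because each use of additivity of the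
  -- integral needs integrability of both summands.
  have hind : ∀ s : Finset K, IsSmooth (∑ i ∈ s, fmul (f i) θ) ∧
      SuppIn K (∑ i ∈ s, fmul (f i) θ) ∧
      ∫ x, ddStar ρ σ (∑ i ∈ s, fmul (f i) θ) 0 x ![] ∂(vol n ρ) = 0 := by
    classical
    intro s
    induction s using Finset.induction_on with
    | empty =>
      have h0 : SuppIn K (0 : Form n M) := fun _ _ _ => rfl
      refine ⟨isSmooth_zero, h0, ?_⟩
      have h2 := SuppIn.ddStar isClosed_empty ρ σ (φ := (0 : Form n M)) fun _ _ _ => rfl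
      have h3 : ∀ x, ddStar ρ σ (0 : Form n M) 0 x ![] = 0 := fun x => by
        rw [h2 0 x (Set.notMem_empty x)]
        rfl
      simp [h3]
    | insert a s ha ih =>
      rw [Finset.sum_insert ha]
      have hsm := hθ.fmul (f a).contMDiff
      have hsa : SuppIn K (fmul (f a) θ) := fun k x hx =>
        fmul_apply_of_right _ (hs k x hx)
      refine ⟨hsm.add ih.1, fun k x hx => ?_, ?_⟩
      · change fmul (f a) θ k x + (∑ i ∈ s, fmul (f i) θ) k x = 0
        rw [hsa k x hx, ih.2.1 k x hx, add_zero]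
      · rw [ddStar_add σ hρ hsm ih.1]
        change ∫ x, (ddStar ρ σ (fmul (f a) θ) 0 x ![] +
          ddStar ρ σ (∑ i ∈ s, fmul (f i) θ) 0 x ![]) ∂(vol n ρ) = 0
        rw [integral_add, hone, ih.2.2, add_zero]
        · exact integrable_of_continuous hρ (hsm.ddStar hρ σ).continuous_apply_zero hK
            fun x hx => by rw [hsa.ddStar hK.isClosed ρ σ 0 x hx]; rfl
        · exact integrable_of_continuous hρ (ih.1.ddStar hρ σ).continuous_apply_zero hK
            fun x hx => by rw [ih.2.1.ddStar hK.isClosed ρ σ 0 x hx]; rfl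
  rw [hsum]
  exact (hind _).2.2

/-- `∂*` and `∂̄*` are the formal adjoints of `∂` and `∂̄`. -/
theorem integral_hm_ddStar (hρ : IsDBoundedStein n ρ) (σ : ℝ) (k : ℕ) {α β : Form n M}
    (hα : IsSmooth α) (hβ : IsSmooth β) (hK : IsCompact K) (hs : SuppIn K α ∨ SuppIn K β) :
    ∫ x, hm (gram ρ x) (ddStar ρ σ β k x) (α k x) ∂(vol n ρ) =
      ∫ x, hm (gram ρ x) (β (k + 1) x) (dd σ α (k + 1) x) ∂(vol n ρ) := by
  have hp : SuppIn K (pairForm ρ k β α) := by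
    intro j x hx
    match j with
    | 0 => rfl
    | 1 =>
      ext v
      change oneForm _ _ _ v = 0
      rw [oneForm_apply]
      rcases hs with hs | hs
      · rw [hs k x hx, hm_zero_right]
      · rw [hs (k + 1) x hx, map_zero, hm_zero_left]
    | j + 2 => rfl
  -- The divergence of the pairing form integrates to zero; compact support of one of the two forms
  -- suffices for this form to be compactly supported.
  have h := integral_ddStar hρ σ (isSmooth_pairForm hρ k hβ hα) hK hp
  simp_rw [ddStar_pairForm hρ σ k hβ hα] at h
  rw [integral_sub, sub_eq_zero] at h
  · exact h
  · refine integrable_of_continuous hρ (continuous_hm hρ k (hβ.ddStar hρ σ) hα) hK fun x hx => ?_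
    rcases hs with hs | hs
    · rw [hs k x hx, hm_zero_right]
    · rw [hs.ddStar hK.isClosed ρ σ k x hx, hm_zero_left]
  · refine integrable_of_continuous hρ (continuous_hm hρ (k + 1) hβ (hα.dd σ)) hK fun x hx => ?_
    rcases hs with hs | hs
    · rw [hs.dd hK.isClosed σ (k + 1) x hx, hm_zero_right]
    · rw [hs (k + 1) x hx, hm_zero_left]

end Manifold

end BottChern

end

/-! ### Symmetry of the Laplacian against compactly supported forms, and the weak equation. -/

noncomputable section

open scoped Manifold ContDiff ComplexConjugate Topology ENNReal

namespace BottChern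

open MeasureTheory

/-! ### Weak formulations -/

theorem herm_conj {n k : ℕ} {G : Matrix (Idx n) (Idx n) ℝ} (hG : G.IsHermitian)
    (S T : (Fin k → Idx n) → ℂ) : conj (herm G S T) = herm G T S := by
  have hs : ∀ i j, G⁻¹ i j = G⁻¹ j i := fun i j => by
    have h := hG.inv.apply j i
    rwa [star_trivial] at h
  have hp : ∀ s t : Fin k → Idx n, conj (((∏ a, G⁻¹ (s a) (t a) : ℝ) : ℂ) * S s * conj (T t)) =
      ((∏ a, G⁻¹ (t a) (s a) : ℝ) : ℂ) * T t * conj (S s) := by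
    intro s t
    rw [map_mul, map_mul, Complex.conj_ofReal, Complex.conj_conj,
      Finset.prod_congr rfl fun a _ => hs (s a) (t a)]
    ring
  rw [herm, herm, map_mul, map_inv₀, Complex.conj_natCast, Finset.sum_comm]
  refine congrArg _ ?_
  rw [map_sum]
  refine Finset.sum_congr rfl fun s _ => ?_
  rw [map_sum]
  exact Finset.sum_congr rfl fun t _ => hp t s

theorem hm_conj {n k : ℕ} {G : Matrix (Idx n) (Idx n) ℝ} (hG : G.IsHermitian) (α β : Alt n k) :
    conj (hm G α β) = hm G β α := herm_conj hG _ _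

theorem integral_add_add {X : Type*} [MeasurableSpace X] {μ : Measure X} {f g h : X → ℂ}
    (hf : Integrable f μ) (hg : Integrable g μ) (hh : Integrable h μ) :
    ∫ x, (f x + g x + h x) ∂μ = ∫ x, f x ∂μ + ∫ x, g x ∂μ + ∫ x, h x ∂μ := by
  have h1 := integral_add (hf.add hg) hh
  have h2 := integral_add hf hg
  simp only [Pi.add_apply] at h1
  rw [h1, h2]

section Support

variable {n : ℕ} {M : Type*} [TopologicalSpace M] [ChartedSpace (Cn n) M] {K : Set M}

theorem SuppIn.lap (hK : IsClosed K) (ρ : M → ℝ) {φ : Form n M} (h : SuppIn K φ) :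
    SuppIn K (lap ρ φ) := fun k x hx => by
  change BottChern.dd (-1) (BottChern.ddStar ρ (-1) φ) k x +
    BottChern.ddStar ρ (-1) (BottChern.dd (-1) φ) k x = 0
  rw [(h.ddStar hK ρ (-1)).dd hK (-1) k x hx, (h.dd hK (-1)).ddStar hK ρ (-1) k x hx, add_zero]

theorem lap_apply (ρ : M → ℝ) (φ : Form n M) (k : ℕ) (x : M) : lap ρ φ k x =
    dd (-1) (ddStar ρ (-1) φ) k x + ddStar ρ (-1) (dd (-1) φ) k x := rfl

end Support

section Manifold

variable {n : ℕ} {M : Type*} [TopologicalSpace M] [ChartedSpace (Cn n) M]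
  [IsManifold 𝓘(ℂ, Cn n) ω M] {ρ : M → ℝ} {K : Set M}

theorem IsSmooth.lap (hρ : IsDBoundedStein n ρ) {φ : Form n M} (hφ : IsSmooth φ) :
    IsSmooth (lap ρ φ) :=
  ((hφ.ddStar hρ (-1)).dd (-1)).add ((hφ.dd (-1)).ddStar hρ (-1))

variable [T2Space M] [MeasurableSpace M] [BorelSpace M]

theorem integrable_hm (hρ : IsDBoundedStein n ρ) (k : ℕ) {α β : Form n M} (hα : IsSmooth α)
    (hβ : IsSmooth β) (hK : IsCompact K) (hs : SuppIn K α) :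
    Integrable (fun x => hm (gram ρ x) (β k x) (α k x)) (vol n ρ) :=
  integrable_of_continuous hρ (continuous_hm hρ k hβ hα) hK fun x hx => by
    rw [hs k x hx, hm_zero_right]

theorem integral_hm_dd (hρ : IsDBoundedStein n ρ) (σ : ℝ) (k : ℕ) {α β : Form n M}
    (hα : IsSmooth α) (hβ : IsSmooth β) (hK : IsCompact K) (hs : SuppIn K α) :
    ∫ x, hm (gram ρ x) (dd σ β (k + 1) x) (α (k + 1) x) ∂(vol n ρ) =
      ∫ x, hm (gram ρ x) (β k x) (ddStar ρ σ α k x) ∂(vol n ρ) := by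
  have h := congrArg conj (integral_hm_ddStar hρ σ k hβ hα hK (Or.inr hs))
  rw [← integral_conj, ← integral_conj] at h
  simp_rw [hm_conj (posDef_gram hρ _).isHermitian] at h
  exact h.symm

theorem integral_hm_lap (hρ : IsDBoundedStein n ρ) (k : ℕ) {α β : Form n M}
    (hα : IsSmooth α) (hβ : IsSmooth β) (hK : IsCompact K) (hs : SuppIn K α) :
    ∫ x, hm (gram ρ x) (lap ρ β k x) (α k x) ∂(vol n ρ) =
      ∫ x, hm (gram ρ x) (β k x) (lap ρ α k x) ∂(vol n ρ) := by
  have hKc := hK.isClosed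
  simp_rw [lap_apply, hm_add_left, hm_add_right]
  rw [integral_add (integrable_hm hρ k hα ((hβ.ddStar hρ (-1)).dd (-1)) hK hs)
    (integrable_hm hρ k hα ((hβ.dd (-1)).ddStar hρ (-1)) hK hs),
    integral_add (integrable_hm hρ k ((hα.ddStar hρ (-1)).dd (-1)) hβ hK
      ((hs.ddStar hKc ρ (-1)).dd hKc (-1)))
    (integrable_hm hρ k ((hα.dd (-1)).ddStar hρ (-1)) hβ hK ((hs.dd hKc (-1)).ddStar hKc ρ (-1)))]
  congr 1
  · cases k with
    | zero =>
      have h0 : ∀ γ : Form n M, ∀ x, dd (-1) γ 0 x = 0 := fun _ _ => rfl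
      simp_rw [h0, hm_zero_left, hm_zero_right]
    | succ j =>
      rw [integral_hm_dd hρ (-1) j hα (hβ.ddStar hρ (-1)) hK hs,
        integral_hm_ddStar hρ (-1) j (hα.ddStar hρ (-1)) hβ hK
          (Or.inl (hs.ddStar hKc ρ (-1)))]
  · rw [integral_hm_ddStar hρ (-1) k hα (hβ.dd (-1)) hK (Or.inl hs),
      integral_hm_dd hρ (-1) k (hα.dd (-1)) hβ hK (hs.dd hKc (-1))]

/-- The weak form of the equation `Δ φ = 0` for the Bott–Chern Laplacian. -/
theorem integral_weak_bottChern (hρ : IsDBoundedStein n ρ) (k : ℕ) {φ α : Form n M}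
    (hφ : IsSmooth φ) (hα : IsSmooth α) (hK : IsCompact K) (hs : SuppIn K α)
    (hBC : bottChernLaplacian ρ φ = 0) :
    ∫ x, (hm (gram ρ x) (lap ρ φ k x) (lap ρ α k x) +
      hm (gram ρ x) (dd 1 φ (k + 1) x) (dd 1 α (k + 1) x) +
      hm (gram ρ x) (dd (-1) φ (k + 1) x) (dd (-1) α (k + 1) x)) ∂(vol n ρ) = 0 := by
  have hKc := hK.isClosed
  have h0 : ∀ x, hm (gram ρ x) (lap ρ (lap ρ φ) k x) (α k x) +
      hm (gram ρ x) (ddStar ρ 1 (dd 1 φ) k x) (α k x) +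
      hm (gram ρ x) (ddStar ρ (-1) (dd (-1) φ) k x) (α k x) = 0 := by
    intro x
    rw [← hm_add_left, ← hm_add_left]
    have h1 : lap ρ (lap ρ φ) k x + ddStar ρ 1 (dd 1 φ) k x + ddStar ρ (-1) (dd (-1) φ) k x =
        bottChernLaplacian ρ φ k x := by rw [bottChernLaplacian_eq hρ hφ]; rfl
    rw [h1, hBC]
    exact hm_zero_left _ _
  have hl := hφ.lap hρ
  have hi : ∀ {β γ : Form n M} (j : ℕ), IsSmooth β → IsSmooth γ → SuppIn K γ →
      Integrable (fun x => hm (gram ρ x) (β j x) (γ j x)) (vol n ρ) :=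
    fun j h1 h2 h3 => integrable_hm hρ j h2 h1 hK h3
  have h2 : ∫ x, (hm (gram ρ x) (lap ρ (lap ρ φ) k x) (α k x) +
      hm (gram ρ x) (ddStar ρ 1 (dd 1 φ) k x) (α k x) +
      hm (gram ρ x) (ddStar ρ (-1) (dd (-1) φ) k x) (α k x)) ∂(vol n ρ) = 0 := by
    simp_rw [h0]
    exact integral_zero _ _
  -- In each term one operator is moved from `φ` to the compactly supported form `α`; no decay of
  -- `φ` is needed here.
  rw [integral_add_add (hi k (hl.lap hρ) hα hs) (hi k ((hφ.dd 1).ddStar hρ 1) hα hs)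
      (hi k ((hφ.dd (-1)).ddStar hρ (-1)) hα hs),
    integral_hm_lap hρ k hα hl hK hs,
    integral_hm_ddStar hρ 1 k hα (hφ.dd 1) hK (Or.inl hs),
    integral_hm_ddStar hρ (-1) k hα (hφ.dd (-1)) hK (Or.inl hs)] at h2
  rw [integral_add_add (hi k hl (hα.lap hρ) (hs.lap hKc ρ))
      (hi (k + 1) (hφ.dd 1) (hα.dd 1) (hs.dd hKc 1))
      (hi (k + 1) (hφ.dd (-1)) (hα.dd (-1)) (hs.dd hKc (-1))), h2]

end Manifold

end BottChern

end

/-! ### Commutators of the operators with multiplication by a function, through principal symbols.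
-/

noncomputable section

open scoped Manifold ContDiff ComplexConjugate Topology

namespace BottChern

open ContinuousAlternatingMap (alternatizeUncurryFin alternatizeUncurryFin_apply
  alternatizeUncurryFinCLM)

/-! ### Commutators with multiplication operators -/

section Abstract

variable {E F G : Type*} [NormedAddCommGroup E] [NormedSpace ℝ E] [NormedAddCommGroup F]
  [NormedSpace ℝ F] [NormedAddCommGroup G] [NormedSpace ℝ G]

/-- The symbol `(ℓ, a) ↦ Λ(ℓ ⊗ a)` of the first-order operator with coefficients `Λ`. -/
def symb (Λ : (E →L[ℝ] F) →L[ℝ] G) : (E →L[ℝ] ℝ) →L[ℝ] F →L[ℝ] G :=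
  (ContinuousLinearMap.compL ℝ F (E →L[ℝ] F) G Λ).comp (ContinuousLinearMap.smulRightL ℝ E F)

theorem symb_apply (Λ : (E →L[ℝ] F) →L[ℝ] G) (ℓ : E →L[ℝ] ℝ) (a : F) :
    symb Λ ℓ a = Λ (ℓ.smulRight a) := rfl

theorem hasFDerivAt_symb {H : Type*} [NormedAddCommGroup H] [NormedSpace ℝ H]
    (B : H →L[ℝ] F →L[ℝ] G) {p : E → H} {q : E → F} {p' : E →L[ℝ] H} {q' : E →L[ℝ] F} {y : E}
    (hp : HasFDerivAt p p' y) (hq : HasFDerivAt q q' y) :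
    HasFDerivAt (fun z => B (p z) (q z)) ((B.flip (q y)).comp p' + (B (p y)).comp q') y := by
  refine (B.hasFDerivAt_of_bilinear hp hq).congr_fderiv ?_
  ext u
  simp [add_comm]

/-- By the Leibniz rule, the commutator of a first-order operator with multiplication by `f` has
order zero: it is the symbol evaluated at `df`. -/
theorem clm_fderiv_smul (Λ : (E →L[ℝ] F) →L[ℝ] G) {f : E → ℝ} {N : E → F} {y : E}
    (hf : DifferentiableAt ℝ f y) (hN : DifferentiableAt ℝ N y) :
    Λ (fderiv ℝ (fun z => f z • N z) y) =
      f y • Λ (fderiv ℝ N y) + symb Λ (fderiv ℝ f y) (N y) := by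
  rw [fderiv_fun_smul hf hN, map_add, map_smul]
  rfl

/-- The linear map `L ↦ -∑ Aᵢ(L(vᵢ))`. -/
def negContr {ι : Type*} [Fintype ι] (A : ι → F →L[ℝ] G) (v : ι → E) : (E →L[ℝ] F) →L[ℝ] G :=
  -∑ i, (A i).comp (ContinuousLinearMap.apply ℝ F (v i))

theorem negContr_apply {ι : Type*} [Fintype ι] (A : ι → F →L[ℝ] G) (v : ι → E) (L : E →L[ℝ] F) :
    negContr A v L = -∑ i, A i (L (v i)) := by
  simp [negContr]

end Abstract

/-- The symbol of the adjoint of `dd σ` for the standard metric. -/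
def coPart (n k : ℕ) (σ : ℝ) : (Cn n →L[ℝ] Alt n (k + 1)) →L[ℝ] Alt n k :=
  (negContr (fun i : Idx n => (iota (vec i) : Alt n (k + 1) →L[ℝ] Alt n k)) vec).comp (partL (-σ))

theorem coPart_apply {n k : ℕ} (σ : ℝ) (L : Cn n →L[ℝ] Alt n (k + 1)) :
    coPart n k σ L = -trace (part (-σ) L) := by
  rw [coPart, ContinuousLinearMap.comp_apply, partL_apply]
  exact negContr_apply (fun i : Idx n => (iota (vec i) : Alt n (k + 1) →L[ℝ] Alt n k)) vec
    (part (-σ) L)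

/-- The flat symbol of the adjoint is the symbol of `dd σ` conjugated by `∗`. It serves to
differentiate `fcommStar`, written as `∗ fcomm ∗`. -/
theorem hodge_altPart_hodge {n k l : ℕ} (h : k + 1 + l = n * 2) (h' : l + 1 + k = n * 2) (σ : ℝ)
    (L : Cn n →L[ℝ] Alt n (k + 1)) :
    hodge h' 1 (altPart n l σ ((hodgeL h 1).comp L)) = -coPart n k σ L := by
  rw [altPart_apply, coPart_apply, hodge_part, alternatize_hodge_one (k := k) (l := l) h (by omega),
    hodge_smul, hodge_hodge_one, smul_smul, neg_neg]
  simp [← mul_pow]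

theorem hodge_symb_hodge {n k l : ℕ} (h : k + 1 + l = n * 2) (h' : l + 1 + k = n * 2) (σ : ℝ)
    (ℓ : Cn n →L[ℝ] ℝ) (a : Alt n (k + 1)) :
    hodge h' 1 (symb (altPart n l σ) ℓ (hodge h 1 a)) = -symb (coPart n k σ) ℓ a := by
  rw [symb_apply, symb_apply, ← hodge_altPart_hodge h h']
  congr 2
  ext1 v
  exact (hodge_real_smul h 1 (ℓ v) a).symm

theorem fmul_add {n : ℕ} {M : Type*} (f : M → ℝ) (φ φ' : Form n M) :
    fmul f (φ + φ') = fmul f φ + fmul f φ' := by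
  funext k x
  ext v
  exact smul_add (f x) (φ k x v) (φ' k x v)

theorem fmul_neg {n : ℕ} {M : Type*} (f : M → ℝ) (φ : Form n M) : fmul f (-φ) = -fmul f φ := by
  funext k x
  ext v
  exact smul_neg (f x) (φ k x v)

section Forms

variable {n : ℕ} {M : Type*} [TopologicalSpace M] [ChartedSpace (Cn n) M]

/-- The commutator of `dd σ` with the multiplication by `f`. -/
def fcomm (σ : ℝ) (f : M → ℝ) (φ : Form n M) : Form n M := dd σ (fmul f φ) - fmul f (dd σ φ)

/-- The commutator of `ddStar ρ σ` with the multiplication by `f`. -/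
def fcommStar (ρ : M → ℝ) (σ : ℝ) (f : M → ℝ) (φ : Form n M) : Form n M :=
  ddStar ρ σ (fmul f φ) - fmul f (ddStar ρ σ φ)

theorem star_fmul (ρ : M → ℝ) (f : M → ℝ) (φ : Form n M) :
    star ρ (fmul f φ) = fmul f (star ρ φ) := by
  funext k x
  by_cases hk : k ≤ n * 2
  · change _ = f x • star ρ φ k x
    rw [star_apply (Nat.sub_add_cancel hk), star_apply (Nat.sub_add_cancel hk), ← hodge_real_smul]
    rfl
  · have := subsingleton_of_lt (n := n) (k := k) (by omega)
    exact Subsingleton.elim _ _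

theorem fcommStar_eq (ρ : M → ℝ) (σ : ℝ) (f : M → ℝ) (φ : Form n M) :
    fcommStar ρ σ f φ = -star ρ (fcomm σ f (star ρ φ)) := by
  rw [fcommStar, fcomm, sub_eq_add_neg, sub_eq_add_neg, star_add, star_neg, ddStar, ddStar,
    star_fmul, star_fmul, fmul_neg, neg_add]

theorem nrep_fmul {x : M} {ψ : Cn n → Cn n} (f : M → ℝ) (φ : Form n M) (k : ℕ) :
    nrep x ψ (fmul f φ) k =
      fun z => f ((chartAt (Cn n) x).symm (ψ z)) • nrep x ψ φ k z := rfl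

variable [IsManifold 𝓘(ℂ, Cn n) ω M] {ρ : M → ℝ} {f : M → ℝ} {x : M} {ψ : Cn n → Cn n}

theorem IsSmooth.fcomm (σ : ℝ) (hf : ContMDiff 𝓘(ℝ, Cn n) 𝓘(ℝ, ℝ) ∞ f) {φ : Form n M}
    (hφ : IsSmooth φ) : IsSmooth (fcomm σ f φ) := ((hφ.fmul hf).dd σ).sub ((hφ.dd σ).fmul hf)

theorem IsSmooth.fcommStar (hρ : IsDBoundedStein n ρ) (σ : ℝ)
    (hf : ContMDiff 𝓘(ℝ, Cn n) 𝓘(ℝ, ℝ) ∞ f) {φ : Form n M} (hφ : IsSmooth φ) :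
    IsSmooth (fcommStar ρ σ f φ) :=
  ((hφ.fmul hf).ddStar hρ σ).sub ((hφ.ddStar hρ σ).fmul hf)

/-- The commutator terms are grouped in two pairs, the commutators of `f` with `∂∂*` and with `∂*∂`.
Each pair is later estimated on its own as the commutator of one composite `Q P`. -/
theorem lap_fmul (hρ : IsDBoundedStein n ρ) (hf : ContMDiff 𝓘(ℝ, Cn n) 𝓘(ℝ, ℝ) ∞ f)
    {φ : Form n M} (hφ : IsSmooth φ) : lap ρ (fmul f φ) = fmul f (lap ρ φ) +
      (fcomm (-1) f (ddStar ρ (-1) φ) + dd (-1) (fcommStar ρ (-1) f φ) +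
        (fcommStar ρ (-1) f (dd (-1) φ) + ddStar ρ (-1) (fcomm (-1) f φ))) := by
  have h1 : ddStar ρ (-1) (fmul f φ) = fmul f (ddStar ρ (-1) φ) + fcommStar ρ (-1) f φ := by
    rw [fcommStar, add_sub_cancel]
  have h2 : dd (-1) (fmul f φ) = fmul f (dd (-1) φ) + fcomm (-1) f φ := by
    rw [fcomm, add_sub_cancel]
  have h3 : dd (-1) (fmul f (ddStar ρ (-1) φ)) = fmul f (dd (-1) (ddStar ρ (-1) φ)) +
      fcomm (-1) f (ddStar ρ (-1) φ) := by
    rw [fcomm, add_sub_cancel]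
  have h4 : ddStar ρ (-1) (fmul f (dd (-1) φ)) = fmul f (ddStar ρ (-1) (dd (-1) φ)) +
      fcommStar ρ (-1) f (dd (-1) φ) := by
    rw [fcommStar, add_sub_cancel]
  rw [lap, lap, h1, h2, dd_add (-1) ((hφ.ddStar hρ (-1)).fmul hf) (hφ.fcommStar hρ (-1) hf),
    ddStar_add (-1) hρ ((hφ.dd (-1)).fmul hf) (hφ.fcomm (-1) hf), h3, h4, fmul_add]
  abel

theorem IsNormal.contDiffAt_fun (h : IsNormal ρ x ψ) (hf : ContMDiff 𝓘(ℝ, Cn n) 𝓘(ℝ, ℝ) ∞ f) :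
    ContDiffAt ℝ ∞ (fun z => f ((chartAt (Cn n) x).symm (ψ z))) 0 :=
  (contDiffAt_comp_symm hf (chart_mem_atlas _ x)
    (by rw [h.map_zero]; exact mem_chart_target _ x)).comp 0 h.hol.contDiffAt

theorem eventually_differentiableAt {E F : Type*} [NormedAddCommGroup E] [NormedSpace ℝ E]
    [NormedAddCommGroup F] [NormedSpace ℝ F] {f : E → F} {y : E} (h : ContDiffAt ℝ ∞ f y) :
    ∀ᶠ z in 𝓝 y, DifferentiableAt ℝ f z := by
  have h2 := (h.of_le (m := 1) (WithTop.coe_le_coe.2 le_top)).eventually (by simp)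
  filter_upwards [h2] with z hz using hz.differentiableAt (by simp)

theorem IsNormal.nrep_fcomm (h : IsNormal ρ x ψ) (σ : ℝ)
    (hf : ContMDiff 𝓘(ℝ, Cn n) 𝓘(ℝ, ℝ) ∞ f) {φ : Form n M} (hφ : IsSmooth φ) (k : ℕ) :
    nrep x ψ (fcomm σ f φ) (k + 1) =ᶠ[𝓝 0] fun z => symb (altPart n k σ)
      (fderiv ℝ (fun z => f ((chartAt (Cn n) x).symm (ψ z))) z) (nrep x ψ φ k z) := by
  filter_upwards [h.nrep_dd σ hφ k, h.nrep_dd σ (hφ.fmul hf) k,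
    eventually_differentiableAt (h.contDiffAt_fun hf),
    eventually_differentiableAt (h.contDiffAt_nrep hφ k)] with z h1 h2 h3 h4
  rw [fcomm, nrep_sub, h2, nrep_fmul, nrep_fmul, lpd_eq, clm_fderiv_smul _ h3 h4]
  beta_reduce
  rw [h1, lpd_eq, add_sub_cancel_left]

theorem IsNormal.hasFDerivAt_fderiv_fun (h : IsNormal ρ x ψ)
    (hf : ContMDiff 𝓘(ℝ, Cn n) 𝓘(ℝ, ℝ) ∞ f) :
    HasFDerivAt (fderiv ℝ (fun z => f ((chartAt (Cn n) x).symm (ψ z))))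
      (fderiv ℝ (fderiv ℝ (fun z => f ((chartAt (Cn n) x).symm (ψ z)))) 0) 0 :=
  (((h.contDiffAt_fun hf).fderiv_right (m := ∞) (by simp)).differentiableAt (by simp)).hasFDerivAt

theorem IsNormal.fderiv_nrep_fcomm (h : IsNormal ρ x ψ) (σ : ℝ)
    (hf : ContMDiff 𝓘(ℝ, Cn n) 𝓘(ℝ, ℝ) ∞ f) {φ : Form n M} (hφ : IsSmooth φ) (k : ℕ) :
    fderiv ℝ (nrep x ψ (fcomm σ f φ) (k + 1)) 0 =
      ((symb (altPart n k σ)).flip (nrep x ψ φ k 0)).comp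
        (fderiv ℝ (fderiv ℝ (fun z => f ((chartAt (Cn n) x).symm (ψ z)))) 0) +
      (symb (altPart n k σ) (fderiv ℝ (fun z => f ((chartAt (Cn n) x).symm (ψ z))) 0)).comp
        (fderiv ℝ (nrep x ψ φ k) 0) := by
  rw [(h.nrep_fcomm σ hf hφ k).fderiv_eq]
  exact (hasFDerivAt_symb (symb (altPart n k σ)) (h.hasFDerivAt_fderiv_fun hf)
    (h.hasFDerivAt_nrep hφ k)).fderiv

theorem IsNormal.nrep_fcommStar (hρ : IsDBoundedStein n ρ) (h : IsNormal ρ x ψ) (σ : ℝ)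
    (hf : ContMDiff 𝓘(ℝ, Cn n) 𝓘(ℝ, ℝ) ∞ f) {φ : Form n M} (hφ : IsSmooth φ) (k : ℕ) :
    nrep x ψ (fcommStar ρ σ f φ) k 0 = symb (coPart n k σ)
      (fderiv ℝ (fun z => f ((chartAt (Cn n) x).symm (ψ z))) 0) (nrep x ψ φ (k + 1) 0) := by
  rw [fcommStar, nrep_sub, nrep_fmul]
  beta_reduce
  rw [h.nrep_ddStar hρ σ (hφ.fmul hf), h.nrep_ddStar hρ σ hφ,
    ← coPart_apply, ← coPart_apply, nrep_fmul,
    clm_fderiv_smul _ ((h.contDiffAt_fun hf).differentiableAt (by simp))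
      ((h.contDiffAt_nrep hφ (k + 1)).differentiableAt (by simp)), add_sub_cancel_left]

/-- `nrep_fcommStar` holds at the centre only, since it relies on the flat form of the adjoint, and
so it cannot be differentiated. Instead one writes `fcommStar` as `-∗ fcomm ∗`: the formula for
`fcomm` holds on a neighbourhood, and `∗` is stationary at the centre. -/
theorem IsNormal.fderiv_nrep_fcommStar (hρ : IsDBoundedStein n ρ) (h : IsNormal ρ x ψ) (σ : ℝ)
    (hf : ContMDiff 𝓘(ℝ, Cn n) 𝓘(ℝ, ℝ) ∞ f) {φ : Form n M} (hφ : IsSmooth φ) {k : ℕ}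
    (hk : k + 1 ≤ n * 2) :
    fderiv ℝ (nrep x ψ (fcommStar ρ σ f φ) k) 0 =
      ((symb (coPart n k σ)).flip (nrep x ψ φ (k + 1) 0)).comp
        (fderiv ℝ (fderiv ℝ (fun z => f ((chartAt (Cn n) x).symm (ψ z)))) 0) +
      (symb (coPart n k σ) (fderiv ℝ (fun z => f ((chartAt (Cn n) x).symm (ψ z))) 0)).comp
        (fderiv ℝ (nrep x ψ φ (k + 1)) 0) := by
  obtain ⟨l, hl⟩ := Nat.exists_eq_add_of_le hk
  have h1 : k + 1 + l = n * 2 := hl.symm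
  have h2 : l + 1 + k = n * 2 := by omega
  have hX := (hφ.star hρ).fcomm σ hf
  have h3 : fderiv ℝ (nrep x ψ (fcommStar ρ σ f φ) k) 0 =
      -(hodgeL h2 1).comp (fderiv ℝ (nrep x ψ (fcomm σ f (star ρ φ)) (l + 1)) 0) := by
    rw [← h.fderiv_nrep_star_apply hρ hX h2, fcommStar_eq]
    exact fderiv_fun_neg (𝕜 := ℝ) (f := nrep x ψ (star ρ (fcomm σ f (star ρ φ))) k)
  rw [h3, h.fderiv_nrep_fcomm σ hf (hφ.star hρ) l, h.nrep_star_apply hρ φ h1,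
    h.fderiv_nrep_star_apply hρ hφ h1]
  ext1 u
  simp only [_root_.neg_apply, ContinuousLinearMap.comp_apply, _root_.add_apply,
    ContinuousLinearMap.flip_apply, hodgeL_apply, hodge_add, hodge_symb_hodge h1 h2]
  rw [neg_add, neg_neg, neg_neg]

end Forms

end BottChern

end

/-! ### Norm bounds for symbols; composites of opposite type see only the `i`-invariant Hessian. -/

noncomputable section

open scoped Manifold ContDiff ComplexConjugate Topology

namespace BottChern

/-! ### Norm estimates on `ℂⁿ` -/

theorem re_hm_one {n k : ℕ} (α : Alt n k) :
    (hm 1 α α).re = (k.factorial : ℝ)⁻¹ * ∑ s, ‖comps α s‖ ^ 2 := by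
  rw [hm, herm_one]
  have h1 : ∀ s, comps α s * conj (comps α s) = ((‖comps α s‖ ^ 2 : ℝ) : ℂ) := fun s => by
    rw [Complex.mul_conj, Complex.normSq_eq_norm_sq]
  simp_rw [h1]
  rw [← Complex.ofReal_sum, ← Complex.ofReal_natCast, ← Complex.ofReal_inv, ← Complex.ofReal_mul,
    Complex.ofReal_re]

theorem re_hm_one_nonneg {n k : ℕ} (α : Alt n k) : 0 ≤ (hm 1 α α).re := by
  rw [re_hm_one]
  positivity

theorem exists_norm_sq_le (n k : ℕ) : ∃ C : ℝ, 0 ≤ C ∧ ∀ α : Alt n k,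
    ‖α‖ ^ 2 ≤ C * (hm 1 α α).re := by
  obtain ⟨K, hK, h⟩ := (compsLin n k).exists_antilipschitzWith
    (LinearMap.ker_eq_bot.2 comps_injective)
  refine ⟨(K : ℝ) ^ 2 * k.factorial, by positivity, fun α => ?_⟩
  have h1 : ‖α‖ ≤ K * ‖compsLin n k α‖ := by
    have h2 := h.le_mul_dist α 0
    simpa using h2
  have h3 : ‖compsLin n k α‖ ^ 2 ≤ ∑ s, ‖comps α s‖ ^ 2 := by
    have h4 : ‖compsLin n k α‖ ≤ √(∑ s, ‖comps α s‖ ^ 2) := by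
      refine (pi_norm_le_iff_of_nonneg (Real.sqrt_nonneg _)).2 fun s => ?_
      refine Real.le_sqrt_of_sq_le ?_
      exact Finset.single_le_sum (f := fun s => ‖comps α s‖ ^ 2) (fun _ _ => sq_nonneg _)
        (Finset.mem_univ s)
    calc ‖compsLin n k α‖ ^ 2 ≤ √(∑ s, ‖comps α s‖ ^ 2) ^ 2 := by gcongr
      _ = _ := Real.sq_sqrt (Finset.sum_nonneg fun _ _ => sq_nonneg _)
  have hf : (0 : ℝ) < k.factorial := by exact_mod_cast k.factorial_pos
  calc ‖α‖ ^ 2 ≤ (K * ‖compsLin n k α‖) ^ 2 := by gcongr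
    _ = K ^ 2 * ‖compsLin n k α‖ ^ 2 := by ring
    _ ≤ K ^ 2 * ∑ s, ‖comps α s‖ ^ 2 := by gcongr
    _ = K ^ 2 * k.factorial * (hm 1 α α).re := by
      rw [re_hm_one]
      field_simp

theorem exists_bilin_bound {E F G : Type*} [NormedAddCommGroup E] [NormedSpace ℝ E]
    [NormedAddCommGroup F] [NormedSpace ℝ F] [NormedAddCommGroup G] [NormedSpace ℝ G]
    (B : E →L[ℝ] F →L[ℝ] G) : ∃ C : ℝ, 0 ≤ C ∧ ∀ a b, ‖B a b‖ ≤ C * ‖a‖ * ‖b‖ :=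
  ⟨‖B‖, norm_nonneg B, B.le_opNorm₂⟩

theorem exists_norm_hm_le (n k : ℕ) : ∃ C : ℝ, 0 ≤ C ∧ ∀ α β : Alt n k,
    ‖hm 1 α β‖ ≤ C * ‖α‖ * ‖β‖ :=
  exists_bilin_bound (E := Alt n k) (F := Alt n k) (hmB n k 1)

theorem abs_coord_le {n : ℕ} (i : Idx n) (v : Cn n) : |coord i v| ≤ ‖v‖ := by
  obtain ⟨j, c⟩ := i
  have h := norm_le_pi_norm v j
  fin_cases c
  · exact (Complex.abs_re_le_norm _).trans h
  · exact (Complex.abs_im_le_norm _).trans h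

theorem opNorm_sq_le {n : ℕ} {V : Type*} [NormedAddCommGroup V] [NormedSpace ℝ V]
    (L : Cn n →L[ℝ] V) : ‖L‖ ^ 2 ≤ Fintype.card (Idx n) * ∑ i, ‖L (vec i)‖ ^ 2 := by
  have h1 : ‖L‖ ≤ ∑ i, ‖L (vec i)‖ := by
    refine L.opNorm_le_bound (Finset.sum_nonneg fun _ _ => norm_nonneg _) fun v => ?_
    have h2 : L v = ∑ i, coord i v • L (vec i) := by
      conv_lhs => rw [← sum_coord_smul_vec v]
      simp only [map_sum, map_smul]
    rw [h2, Finset.sum_mul]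
    refine norm_sum_le_of_le _ fun i _ => ?_
    rw [norm_smul, mul_comm]
    exact mul_le_mul_of_nonneg_left (abs_coord_le i v) (norm_nonneg _)
  calc ‖L‖ ^ 2 ≤ (∑ i, ‖L (vec i)‖) ^ 2 := by gcongr
    _ ≤ _ := sq_sum_le_card_mul_sum_sq

/-! ### Mixed second derivatives -/

/-- The bilinear form `(u, v) ↦ H(iu, iv)`. -/
def conjI {n : ℕ} (H : Cn n →L[ℝ] Cn n →L[ℝ] ℝ) : Cn n →L[ℝ] Cn n →L[ℝ] ℝ :=
  (ContinuousLinearMap.precomp ℝ (mulI n)).comp (H.comp (mulI n))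

theorem conjI_apply {n : ℕ} (H : Cn n →L[ℝ] Cn n →L[ℝ] ℝ) (u : Cn n) :
    conjI H u = (H (Complex.I • u)).comp (mulI n) := rfl

section Symbols

variable {n : ℕ} {V W U : Type*} [NormedAddCommGroup V] [NormedSpace ℝ V]
  [NormedAddCommGroup W] [NormedSpace ℝ W] [NormedAddCommGroup U] [NormedSpace ℝ U]

theorem norm_symb_le (P : (Cn n →L[ℝ] V) →L[ℝ] W) (ℓ : Cn n →L[ℝ] ℝ) (a : V) :
    ‖symb P ℓ a‖ ≤ ‖P‖ * ‖ℓ‖ * ‖a‖ := by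
  rw [symb_apply]
  refine (P.le_opNorm _).trans ?_
  rw [ContinuousLinearMap.norm_smulRight_apply, mul_assoc]

theorem norm_symb_flip_comp_le (P : (Cn n →L[ℝ] V) →L[ℝ] W) (Q : (Cn n →L[ℝ] W) →L[ℝ] U)
    (H : Cn n →L[ℝ] Cn n →L[ℝ] ℝ) (a : V) :
    ‖Q (((symb P).flip a).comp H)‖ ≤ ‖Q‖ * ‖P‖ * ‖H‖ * ‖a‖ := by
  have h1 : ‖((symb P).flip a).comp H‖ ≤ ‖P‖ * ‖H‖ * ‖a‖ := by
    refine ContinuousLinearMap.opNorm_le_bound _ (by positivity) fun u => ?_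
    refine (norm_symb_le P (H u) a).trans ?_
    have := H.le_opNorm u
    calc ‖P‖ * ‖H u‖ * ‖a‖ ≤ ‖P‖ * (‖H‖ * ‖u‖) * ‖a‖ := by gcongr
      _ = _ := by ring
  calc _ ≤ ‖Q‖ * ‖((symb P).flip a).comp H‖ := Q.le_opNorm _
    _ ≤ ‖Q‖ * (‖P‖ * ‖H‖ * ‖a‖) := by gcongr
    _ = _ := by ring

theorem norm_symb_comp_le (P : (Cn n →L[ℝ] V) →L[ℝ] W) (Q : (Cn n →L[ℝ] W) →L[ℝ] U)
    (ℓ : Cn n →L[ℝ] ℝ) (L : Cn n →L[ℝ] V) :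
    ‖Q ((symb P ℓ).comp L)‖ ≤ ‖Q‖ * ‖P‖ * ‖ℓ‖ * ‖L‖ := by
  have h1 : ‖(symb P ℓ).comp L‖ ≤ ‖P‖ * ‖ℓ‖ * ‖L‖ := by
    refine ContinuousLinearMap.opNorm_le_bound _ (by positivity) fun u => ?_
    refine (norm_symb_le P ℓ (L u)).trans ?_
    have := L.le_opNorm u
    calc ‖P‖ * ‖ℓ‖ * ‖L u‖ ≤ ‖P‖ * ‖ℓ‖ * (‖L‖ * ‖u‖) := by gcongr
      _ = _ := by ring
  calc _ ≤ ‖Q‖ * ‖(symb P ℓ).comp L‖ := Q.le_opNorm _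
    _ ≤ ‖Q‖ * (‖P‖ * ‖ℓ‖ * ‖L‖) := by gcongr
    _ = _ := by ring

theorem exists_norm_symb_le (P : (Cn n →L[ℝ] V) →L[ℝ] W) {D : ℝ} (hD : 0 ≤ D) :
    ∃ C : ℝ, 0 ≤ C ∧ ∀ (ℓ : Cn n →L[ℝ] ℝ) (a : V) (p ε : ℝ), ‖ℓ‖ ≤ D → |p| ≤ ε →
      ‖symb P (p • ℓ) a‖ ≤ C * ε * ‖a‖ := by
  refine ⟨‖P‖ * D, by positivity, fun ℓ a p ε hℓ hp => (norm_symb_le P _ a).trans ?_⟩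
  have hε : 0 ≤ ε := (abs_nonneg _).trans hp
  rw [norm_smul, Real.norm_eq_abs]
  calc ‖P‖ * (|p| * ‖ℓ‖) * ‖a‖ ≤ ‖P‖ * (ε * D) * ‖a‖ := by gcongr
    _ = _ := by ring

end Symbols

section Mixed

variable {n : ℕ} {V W U : Type*} [NormedAddCommGroup V] [NormedSpace ℝ V]
  [NormedAddCommGroup W] [NormedSpace ℝ W] [NormedSpace ℂ W] [SMulCommClass ℝ ℂ W]
  [NormedAddCommGroup U] [NormedSpace ℝ U] [NormedSpace ℂ U]

/-- Rotating both slots of the Hessian by `i` produces a factor `c` from `P`, and the rotation left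
in the slot of `Q` cancels it, because the two symbols have opposite types. Hence `Q P` does not
distinguish `H` from `H(i·, i·)`. -/
theorem mixed_conjI {c : ℂ} (P : (Cn n →L[ℝ] V) →L[ℝ] W) (Q : (Cn n →L[ℝ] W) →L[ℝ] U)
    (hP : ∀ L, P (L.comp (mulI n)) = c • P L)
    (hQ : ∀ N, c • Q (N.comp (mulI n)) = Q N)
    (hQc : ∀ N : Cn n →L[ℝ] W, Q (c • N) = c • Q N) (H : Cn n →L[ℝ] Cn n →L[ℝ] ℝ) (a : V) :
    Q (((symb P).flip a).comp (conjI H)) = Q (((symb P).flip a).comp H) := by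
  have h1 : ((symb P).flip a).comp (conjI H) =
      c • (((symb P).flip a).comp H).comp (mulI n) := by
    ext1 u
    change P ((conjI H u).smulRight a) = c • P ((H (Complex.I • u)).smulRight a)
    rw [← hP]
    rfl
  rw [h1, hQc, hQ]

/-- A mixed second-order symbol only sees the `i`-invariant part of a Hessian. -/
theorem norm_mixed_le {c : ℂ} (P : (Cn n →L[ℝ] V) →L[ℝ] W) (Q : (Cn n →L[ℝ] W) →L[ℝ] U)
    (hP : ∀ L, P (L.comp (mulI n)) = c • P L)
    (hQ : ∀ N, c • Q (N.comp (mulI n)) = Q N)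
    (hQc : ∀ N : Cn n →L[ℝ] W, Q (c • N) = c • Q N) (H : Cn n →L[ℝ] Cn n →L[ℝ] ℝ)
    (ℓ : Cn n →L[ℝ] ℝ) (a : V) (p q D B : ℝ) (hℓ : ‖ℓ‖ ≤ D)
    (hH : ‖(1 / 2 : ℝ) • (H + conjI H)‖ ≤ B) :
    ‖Q (((symb P).flip a).comp (p • ℓ.smulRight ℓ + q • H))‖ ≤
      ‖Q‖ * ‖P‖ * (|p| * D ^ 2 + |q| * B) * ‖a‖ := by
  have h1 : ∀ H₁ H₂ : Cn n →L[ℝ] Cn n →L[ℝ] ℝ, Q (((symb P).flip a).comp (H₁ + H₂)) =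
      Q (((symb P).flip a).comp H₁) + Q (((symb P).flip a).comp H₂) := fun H₁ H₂ => by
    rw [ContinuousLinearMap.comp_add, map_add]
  have h2 : ∀ (r : ℝ) (H₁ : Cn n →L[ℝ] Cn n →L[ℝ] ℝ), Q (((symb P).flip a).comp (r • H₁)) =
      r • Q (((symb P).flip a).comp H₁) := fun r H₁ => by
    rw [ContinuousLinearMap.comp_smul, map_smul]
  -- The Hessian may be replaced by its average with `H(i·, i·)`, the only part assumed to be
  -- bounded.
  have h3 : Q (((symb P).flip a).comp H) =
      Q (((symb P).flip a).comp ((1 / 2 : ℝ) • (H + conjI H))) := by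
    rw [h2, h1, mixed_conjI P Q hP hQ hQc, ← two_smul ℝ, smul_smul]
    norm_num
  have hD : 0 ≤ D := (norm_nonneg _).trans hℓ
  have h4 : ‖ℓ.smulRight ℓ‖ ≤ D ^ 2 := by
    rw [ContinuousLinearMap.norm_smulRight_apply, sq]
    gcongr
  rw [h1, h2, h2, h3]
  refine (norm_add_le _ _).trans ?_
  rw [norm_smul, norm_smul, Real.norm_eq_abs, Real.norm_eq_abs]
  have h5 := norm_symb_flip_comp_le P Q (ℓ.smulRight ℓ) a
  have h6 := norm_symb_flip_comp_le P Q ((1 / 2 : ℝ) • (H + conjI H)) a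
  calc _ ≤ |p| * (‖Q‖ * ‖P‖ * ‖ℓ.smulRight ℓ‖ * ‖a‖) +
        |q| * (‖Q‖ * ‖P‖ * ‖(1 / 2 : ℝ) • (H + conjI H)‖ * ‖a‖) := by gcongr
    _ ≤ |p| * (‖Q‖ * ‖P‖ * D ^ 2 * ‖a‖) + |q| * (‖Q‖ * ‖P‖ * B * ‖a‖) := by gcongr
    _ = _ := by ring

/-- The bound for the commutator of the second-order operator `Q P` with a function `g ∘ r`, whose
first and second derivatives are `p ℓ` and `q ℓ ⊗ ℓ + p H`. -/
theorem norm_pair_le {c : ℂ} (P : (Cn n →L[ℝ] V) →L[ℝ] W) (Q : (Cn n →L[ℝ] W) →L[ℝ] U)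
    (hP : ∀ L, P (L.comp (mulI n)) = c • P L)
    (hQ : ∀ N, c • Q (N.comp (mulI n)) = Q N)
    (hQc : ∀ N : Cn n →L[ℝ] W, Q (c • N) = c • Q N) (H : Cn n →L[ℝ] Cn n →L[ℝ] ℝ)
    (ℓ : Cn n →L[ℝ] ℝ) (a : V) (L : Cn n →L[ℝ] V) {p q D B ε : ℝ} (hℓ : ‖ℓ‖ ≤ D)
    (hH : ‖(1 / 2 : ℝ) • (H + conjI H)‖ ≤ B) (hp : |p| ≤ ε) (hq : |q| ≤ ε) :
    ‖symb Q (p • ℓ) (P L) + Q (((symb P).flip a).comp (q • ℓ.smulRight ℓ + p • H) +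
      (symb P (p • ℓ)).comp L)‖ ≤
      ‖Q‖ * ‖P‖ * (2 * D + D ^ 2 + B) * ε * (‖a‖ + ‖L‖) := by
  have hD : 0 ≤ D := (norm_nonneg _).trans hℓ
  have hB : 0 ≤ B := (norm_nonneg ((1 / 2 : ℝ) • (H + conjI H))).trans hH
  have hε : 0 ≤ ε := (abs_nonneg _).trans hp
  have h1 : ‖p • ℓ‖ ≤ ε * D := by
    rw [norm_smul, Real.norm_eq_abs]
    gcongr
  have h2 : ‖symb Q (p • ℓ) (P L)‖ ≤ ‖Q‖ * (ε * D) * (‖P‖ * ‖L‖) := by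
    refine (norm_symb_le Q _ _).trans ?_
    have := P.le_opNorm L
    gcongr
  have h3 : ‖Q ((symb P (p • ℓ)).comp L)‖ ≤ ‖Q‖ * ‖P‖ * (ε * D) * ‖L‖ := by
    refine (norm_symb_comp_le P Q _ _).trans ?_
    gcongr
  have h4 : ‖Q (((symb P).flip a).comp (q • ℓ.smulRight ℓ + p • H))‖ ≤
      ‖Q‖ * ‖P‖ * (ε * D ^ 2 + ε * B) * ‖a‖ := by
    refine (norm_mixed_le P Q hP hQ hQc H ℓ a q p D B hℓ hH).trans ?_
    gcongr
  rw [map_add]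
  refine (norm_add_le _ _).trans ((add_le_add h2 ((norm_add_le _ _).trans (add_le_add h4 h3))).trans ?_)
  have h5 : 0 ≤ ‖Q‖ * ‖P‖ * (2 * D * ε * ‖a‖ + (D ^ 2 + B) * ε * ‖L‖) := by positivity
  nlinarith [h5]

theorem exists_norm_pair_le {c : ℂ} (P : (Cn n →L[ℝ] V) →L[ℝ] W) (Q : (Cn n →L[ℝ] W) →L[ℝ] U)
    (hP : ∀ L, P (L.comp (mulI n)) = c • P L)
    (hQ : ∀ N, c • Q (N.comp (mulI n)) = Q N)
    (hQc : ∀ N : Cn n →L[ℝ] W, Q (c • N) = c • Q N) {D B : ℝ} (hD : 0 ≤ D) (hB : 0 ≤ B) :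
    ∃ C : ℝ, 0 ≤ C ∧ ∀ (H : Cn n →L[ℝ] Cn n →L[ℝ] ℝ) (ℓ : Cn n →L[ℝ] ℝ) (a : V)
      (L : Cn n →L[ℝ] V) (p q ε : ℝ), ‖ℓ‖ ≤ D → ‖(1 / 2 : ℝ) • (H + conjI H)‖ ≤ B →
      |p| ≤ ε → |q| ≤ ε →
      ‖symb Q (p • ℓ) (P L) + Q (((symb P).flip a).comp (q • ℓ.smulRight ℓ + p • H) +
        (symb P (p • ℓ)).comp L)‖ ≤ C * ε * (‖a‖ + ‖L‖) :=
  ⟨‖Q‖ * ‖P‖ * (2 * D + D ^ 2 + B), by positivity, fun H ℓ a L _ _ _ hℓ hH hp hq =>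
    norm_pair_le P Q hP hQ hQc H ℓ a L hℓ hH hp hq⟩

end Mixed

theorem isCLin_mulI (n : ℕ) : IsCLin (mulI n) := fun _ => rfl

theorem part_comp_mulI {n : ℕ} {k : ℕ} {σ : ℝ} (hσ : σ ^ 2 = 1) (L : Cn n →L[ℝ] Alt n k) :
    part σ (L.comp (mulI n)) = -((σ : ℂ) * Complex.I) • part σ L := by
  rw [part_comp σ L (isCLin_mulI n)]
  ext1 v
  exact part_I_smul hσ L v

theorem altPart_comp_mulI {n k : ℕ} {σ : ℝ} (hσ : σ ^ 2 = 1) (L : Cn n →L[ℝ] Alt n k) :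
    altPart n k σ (L.comp (mulI n)) = -((σ : ℂ) * Complex.I) • altPart n k σ L := by
  rw [altPart_apply, part_comp_mulI hσ, altPart_apply,
    ContinuousAlternatingMap.alternatizeUncurryFin_smul]

theorem coPart_smul {n k : ℕ} (σ : ℝ) (c : ℂ) (L : Cn n →L[ℝ] Alt n (k + 1)) :
    coPart n k σ (c • L) = c • coPart n k σ L := by
  rw [coPart_apply, coPart_apply, part_smul]
  ext v
  simp [trace_apply, Finset.mul_sum]

theorem coPart_comp_mulI {n k : ℕ} {σ : ℝ} (hσ : σ ^ 2 = 1) (L : Cn n →L[ℝ] Alt n (k + 1)) :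
    coPart n k σ (L.comp (mulI n)) = ((σ : ℂ) * Complex.I) • coPart n k σ L := by
  rw [coPart_apply, coPart_apply, part_comp_mulI (by simpa using hσ)]
  ext v
  simp [trace_apply, Finset.mul_sum]

end BottChern

end

/-! ### Uniform commutator bounds for functions `g ∘ ρ` of the potential. -/

noncomputable section

open scoped Manifold ContDiff ComplexConjugate Topology

namespace BottChern

/-! ### Commutators with functions of the potential -/

theorem fderiv_comp_fun {E : Type*} [NormedAddCommGroup E] [NormedSpace ℝ E] {g : ℝ → ℝ}
    (hg : Differentiable ℝ g) {r : E → ℝ} {y : E} (hr : DifferentiableAt ℝ r y) :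
    fderiv ℝ (fun z => g (r z)) y = deriv g (r y) • fderiv ℝ r y :=
  ((hg (r y)).hasDerivAt.comp_hasFDerivAt y hr.hasFDerivAt).fderiv

theorem fderiv_fderiv_comp_fun {E : Type*} [NormedAddCommGroup E] [NormedSpace ℝ E] {g : ℝ → ℝ}
    (hg : ContDiff ℝ ∞ g) {r : E → ℝ} {y : E} (hr : ContDiffAt ℝ ∞ r y) :
    fderiv ℝ (fderiv ℝ (fun z => g (r z))) y =
      deriv (deriv g) (r y) • (fderiv ℝ r y).smulRight (fderiv ℝ r y) +
        deriv g (r y) • fderiv ℝ (fderiv ℝ r) y := by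
  have hd : Differentiable ℝ g := hg.differentiable (by simp)
  have hd' : Differentiable ℝ (deriv g) :=
    ((contDiff_infty_iff_deriv.1 hg).2).differentiable (by simp)
  have h1 : fderiv ℝ (fun z => g (r z)) =ᶠ[𝓝 y] fun z => deriv g (r z) • fderiv ℝ r z := by
    filter_upwards [eventually_differentiableAt hr] with z hz using fderiv_comp_fun hd hz
  have h2 := ((hd' (r y)).hasDerivAt.comp_hasFDerivAt y
    (hr.differentiableAt (by simp)).hasFDerivAt)
  have h3 := ((hr.fderiv_right (m := ∞) (by simp)).differentiableAt (by simp)).hasFDerivAt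
  have h4 : HasFDerivAt (fun z => deriv g (r z) • fderiv ℝ r z) _ y := h2.smul h3
  rw [h1.fderiv_eq, h4.fderiv]
  ext u v
  simp [mul_assoc, add_comm]

theorem contMDiff_comp_fun {n : ℕ} {M : Type*} [TopologicalSpace M] [ChartedSpace (Cn n) M]
    {ρ : M → ℝ} (hρ : IsDBoundedStein n ρ) {g : ℝ → ℝ} (hg : ContDiff ℝ ∞ g) :
    ContMDiff 𝓘(ℝ, Cn n) 𝓘(ℝ, ℝ) ∞ fun x => g (ρ x) := hg.contMDiff.comp hρ.smooth

section Manifold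

variable {n : ℕ} {M : Type*} [TopologicalSpace M] [ChartedSpace (Cn n) M]
  [IsManifold 𝓘(ℂ, Cn n) ω M] {ρ : M → ℝ}

/-- The `i`-invariant half of the Hessian of `ρ` is the metric itself, which is the standard one at
the centre. The constant `2n` comes from bounding each coordinate crudely by the norm. -/
theorem IsNormal.norm_invariant_hessian_le (hρ : IsDBoundedStein n ρ) {x : M} {ψ : Cn n → Cn n}
    (h : IsNormal ρ x ψ) :
    ‖(1 / 2 : ℝ) • (fderiv ℝ (fderiv ℝ (fun z => ρ ((chartAt (Cn n) x).symm (ψ z)))) 0 +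
      conjI (fderiv ℝ (fderiv ℝ (fun z => ρ ((chartAt (Cn n) x).symm (ψ z)))) 0))‖ ≤
      Fintype.card (Idx n) := by
  set r := fun z => ρ ((chartAt (Cn n) x).symm (ψ z)) with hr
  have hs : ContDiffAt ℝ ∞ r 0 := h.contDiffAt_fun hρ.smooth
  obtain ⟨B, hB⟩ := exists_bilin_kMet hs
  refine ContinuousLinearMap.opNorm_le_bound₂ _ (by positivity) fun u v => ?_
  have h1 : ((1 / 2 : ℝ) • (fderiv ℝ (fderiv ℝ r) 0 + conjI (fderiv ℝ (fderiv ℝ r) 0))) u v =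
      B u v := by
    rw [← hB, kMet_eq hs]
    simp only [_root_.smul_apply, _root_.add_apply, conjI_apply, ContinuousLinearMap.comp_apply,
      smul_eq_mul]
    change 1 / 2 * (_ + fderiv ℝ (fderiv ℝ r) 0 (Complex.I • u) (Complex.I • v)) = _
    ring
  have h2 : ∀ i j, B (vec i) (vec j) = if i = j then 1 else 0 := fun i j => by
    rw [← hB]
    exact congrFun (congrFun h.gram_one i) j |>.trans (Matrix.one_apply)
  have h3 : B u v = ∑ i, coord i u * coord i v := by
    conv_lhs => rw [← sum_coord_smul_vec u, ← sum_coord_smul_vec v]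
    simp [map_sum, LinearMap.sum_apply, h2, mul_comm]
  rw [h1, h3]
  calc ‖∑ i, coord i u * coord i v‖ ≤ ∑ _i : Idx n, ‖u‖ * ‖v‖ := by
        refine norm_sum_le_of_le _ fun i _ => ?_
        rw [norm_mul]
        exact mul_le_mul (abs_coord_le i u) (abs_coord_le i v) (norm_nonneg _) (norm_nonneg _)
    _ = _ := by
      rw [Finset.sum_const, nsmul_eq_mul, mul_assoc]
      rfl

/-- `d`-boundedness enters here. From `η = i∂̄ρ` one gets `η(v) = (i/2)(dρ(v) + i dρ(iv))`, so
`dρ(v) = 2 Im η(v)`, and the bound on `|η|` bounds `dρ` uniformly in normal coordinates. -/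
theorem exists_norm_fderiv_le (hρ : IsDBoundedStein n ρ) : ∃ D : ℝ, 0 ≤ D ∧
    ∀ (x : M) (ψ : Cn n → Cn n), IsNormal ρ x ψ →
      ‖fderiv ℝ (fun z => ρ ((chartAt (Cn n) x).symm (ψ z))) 0‖ ≤ D := by
  obtain ⟨C, hC⟩ := hρ.bounded
  obtain ⟨C', hC', hn⟩ := exists_norm_sq_le n 1
  refine ⟨2 * √(C' * C ^ 2), by positivity, fun x ψ h => ?_⟩
  set r := fun z => ρ ((chartAt (Cn n) x).symm (ψ z)) with hr
  have hs : ContDiffAt ℝ ∞ r 0 := h.contDiffAt_fun hρ.smooth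
  set η := nrep x ψ (eta ρ) 1 0 with hη
  have h1 : normSq ρ 1 (eta (n := n) ρ) x = (hm 1 η η).re := by
    rw [normSq, h.herm_nrep hρ]
    rfl
  have h2 : ‖η‖ ^ 2 ≤ C' * C ^ 2 := by
    refine (hn η).trans (mul_le_mul_of_nonneg_left ?_ hC')
    have h3 := hC x
    rw [h1] at h3
    calc (hm 1 η η).re = √(hm 1 η η).re ^ 2 := (Real.sq_sqrt (re_hm_one_nonneg η)).symm
      _ ≤ C ^ 2 := by gcongr
  have h3 : ‖η‖ ≤ √(C' * C ^ 2) := Real.le_sqrt_of_sq_le h2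
  have h4 : ∀ v : Cn n, η (fun _ => v) =
      Complex.I * ((1 / 2 : ℂ) * (fderiv ℝ r 0 v + Complex.I * fderiv ℝ r 0 (Complex.I • v))) := by
    intro v
    have h5 : η = Complex.I • nrep x ψ (dd 1 (ofFun fun x => (ρ x : ℂ))) 1 0 := by
      rw [hη, eta, delbar_eq]
      rfl
    have h6 : nrep x ψ (ofFun fun x => (ρ x : ℂ)) 0 = scal r :=
      pull_scal (fun z => ρ ((chartAt (Cn n) x).symm z)) ψ
    rw [h5, ContinuousAlternatingMap.smul_apply, h.nrep_dd_zero 1 (isSmooth_ofFun hρ.smooth), h6,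
      alternatize_one, fderiv_scal (hs.differentiableAt (by simp)), part_apply]
    simp
    ring
  refine ContinuousLinearMap.opNorm_le_bound _ (by positivity) fun v => ?_
  have h5 : fderiv ℝ r 0 v = 2 * (η fun _ => v).im := by
    rw [h4]
    simp
  rw [h5, norm_mul, Real.norm_eq_abs, abs_two, mul_assoc]
  refine mul_le_mul_of_nonneg_left ?_ zero_le_two
  calc ‖(η fun _ => v).im‖ ≤ ‖η fun _ => v‖ := Complex.abs_im_le_norm _
    _ ≤ ‖η‖ * ∏ _i : Fin 1, ‖v‖ := η.le_opNorm _
    _ ≤ _ := by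
      rw [Finset.prod_const, Finset.card_univ, Fintype.card_fin, pow_one]
      gcongr

/-- The Hessian of `g ∘ ρ` is `g'' dρ ⊗ dρ + g' D²ρ`. Of `D²ρ` only the invariant part enters, and
this is bounded by the Kähler condition, while `dρ` is bounded by `d`-boundedness. The constant
depends neither on the point nor on `g`, only on bounds for `g'` and `g''`. -/
theorem exists_norm_lap_comm_le (hρ : IsDBoundedStein n ρ) (k : ℕ) : ∃ C : ℝ, 0 ≤ C ∧
    ∀ (x : M) (ψ : Cn n → Cn n), IsNormal ρ x ψ → ∀ (g : ℝ → ℝ), ContDiff ℝ ∞ g → ∀ ε : ℝ,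
      |deriv g (ρ x)| ≤ ε → |deriv (deriv g) (ρ x)| ≤ ε → ∀ φ : Form n M, IsSmooth φ →
      ‖nrep x ψ (lap ρ (fmul (fun x => g (ρ x)) φ) - fmul (fun x => g (ρ x)) (lap ρ φ)) k 0‖ ≤
        C * ε * (‖nrep x ψ φ k 0‖ + ‖fderiv ℝ (nrep x ψ φ k) 0‖) := by
  obtain ⟨D, hD, hD'⟩ := exists_norm_fderiv_le hρ
  have hσ : (-1 : ℝ) ^ 2 = 1 := by norm_num
  have hB : (0 : ℝ) ≤ (Fintype.card (Idx n) : ℝ) := Nat.cast_nonneg _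
  have hhalf : ∃ C : ℝ, 0 ≤ C ∧
    ∀ (x : M) (ψ : Cn n → Cn n), IsNormal ρ x ψ → ∀ (g : ℝ → ℝ), ContDiff ℝ ∞ g → ∀ ε : ℝ,
      |deriv g (ρ x)| ≤ ε → |deriv (deriv g) (ρ x)| ≤ ε → ∀ φ : Form n M, IsSmooth φ →
      ‖nrep x ψ (fcommStar ρ (-1) (fun x => g (ρ x)) (dd (-1) φ) +
        ddStar ρ (-1) (fcomm (-1) (fun x => g (ρ x)) φ)) k 0‖ ≤
        C * ε * (‖nrep x ψ φ k 0‖ + ‖fderiv ℝ (nrep x ψ φ k) 0‖) := by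
    -- For `∂*∂`, the symbol of `∂` is multiplied by `c = i` under rotation and that of `∂*` by
    -- `-i`.
    obtain ⟨C, hC, hC'⟩ := exists_norm_pair_le (V := Alt n k) (W := Alt n (k + 1)) (U := Alt n k)
      (c := Complex.I) (altPart n k (-1)) (coPart n k (-1)) (fun L => by
        rw [altPart_comp_mulI hσ]
        simp) (fun N => by
        rw [coPart_comp_mulI hσ, smul_smul]
        simp) (coPart_smul (-1) Complex.I) hD hB
    refine ⟨C, hC, ?_⟩
    intro x ψ h g hg ε h1 h2 φ hφ
    have hf := contMDiff_comp_fun hρ hg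
    have hx : ρ ((chartAt (Cn n) x).symm (ψ 0)) = ρ x := by
      rw [h.map_zero, (chartAt (Cn n) x).left_inv (mem_chart_source _ x)]
    have hr := h.contDiffAt_fun hρ.smooth
    rw [nrep_add, h.nrep_fcommStar hρ (-1) hf (hφ.dd (-1)),
      h.nrep_ddStar hρ (-1) (hφ.fcomm (-1) hf), ← coPart_apply,
      h.fderiv_nrep_fcomm (-1) hf hφ, h.nrep_dd_zero (-1) hφ, ← altPart_apply,
      fderiv_comp_fun (hg.differentiable (by simp)) (hr.differentiableAt (by simp)),
      fderiv_fderiv_comp_fun hg hr, hx]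
    exact hC' _ _ _ _ _ _ _ (hD' x ψ h) (h.norm_invariant_hessian_le hρ) h1 h2
  obtain ⟨C₁, hC₁, hC₁'⟩ := hhalf
  have hhalf' : ∃ C : ℝ, 0 ≤ C ∧
    ∀ (x : M) (ψ : Cn n → Cn n), IsNormal ρ x ψ → ∀ (g : ℝ → ℝ), ContDiff ℝ ∞ g → ∀ ε : ℝ,
      |deriv g (ρ x)| ≤ ε → |deriv (deriv g) (ρ x)| ≤ ε → ∀ φ : Form n M, IsSmooth φ →
      ‖nrep x ψ (fcomm (-1) (fun x => g (ρ x)) (ddStar ρ (-1) φ) +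
        dd (-1) (fcommStar ρ (-1) (fun x => g (ρ x)) φ)) k 0‖ ≤
        C * ε * (‖nrep x ψ φ k 0‖ + ‖fderiv ℝ (nrep x ψ φ k) 0‖) := by
    cases k with
    | zero =>
      refine ⟨0, le_rfl, fun x ψ h g hg ε h1 h2 φ hφ => ?_⟩
      have h0 : (fcomm (-1) (fun x => g (ρ x)) (ddStar ρ (-1) φ) +
          dd (-1) (fcommStar ρ (-1) (fun x => g (ρ x)) φ)) 0 x = 0 := by
        ext v
        change (0 : ℂ) - g (ρ x) • (0 : ℂ) + 0 = 0
        simp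
      rw [h.nrep_zero, h0, zero_mul, zero_mul]
      exact norm_zero.le
    | succ k =>
    -- Degrees above `2n` carry no forms; below, `k + 1 ≤ 2n` is what `fderiv_nrep_fcommStar`
    -- requires.
    rcases lt_or_ge (n * 2) (k + 1) with hk | hk
    · refine ⟨0, le_rfl, fun x ψ h g hg ε h1 h2 φ hφ => ?_⟩
      have := subsingleton_of_lt (n := n) (k := k + 1) hk
      rw [Subsingleton.elim (nrep x ψ _ (k + 1) 0) 0, norm_zero,
        zero_mul, zero_mul]
    -- For `∂∂*` the roles are exchanged, hence `c = -i`.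
    obtain ⟨C, hC, hC'⟩ := exists_norm_pair_le (V := Alt n (k + 1)) (W := Alt n k)
      (U := Alt n (k + 1)) (c := -Complex.I) (coPart n k (-1)) (altPart n k (-1)) (fun L => by
        rw [coPart_comp_mulI hσ]
        congr 1
        simp) (fun N => by
        rw [altPart_comp_mulI hσ, smul_smul]
        simp) (altPart_smul (-1) (-Complex.I)) hD hB
    refine ⟨C, hC, ?_⟩
    intro x ψ h g hg ε h1 h2 φ hφ
    have hf := contMDiff_comp_fun hρ hg
    have hx : ρ ((chartAt (Cn n) x).symm (ψ 0)) = ρ x := by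
      rw [h.map_zero, (chartAt (Cn n) x).left_inv (mem_chart_source _ x)]
    have hr := h.contDiffAt_fun hρ.smooth
    have hc := (h.nrep_fcomm (-1) hf (hφ.ddStar hρ (-1)) k).self_of_nhds
    beta_reduce at hc
    rw [nrep_add, hc, h.nrep_ddStar hρ (-1) hφ, ← coPart_apply,
      h.nrep_dd_zero (-1) (hφ.fcommStar hρ (-1) hf), ← altPart_apply,
      h.fderiv_nrep_fcommStar hρ (-1) hf hφ hk,
      fderiv_comp_fun (hg.differentiable (by simp)) (hr.differentiableAt (by simp)),
      fderiv_fderiv_comp_fun hg hr, hx]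
    exact hC' _ _ _ _ _ _ _ (hD' x ψ h) (h.norm_invariant_hessian_le hρ) h1 h2
  obtain ⟨C₂, hC₂, hC₂'⟩ := hhalf'
  refine ⟨C₂ + C₁, by positivity, fun x ψ h g hg ε h1 h2 φ hφ => ?_⟩
  rw [lap_fmul hρ (contMDiff_comp_fun hρ hg) hφ, add_sub_cancel_left, nrep_add, add_mul, add_mul]
  exact (norm_add_le _ _).trans
    (add_le_add (hC₂' x ψ h g hg ε h1 h2 φ hφ) (hC₁' x ψ h g hg ε h1 h2 φ hφ))

theorem exists_norm_fcomm_le (hρ : IsDBoundedStein n ρ) (σ : ℝ) (k : ℕ) : ∃ C : ℝ, 0 ≤ C ∧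
    ∀ (x : M) (ψ : Cn n → Cn n), IsNormal ρ x ψ → ∀ (g : ℝ → ℝ), ContDiff ℝ ∞ g → ∀ ε : ℝ,
      |deriv g (ρ x)| ≤ ε → ∀ φ : Form n M, IsSmooth φ →
      ‖nrep x ψ (fcomm σ (fun x => g (ρ x)) φ) (k + 1) 0‖ ≤ C * ε * ‖nrep x ψ φ k 0‖ := by
  obtain ⟨D, hD, hD'⟩ := exists_norm_fderiv_le hρ
  obtain ⟨C, hC, hC'⟩ := exists_norm_symb_le (V := Alt n k) (W := Alt n (k + 1)) (altPart n k σ) hD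
  refine ⟨C, hC, fun x ψ h g hg ε h1 φ hφ => ?_⟩
  have hx : ρ ((chartAt (Cn n) x).symm (ψ 0)) = ρ x := by
    rw [h.map_zero, (chartAt (Cn n) x).left_inv (mem_chart_source _ x)]
  have hc := (h.nrep_fcomm σ (contMDiff_comp_fun hρ hg) hφ k).self_of_nhds
  beta_reduce at hc
  rw [hc, fderiv_comp_fun (hg.differentiable (by simp))
    ((h.contDiffAt_fun hρ.smooth).differentiableAt (by simp)), hx]
  exact hC' _ _ _ _ (hD' x ψ h) h1

theorem exists_norm_fcommStar_le (hρ : IsDBoundedStein n ρ) (σ : ℝ) (k : ℕ) : ∃ C : ℝ, 0 ≤ C ∧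
    ∀ (x : M) (ψ : Cn n → Cn n), IsNormal ρ x ψ → ∀ (g : ℝ → ℝ), ContDiff ℝ ∞ g → ∀ ε : ℝ,
      |deriv g (ρ x)| ≤ ε → ∀ φ : Form n M, IsSmooth φ →
      ‖nrep x ψ (fcommStar ρ σ (fun x => g (ρ x)) φ) k 0‖ ≤ C * ε * ‖nrep x ψ φ (k + 1) 0‖ := by
  obtain ⟨D, hD, hD'⟩ := exists_norm_fderiv_le hρ
  obtain ⟨C, hC, hC'⟩ := exists_norm_symb_le (V := Alt n (k + 1)) (W := Alt n k) (coPart n k σ) hD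
  refine ⟨C, hC, fun x ψ h g hg ε h1 φ hφ => ?_⟩
  have hx : ρ ((chartAt (Cn n) x).symm (ψ 0)) = ρ x := by
    rw [h.map_zero, (chartAt (Cn n) x).left_inv (mem_chart_source _ x)]
  rw [h.nrep_fcommStar hρ σ (contMDiff_comp_fun hρ hg) hφ k,
    fderiv_comp_fun (hg.differentiable (by simp))
    ((h.contDiffAt_fun hρ.smooth).differentiableAt (by simp)), hx]
  exact hC' _ _ _ _ (hD' x ψ h) h1

end Manifold

end BottChern

end

/-! ### Cutoff functions, absorption of error terms, and the limit of large radius. -/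

noncomputable section

open scoped Manifold ContDiff ComplexConjugate Topology

namespace BottChern

open MeasureTheory Set

/-! ### Cutoff functions -/

section Cutoff

theorem hasCompactSupport_deriv_smoothTransition :
    HasCompactSupport (deriv Real.smoothTransition) := by
  refine HasCompactSupport.intro (isCompact_Icc (a := (0 : ℝ)) (b := 1)) fun t ht => ?_
  rw [mem_Icc, not_and_or, not_le, not_le] at ht
  rcases ht with ht | ht
  · rw [Filter.EventuallyEq.deriv_eq (f := fun _ => (0 : ℝ)), deriv_const]
    filter_upwards [Iio_mem_nhds ht] with s hs
    exact Real.smoothTransition.zero_of_nonpos (le_of_lt hs)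
  · rw [Filter.EventuallyEq.deriv_eq (f := fun _ => (1 : ℝ)), deriv_const]
    filter_upwards [Ioi_mem_nhds ht] with s hs
    exact Real.smoothTransition.one_of_one_le (le_of_lt hs)

/-- A smooth function that is `1` on `(-∞, 1]` and vanishes on `[2, ∞)`. -/
def bump (t : ℝ) : ℝ := Real.smoothTransition (2 - t)

/-- The cutoff function at scale `R`; the fourth power makes its derivatives small compared with
its square root. -/
def cut (R t : ℝ) : ℝ := bump (t / R) ^ 4

theorem contDiff_bump : ContDiff ℝ ∞ bump :=
  Real.smoothTransition.contDiff.comp (contDiff_const.sub contDiff_id)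

theorem contDiff_cut (R : ℝ) : ContDiff ℝ ∞ (cut R) :=
  (contDiff_bump.comp (contDiff_id.div_const R)).pow 4

theorem bump_nonneg (t : ℝ) : 0 ≤ bump t := Real.smoothTransition.nonneg _

theorem bump_le_one (t : ℝ) : bump t ≤ 1 := Real.smoothTransition.le_one _

theorem cut_nonneg (R t : ℝ) : 0 ≤ cut R t := pow_nonneg (bump_nonneg _) 4

theorem cut_le_one (R t : ℝ) : cut R t ≤ 1 := pow_le_one₀ (bump_nonneg _) (bump_le_one _)

theorem cut_eq_one {R t : ℝ} (hR : 0 < R) (ht : t ≤ R) : cut R t = 1 := by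
  rw [cut, bump, Real.smoothTransition.one_of_one_le, one_pow]
  linarith [(div_le_one hR).2 ht]

theorem cut_eq_zero {R t : ℝ} (hR : 0 < R) (ht : 2 * R ≤ t) : cut R t = 0 := by
  rw [cut, bump, Real.smoothTransition.zero_of_nonpos, zero_pow (by norm_num)]
  linarith [(le_div_iff₀ hR).2 ht]

theorem exists_bump_bound : ∃ B : ℝ, 0 ≤ B ∧ ∀ t, |deriv bump t| ≤ B ∧
    |deriv (deriv bump) t| ≤ B := by
  have h1 : ContDiff ℝ ∞ (deriv bump) := (contDiff_infty_iff_deriv.1 contDiff_bump).2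
  have h2 : ContDiff ℝ ∞ (deriv (deriv bump)) := (contDiff_infty_iff_deriv.1 h1).2
  have hd : deriv bump = fun t => -deriv Real.smoothTransition (2 - t) := by
    funext t
    exact deriv_comp_const_sub (f := Real.smoothTransition) 2 t
  have hs : HasCompactSupport (deriv bump) := by
    rw [hd]
    exact (hasCompactSupport_deriv_smoothTransition.comp_homeomorph
      (Homeomorph.subLeft (2 : ℝ))).neg
  obtain ⟨A, hA⟩ := hs.exists_bound_of_continuous h1.continuous
  obtain ⟨B, hB⟩ := hs.deriv.exists_bound_of_continuous h2.continuous
  exact ⟨max A B, le_max_of_le_left ((norm_nonneg _).trans (hA 0)), fun t =>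
    ⟨le_max_of_le_left (hA t), le_max_of_le_right (hB t)⟩⟩

/-- Two derivatives of a fourth power still leave a factor `bump²`, the square root of the cutoff.
Each derivative also gains `1/R`, and for `R ≥ 1` one such factor is kept. -/
theorem exists_cut_bound : ∃ B : ℝ, 0 ≤ B ∧ ∀ R, 1 ≤ R → ∀ t,
    |deriv (cut R) t| ≤ B / R * bump (t / R) ^ 2 ∧
      |deriv (deriv (cut R)) t| ≤ B / R * bump (t / R) ^ 2 := by
  obtain ⟨B, hB, hb⟩ := exists_bump_bound
  have h1 : ContDiff ℝ ∞ (deriv bump) := (contDiff_infty_iff_deriv.1 contDiff_bump).2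
  -- The second derivative of `b⁴` is `12 b² b'² + 4 b³ b''`, and the first is `4 b³ b'`.
  refine ⟨12 * B ^ 2 + 4 * B, by positivity, fun R hR t => ?_⟩
  have hR0 : 0 < R := by linarith
  have hq : ∀ t : ℝ, HasDerivAt (fun t : ℝ => t / R) (1 / R) t := fun t =>
    (hasDerivAt_id t).div_const R
  have hbd : ∀ t, HasDerivAt (fun t => bump (t / R)) (deriv bump (t / R) * (1 / R)) t := fun t =>
    HasDerivAt.comp (h₂ := bump) t ((contDiff_bump.differentiable (by simp)) (t / R)).hasDerivAt (hq t)
  have hbd' : ∀ t, HasDerivAt (fun t => deriv bump (t / R))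
      (deriv (deriv bump) (t / R) * (1 / R)) t := fun t =>
    HasDerivAt.comp (h₂ := deriv bump) t ((h1.differentiable (by simp)) (t / R)).hasDerivAt (hq t)
  have hc : deriv (cut R) = fun t => 4 * bump (t / R) ^ 3 * (deriv bump (t / R) * (1 / R)) := by
    funext t
    have := ((hbd t).fun_pow 4).deriv
    refine this.trans ?_
    push_cast
    rfl
  have hc' : deriv (deriv (cut R)) t =
      (12 * bump (t / R) ^ 2 * (deriv bump (t / R) * (1 / R))) * (deriv bump (t / R) * (1 / R)) +
        4 * bump (t / R) ^ 3 * (deriv (deriv bump) (t / R) * (1 / R) * (1 / R)) := by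
    rw [hc]
    have := ((((hbd t).fun_pow 3).const_mul 4).mul ((hbd' t).mul_const (1 / R))).deriv
    refine this.trans ?_
    push_cast
    ring
  obtain ⟨hb1, hb2⟩ := hb (t / R)
  have s0 := bump_nonneg (t / R)
  have s1 := bump_le_one (t / R)
  set s := bump (t / R)
  set a := deriv bump (t / R)
  set b := deriv (deriv bump) (t / R)
  have hr : 0 < 1 / R := by positivity
  have hr1 : 1 / R ≤ 1 := (div_le_one hR0).2 hR
  have hs3 : s ^ 3 ≤ s ^ 2 := pow_le_pow_of_le_one s0 s1 (by norm_num)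
  have hrr : 1 / R * (1 / R) ≤ 1 / R := mul_le_of_le_one_left hr.le hr1
  have ha2 : |a| * |a| ≤ B ^ 2 := by nlinarith [abs_nonneg a]
  constructor
  · rw [hc]
    change |4 * s ^ 3 * (a * (1 / R))| ≤ _
    rw [abs_mul, abs_mul, abs_mul, abs_of_pos hr, abs_of_nonneg (pow_nonneg s0 3),
      abs_of_pos (by norm_num : (0 : ℝ) < 4)]
    calc 4 * s ^ 3 * (|a| * (1 / R)) ≤ 4 * s ^ 2 * (B * (1 / R)) := by gcongr
      _ = (4 * B) * (1 / R * s ^ 2) := by ring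
      _ ≤ (12 * B ^ 2 + 4 * B) * (1 / R * s ^ 2) := by
        gcongr
        nlinarith
      _ = _ := by ring
  · rw [hc']
    refine (abs_add_le _ _).trans ?_
    simp only [abs_mul, abs_of_pos hr, abs_of_nonneg (pow_nonneg s0 3),
      abs_of_nonneg (pow_nonneg s0 2), abs_of_pos (by norm_num : (0 : ℝ) < 4),
      abs_of_pos (by norm_num : (0 : ℝ) < 12)]
    calc 12 * s ^ 2 * (|a| * (1 / R)) * (|a| * (1 / R)) + 4 * s ^ 3 * (|b| * (1 / R) * (1 / R))
        = 12 * s ^ 2 * ((|a| * |a|) * (1 / R * (1 / R))) + 4 * s ^ 3 * (|b| * (1 / R * (1 / R))) := by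
          ring
      _ ≤ 12 * s ^ 2 * (B ^ 2 * (1 / R)) + 4 * s ^ 2 * (B * (1 / R)) := by gcongr
      _ = _ := by ring

end Cutoff

section Pointwise

variable {n : ℕ}

/-- Young's inequality: `|⟨u, E⟩|` is at most a constant times `(s²|u|)(εy)`, and its first factor
is absorbed by half of `s⁴|u|²`. This works because the error carries the weight `s²`, the square
root of the main weight. -/
theorem exists_re_hm_ge (n k : ℕ) : ∃ C : ℝ, 0 ≤ C ∧ ∀ (u E : Alt n k) (s ε y : ℝ),
    ‖E‖ ≤ ε * s ^ 2 * y →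
      1 / 2 * s ^ 4 * (hm 1 u u).re - (hm 1 u (s ^ 4 • u + E)).re ≤ C * ε ^ 2 * y ^ 2 := by
  obtain ⟨A, hA, hA'⟩ := exists_norm_sq_le n k
  obtain ⟨B, hB, hB'⟩ := exists_norm_hm_le n k
  refine ⟨A * B ^ 2, by positivity, fun u E s ε y h => ?_⟩
  have h1 := hA' u
  have h2 : |(hm 1 u E).re| ≤ B * ‖u‖ * (ε * s ^ 2 * y) :=
    (Complex.abs_re_le_norm _).trans ((hB' u E).trans
      (mul_le_mul_of_nonneg_left h (mul_nonneg hB (norm_nonneg _))))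
  have h0 := re_hm_one_nonneg u
  rw [hm_add_right, hm_real_smul_right, Complex.add_re, Complex.re_ofReal_mul]
  set q := (hm 1 u u).re
  set N := ‖u‖
  have hN : 0 ≤ N := norm_nonneg u
  have h3 := (abs_le.1 h2).1
  have h4 : B * N * (ε * s ^ 2 * y) ≤ 1 / 2 * s ^ 4 * q + A * B ^ 2 * ε ^ 2 * y ^ 2 := by
    -- If the constant `A` is `0` then the form `u` is zero; otherwise one may divide by `2A`.
    rcases hA.eq_or_lt with h | h
    · have : N = 0 := by
        rw [← h, zero_mul] at h1
        nlinarith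
      rw [this, mul_zero, zero_mul, ← h]
      positivity
    · have h5 : s ^ 4 * N ^ 2 / (2 * A) ≤ 1 / 2 * s ^ 4 * q := by
        rw [div_le_iff₀ (by positivity)]
        nlinarith [mul_le_mul_of_nonneg_left h1 (by positivity : 0 ≤ s ^ 4)]
      have h6 : B * N * (ε * s ^ 2 * y) ≤ s ^ 4 * N ^ 2 / (2 * A) + A * B ^ 2 * ε ^ 2 * y ^ 2 := by
        have e : s ^ 4 * N ^ 2 / (2 * A) + A * B ^ 2 * ε ^ 2 * y ^ 2 =
            (s ^ 4 * N ^ 2 + 2 * (A * B * ε * y) ^ 2) / (2 * A) := by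
          field_simp
        rw [e, le_div_iff₀ (by positivity)]
        nlinarith [sq_nonneg (s ^ 2 * N - A * B * ε * y), sq_nonneg (A * B * ε * y)]
      linarith
  linarith

end Pointwise

section Manifold

variable {n : ℕ} {M : Type*} [TopologicalSpace M] [ChartedSpace (Cn n) M]
  [IsManifold 𝓘(ℂ, Cn n) ω M] {ρ : M → ℝ}

/-- At the centre the value and the derivative of a form represent `φ` and `∇φ`, so the `W^{1,2}`
density controls its first-order jet. -/
theorem exists_norm_add_sq_le (hρ : IsDBoundedStein n ρ) (k : ℕ) : ∃ C : ℝ, 0 ≤ C ∧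
    ∀ (x : M) (ψ : Cn n → Cn n), IsNormal ρ x ψ → ∀ φ : Form n M, IsSmooth φ →
      (‖nrep x ψ φ k 0‖ + ‖fderiv ℝ (nrep x ψ φ k) 0‖) ^ 2 ≤
        C * (normSq ρ k φ x + nablaNormSq ρ k φ x) := by
  obtain ⟨A, hA, hA'⟩ := exists_norm_sq_le n k
  set N : ℝ := (Fintype.card (Idx n) : ℝ)
  have hN : 0 ≤ N := Nat.cast_nonneg _
  refine ⟨2 * A + 2 * (N * A), by positivity, fun x ψ h φ hφ => ?_⟩
  rw [normSq, h.herm_nrep hρ, nablaNormSq_eq hρ h hφ, Complex.re_sum]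
  have h1 := hA' (nrep x ψ φ k 0)
  have h2 := opNorm_sq_le (V := Alt n k) (fderiv ℝ (nrep x ψ φ k) 0)
  have h3 : ∑ i, ‖fderiv ℝ (nrep x ψ φ k) 0 (vec i)‖ ^ 2 ≤
      A * ∑ i, (hm 1 (fderiv ℝ (nrep x ψ φ k) 0 (vec i))
        (fderiv ℝ (nrep x ψ φ k) 0 (vec i))).re := by
    rw [Finset.mul_sum]
    exact Finset.sum_le_sum fun i _ => hA' _
  have h4 := re_hm_one_nonneg (nrep x ψ φ k 0)
  have h5 : 0 ≤ ∑ i, (hm 1 (fderiv ℝ (nrep x ψ φ k) 0 (vec i))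
        (fderiv ℝ (nrep x ψ φ k) 0 (vec i))).re := Finset.sum_nonneg fun i _ => re_hm_one_nonneg _
  change _ ≤ _ * ((hm 1 (nrep x ψ φ k 0) (nrep x ψ φ k 0)).re + ∑ i, (hm 1 _ _).re)
  set a := ‖nrep x ψ φ k 0‖
  set l := ‖fderiv ℝ (nrep x ψ φ k) 0‖
  set S := ∑ i, (hm 1 (fderiv ℝ (nrep x ψ φ k) 0 (vec i))
        (fderiv ℝ (nrep x ψ φ k) 0 (vec i))).re
  set q := (hm 1 (nrep x ψ φ k 0) (nrep x ψ φ k 0)).re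
  have h6 : l ^ 2 ≤ N * (A * S) := h2.trans (mul_le_mul_of_nonneg_left h3 hN)
  have h7 : 0 ≤ A * S := mul_nonneg hA h5
  have h8 : 0 ≤ N * A * q := by positivity
  nlinarith [sq_nonneg (a - l)]

/-- The common template for `lap`, `dd` and `ddStar`: `u` is the operator applied to `φ`, `T g` is
the operator applied to `g(ρ)φ`, and `hT` bounds the commutator. Young's inequality with weight
`bump(ρ/R)` converts this into a remainder against the `W^{1,2}` density. -/
theorem exists_pairing_bound (hρ : IsDBoundedStein n ρ) {k j : ℕ} {φ u : Form n M}
    (hφ : IsSmooth φ) {T : (ℝ → ℝ) → Form n M} {C : ℝ}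
    (hT : ∀ (x : M) (ψ : Cn n → Cn n), IsNormal ρ x ψ → ∀ (g : ℝ → ℝ), ContDiff ℝ ∞ g → ∀ ε : ℝ,
      |deriv g (ρ x)| ≤ ε → |deriv (deriv g) (ρ x)| ≤ ε →
      ‖nrep x ψ (T g - fmul (fun x => g (ρ x)) u) j 0‖ ≤
        C * ε * (‖nrep x ψ φ k 0‖ + ‖fderiv ℝ (nrep x ψ φ k) 0‖)) :
    ∃ C' : ℝ, 0 ≤ C' ∧ ∀ R, 1 ≤ R → ∀ x : M,
      1 / 2 * cut R (ρ x) * normSq ρ j u x - (hm (gram ρ x) (u j x) (T (cut R) j x)).re ≤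
        C' / R * (normSq ρ k φ x + nablaNormSq ρ k φ x) := by
  obtain ⟨A, hA, hA'⟩ := exists_norm_add_sq_le hρ k
  obtain ⟨B, hB, hB'⟩ := exists_cut_bound
  obtain ⟨D, hD, hD'⟩ := exists_re_hm_ge n j
  refine ⟨D * (C * B) ^ 2 * A, by positivity, fun R hR x => ?_⟩
  have hR0 : 0 < R := by linarith
  obtain ⟨ψ, h⟩ := exists_isNormal hρ x
  obtain ⟨h1, h2⟩ := hB' R hR (ρ x)
  have h3 := hT x ψ h (cut R) (contDiff_cut R) _ h1 h2
  have h4 := hA' x ψ h φ hφ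
  set y := ‖nrep x ψ φ k 0‖ + ‖fderiv ℝ (nrep x ψ φ k) 0‖
  set s := bump (ρ x / R)
  have hx : ρ ((chartAt (Cn n) x).symm (ψ 0)) = ρ x := by
    rw [h.map_zero, (chartAt (Cn n) x).left_inv (mem_chart_source _ x)]
  have h5 := hD' (nrep x ψ u j 0) (nrep x ψ (T (cut R) - fmul (fun x => cut R (ρ x)) u) j 0) s
    (C * B / R) y (h3.trans (le_of_eq (by ring)))
  have h6 : s ^ 4 • nrep x ψ u j 0 + nrep x ψ (T (cut R) - fmul (fun x => cut R (ρ x)) u) j 0 =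
      nrep x ψ (T (cut R)) j 0 := by
    rw [nrep_sub, nrep_fmul]
    beta_reduce
    rw [hx]
    exact add_sub_cancel _ _
  rw [h6] at h5
  have h7 : normSq ρ j u x = (hm 1 (nrep x ψ u j 0) (nrep x ψ u j 0)).re := by
    rw [normSq, h.herm_nrep hρ]
    rfl
  have h8 : hm (gram ρ x) (u j x) (T (cut R) j x) =
      hm 1 (nrep x ψ u j 0) (nrep x ψ (T (cut R)) j 0) := h.herm_nrep hρ _ _ _
  rw [h7, h8]
  have hW : 0 ≤ A * (normSq ρ k φ x + nablaNormSq ρ k φ x) := (sq_nonneg _).trans h4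
  calc _ ≤ D * (C * B / R) ^ 2 * y ^ 2 := h5
    _ ≤ D * (C * B / R) ^ 2 * (A * (normSq ρ k φ x + nablaNormSq ρ k φ x)) :=
      mul_le_mul_of_nonneg_left h4 (by positivity)
    _ = D * (C * B) ^ 2 * (A * (normSq ρ k φ x + nablaNormSq ρ k φ x)) * (1 / R * (1 / R)) := by
      field_simp
    -- The error is in fact `O(1/R²)`; one factor `1/R ≤ 1` is dropped, since `O(1/R)` suffices.
    _ ≤ D * (C * B) ^ 2 * (A * (normSq ρ k φ x + nablaNormSq ρ k φ x)) * (1 / R) := by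
      refine mul_le_mul_of_nonneg_left ?_ (by positivity)
      exact mul_le_of_le_one_left (by positivity) ((div_le_one hR0).2 hR)
    _ = _ := by ring

theorem IsDBoundedStein.apply_eq_zero (hρ : IsDBoundedStein n ρ) {k : ℕ} {φ : Form n M} {x : M}
    (h0 : normSq ρ k φ x = 0) : φ k x = 0 := by
  obtain ⟨A, hA, hA'⟩ := exists_norm_sq_le n k
  obtain ⟨ψ, h⟩ := exists_isNormal hρ x
  have h1 := hA' (nrep x ψ φ k 0)
  have h2 : normSq ρ k φ x = (hm 1 (nrep x ψ φ k 0) (nrep x ψ φ k 0)).re := by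
    rw [normSq, h.herm_nrep hρ]
    rfl
  rw [← h2, h0, mul_zero] at h1
  have h3 : nrep x ψ φ k 0 = 0 := norm_eq_zero.1 (pow_eq_zero_iff two_ne_zero |>.1
    (le_antisymm h1 (sq_nonneg _)))
  exact h.eq_of_nrep (φ' := 0) (h3.trans (h.nrep_zero 0 k).symm |>.trans rfl)

theorem IsDBoundedStein.normSq_nonneg (hρ : IsDBoundedStein n ρ) (k : ℕ) (φ : Form n M) (x : M) :
    0 ≤ normSq ρ k φ x := by
  obtain ⟨ψ, h⟩ := exists_isNormal hρ x
  rw [normSq, h.herm_nrep hρ]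
  exact re_hm_one_nonneg _

/-- The estimate goes through the positive part of `f`, so neither measurability nor integrability
of `W` is needed, only finiteness of its lower integral. -/
theorem integral_le_toReal_lintegral {X : Type*} [MeasurableSpace X] {μ : Measure X}
    {f W : X → ℝ} {c : ℝ} (hc : 0 ≤ c) (hf : Integrable f μ) (hle : ∀ x, f x ≤ c * W x)
    (hW : ∫⁻ x, ENNReal.ofReal (W x) ∂μ < ⊤) :
    ∫ x, f x ∂μ ≤ c * (∫⁻ x, ENNReal.ofReal (W x) ∂μ).toReal := by
  rw [integral_eq_lintegral_pos_part_sub_lintegral_neg_part hf]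
  refine (sub_le_self _ ENNReal.toReal_nonneg).trans ?_
  rw [← ENNReal.toReal_ofReal hc, ← ENNReal.toReal_mul, ← lintegral_const_mul' _ _
    ENNReal.ofReal_ne_top]
  refine ENNReal.toReal_mono ?_ (lintegral_mono fun x => ?_)
  · rw [lintegral_const_mul' _ _ ENNReal.ofReal_ne_top]
    exact ENNReal.mul_ne_top ENNReal.ofReal_ne_top hW.ne
  · rw [← ENNReal.ofReal_mul hc]
    exact ENNReal.ofReal_le_ofReal (hle x)

variable [T2Space M] [MeasurableSpace M] [BorelSpace M]

/-- Integrating the pointwise bound removes `G R` and gives `½∫χ_R F ≤ (C/R)∫W`. If `F` were nonzero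
somewhere, the left side would stay above a positive constant for all large `R`, while the right
side tends to `0`. -/
theorem eq_zero_of_cutoff (hρ : IsDBoundedStein n ρ) {F W : M → ℝ} (hF : Continuous F)
    (hF0 : ∀ x, 0 ≤ F x) (hW : ∫⁻ x, ENNReal.ofReal (W x) ∂(vol n ρ) < ⊤) {C : ℝ} (hC : 0 ≤ C)
    {G : ℝ → M → ℝ} (hG : ∀ R, 1 ≤ R → Integrable (G R) (vol n ρ))
    (hG0 : ∀ R, 1 ≤ R → ∫ x, G R x ∂(vol n ρ) = 0)
    (hle : ∀ R, 1 ≤ R → ∀ x, 1 / 2 * cut R (ρ x) * F x - G R x ≤ C / R * W x) (x : M) :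
    F x = 0 := by
  by_contra hx
  have := isOpenPosMeasure_vol hρ
  have := isLocallyFiniteMeasure_vol hρ
  have hcont : ∀ R, Continuous fun x => 1 / 2 * cut R (ρ x) * F x := fun R =>
    (continuous_const.mul ((contDiff_cut R).continuous.comp hρ.smooth.continuous)).mul hF
  have hint : ∀ R, 1 ≤ R → Integrable (fun x => 1 / 2 * cut R (ρ x) * F x) (vol n ρ) := by
    intro R hR
    refine (hcont R).integrable_of_hasCompactSupport
      (HasCompactSupport.intro (hρ.exhaustion (2 * R)) fun x hx => ?_)
    rw [cut_eq_zero (by linarith) (le_of_not_ge hx), mul_zero, zero_mul]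
  -- This makes the cutoff equal to `1` at the point `x` where `F` is assumed not to vanish.
  set R₀ := max 1 (ρ x)
  have hR₀ : 1 ≤ R₀ := le_max_left _ _
  set I := ∫ x, 1 / 2 * cut R₀ (ρ x) * F x ∂(vol n ρ)
  have hI : 0 < I := by
    refine (hcont R₀).integral_pos_of_hasCompactSupport_nonneg_nonzero
      (HasCompactSupport.intro (hρ.exhaustion (2 * R₀)) fun x hx => ?_) (fun x => ?_) (x := x) ?_
    · rw [cut_eq_zero (by linarith) (le_of_not_ge hx), mul_zero, zero_mul]
    · exact mul_nonneg (mul_nonneg (by norm_num) (cut_nonneg _ _)) (hF0 x)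
    · rw [cut_eq_one (by linarith) (le_max_right _ _)]
      simpa using hx
  set w := (∫⁻ x, ENNReal.ofReal (W x) ∂(vol n ρ)).toReal
  have hw : 0 ≤ w := ENNReal.toReal_nonneg
  have key : ∀ R, 2 * R₀ ≤ R → I ≤ C / R * w := by
    intro R hR
    have hR1 : 1 ≤ R := by linarith
    have h1 := integral_le_toReal_lintegral (by positivity) ((hint R hR1).sub (hG R hR1))
      (hle R hR1) hW
    have h2 : ∫ x, ((fun x => 1 / 2 * cut R (ρ x) * F x) - G R) x ∂(vol n ρ) =
        ∫ x, 1 / 2 * cut R (ρ x) * F x ∂(vol n ρ) := by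
      rw [integral_sub' (hint R hR1) (hG R hR1), hG0 R hR1, sub_zero]
    rw [h2] at h1
    refine le_trans (integral_mono (hint R₀ hR₀) (hint R hR1) fun z => ?_) h1
    refine mul_le_mul_of_nonneg_right (mul_le_mul_of_nonneg_left ?_ (by norm_num)) (hF0 z)
    -- For `R ≥ 2R₀` the cutoffs are ordered: where the larger one is not known to be `1`, the
    -- smaller one is already `0`.
    rcases le_or_gt (ρ z) R with h | h
    · rw [cut_eq_one (by linarith) h]
      exact cut_le_one _ _
    · rw [cut_eq_zero (by linarith) (hR.trans h.le)]
      exact cut_nonneg _ _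
  -- Chosen so that `I R ≥ C w + 1`, against the bound `I R ≤ C w`.
  set R := max (2 * R₀) ((C * w + 1) / I)
  have hR : 0 < R := lt_of_lt_of_le (by linarith) (le_max_left _ _)
  have h1 := key R (le_max_left _ _)
  have h2 : (C * w + 1) / I ≤ R := le_max_right _ _
  rw [div_le_iff₀ hI] at h2
  rw [div_mul_eq_mul_div, le_div_iff₀ hR] at h1
  linarith

end Manifold

end BottChern

end

/-! ### The cutoff argument applied to the weak equation, and the conclusion. -/

noncomputable section

open scoped Manifold ContDiff ComplexConjugate Topology

namespace BottChern

open MeasureTheory Set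

/-! ### The vanishing theorem -/

section Manifold

variable {n : ℕ} {M : Type*}

theorem suppIn_fmul_cut (ρ : M → ℝ) {R : ℝ} (hR : 1 ≤ R) (φ : Form n M) :
    SuppIn {x | ρ x ≤ 2 * R} (fmul (fun x => cut R (ρ x)) φ) := fun k x hx =>
  fmul_apply_of_left (f := fun x => cut R (ρ x)) (cut_eq_zero (by linarith) (le_of_not_ge hx)) φ k

variable [TopologicalSpace M] [ChartedSpace (Cn n) M] [IsManifold 𝓘(ℂ, Cn n) ω M] {ρ : M → ℝ} {φ : Form n M}

theorem ddStar_of_degree_eq_zero (hρ : IsDBoundedStein n ρ) (σ : ℝ) (hφ : IsSmooth φ) {k : ℕ}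
    (h : φ (k + 1) = 0) : ddStar ρ σ φ k = 0 := by
  funext x
  obtain ⟨ψ, hψ⟩ := exists_isNormal hρ x
  refine hψ.eq_of_nrep (φ' := 0) ?_
  have h0 : nrep x ψ φ (k + 1) = fun _ => 0 := by
    funext z
    rw [nrep, pull, rep, h]
    rfl
  rw [hψ.nrep_ddStar hρ σ hφ, h0, fderiv_fun_const, ← coPart_apply]
  exact (map_zero (coPart n k σ)).trans rfl

variable [T2Space M] [MeasurableSpace M] [BorelSpace M]

/-- The weak equation is tested with `χ_R φ`. Each of its three terms equals the cutoff square norm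
up to a commutator controlled by `exists_pairing_bound`, so `eq_zero_of_cutoff` applies to the sum
of the three squares. -/
theorem eq_zero_of_bottChernLaplacian_eq_zero (hρ : IsDBoundedStein n ρ) (k : ℕ)
    (hφ : IsSmooth φ) (hW : MemW12 ρ k φ) (hBC : bottChernLaplacian ρ φ = 0) :
    lap ρ φ k = 0 ∧ dd 1 φ (k + 1) = 0 ∧ dd (-1) φ (k + 1) = 0 := by
  have hdd : ∀ σ : ℝ, ∃ C' : ℝ, 0 ≤ C' ∧ ∀ R, 1 ≤ R → ∀ x : M,
      1 / 2 * cut R (ρ x) * normSq ρ (k + 1) (dd σ φ) x -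
        (hm (gram ρ x) (dd σ φ (k + 1) x)
          (dd σ (fmul (fun x => cut R (ρ x)) φ) (k + 1) x)).re ≤
        C' / R * (normSq ρ k φ x + nablaNormSq ρ k φ x) := by
    intro σ
    obtain ⟨C, hC, hC'⟩ := exists_norm_fcomm_le hρ σ k
    refine exists_pairing_bound hρ hφ (T := fun g => dd σ (fmul (fun x => g (ρ x)) φ)) (C := C) ?_
    intro x ψ h g hg ε h1 _
    have hε : 0 ≤ ε := (abs_nonneg _).trans h1
    refine (hC' x ψ h g hg ε h1 φ hφ).trans (mul_le_mul_of_nonneg_left ?_ (by positivity))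
    exact le_add_of_nonneg_right (norm_nonneg (fderiv ℝ (nrep x ψ φ k) 0))
  obtain ⟨C, hC, hC'⟩ := exists_norm_lap_comm_le hρ k
  obtain ⟨A, hA, hA'⟩ := exists_pairing_bound hρ hφ
    (T := fun g => lap ρ (fmul (fun x => g (ρ x)) φ)) (C := C)
    fun x ψ h g hg ε h1 h2 => hC' x ψ h g hg ε h1 h2 φ hφ
  obtain ⟨A₁, hA₁, hA₁'⟩ := hdd 1
  obtain ⟨A₂, hA₂, hA₂'⟩ := hdd (-1)
  have hα : ∀ R, IsSmooth (fmul (fun x => cut R (ρ x)) φ) := fun R =>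
    hφ.fmul (contMDiff_comp_fun hρ (contDiff_cut R))
  have hint : ∀ R, 1 ≤ R → Integrable (fun x =>
      hm (gram ρ x) (lap ρ φ k x) (lap ρ (fmul (fun x => cut R (ρ x)) φ) k x) +
      hm (gram ρ x) (dd 1 φ (k + 1) x) (dd 1 (fmul (fun x => cut R (ρ x)) φ) (k + 1) x) +
      hm (gram ρ x) (dd (-1) φ (k + 1) x) (dd (-1) (fmul (fun x => cut R (ρ x)) φ) (k + 1) x))
      (vol n ρ) := by
    intro R hR
    have hK := hρ.exhaustion (2 * R)
    have hs := suppIn_fmul_cut ρ hR φ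
    exact ((integrable_hm hρ k ((hα R).lap hρ) (hφ.lap hρ) hK (hs.lap hK.isClosed ρ)).add
      (integrable_hm hρ (k + 1) ((hα R).dd 1) (hφ.dd 1) hK (hs.dd hK.isClosed 1))).add
      (integrable_hm hρ (k + 1) ((hα R).dd (-1)) (hφ.dd (-1)) hK (hs.dd hK.isClosed (-1)))
  have hcont : ∀ (j : ℕ) {u : Form n M}, IsSmooth u → Continuous (normSq ρ j u) := fun j u hu =>
    Complex.continuous_re.comp (continuous_hm hρ j hu hu)
  have key := eq_zero_of_cutoff hρ
    (F := fun x => normSq ρ k (lap ρ φ) x + normSq ρ (k + 1) (dd 1 φ) x +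
      normSq ρ (k + 1) (dd (-1) φ) x)
    (((hcont k (hφ.lap hρ)).add (hcont (k + 1) (hφ.dd 1))).add (hcont (k + 1) (hφ.dd (-1))))
    (fun x => add_nonneg (add_nonneg (hρ.normSq_nonneg _ _ _) (hρ.normSq_nonneg _ _ _))
      (hρ.normSq_nonneg _ _ _)) hW (add_nonneg (add_nonneg hA hA₁) hA₂)
    -- `G R` is the real part of the integrand of the weak equation, whose integral vanishes.
    (fun R hR => (hint R hR).re)
    (fun R hR => (integral_re (hint R hR)).trans (by
      rw [integral_weak_bottChern hρ k hφ (hα R) (hρ.exhaustion (2 * R))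
        (suppIn_fmul_cut ρ hR φ) hBC, map_zero]))
    (fun R hR x => by
      have h1 := hA' R hR x
      have h2 := hA₁' R hR x
      have h3 := hA₂' R hR x
      simp only [RCLike.re_to_complex, Complex.add_re, add_div, add_mul, mul_add] at *
      linarith)
  have h0 : ∀ x, normSq ρ k (lap ρ φ) x = 0 ∧ normSq ρ (k + 1) (dd 1 φ) x = 0 ∧
      normSq ρ (k + 1) (dd (-1) φ) x = 0 := by
    intro x
    have h1 := hρ.normSq_nonneg k (lap ρ φ) x
    have h2 := hρ.normSq_nonneg (k + 1) (dd 1 φ) x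
    have h3 := hρ.normSq_nonneg (k + 1) (dd (-1) φ) x
    have h4 := key x
    beta_reduce at h4
    refine ⟨?_, ?_, ?_⟩ <;> linarith
  exact ⟨funext fun x => hρ.apply_eq_zero (h0 x).1, funext fun x => hρ.apply_eq_zero (h0 x).2.1,
    funext fun x => hρ.apply_eq_zero (h0 x).2.2⟩

/-- Formally `∫|∂*φ|² = ∫⟨∂∂*φ, φ⟩ = 0`. With cutoffs, `∫⟨∂*φ, ∂*(χφ)⟩ = ∫⟨∂∂*φ, χφ⟩ = 0`, and the
commutator of `∂*` with `χ` is absorbed as before. -/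
theorem ddStar_eq_zero_of_dd_ddStar_eq_zero (hρ : IsDBoundedStein n ρ) (σ : ℝ) (k : ℕ)
    (hφ : IsSmooth φ) (hW : MemW12 ρ (k + 1) φ) (h0 : dd σ (ddStar ρ σ φ) (k + 1) = 0) :
    ddStar ρ σ φ k = 0 := by
  obtain ⟨C, hC, hC'⟩ := exists_norm_fcommStar_le hρ σ k
  obtain ⟨A, hA, hA'⟩ := exists_pairing_bound hρ (u := ddStar ρ σ φ) (j := k) (k := k + 1) hφ
    (T := fun g => ddStar ρ σ (fmul (fun x => g (ρ x)) φ)) (C := C) (by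
      intro x ψ h g hg ε h1 _
      have hε : 0 ≤ ε := (abs_nonneg _).trans h1
      refine (hC' x ψ h g hg ε h1 φ hφ).trans (mul_le_mul_of_nonneg_left ?_ (by positivity))
      exact le_add_of_nonneg_right (norm_nonneg (fderiv ℝ (nrep x ψ φ (k + 1)) 0)))
  have hα : ∀ R, IsSmooth (fmul (fun x => cut R (ρ x)) φ) := fun R =>
    hφ.fmul (contMDiff_comp_fun hρ (contDiff_cut R))
  have hu := hφ.ddStar hρ σ
  have hint : ∀ R, 1 ≤ R → Integrable (fun x => hm (gram ρ x) (ddStar ρ σ φ k x)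
      (ddStar ρ σ (fmul (fun x => cut R (ρ x)) φ) k x)) (vol n ρ) := fun R hR =>
    integrable_hm hρ k ((hα R).ddStar hρ σ) hu (hρ.exhaustion (2 * R))
      ((suppIn_fmul_cut ρ hR φ).ddStar (hρ.exhaustion (2 * R)).isClosed ρ σ)
  refine funext fun x => hρ.apply_eq_zero (eq_zero_of_cutoff hρ (F := normSq ρ k (ddStar ρ σ φ))
    (Complex.continuous_re.comp (continuous_hm hρ k hu hu)) (hρ.normSq_nonneg _ _) hW hA
    (fun R hR => (hint R hR).re)
    (fun R hR => (integral_re (hint R hR)).trans ?_) hA' x)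
  rw [← integral_hm_dd hρ σ k (hα R) hu (hρ.exhaustion (2 * R)) (suppIn_fmul_cut ρ hR φ), h0]
  have : ∀ x, hm (gram ρ x) ((0 : M → Alt n (k + 1)) x)
      (fmul (fun x => cut R (ρ x)) φ (k + 1) x) = 0 := fun x => hm_zero_left _ _
  simp only [this, integral_zero, map_zero]

/-- Once `∂φ = 0`, the equation `Δφ = 0` reduces to `∂∂*φ = 0`, and the previous lemma gives the
vanishing of `∂*φ` itself. -/
theorem bottChern_vanishing (hρ : IsDBoundedStein n ρ) {k : ℕ} (hφ : IsSmooth φ)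
    (hk : ∀ j, j ≠ k → φ j = 0) (hW : MemW12 ρ k φ) (hBC : bottChernLaplacian ρ φ = 0) :
    dd (-1) φ = 0 ∧ dd 1 φ = 0 ∧ ddStar ρ (-1) φ = 0 := by
  obtain ⟨h1, h2, h3⟩ := eq_zero_of_bottChernLaplacian_eq_zero hρ k hφ hW hBC
  have hdd : ∀ σ : ℝ, dd σ φ (k + 1) = 0 → dd σ φ = 0 := by
    intro σ h
    funext j
    match j with
    | 0 => rfl
    | j + 1 =>
      rcases eq_or_ne j k with rfl | hj
      · exact h
      · exact dd_of_degree_eq_zero σ (hk j hj)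
  have h4 := hdd _ h3
  refine ⟨h4, hdd _ h2, ?_⟩
  funext j
  rcases eq_or_ne (j + 1) k with rfl | hj
  · refine ddStar_eq_zero_of_dd_ddStar_eq_zero hρ (-1) j hφ hW ?_
    rw [lap, h4] at h1
    have h5 : ddStar ρ (-1) (0 : Form n M) (j + 1) = 0 :=
      ddStar_of_degree_eq_zero hρ (-1) (h4 ▸ hφ.dd (-1)) rfl
    rwa [Pi.add_apply, h5, add_zero] at h1
  · exact ddStar_of_degree_eq_zero hρ (-1) hφ (hk _ hj)

end Manifold

end BottChern

end

theorem mainTheorem2 {n : ℕ} {M : Type*} [TopologicalSpace M] [T2Space M]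
    [ChartedSpace (BottChern.Cn n) M] [IsManifold 𝓘(ℂ, BottChern.Cn n) ω M]
    [MeasurableSpace M] [BorelSpace M]
    (ρ : M → ℝ) (hρ : BottChern.IsDBoundedStein n ρ)
    (p q : ℕ) (φ : BottChern.Form n M) (hφ : BottChern.IsSmooth φ)
    (hpq : BottChern.IsOfType p q φ) (hW : BottChern.MemW12 ρ (p + q) φ)
    (hBC : BottChern.bottChernLaplacian ρ φ = 0) :
    BottChern.del φ = 0 ∧ BottChern.delbar φ = 0 ∧
      BottChern.delbarStar ρ (BottChern.delStar ρ φ) = 0 := by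
  obtain ⟨h1, h2, h3⟩ := BottChern.bottChern_vanishing hρ hφ hpq.1 hW hBC
  refine ⟨(BottChern.del_eq φ).trans h1, (BottChern.delbar_eq φ).trans h2, ?_⟩
  rw [BottChern.delStar_eq, BottChern.delbarStar_eq]
  funext k
  exact BottChern.ddStar_of_degree_eq_zero hρ 1 (hφ.ddStar hρ (-1)) (by rw [h3]; rfl)
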